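/- Let $k$ be a field of characteristic $0$ and let $\mathcal C$ be a coaugmented dg cooperad over $k$ with $\mathcal C(0)=0$. For a graded vector space $A$ let $\mathcal C(A)=\bigoplus_n(\mathcal C(n)\otimes A^{\otimes n})_{S_n}$ be the cofree $\mathcal C$-coalgebra, with structure maps $\Delta_n:\mathcal C(A)\to(\mathcal C(n)\otimes\mathcal C(A)^{\otimes n})^{S_n}$ and projection $p_A:\mathcal C(A)\to A$. A $\mathrm{Cobar}(\mathcal C)$-algebra (homotopy algebra of type $\mathcal C$) is a cochain complex $(A,\partial_A)$ with a degree $1$ coderivation $Q_A$ of $\mathcal C(A)$ such that $Q_A|_A=0$ and $\partial Q_A+Q_A\partial+Q_A^2=0$, where $\partial$ is the differential on $\mathcal C(A)$ induced by those of $\mathcal C$ and $A$. An $\mathfrak S\mathrm{Lie}_\infty$-algebra is a homotopy algebra $L$ of type $\mathsf{coCom}$ (cocommutative coalgebras without counit), $\underline S(L)=\mathsf{coCom}(L)$, and an $\infty$-morphism $L\to L'$ is a morphism of dg $\mathsf{coCom}$-coalgebras $(\underline S(L),\partial+Q_L)\to(\underline S(L'),\partial+Q_{L'})$. For filtered algebras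 (i.e. with a complete descending filtration $L=\mathcal F_1L\supseteq\mathcal F_2L\supseteq\cdots$ by graded subcomplexes such that $\{\mathcal F_{i_1}L,\dots,\mathcal F_{i_m}L\}\subseteq\mathcal F_{i_1+\dots+i_m}L$ for $m\ge2$; completeness is understood in each degree) $\infty$-morphisms are required to be continuous for the induced filtrations of $\underline S(L)$, $\underline S(L')$. Direct sums of filtered $\mathfrak S\mathrm{Lie}_\infty$-algebras have componentwise operations and filtrations, and for $\infty$-morphisms $F:L\to M$, $F':L'\to M'$ the $\infty$-morphism $F\otimes F':L\oplus L'\to M\oplus M'$ is the coalgebra morphism with components $p_M F\,\underline S(\mathrm{pr}_L)$ and $p_{M'}F'\,\underline S(\mathrm{pr}_{L'})$. Then the following hold. (1) For all $\mathrm{Cobar}(\mathcal C)$-algebras $A,B$, the graded space $\mathbf{map}(A,B)=\mathrm{Hom}(\mathcal C(A),B)$ (spanned by homogeneous linear maps) with the brackets $$\{f\}=\partial_B f-(-1)^{|f|}f(\partial+Q_A)+p_BQ_B(1\otimes f)\Delta_1,\qquad \{f_1,\dots,f_m\}=p_BQ_B(1\otimes f_1\otimes\dots\otimes f_m)\Delta_m\quad(m\ge2)$$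 and the arity filtration $\mathcal F_n=\{f : f|_{(\mathcal C(m)\otimes A^{\otimes m})_{S_m}}=0\ \ \forall\, m<n\}$ is a filtered $\mathfrak S\mathrm{Lie}_\infty$-algebra. (2) For all $\mathrm{Cobar}(\mathcal C)$-algebras $A_1,A_2,A_3$ let $\mathcal U_{123}:\underline S(\mathbf{map}(A_2,A_3)\oplus\mathbf{map}(A_1,A_2))\to\underline S(\mathbf{map}(A_1,A_3))$ be the coalgebra morphism whose projection $\mathcal U'$ to $\mathbf{map}(A_1,A_3)$ is $$\mathcal U'(g\otimes f_1\cdots f_n)(X)=g\big((1\otimes f_1\otimes\dots\otimes f_n)(\Delta_nX)\big)\qquad(n\ge1,\ g\in\mathbf{map}(A_2,A_3),\ f_i\in\mathbf{map}(A_1,A_2))$$ and vanishes on $\underline S(\mathbf{map}(A_2,A_3))$, on $\underline S(\mathbf{map}(A_1,A_2))$ and on $\underline S^{m\ne1}(\mathbf{map}(A_2,A_3))\otimes\underline S(\mathbf{map}(A_1,A_2))$. Then $\mathcal U_{123}$ is a (continuous) $\infty$-morphism $\mathbf{map}(A_2,A_3)\oplus\mathbf{map}(A_1,A_2)\to\mathbf{map}(A_1,A_3)$.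 (3) For all $\mathrm{Cobar}(\mathcal C)$-algebras $A_1,\dots,A_4$, with $\mathcal U_{i_1i_2i_3}$ the morphism of (2) for $A_{i_1},A_{i_2},A_{i_3}$ and $\mathfrak a$ the associativity isomorphism $\mathbf{map}(A_3,A_4)\oplus(\mathbf{map}(A_2,A_3)\oplus\mathbf{map}(A_1,A_2))\cong(\mathbf{map}(A_3,A_4)\oplus\mathbf{map}(A_2,A_3))\oplus\mathbf{map}(A_1,A_2)$, $$\mathcal U_{124}\circ(\mathcal U_{234}\otimes\mathrm{id})\circ\mathfrak a=\mathcal U_{134}\circ(\mathrm{id}\otimes\mathcal U_{123}).$$ -/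

import Mathlib

open scoped TensorProduct DirectSum

universe u v w v' w'

noncomputable section

namespace HomotopyAlg

/-! ### Graded vector spaces -/

section Degrees

variable {k : Type u} [Field k] {V : Type v} {W : Type w} {V' : Type v'} {W' : Type w'}
  [AddCommGroup V] [Module k V] [AddCommGroup W] [Module k W]
  [AddCommGroup V'] [Module k V'] [AddCommGroup W'] [Module k W']

/-- `f` is homogeneous of degree `p` for the gradings `𝒱`, `𝒲`. -/
def IsDeg (𝒱 : ℤ → Submodule k V) (𝒲 : ℤ → Submodule k W) (f : V →ₗ[k] W) (p : ℤ) : Prop :=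
  ∀ i, ∀ v ∈ 𝒱 i, f v ∈ 𝒲 (i + p)

/-- The total grading of a tensor product. -/
def tensorDeg (𝒱 : ℤ → Submodule k V) (𝒲 : ℤ → Submodule k W) (D : ℤ) :
    Submodule k (V ⊗[k] W) :=
  Submodule.span k {x | ∃ (i j : ℤ) (v : V) (w : W), v ∈ 𝒱 i ∧ w ∈ 𝒲 j ∧ i + j = D ∧ x = v ⊗ₜ w}

/-- The total grading of a finite tensor product. -/
def piDeg {ι : Type} [Fintype ι] {V : ι → Type v} [∀ i, AddCommGroup (V i)] [∀ i, Module k (V i)]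
    (𝒱 : ∀ i, ℤ → Submodule k (V i)) (D : ℤ) : Submodule k (⨂[k] i, V i) :=
  Submodule.span k {x | ∃ (d : ι → ℤ) (v : ∀ i, V i),
    (∀ i, v i ∈ 𝒱 i (d i)) ∧ ∑ i, d i = D ∧ x = PiTensorProduct.tprod k v}

variable {𝒱 : ℤ → Submodule k V} {𝒲 : ℤ → Submodule k W} {𝒱' : ℤ → Submodule k V'}
  {𝒲' : ℤ → Submodule k W'}

theorem IsDeg.comp {g : W →ₗ[k] V'} {f : V →ₗ[k] W} {p q r : ℤ} (hg : IsDeg 𝒲 𝒱' g q)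
    (hf : IsDeg 𝒱 𝒲 f p) (h : p + q = r) : IsDeg 𝒱 𝒱' (g ∘ₗ f) r := by
  intro i v hv
  have := hg _ _ (hf i v hv)
  rwa [add_assoc, h] at this

theorem IsDeg.add {f g : V →ₗ[k] W} {p : ℤ} (hf : IsDeg 𝒱 𝒲 f p) (hg : IsDeg 𝒱 𝒲 g p) :
    IsDeg 𝒱 𝒲 (f + g) p := fun i v hv => Submodule.add_mem _ (hf i v hv) (hg i v hv)

theorem IsDeg.sub {f g : V →ₗ[k] W} {p : ℤ} (hf : IsDeg 𝒱 𝒲 f p) (hg : IsDeg 𝒱 𝒲 g p) :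
    IsDeg 𝒱 𝒲 (f - g) p := fun i v hv => Submodule.sub_mem _ (hf i v hv) (hg i v hv)

theorem IsDeg.smul {f : V →ₗ[k] W} {p : ℤ} (c : k) (hf : IsDeg 𝒱 𝒲 f p) :
    IsDeg 𝒱 𝒲 (c • f) p := fun i v hv => Submodule.smul_mem _ c (hf i v hv)

theorem IsDeg.sum {ι : Type*} (s : Finset ι) {f : ι → V →ₗ[k] W} {p : ℤ}
    (hf : ∀ i ∈ s, IsDeg 𝒱 𝒲 (f i) p) : IsDeg 𝒱 𝒲 (∑ i ∈ s, f i) p := by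
  intro i v hv
  rw [LinearMap.sum_apply]
  exact Submodule.sum_mem _ fun j hj => hf j hj i v hv

theorem IsDeg.id : IsDeg 𝒱 𝒱 LinearMap.id 0 := fun i v hv => by simpa using hv

theorem isDeg_of_span {S : ℤ → Set V} {f : V →ₗ[k] W} {p : ℤ}
    (h : ∀ i, ∀ v ∈ S i, f v ∈ 𝒲 (i + p)) :
    IsDeg (fun i => Submodule.span k (S i)) 𝒲 f p := by
  intro i v hv
  have : Submodule.span k (S i) ≤ (𝒲 (i + p)).comap f := Submodule.span_le.2 fun x hx => h i x hx
  exact this hv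

theorem IsDeg.tensor {f : V →ₗ[k] W} {g : V' →ₗ[k] W'} {p q r : ℤ} (hf : IsDeg 𝒱 𝒲 f p)
    (hg : IsDeg 𝒱' 𝒲' g q) (h : p + q = r) :
    IsDeg (tensorDeg 𝒱 𝒱') (tensorDeg 𝒲 𝒲') (TensorProduct.map f g) r := by
  apply isDeg_of_span
  rintro D _ ⟨i, j, v, w, hv, hw, rfl, rfl⟩
  exact Submodule.subset_span ⟨i + p, j + q, f v, g w, hf i v hv, hg j w hw, by omega, by simp⟩

theorem IsDeg.pi {ι : Type} [Fintype ι] {V : ι → Type v} [∀ i, AddCommGroup (V i)]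
    [∀ i, Module k (V i)] {W : ι → Type w} [∀ i, AddCommGroup (W i)] [∀ i, Module k (W i)]
    {𝒱 : ∀ i, ℤ → Submodule k (V i)} {𝒲 : ∀ i, ℤ → Submodule k (W i)}
    {f : ∀ i, V i →ₗ[k] W i} {p : ι → ℤ} {r : ℤ} (hf : ∀ i, IsDeg (𝒱 i) (𝒲 i) (f i) (p i))
    (h : ∑ i, p i = r) : IsDeg (piDeg 𝒱) (piDeg 𝒲) (PiTensorProduct.map f) r := by
  apply isDeg_of_span
  rintro D _ ⟨d, v, hv, rfl, rfl⟩
  refine Submodule.subset_span ⟨fun i => d i + p i, fun i => f i (v i), fun i => hf i _ _ (hv i),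
    ?_, by simp⟩
  rw [Finset.sum_add_distrib, h]

/-- A multilinear map that sends tuples of homogeneous vectors into `N` takes values in `N`. -/
theorem multilinear_mem {ι : Type} [Finite ι] {V : ι → Type v} [∀ i, AddCommGroup (V i)]
    [∀ i, Module k (V i)] {𝒱 : ∀ i, ℤ → Submodule k (V i)} (f : MultilinearMap k V W)
    (N : Submodule k W)
    (h : ∀ (d : ι → ℤ) (v : ∀ i, V i), (∀ i, v i ∈ 𝒱 i (d i)) → f v ∈ N)
    (v : ∀ i, V i) (hv : ∀ i, v i ∈ ⨆ d, 𝒱 i d) : f v ∈ N := by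
  classical
  have := Fintype.ofFinite ι
  suffices H : ∀ s : Finset ι, ∀ v : ∀ i, V i, (∀ i ∈ s, v i ∈ ⨆ d, 𝒱 i d) →
      (∀ i ∉ s, ∃ d, v i ∈ 𝒱 i d) → f v ∈ N from
    H Finset.univ v (fun i _ => hv i) (fun i hi => (hi (Finset.mem_univ i)).elim)
  intro s
  induction s using Finset.induction_on with
  | empty =>
    intro v _ hv
    choose d hd using fun i => hv i (Finset.notMem_empty i)
    exact h d v hd
  | insert a s ha ih =>
    intro v hv hv'
    have key : (⨆ d, 𝒱 a d) ≤ N.comap (f.toLinearMap v a) := by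
      refine iSup_le fun d x hx => ?_
      simp only [Submodule.mem_comap, MultilinearMap.toLinearMap_apply]
      apply ih
      · intro i hi
        have : i ≠ a := fun h => ha (h ▸ hi)
        rw [Function.update_of_ne this]
        exact hv i (Finset.mem_insert_of_mem hi)
      · intro i hi
        by_cases hia : i = a
        · subst hia; exact ⟨d, by simpa using hx⟩
        · rw [Function.update_of_ne hia]
          exact hv' i (by simp [hia, hi])
    have := key (hv a (Finset.mem_insert_self a s))
    simpa using this

end Degrees

/-- A `ℤ`-graded vector space. -/
structure GrMod (k : Type u) [Field k] where
  carrier : Type v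
  [grp : AddCommGroup carrier]
  [mod : Module k carrier]
  deg : ℤ → Submodule k carrier
  internal : DirectSum.IsInternal deg

namespace GrMod

attribute [instance] GrMod.grp GrMod.mod

variable {k : Type u} [Field k]

instance : CoeSort (GrMod.{u, v} k) (Type v) := ⟨GrMod.carrier⟩

variable (V : GrMod.{u, v} k)

/-- The decomposition of `V` into its homogeneous components. -/
def decompose : V ≃ₗ[k] ⨁ d, V.deg d :=
  (LinearEquiv.ofBijective (DirectSum.coeLinearMap V.deg)
    (show Function.Bijective (DirectSum.coeLinearMap V.deg) from V.internal)).symm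

/-- The operator that multiplies homogeneous vectors of degree `d` by `c d`. -/
def diag (c : ℤ → k) : V →ₗ[k] V :=
  (DirectSum.toModule k ℤ V fun d => c d • (V.deg d).subtype) ∘ₗ
    V.decompose.toLinearMap

theorem diag_of_mem (c : ℤ → k) {d : ℤ} {x : V} (hx : x ∈ V.deg d) : V.diag c x = c d • x := by
  have : V.decompose x = DirectSum.lof k ℤ (fun d => V.deg d) d ⟨x, hx⟩ := by
    rw [decompose, LinearEquiv.symm_apply_eq]
    exact (DirectSum.coeLinearMap_lof V.deg d ⟨x, hx⟩).symm
  simp [diag, this]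

theorem iSup_deg : ⨆ d, V.deg d = ⊤ := V.internal.submodule_iSup_eq_top

theorem ext_deg {W : Type w} [AddCommGroup W] [Module k W] {f g : V →ₗ[k] W}
    (h : ∀ d, ∀ x ∈ V.deg d, f x = g x) : f = g := by
  have : (⨆ d, V.deg d) ≤ LinearMap.eqLocus f g := iSup_le fun d x hx => h d x hx
  rw [iSup_deg] at this
  exact LinearMap.ext fun x => this trivial

/-- The degree involution `v ↦ (-1) ^ |v| v`. -/
def eps : V →ₗ[k] V := V.diag fun d => (-1) ^ d

/-- `v ↦ (-1) ^ (p |v|) v`. -/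
def sgn (p : ZMod 2) : V →ₗ[k] V := if p = 1 then V.eps else LinearMap.id

/-- The projection onto the sum of the components whose degree has parity `p`. -/
def par (p : ZMod 2) : V →ₗ[k] V := V.diag fun d => if (d : ZMod 2) = p then 1 else 0

theorem par_of_mem {d : ℤ} {x : V} (hx : x ∈ V.deg d) (p : ZMod 2) :
    V.par p x = if (d : ZMod 2) = p then x else 0 := by
  rw [par, diag_of_mem V _ hx]; split_ifs <;> simp

theorem isDeg_diag (c : ℤ → k) : IsDeg V.deg V.deg (V.diag c) 0 := by
  intro i v hv
  rw [V.diag_of_mem c hv, add_zero]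
  exact Submodule.smul_mem _ _ hv

theorem isDeg_par (p : ZMod 2) : IsDeg V.deg V.deg (V.par p) 0 := V.isDeg_diag _

theorem isDeg_eps : IsDeg V.deg V.deg V.eps 0 := V.isDeg_diag _

theorem isDeg_sgn (p : ZMod 2) : IsDeg V.deg V.deg (V.sgn p) 0 := by
  unfold sgn; split_ifs
  exacts [V.isDeg_eps, IsDeg.id]

theorem diag_comp_diag (c c' : ℤ → k) : V.diag c ∘ₗ V.diag c' = V.diag fun d => c d * c' d := by
  refine V.ext_deg fun d x hx => ?_
  simp [V.diag_of_mem _ hx, smul_smul, mul_comm]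

variable [CharZero k]

theorem two_zpow_injective : Function.Injective fun d : ℤ => (2 : k) ^ d := by
  intro a b h
  have h' : (((2 : ℚ) ^ a : ℚ) : k) = (((2 : ℚ) ^ b : ℚ) : k) := by push_cast; exact h
  exact zpow_right_injective₀ (by norm_num) (by norm_num) (Rat.cast_injective h')

/-- Submodules on which an operator acts by distinct powers of two are independent. -/
theorem iSupIndep_of_weight {M : Type w} [AddCommGroup M] [Module k M] (deg : ℤ → Submodule k M)
    (φ : M →ₗ[k] M) (hφ : ∀ d, ∀ x ∈ deg d, φ x = (2 : k) ^ d • x) : iSupIndep deg :=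
  ((Module.End.eigenspaces_iSupIndep φ).comp (two_zpow_injective (k := k))).mono fun d x hx =>
    Module.End.mem_eigenspace_iff.2 (hφ d x hx)

theorem isInternal_of_weight {M : Type w} [AddCommGroup M] [Module k M] (deg : ℤ → Submodule k M)
    (h : ⨆ d, deg d = ⊤) (φ : M →ₗ[k] M) (hφ : ∀ d, ∀ x ∈ deg d, φ x = (2 : k) ^ d • x) :
    DirectSum.IsInternal deg :=
  DirectSum.isInternal_submodule_of_iSupIndep_of_iSup_eq_top (iSupIndep_of_weight deg φ hφ) h

/-- The direct sum `V ⊕ W`. -/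
def prod (V : GrMod.{u, v} k) (W : GrMod.{u, w} k) : GrMod.{u, max v w} k where
  carrier := V × W
  deg d := (V.deg d).prod (W.deg d)
  internal := by
    refine isInternal_of_weight _ ?_ (LinearMap.prodMap (V.diag (2 ^ ·)) (W.diag (2 ^ ·))) ?_
    · rw [eq_top_iff]
      rintro ⟨x, y⟩ -
      have hx : (⨆ d, V.deg d) ≤ (⨆ d, (V.deg d).prod (W.deg d)).comap (LinearMap.inl k V W) :=
        iSup_le fun d z hz => Submodule.mem_iSup_of_mem d (by simpa using hz)
      have hy : (⨆ d, W.deg d) ≤ (⨆ d, (V.deg d).prod (W.deg d)).comap (LinearMap.inr k V W) :=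
        iSup_le fun d z hz => Submodule.mem_iSup_of_mem d (by simpa using hz)
      rw [iSup_deg] at hx hy
      have hx' := hx (Submodule.mem_top : x ∈ (⊤ : Submodule k V))
      have hy' := hy (Submodule.mem_top : y ∈ (⊤ : Submodule k W))
      rw [Submodule.mem_comap] at hx' hy'
      have := Submodule.add_mem _ hx' hy'
      simpa using this
    · rintro d ⟨x, y⟩ ⟨hx, hy⟩
      simp [V.diag_of_mem _ hx, W.diag_of_mem _ hy]

/-- The space spanned by the homogeneous linear maps `V → W`. -/
def homSpan (V : GrMod.{u, v} k) (W : GrMod.{u, w} k) : Submodule k (V →ₗ[k] W) :=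
  Submodule.span k {f | ∃ p, IsDeg V.deg W.deg f p}

/-- The inner hom `Hom(V, W)` of graded vector spaces. -/
def hom (V : GrMod.{u, v} k) (W : GrMod.{u, w} k) : GrMod.{u, max v w} k where
  carrier := homSpan V W
  deg p :=
    { carrier := {f | IsDeg V.deg W.deg f.1 p}
      add_mem' := fun hf hg => hf.add hg
      zero_mem' := fun i v _ => Submodule.zero_mem _
      smul_mem' := fun c _ hf => hf.smul c }
  internal := by
    have hstab : ∀ f ∈ homSpan V W, W.diag (2 ^ ·) ∘ₗ f ∘ₗ V.diag (fun d => 2 ^ (-d)) ∈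
        homSpan V W := by
      intro f hf
      induction hf using Submodule.span_induction with
      | mem f hf =>
        obtain ⟨p, hp⟩ := hf
        exact Submodule.subset_span ⟨p, (W.isDeg_diag _).comp (hp.comp (V.isDeg_diag _)
          (zero_add p)) (add_zero p)⟩
      | zero => simp
      | add f g _ _ hf hg =>
        rw [LinearMap.add_comp, LinearMap.comp_add]; exact Submodule.add_mem _ hf hg
      | smul c f _ hf =>
        rw [LinearMap.smul_comp, LinearMap.comp_smul]; exact Submodule.smul_mem _ c hf
    refine isInternal_of_weight _ ?_
      { toFun := fun f => ⟨_, hstab f.1 f.2⟩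
        map_add' := fun f g => Subtype.ext (by simp [LinearMap.add_comp, LinearMap.comp_add])
        map_smul' := fun c f => Subtype.ext (by simp [LinearMap.smul_comp, LinearMap.comp_smul]) }
      ?_
    · rw [eq_top_iff]
      rintro ⟨f, hf⟩ -
      induction hf using Submodule.span_induction with
      | mem f hf =>
        obtain ⟨p, hp⟩ := hf
        exact Submodule.mem_iSup_of_mem p hp
      | zero => exact Submodule.zero_mem _
      | add f g _ _ hf hg => exact Submodule.add_mem _ hf hg
      | smul c f _ hf => exact Submodule.smul_mem _ c hf
    · intro p f hf
      refine Subtype.ext (V.ext_deg fun d x hx => ?_)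
      simp only [LinearMap.coe_mk, AddHom.coe_mk, LinearMap.comp_apply, V.diag_of_mem _ hx,
        map_smul, W.diag_of_mem _ (hf d x hx), Submodule.coe_smul, LinearMap.smul_apply, smul_smul]
      rw [zpow_add₀ two_ne_zero, zpow_neg, inv_mul_cancel_left₀ (zpow_ne_zero _ two_ne_zero)]

end GrMod

/-! ### Koszul signs -/

/-- The Koszul sign of a rearrangement of homogeneous factors indexed by `T`, of parities `p`, from
the order given by the positions `old` to the order given by the positions `new`: one factor `-1`
for every pair of odd factors whose order is reversed. -/
def koszulSign {T α β : Type} [Fintype T] [LinearOrder α] [LinearOrder β] (k : Type u) [Field k]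
    (old : T → α) (new : T → β) (p : T → ZMod 2) : k :=
  ∏ x, ∏ y, if old x < old y ∧ new y < new x ∧ p x = 1 ∧ p y = 1 then -1 else 1

section Signs

variable {k : Type u} [Field k] {T α β γ : Type} [Fintype T] [LinearOrder α] [LinearOrder β]
  [LinearOrder γ]

theorem koszulSign_zero (old : T → α) (new : T → β) : koszulSign k old new (fun _ => 0) = 1 := by
  simp [koszulSign]

theorem koszulSign_comp_equiv {T' : Type} [Fintype T'] (σ : T' ≃ T) (old : T → α) (new : T → β)
    (p : T → ZMod 2) :
    koszulSign k (old ∘ σ) (new ∘ σ) (p ∘ σ) = koszulSign k old new p := by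
  unfold koszulSign
  rw [← σ.prod_comp]
  refine Finset.prod_congr rfl fun x _ => ?_
  rw [← σ.prod_comp]
  rfl

theorem prod_prod_eq_of_injective (old : T → α) (h : Function.Injective old) (G : T → T → k)
    (hG : ∀ x, G x x = 1) :
    ∏ x, ∏ y, G x y = ∏ x, ∏ y, if old x < old y then G x y * G y x else 1 := by
  have h1 : ∀ x y, G x y = (if old x < old y then G x y else 1) *
      (if old y < old x then G x y else 1) := by
    intro x y
    rcases lt_trichotomy (old x) (old y) with hxy | hxy | hxy
    · simp [hxy, hxy.not_gt]
    · simp [h hxy, hG]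
    · simp [hxy, hxy.not_gt]
  have h2 : ∏ x, ∏ y, (if old y < old x then G x y else 1) =
      ∏ x, ∏ y, if old x < old y then G y x else 1 := by
    rw [Finset.prod_comm]
  calc ∏ x, ∏ y, G x y
      = ∏ x, ∏ y, (if old x < old y then G x y else 1) *
          (if old y < old x then G x y else 1) :=
        Finset.prod_congr rfl fun x _ => Finset.prod_congr rfl fun y _ => h1 x y
    _ = (∏ x, ∏ y, if old x < old y then G x y else 1) *
          ∏ x, ∏ y, (if old x < old y then G y x else 1) := by
        rw [← h2]; simp only [Finset.prod_mul_distrib]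
    _ = _ := by
        simp only [← Finset.prod_mul_distrib]
        refine Finset.prod_congr rfl fun x _ => Finset.prod_congr rfl fun y _ => ?_
        split_ifs <;> simp

/-- Koszul signs are multiplicative under composition of rearrangements. -/
theorem koszulSign_mul (old : T → α) (mid : T → β) (new : T → γ) (ho : Function.Injective old)
    (hm : Function.Injective mid) (hn : Function.Injective new) (p : T → ZMod 2) :
    koszulSign k old mid p * koszulSign k mid new p = koszulSign k old new p := by
  unfold koszulSign
  rw [prod_prod_eq_of_injective (k := k) old ho (fun x y =>
      if mid x < mid y ∧ new y < new x ∧ p x = 1 ∧ p y = 1 then -1 else 1) (by simp)]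
  simp only [← Finset.prod_mul_distrib]
  refine Finset.prod_congr rfl fun x _ => Finset.prod_congr rfl fun y _ => ?_
  by_cases hxy : old x < old y
  · have hne : x ≠ y := fun h => by simp [h] at hxy
    have h1 := lt_or_gt_of_ne (hm.ne hne)
    have h2 := lt_or_gt_of_ne (hn.ne hne)
    by_cases hp : p x = 1 <;> by_cases hq : p y = 1 <;>
      rcases h1 with h1 | h1 <;> rcases h2 with h2 | h2 <;>
      simp [hxy, h1, h2, h1.not_gt, h2.not_gt, hp, hq]
  · simp [hxy]

end Signs

section Operators

variable {k : Type u} [Field k]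

/-- The Koszul sign rule for rearranging the factors of `⨂ V i`, as a diagonal operator. -/
def signOp {ι α β : Type} [Fintype ι] [DecidableEq ι] [LinearOrder α] [LinearOrder β]
    (V : ι → GrMod.{u, v} k) (old : ι → α) (new : ι → β) : (⨂[k] i, V i) →ₗ[k] ⨂[k] i, V i :=
  ∑ p : ι → ZMod 2, koszulSign k old new p • PiTensorProduct.map fun i => (V i).par (p i)

theorem signOp_tprod {ι α β : Type} [Fintype ι] [DecidableEq ι] [LinearOrder α] [LinearOrder β]
    (V : ι → GrMod.{u, v} k) (old : ι → α) (new : ι → β) (d : ι → ℤ) (v : ∀ i, V i)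
    (hv : ∀ i, v i ∈ (V i).deg (d i)) :
    signOp V old new (PiTensorProduct.tprod k v) =
      koszulSign k old new (fun i => (d i : ZMod 2)) • PiTensorProduct.tprod k v := by
  rw [signOp, LinearMap.sum_apply, Finset.sum_eq_single fun i => (d i : ZMod 2)]
  · simp [PiTensorProduct.map_tprod, (V _).par_of_mem (hv _)]
  · intro p _ hp
    obtain ⟨i, hi⟩ := Function.ne_iff.1 hp
    rw [LinearMap.smul_apply, PiTensorProduct.map_tprod, MultilinearMap.map_coord_zero _ i,
      smul_zero]
    rw [(V i).par_of_mem (hv i), if_neg (Ne.symm hi)]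
  · simp

/-- The signed permutation `⨂ v i ↦ ± ⨂ v (ρ i)` of tensor factors. -/
def permPi {n : ℕ} (V : Fin n → GrMod.{u, v} k) (ρ : Equiv.Perm (Fin n)) :
    (⨂[k] i, V i) →ₗ[k] ⨂[k] i, V (ρ i) :=
  (PiTensorProduct.reindex k (fun i => V i) ρ.symm).toLinearMap ∘ₗ signOp V id ρ.symm

theorem permPi_tprod {n : ℕ} (V : Fin n → GrMod.{u, v} k) (ρ : Equiv.Perm (Fin n)) (d : Fin n → ℤ)
    (v : ∀ i, V i) (hv : ∀ i, v i ∈ (V i).deg (d i)) :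
    permPi V ρ (PiTensorProduct.tprod k v) =
      koszulSign k id ρ.symm (fun i => (d i : ZMod 2)) •
        PiTensorProduct.tprod k fun i => v (ρ i) := by
  rw [permPi, LinearMap.comp_apply, signOp_tprod V _ _ d v hv, map_smul]
  congr 1
  exact PiTensorProduct.reindex_tprod ρ.symm v

/-- The derivation `∑ i, 1 ⊗ ⋯ ⊗ D i ⊗ ⋯ ⊗ 1` of a tensor product, for operators `D i` of odd
degree. -/
def piDer {n : ℕ} (V : Fin n → GrMod.{u, v} k) (D : ∀ i, V i →ₗ[k] V i) :
    (⨂[k] i, V i) →ₗ[k] ⨂[k] i, V i :=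
  ∑ i, PiTensorProduct.map fun j =>
    if j < i then (V j).eps else if j = i then D j else LinearMap.id

/-- The parity `p` component of a linear map between graded vector spaces. -/
def parPart (V : GrMod.{u, v} k) (W : GrMod.{u, w} k) (p : ZMod 2) :
    (V →ₗ[k] W) →ₗ[k] (V →ₗ[k] W) :=
  ∑ q : ZMod 2, (LinearMap.lcomp k W (V.par q)) ∘ₗ (LinearMap.llcomp k V W W (W.par (q + p)))

/-- The operator `1 ⊗ f 0 ⊗ ⋯ ⊗ f (n - 1)` from `M ⊗ V ⊗ ⋯ ⊗ V` to `M ⊗ W ⊗ ⋯ ⊗ W`, with the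
Koszul sign rule: the parity `p j` component of `f j` passes `M` and the factors `V` that precede
the `j`-th one. -/
def tensorMap (M : GrMod.{u, v'} k) (V : GrMod.{u, v} k) (W : GrMod.{u, w} k) (n : ℕ) :
    MultilinearMap k (fun _ : Fin n => V →ₗ[k] W)
      ((M ⊗[k] (⨂[k] _ : Fin n, V)) →ₗ[k] (M ⊗[k] (⨂[k] _ : Fin n, W))) :=
  ∑ p : Fin n → ZMod 2,
    (TensorProduct.mapBilinear (RingHom.id k) M (⨂[k] _ : Fin n, V) M (⨂[k] _ : Fin n, W)
        (M.sgn (∑ j, p j))).compMultilinearMap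
      ((PiTensorProduct.mapMultilinear k (fun _ : Fin n => (V : Type v))
        (fun _ : Fin n => (W : Type w))).compLinearMap fun j =>
          (LinearMap.lcomp k W (V.sgn (∑ i with j < i, p i))) ∘ₗ parPart V W (p j))

/-- The isomorphism `⨂ x, W x ≅ ⨂ j, ⨂ s, W (e (j, s))`, without signs. -/
def blocks {m n : ℕ} (W : Fin n → GrMod.{u, w} k) (r : Fin m → ℕ)
    (e : (Σ j, Fin (r j)) ≃ Fin n) :
    (⨂[k] x, W x) →ₗ[k] ⨂[k] j, ⨂[k] s, W (e ⟨j, s⟩) :=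
  PiTensorProduct.lift
      ((PiTensorProduct.tprod k).compMultilinearMap fun j =>
        PiTensorProduct.tprod k (s := fun s : Fin (r j) => (W (e ⟨j, s⟩) : Type w))) ∘ₗ
    (PiTensorProduct.reindex k (fun x => (W x : Type w)) e.symm).toLinearMap

/-- The positions of the factors `V j` (for `j : Fin m`) and `W x` (for `x : Fin n`) in the order
`V 0, W (e (0, 0)), W (e (0, 1)), …, V 1, W (e (1, 0)), …`. -/
abbrev regroupPos {m n : ℕ} (r : Fin m → ℕ) (e : (Σ j, Fin (r j)) ≃ Fin n) :
    Fin m ⊕ Fin n → ℕ ×ₗ ℕ :=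
  Sum.elim (fun j => toLex ((j : ℕ), 0)) fun x =>
    toLex (((e.symm x).1 : ℕ), ((e.symm x).2 : ℕ) + 1)

/-- The sign operator for `regroup`: the factors `V 0, …, V (m - 1), W 0, …, W (n - 1)` are moved to
the order `V 0, W (e (0, 0)), W (e (0, 1)), …, V 1, W (e (1, 0)), …`. -/
def regroupSign {m n : ℕ} (V : Fin m → GrMod.{u, v} k) (W : Fin n → GrMod.{u, w} k)
    (r : Fin m → ℕ) (e : (Σ j, Fin (r j)) ≃ Fin n) :
    ((⨂[k] j, V j) ⊗[k] (⨂[k] x, W x)) →ₗ[k] ((⨂[k] j, V j) ⊗[k] (⨂[k] x, W x)) :=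
  ∑ p : Fin m → ZMod 2, ∑ q : Fin n → ZMod 2,
    koszulSign k (fun t : Fin m ⊕ Fin n => toLex t) (regroupPos r e) (Sum.elim p q) •
    TensorProduct.map (PiTensorProduct.map fun j => (V j).par (p j))
      (PiTensorProduct.map fun x => (W x).par (q x))

/-- The isomorphism `(⨂ j, V j) ⊗ (⨂ x, W x) ≅ ⨂ j, (V j ⊗ ⨂ s, W (e (j, s)))` that distributes the
factors `W x` over the blocks given by `e`, with the Koszul sign rule. -/
def regroup {m n : ℕ} (V : Fin m → GrMod.{u, v} k) (W : Fin n → GrMod.{u, w} k) (r : Fin m → ℕ)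
    (e : (Σ j, Fin (r j)) ≃ Fin n) :
    ((⨂[k] j, V j) ⊗[k] (⨂[k] x, W x)) →ₗ[k] ⨂[k] j, (V j ⊗[k] (⨂[k] s, W (e ⟨j, s⟩))) :=
  TensorProduct.lift
    (LinearMap.lcomp k _ (blocks W r e) ∘ₗ
      PiTensorProduct.map₂ fun j => TensorProduct.mk k (V j) (⨂[k] s, W (e ⟨j, s⟩))) ∘ₗ
  regroupSign V W r e

theorem blocks_tprod {m n : ℕ} (W : Fin n → GrMod.{u, w} k) (r : Fin m → ℕ)
    (e : (Σ j, Fin (r j)) ≃ Fin n) (w : ∀ x, W x) :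
    blocks W r e (PiTensorProduct.tprod k w) =
      PiTensorProduct.tprod k fun j => PiTensorProduct.tprod k fun s => w (e ⟨j, s⟩) := by
  rw [blocks, LinearMap.comp_apply, LinearEquiv.coe_coe, PiTensorProduct.reindex_tprod]
  exact PiTensorProduct.lift.tprod _

theorem regroupSign_tmul {m n : ℕ} (V : Fin m → GrMod.{u, v} k) (W : Fin n → GrMod.{u, w} k)
    (r : Fin m → ℕ) (e : (Σ j, Fin (r j)) ≃ Fin n) (c : Fin m → ℤ) (d : Fin n → ℤ)
    (v : ∀ j, V j) (w : ∀ x, W x) (hv : ∀ j, v j ∈ (V j).deg (c j))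
    (hw : ∀ x, w x ∈ (W x).deg (d x)) :
    regroupSign V W r e (PiTensorProduct.tprod k v ⊗ₜ PiTensorProduct.tprod k w) =
      koszulSign k (fun t : Fin m ⊕ Fin n => toLex t) (regroupPos r e)
        (Sum.elim (fun j => (c j : ZMod 2)) fun x => (d x : ZMod 2)) •
      (PiTensorProduct.tprod k v ⊗ₜ PiTensorProduct.tprod k w) := by
  rw [regroupSign, LinearMap.sum_apply, Finset.sum_eq_single fun i => (c i : ZMod 2)]
  · rw [LinearMap.sum_apply, Finset.sum_eq_single fun i => (d i : ZMod 2)]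
    · simp [PiTensorProduct.map_tprod, (V _).par_of_mem (hv _), (W _).par_of_mem (hw _)]
    · intro p _ hp
      obtain ⟨i, hi⟩ := Function.ne_iff.1 hp
      rw [LinearMap.smul_apply, TensorProduct.map_tmul, PiTensorProduct.map_tprod,
        PiTensorProduct.map_tprod, (PiTensorProduct.tprod k (s := fun x => (W x : Type w))
          ).map_coord_zero i, TensorProduct.tmul_zero, smul_zero]
      rw [(W i).par_of_mem (hw i), if_neg (Ne.symm hi)]
    · simp
  · intro p _ hp
    obtain ⟨i, hi⟩ := Function.ne_iff.1 hp
    rw [LinearMap.sum_apply]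
    refine Finset.sum_eq_zero fun q _ => ?_
    rw [LinearMap.smul_apply, TensorProduct.map_tmul, PiTensorProduct.map_tprod,
      PiTensorProduct.map_tprod, (PiTensorProduct.tprod k (s := fun x => (V x : Type v))
        ).map_coord_zero i, TensorProduct.zero_tmul, smul_zero]
    rw [(V i).par_of_mem (hv i), if_neg (Ne.symm hi)]
  · simp

theorem regroup_tmul {m n : ℕ} (V : Fin m → GrMod.{u, v} k) (W : Fin n → GrMod.{u, w} k)
    (r : Fin m → ℕ) (e : (Σ j, Fin (r j)) ≃ Fin n) (c : Fin m → ℤ) (d : Fin n → ℤ)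
    (v : ∀ j, V j) (w : ∀ x, W x) (hv : ∀ j, v j ∈ (V j).deg (c j))
    (hw : ∀ x, w x ∈ (W x).deg (d x)) :
    regroup V W r e (PiTensorProduct.tprod k v ⊗ₜ PiTensorProduct.tprod k w) =
      koszulSign k (fun t : Fin m ⊕ Fin n => toLex t) (regroupPos r e)
        (Sum.elim (fun j => (c j : ZMod 2)) fun x => (d x : ZMod 2)) •
      PiTensorProduct.tprod k fun j =>
        v j ⊗ₜ[k] PiTensorProduct.tprod k fun s => w (e ⟨j, s⟩) := by
  rw [regroup, LinearMap.comp_apply, regroupSign_tmul V W r e c d v w hv hw, map_smul]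
  congr 1
  simp [blocks_tprod, PiTensorProduct.map₂_tprod_tprod]

theorem isDeg_regroup {m n : ℕ} (V : Fin m → GrMod.{u, v} k) (W : Fin n → GrMod.{u, w} k)
    (r : Fin m → ℕ) (e : (Σ j, Fin (r j)) ≃ Fin n) :
    IsDeg (tensorDeg (piDeg fun j => (V j).deg) (piDeg fun x => (W x).deg))
      (piDeg fun j => tensorDeg (V j).deg (piDeg fun s => (W (e ⟨j, s⟩)).deg))
      (regroup V W r e) 0 := by
  apply isDeg_of_span
  rintro D _ ⟨i, j, x, y, hx, hy, rfl, rfl⟩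
  rw [add_zero]
  induction hx using Submodule.span_induction with
  | zero => simp
  | add a b _ _ ha hb => rw [TensorProduct.add_tmul, map_add]; exact Submodule.add_mem _ ha hb
  | smul a b _ hb => rw [← TensorProduct.smul_tmul', map_smul]; exact Submodule.smul_mem _ _ hb
  | mem x hx =>
    obtain ⟨c, v, hv, rfl, rfl⟩ := hx
    induction hy using Submodule.span_induction with
    | zero => simp
    | add a b _ _ ha hb => rw [TensorProduct.tmul_add, map_add]; exact Submodule.add_mem _ ha hb
    | smul a b _ hb => rw [TensorProduct.tmul_smul, map_smul]; exact Submodule.smul_mem _ _ hb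
    | mem y hy =>
      obtain ⟨d, w, hw, rfl, rfl⟩ := hy
      rw [regroup_tmul V W r e c d v w hv hw]
      refine Submodule.smul_mem _ _ (Submodule.subset_span
        ⟨fun j => c j + ∑ s, d (e ⟨j, s⟩), _, fun j => Submodule.subset_span
          ⟨c j, ∑ s, d (e ⟨j, s⟩), _, _, hv j, Submodule.subset_span
            ⟨fun s => d (e ⟨j, s⟩), _, fun s => hw _, rfl, rfl⟩, rfl, rfl⟩, ?_, rfl⟩)
      rw [Finset.sum_add_distrib, ← e.sum_comp d, Fintype.sum_sigma]

theorem isDeg_piDer {n : ℕ} (V : Fin n → GrMod.{u, v} k) (D : ∀ i, V i →ₗ[k] V i) (p : ℤ)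
    (hD : ∀ i, IsDeg (V i).deg (V i).deg (D i) p) :
    IsDeg (piDeg fun i => (V i).deg) (piDeg fun i => (V i).deg) (piDer V D) p := by
  refine IsDeg.sum _ fun i _ => IsDeg.pi (p := fun j => if j = i then p else 0) (fun j => ?_)
    (by simp)
  by_cases h1 : j < i
  · simpa [h1, h1.ne] using (V j).isDeg_eps
  · by_cases h2 : j = i
    · simpa [h1, h2] using hD j
    · simpa [h1, h2] using IsDeg.id

theorem isDeg_parPart (V : GrMod.{u, v} k) (W : GrMod.{u, w} k) (q : ZMod 2) {f : V →ₗ[k] W}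
    {p : ℤ} (hf : IsDeg V.deg W.deg f p) : IsDeg V.deg W.deg (parPart V W q f) p := by
  rw [parPart, LinearMap.sum_apply]
  refine IsDeg.sum _ fun i _ => ?_
  exact ((W.isDeg_par _).comp hf (add_zero p)).comp (V.isDeg_par _) (zero_add p)

theorem isDeg_tensorMap (M : GrMod.{u, v'} k) (V : GrMod.{u, v} k) (W : GrMod.{u, w} k) (n : ℕ)
    (f : Fin n → V →ₗ[k] W) (d : Fin n → ℤ) (hf : ∀ j, IsDeg V.deg W.deg (f j) (d j)) :
    IsDeg (tensorDeg M.deg (piDeg fun _ : Fin n => V.deg))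
      (tensorDeg M.deg (piDeg fun _ : Fin n => W.deg)) (tensorMap M V W n f) (∑ j, d j) := by
  rw [tensorMap, sum_apply]
  refine IsDeg.sum _ fun p _ => ?_
  refine IsDeg.tensor (M.isDeg_sgn _) (IsDeg.pi (fun j => ?_) rfl) (zero_add _)
  exact (isDeg_parPart V W (p j) (hf j)).comp (V.isDeg_sgn _) (zero_add _)

end Operators

/-! ### Cooperads -/

/-- A reduced coaugmented dg cooperad. The map `decomp r e` is the cooperadic comultiplication
`C(n) → C(m) ⊗ C(r 0) ⊗ ⋯ ⊗ C(r (m - 1))` of the two-level planar tree whose upper vertices have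
`r 0, …, r (m - 1)` inputs, where the `s`-th input of the `j`-th upper vertex is labelled by
`e (j, s)`. -/
structure Cooperad (k : Type u) [Field k] where
  /-- the graded vector spaces `C(n)` -/
  obj : ℕ → GrMod.{u, v} k
  /-- the cooperad is reduced, i.e. `C(0) = 0` -/
  obj_zero : ∀ x : obj 0, x = 0
  d : ∀ n, obj n →ₗ[k] obj n
  d_deg : ∀ n, IsDeg (obj n).deg (obj n).deg (d n) 1
  d_comp_d : ∀ n, d n ∘ₗ d n = 0
  /-- the left action of the symmetric group -/
  act : ∀ n, Representation k (Equiv.Perm (Fin n)) (obj n)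
  act_deg : ∀ n σ, IsDeg (obj n).deg (obj n).deg (act n σ) 0
  act_d : ∀ n σ, act n σ ∘ₗ d n = d n ∘ₗ act n σ
  decomp : ∀ {m n : ℕ} (r : Fin m → ℕ) (_ : (Σ j, Fin (r j)) ≃ Fin n),
    obj n →ₗ[k] (obj m ⊗[k] (⨂[k] j, obj (r j)))
  decomp_deg : ∀ {m n : ℕ} (r : Fin m → ℕ) (e : (Σ j, Fin (r j)) ≃ Fin n),
    IsDeg (obj n).deg (tensorDeg (obj m).deg (piDeg fun j => (obj (r j)).deg)) (decomp r e) 0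
  decomp_d : ∀ {m n : ℕ} (r : Fin m → ℕ) (e : (Σ j, Fin (r j)) ≃ Fin n),
    decomp r e ∘ₗ d n =
      (TensorProduct.map (d m) LinearMap.id +
        TensorProduct.map (obj m).eps (piDer (fun j => obj (r j)) fun j => d (r j))) ∘ₗ decomp r e
  /-- equivariance: relabelling the inputs of the tree -/
  decomp_relabel : ∀ {m n : ℕ} (r : Fin m → ℕ) (e : (Σ j, Fin (r j)) ≃ Fin n)
    (σ : Equiv.Perm (Fin n)), decomp r (e.trans σ) ∘ₗ act n σ = decomp r e
  /-- equivariance: permuting the inputs of each upper vertex -/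
  decomp_inner : ∀ {m n : ℕ} (r : Fin m → ℕ) (e : (Σ j, Fin (r j)) ≃ Fin n)
    (τ : ∀ j, Equiv.Perm (Fin (r j))),
    TensorProduct.map LinearMap.id (PiTensorProduct.map fun j => act (r j) (τ j)) ∘ₗ
      decomp r ((Equiv.sigmaCongrRight τ).trans e) = decomp r e
  /-- equivariance: permuting the upper vertices -/
  decomp_outer : ∀ {m n : ℕ} (r : Fin m → ℕ) (e : (Σ j, Fin (r j)) ≃ Fin n)
    (ρ : Equiv.Perm (Fin m)),
    TensorProduct.map (act m ρ) LinearMap.id ∘ₗ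
      decomp (fun j => r (ρ j)) ((Equiv.sigmaCongrLeft (β := fun j => Fin (r j)) ρ).trans e) =
    TensorProduct.map LinearMap.id (permPi (fun j => obj (r j)) ρ) ∘ₗ decomp r e
  /-- coassociativity: the two ways of decomposing along a three-level tree agree -/
  coassoc : ∀ {m K N : ℕ} (r : Fin m → ℕ) (e : (Σ j, Fin (r j)) ≃ Fin K) (l : Fin K → ℕ)
    (E : (Σ x, Fin (l x)) ≃ Fin N) (a : Fin m → ℕ)
    (f : ∀ j, (Σ s : Fin (r j), Fin (l (e ⟨j, s⟩))) ≃ Fin (a j)) (F : (Σ j, Fin (a j)) ≃ Fin N),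
    (∀ j s t, E ⟨e ⟨j, s⟩, t⟩ = F ⟨j, f j ⟨s, t⟩⟩) →
    TensorProduct.map LinearMap.id
        (PiTensorProduct.map fun j => decomp (fun s => l (e ⟨j, s⟩)) (f j)) ∘ₗ decomp a F =
      TensorProduct.map LinearMap.id
          (regroup (fun j => obj (r j)) (fun x => obj (l x)) r e) ∘ₗ
        (TensorProduct.assoc k (obj m) (⨂[k] j, obj (r j)) (⨂[k] x, obj (l x))).toLinearMap ∘ₗ
        TensorProduct.map (decomp r e) LinearMap.id ∘ₗ decomp l E
  counit : obj 1 →ₗ[k] k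
  counit_deg : ∀ i ≠ 0, ∀ x ∈ (obj 1).deg i, counit x = 0
  counit_d : counit ∘ₗ d 1 = 0
  counit_left : ∀ n,
    (TensorProduct.lid k (obj n)).toLinearMap ∘ₗ
      TensorProduct.map counit
        (PiTensorProduct.subsingletonEquiv (s := fun _ => (obj n : Type v)) (0 : Fin 1)
          ).toLinearMap ∘ₗ
      decomp (fun _ : Fin 1 => n) (Equiv.uniqueSigma fun _ : Fin 1 => Fin n) = LinearMap.id
  counit_right : ∀ n,
    (TensorProduct.rid k (obj n)).toLinearMap ∘ₗ
      TensorProduct.map LinearMap.id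
        (PiTensorProduct.lift ((MultilinearMap.mkPiAlgebra k (Fin n) k).compLinearMap
          fun _ => counit)) ∘ₗ
      decomp (fun _ : Fin n => 1) (Equiv.sigmaUnique (Fin n) fun _ => Fin 1) = LinearMap.id
  /-- the image of `1` under the coaugmentation -/
  coaug : obj 1
  coaug_deg : coaug ∈ (obj 1).deg 0
  coaug_d : d 1 coaug = 0
  counit_coaug : counit coaug = 1
  decomp_coaug : ∀ e : (Σ _ : Fin 1, Fin 1) ≃ Fin 1,
    decomp (fun _ => 1) e coaug = coaug ⊗ₜ PiTensorProduct.tprod k fun _ => coaug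

/-! ### Cofree coalgebras over a cooperad -/

section Cofree

variable {k : Type u} [Field k] (C : Cooperad.{u, v} k) (A : GrMod.{u, w} k)

/-- `C(n) ⊗ A ⊗ ⋯ ⊗ A`. -/
abbrev Ten (n : ℕ) : Type (max u v w) := C.obj n ⊗[k] (⨂[k] _ : Fin n, A)

/-- The total grading of `C(n) ⊗ A ⊗ ⋯ ⊗ A`. -/
abbrev tenDeg (n : ℕ) : ℤ → Submodule k (Ten C A n) :=
  tensorDeg (C.obj n).deg (piDeg fun _ : Fin n => A.deg)

/-- The action of the symmetric group on `C(n) ⊗ A ⊗ ⋯ ⊗ A`, with Koszul signs. -/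
def permTen {n : ℕ} (σ : Equiv.Perm (Fin n)) : Ten C A n →ₗ[k] Ten C A n :=
  TensorProduct.map (C.act n σ) (permPi (fun _ : Fin n => A) σ.symm)

/-- The relations that define the coinvariants. -/
def cofreeRel : Submodule k (⨁ n, Ten C A n) :=
  Submodule.span k {x | ∃ (n : ℕ) (σ : Equiv.Perm (Fin n)) (t : Ten C A n),
    x = DirectSum.lof k ℕ (Ten C A) n (permTen C A σ t) - DirectSum.lof k ℕ (Ten C A) n t}

/-- The underlying vector space of `C(A) = ⨁ n, (C(n) ⊗ A ⊗ ⋯ ⊗ A)_{S_n}`. -/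
abbrev CofreeSpace : Type (max u v w) := (⨁ n, Ten C A n) ⧸ cofreeRel C A

/-- The class in `C(A)` of an element of `C(n) ⊗ A ⊗ ⋯ ⊗ A`. -/
def clsAux (n : ℕ) : Ten C A n →ₗ[k] CofreeSpace C A :=
  (cofreeRel C A).mkQ ∘ₗ DirectSum.lof k ℕ (Ten C A) n

theorem clsAux_permTen {n : ℕ} (σ : Equiv.Perm (Fin n)) : clsAux C A n ∘ₗ permTen C A σ = clsAux C A n := by
  refine LinearMap.ext fun t => ?_
  exact (Submodule.Quotient.eq _).2 (Submodule.subset_span ⟨n, σ, _, rfl⟩)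

variable {C A}

/-- The linear map on `C(A)` given by invariant maps on the spaces `C(n) ⊗ A ⊗ ⋯ ⊗ A`. -/
def elimAux {M : Type*} [AddCommGroup M] [Module k M] (φ : ∀ n, Ten C A n →ₗ[k] M)
    (hφ : ∀ n σ, φ n ∘ₗ permTen C A σ = φ n) : CofreeSpace C A →ₗ[k] M :=
  (cofreeRel C A).liftQ (DirectSum.toModule k ℕ M φ) <| Submodule.span_le.2 <| by
    rintro _ ⟨n, σ, t, rfl⟩
    have := LinearMap.congr_fun (hφ n σ) t
    simpa [sub_eq_zero] using this

theorem elimAux_cls {M : Type*} [AddCommGroup M] [Module k M] (φ : ∀ n, Ten C A n →ₗ[k] M)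
    (hφ : ∀ n σ, φ n ∘ₗ permTen C A σ = φ n) (n : ℕ) (t : Ten C A n) :
    elimAux φ hφ (clsAux C A n t) = φ n t :=
  DirectSum.toModule_lof k n t

theorem aux_induction {P : CofreeSpace C A → Prop} (h0 : P 0)
    (hadd : ∀ x y, P x → P y → P (x + y)) (hcls : ∀ n t, P (clsAux C A n t)) (x) : P x := by
  obtain ⟨x, rfl⟩ := Submodule.mkQ_surjective _ x
  induction x using DirectSum.induction_on with
  | zero => simpa using h0
  | of n t => exact hcls n t
  | add x y hx hy => rw [map_add]; exact hadd _ _ hx hy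

/-- The elements of `C(n) ⊗ A ⊗ ⋯ ⊗ A` are spanned by the homogeneous ones. -/
theorem mem_of_homogeneous {n : ℕ} (N : Submodule k (Ten C A n))
    (h : ∀ (i : ℤ) (d : Fin n → ℤ) (c : C.obj n) (a : Fin n → A), c ∈ (C.obj n).deg i →
      (∀ j, a j ∈ A.deg (d j)) → c ⊗ₜ PiTensorProduct.tprod k a ∈ N) (t : Ten C A n) : t ∈ N := by
  induction t using TensorProduct.induction_on with
  | zero => exact Submodule.zero_mem _
  | add x y hx hy => exact Submodule.add_mem _ hx hy
  | tmul c a =>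
    have hc : (⨆ i, (C.obj n).deg i) ≤ N.comap ((TensorProduct.mk k _ _).flip a) := by
      refine iSup_le fun i c hc => ?_
      have ha : a ∈ Submodule.span k (Set.range (PiTensorProduct.tprod k (s := fun _ : Fin n =>
          (A : Type w)))) := by
        rw [PiTensorProduct.span_tprod_eq_top]; trivial
      induction ha using Submodule.span_induction with
      | zero => simp
      | add x y _ _ hx hy =>
        simp only [Submodule.mem_comap, LinearMap.flip_apply, TensorProduct.mk_apply,
          TensorProduct.tmul_add] at hx hy ⊢
        exact Submodule.add_mem _ hx hy
      | smul b x _ hx =>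
        simp only [Submodule.mem_comap, LinearMap.flip_apply, TensorProduct.mk_apply,
          TensorProduct.tmul_smul] at hx ⊢
        exact Submodule.smul_mem _ _ hx
      | mem x hx =>
        obtain ⟨a, rfl⟩ := hx
        exact multilinear_mem (𝒱 := fun _ => A.deg)
          ((TensorProduct.mk k _ _ c).compMultilinearMap (PiTensorProduct.tprod k)) N
          (fun d a ha => h i d c a hc ha) a fun j => by rw [A.iSup_deg]; trivial
    rw [GrMod.iSup_deg] at hc
    exact hc (Submodule.mem_top : c ∈ (⊤ : Submodule k (C.obj n)))

theorem ten_ext {M : Type*} [AddCommGroup M] [Module k M] {n : ℕ} {f g : Ten C A n →ₗ[k] M}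
    (h : ∀ (i : ℤ) (d : Fin n → ℤ) (c : C.obj n) (a : Fin n → A), c ∈ (C.obj n).deg i →
      (∀ j, a j ∈ A.deg (d j)) →
      f (c ⊗ₜ PiTensorProduct.tprod k a) = g (c ⊗ₜ PiTensorProduct.tprod k a)) : f = g :=
  LinearMap.ext fun t => mem_of_homogeneous (LinearMap.eqLocus f g) h t

theorem permTen_tmul {n : ℕ} (σ : Equiv.Perm (Fin n)) (d : Fin n → ℤ) (c : C.obj n)
    (a : Fin n → A) (ha : ∀ j, a j ∈ A.deg (d j)) :
    permTen C A σ (c ⊗ₜ PiTensorProduct.tprod k a) =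
      koszulSign k id σ (fun j => (d j : ZMod 2)) •
        (C.act n σ c ⊗ₜ PiTensorProduct.tprod k fun j => a (σ.symm j)) := by
  rw [permTen, TensorProduct.map_tmul, permPi_tprod (fun _ => A) σ.symm d a ha,
    TensorProduct.tmul_smul]
  rfl

/-- The operator that multiplies elements of `C(n) ⊗ A ⊗ ⋯ ⊗ A` of degree `D` by `2 ^ D`. -/
def weightTen (C : Cooperad.{u, v} k) (A : GrMod.{u, w} k) (n : ℕ) : Ten C A n →ₗ[k] Ten C A n :=
  TensorProduct.map ((C.obj n).diag (2 ^ ·)) (PiTensorProduct.map fun _ => A.diag (2 ^ ·))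

theorem weightTen_tmul {n : ℕ} (i : ℤ) (d : Fin n → ℤ) (c : C.obj n) (a : Fin n → A)
    (hc : c ∈ (C.obj n).deg i) (ha : ∀ j, a j ∈ A.deg (d j)) :
    weightTen C A n (c ⊗ₜ PiTensorProduct.tprod k a) =
      ((2 : k) ^ i * ∏ j, (2 : k) ^ d j) • (c ⊗ₜ PiTensorProduct.tprod k a) := by
  simp only [weightTen, TensorProduct.map_tmul, PiTensorProduct.map_tprod, A.diag_of_mem _ (ha _),
    MultilinearMap.map_smul_univ, (C.obj n).diag_of_mem _ hc, TensorProduct.smul_tmul_smul]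

theorem weightTen_permTen {n : ℕ} (σ : Equiv.Perm (Fin n)) :
    weightTen C A n ∘ₗ permTen C A σ = permTen C A σ ∘ₗ weightTen C A n := by
  refine ten_ext fun i d c a hc ha => ?_
  have hc' := C.act_deg n σ i c hc
  rw [add_zero] at hc'
  rw [LinearMap.comp_apply, LinearMap.comp_apply, weightTen_tmul i d c a hc ha, map_smul,
    permTen_tmul σ d c a ha, map_smul,
    weightTen_tmul i (fun j => d (σ.symm j)) _ _ hc' fun j => ha _,
    Equiv.prod_comp σ.symm fun j => (2 : k) ^ d j, smul_comm]

variable (C A)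

/-- The operator that multiplies elements of `C(A)` of degree `D` by `2 ^ D`. -/
def weightCofree : CofreeSpace C A →ₗ[k] CofreeSpace C A :=
  elimAux (fun n => clsAux C A n ∘ₗ weightTen C A n) fun n σ => by
    rw [LinearMap.comp_assoc, weightTen_permTen, ← LinearMap.comp_assoc, clsAux_permTen]

theorem prod_two_zpow [CharZero k] {n : ℕ} (d : Fin n → ℤ) :
    ∏ j, (2 : k) ^ d j = 2 ^ ∑ j, d j := by
  induction n with
  | zero => simp
  | succ n ih => rw [Fin.prod_univ_succ, Fin.sum_univ_succ, ih, zpow_add₀ two_ne_zero]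

variable [CharZero k]

/-- The cofree `C`-coalgebra `C(A) = ⨁ n, (C(n) ⊗ A ⊗ ⋯ ⊗ A)_{S_n}`, as a graded vector space. -/
def cofree : GrMod.{u, max u v w} k where
  carrier := CofreeSpace C A
  deg D := ⨆ n, (tenDeg C A n D).map (clsAux C A n)
  internal := by
    refine GrMod.isInternal_of_weight _ ?_ (weightCofree C A) ?_
    · rw [eq_top_iff]
      rintro x -
      induction x using aux_induction with
      | h0 => exact Submodule.zero_mem _
      | hadd x y hx hy => exact Submodule.add_mem _ hx hy
      | hcls n t =>
        refine mem_of_homogeneous ((⨆ D, ⨆ n, (tenDeg C A n D).map (clsAux C A n)).comap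
          (clsAux C A n)) (fun i d c a hc ha => ?_) t
        exact Submodule.mem_iSup_of_mem (i + ∑ j, d j) (Submodule.mem_iSup_of_mem n
          (Submodule.mem_map_of_mem (Submodule.subset_span ⟨i, ∑ j, d j, c, _, hc,
            Submodule.subset_span ⟨d, a, ha, rfl, rfl⟩, rfl, rfl⟩)))
    · intro D x hx
      have key : ∀ n, (tenDeg C A n D).map (clsAux C A n) ≤
          LinearMap.eqLocus (weightCofree C A) ((2 : k) ^ D • LinearMap.id) := by
        intro n
        rw [Submodule.map_le_iff_le_comap]
        refine Submodule.span_le.2 ?_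
        rintro _ ⟨i, j, c, a, hc, ha, rfl, rfl⟩
        induction ha using Submodule.span_induction with
        | zero => simp
        | add x y _ _ hx hy =>
          rw [TensorProduct.tmul_add]; exact Submodule.add_mem _ hx hy
        | smul b x _ hx => rw [TensorProduct.tmul_smul]; exact Submodule.smul_mem _ _ hx
        | mem a ha =>
          obtain ⟨d, a, ha, rfl, rfl⟩ := ha
          change weightCofree C A (clsAux C A n _) = _
          rw [weightCofree, elimAux_cls, LinearMap.comp_apply, weightTen_tmul i d c a hc ha,
            prod_two_zpow, ← zpow_add₀ two_ne_zero, map_smul]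
          rfl
      exact iSup_le key hx

/-- The class in `C(A)` of an element of `C(n) ⊗ A ⊗ ⋯ ⊗ A`. -/
def cls (n : ℕ) : Ten C A n →ₗ[k] cofree C A := clsAux C A n

theorem cls_permTen {n : ℕ} (σ : Equiv.Perm (Fin n)) : cls C A n ∘ₗ permTen C A σ = cls C A n :=
  clsAux_permTen C A σ

variable {C A}

/-- The linear map on `C(A)` given by invariant maps on the spaces `C(n) ⊗ A ⊗ ⋯ ⊗ A`. -/
def cofreeElim {M : Type*} [AddCommGroup M] [Module k M] (φ : ∀ n, Ten C A n →ₗ[k] M)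
    (hφ : ∀ n σ, φ n ∘ₗ permTen C A σ = φ n) : cofree C A →ₗ[k] M := elimAux φ hφ

theorem cofreeElim_cls {M : Type*} [AddCommGroup M] [Module k M] (φ : ∀ n, Ten C A n →ₗ[k] M)
    (hφ : ∀ n σ, φ n ∘ₗ permTen C A σ = φ n) (n : ℕ) (t : Ten C A n) :
    cofreeElim φ hφ (cls C A n t) = φ n t := elimAux_cls φ hφ n t

variable (C A)

theorem cofree_deg (D : ℤ) :
    (cofree C A).deg D = ⨆ n, (tenDeg C A n D).map (cls C A n) := rfl

theorem isDeg_cls (n : ℕ) : IsDeg (tenDeg C A n) (cofree C A).deg (cls C A n) 0 := by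
  intro D t ht
  rw [add_zero, cofree_deg]
  exact Submodule.mem_iSup_of_mem n (Submodule.mem_map_of_mem ht)

theorem isDeg_cofree {M : Type*} [AddCommGroup M] [Module k M] {ℳ : ℤ → Submodule k M}
    {f : cofree C A →ₗ[k] M} {p : ℤ} (h : ∀ n, IsDeg (tenDeg C A n) ℳ (f ∘ₗ cls C A n) p) :
    IsDeg (cofree C A).deg ℳ f p := by
  intro D x hx
  have : (⨆ n, (tenDeg C A n D).map (cls C A n)) ≤ (ℳ (D + p)).comap f :=
    iSup_le fun n => Submodule.map_le_iff_le_comap.2 fun t ht => h n D t ht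
  exact this hx

/-! #### The coalgebra structure -/

/-- The summand of `comul` that belongs to the labelled tree `(r, e)`. -/
def comulTerm {m n : ℕ} (r : Fin m → ℕ) (e : (Σ j, Fin (r j)) ≃ Fin n) :
    Ten C A n →ₗ[k] (C.obj m ⊗[k] (⨂[k] _ : Fin m, cofree C A)) :=
  TensorProduct.map LinearMap.id (PiTensorProduct.map fun j => cls C A (r j)) ∘ₗ
    TensorProduct.map LinearMap.id (regroup (fun j => C.obj (r j)) (fun _ : Fin n => A) r e) ∘ₗ
    (TensorProduct.assoc k (C.obj m) (⨂[k] j, C.obj (r j)) (⨂[k] _ : Fin n, A)).toLinearMap ∘ₗ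
    TensorProduct.map (C.decomp r e) LinearMap.id

theorem isDeg_assoc {X Y Z : Type*} [AddCommGroup X] [Module k X] [AddCommGroup Y] [Module k Y]
    [AddCommGroup Z] [Module k Z] (𝒳 : ℤ → Submodule k X) (𝒴 : ℤ → Submodule k Y)
    (𝒵 : ℤ → Submodule k Z) :
    IsDeg (tensorDeg (tensorDeg 𝒳 𝒴) 𝒵) (tensorDeg 𝒳 (tensorDeg 𝒴 𝒵))
      (TensorProduct.assoc k X Y Z).toLinearMap 0 := by
  apply isDeg_of_span
  rintro D _ ⟨i, j, t, z, ht, hz, rfl, rfl⟩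
  rw [add_zero]
  induction ht using Submodule.span_induction with
  | zero => simp
  | add x y _ _ hx hy => rw [TensorProduct.add_tmul, map_add]; exact Submodule.add_mem _ hx hy
  | smul b x _ hx => rw [← TensorProduct.smul_tmul', map_smul]; exact Submodule.smul_mem _ _ hx
  | mem t ht =>
    obtain ⟨a, b, x, y, hx, hy, rfl, rfl⟩ := ht
    exact Submodule.subset_span ⟨a, b + j, x, y ⊗ₜ z, hx,
      Submodule.subset_span ⟨b, j, y, z, hy, hz, rfl, rfl⟩, by ring, rfl⟩

theorem isDeg_comulTerm {m n : ℕ} (r : Fin m → ℕ) (e : (Σ j, Fin (r j)) ≃ Fin n) :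
    IsDeg (tenDeg C A n) (tensorDeg (C.obj m).deg (piDeg fun _ : Fin m => (cofree C A).deg))
      (comulTerm C A r e) 0 := by
  have h1 : IsDeg (tenDeg C A n) (tensorDeg (tensorDeg (C.obj m).deg
      (piDeg fun j => (C.obj (r j)).deg)) (piDeg fun _ : Fin n => A.deg))
      (TensorProduct.map (C.decomp r e) LinearMap.id) 0 :=
    (C.decomp_deg r e).tensor IsDeg.id (add_zero 0)
  have h2 := (isDeg_assoc (C.obj m).deg (piDeg fun j => (C.obj (r j)).deg)
    (piDeg fun _ : Fin n => A.deg)).comp h1 (add_zero 0)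
  have h3 : IsDeg (tensorDeg (C.obj m).deg (tensorDeg (piDeg fun j => (C.obj (r j)).deg)
      (piDeg fun _ : Fin n => A.deg)))
      (tensorDeg (C.obj m).deg (piDeg fun j => tenDeg C A (r j)))
      (TensorProduct.map LinearMap.id
        (regroup (fun j => C.obj (r j)) (fun _ : Fin n => A) r e)) 0 :=
    IsDeg.id.tensor (isDeg_regroup _ _ r e) (add_zero 0)
  have h4 : IsDeg (tensorDeg (C.obj m).deg (piDeg fun j => tenDeg C A (r j)))
      (tensorDeg (C.obj m).deg (piDeg fun _ : Fin m => (cofree C A).deg))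
      (TensorProduct.map LinearMap.id (PiTensorProduct.map fun j => cls C A (r j))) 0 :=
    IsDeg.id.tensor (IsDeg.pi (p := fun _ => 0) (fun j => isDeg_cls C A (r j)) (by simp))
      (add_zero 0)
  exact h4.comp (h3.comp h2 (add_zero 0)) (add_zero 0)

theorem tprod_tmul_ext {m n : ℕ} {V : Fin m → GrMod.{u, v} k} {W : Fin n → GrMod.{u, w} k}
    {M : Type*} [AddCommGroup M] [Module k M] {f g : ((⨂[k] j, V j) ⊗[k] (⨂[k] x, W x)) →ₗ[k] M}
    (h : ∀ (c : Fin m → ℤ) (d : Fin n → ℤ) (v : ∀ j, V j) (w : ∀ x, W x),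
      (∀ j, v j ∈ (V j).deg (c j)) → (∀ x, w x ∈ (W x).deg (d x)) →
      f (PiTensorProduct.tprod k v ⊗ₜ PiTensorProduct.tprod k w) =
        g (PiTensorProduct.tprod k v ⊗ₜ PiTensorProduct.tprod k w)) : f = g := by
  refine TensorProduct.ext (PiTensorProduct.ext (MultilinearMap.ext fun v =>
    PiTensorProduct.ext (MultilinearMap.ext fun w => ?_)))
  have key : ∀ (d : Fin n → ℤ) (w : ∀ x, W x), (∀ x, w x ∈ (W x).deg (d x)) →
      (f - g) (PiTensorProduct.tprod k v ⊗ₜ PiTensorProduct.tprod k w) = 0 := by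
    intro d w hw
    exact multilinear_mem (𝒱 := fun j => (V j).deg)
      (((f - g) ∘ₗ (TensorProduct.mk k _ _).flip (PiTensorProduct.tprod k w)).compMultilinearMap
        (PiTensorProduct.tprod k)) ⊥ (fun c v hv => by simp [h c d v w hv hw]) v
      fun j => by rw [(V j).iSup_deg]; trivial
  have := multilinear_mem (𝒱 := fun j => (W j).deg)
      (((f - g) ∘ₗ (TensorProduct.mk k _ _) (PiTensorProduct.tprod k v)).compMultilinearMap
        (PiTensorProduct.tprod k)) ⊥ (fun d w hw => key d w hw) w
      fun j => by rw [(W j).iSup_deg]; trivial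
  exact sub_eq_zero.1 this

theorem regroupPos_injective {m n : ℕ} (r : Fin m → ℕ) (e : (Σ j, Fin (r j)) ≃ Fin n) :
    Function.Injective (regroupPos r e) := by
  rintro (i | x) (j | y) h
  · have h1 := congrArg (fun z => (ofLex z).1) h
    simpa [Fin.ext_iff] using h1
  · have h2 := congrArg (fun z => (ofLex z).2) h
    simp at h2
  · have h2 := congrArg (fun z => (ofLex z).2) h
    simp at h2
  · have h1 := congrArg (fun z => (ofLex z).1) h
    have h2 := congrArg (fun z => (ofLex z).2) h
    simp only [Sum.elim_inr, ofLex_toLex, add_left_inj] at h1 h2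
    congr 1
    apply e.symm.injective
    generalize e.symm x = x' at *
    generalize e.symm y = y' at *
    obtain ⟨a, s⟩ := x'
    obtain ⟨b, t⟩ := y'
    obtain rfl := Fin.ext h1
    obtain rfl := Fin.ext h2
    rfl

theorem koszulSign_inr {m n : ℕ} (σ : Equiv.Perm (Fin n)) (p : Fin m → ZMod 2)
    (q : Fin n → ZMod 2) :
    koszulSign k (fun t : Fin m ⊕ Fin n => toLex t)
      (fun t => toLex (Equiv.sumCongr (Equiv.refl _) σ t)) (Sum.elim p q) =
    koszulSign k id σ q := by
  simp only [koszulSign, Fintype.prod_sum_type]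
  simp +contextual [Sum.Lex.toLex_lt_toLex, not_lt_of_gt]
  refine (congrArg (· * _) ?_).trans (one_mul _)
  apply Finset.prod_eq_one
  intro x _
  apply Finset.prod_eq_one
  intro y _
  exact if_neg fun h => absurd h.1 h.2.1.not_gt

theorem regroup_permPi {m n : ℕ} (V : Fin m → GrMod.{u, v} k) (r : Fin m → ℕ)
    (e : (Σ j, Fin (r j)) ≃ Fin n) (σ : Equiv.Perm (Fin n)) :
    regroup V (fun _ => A) r (e.trans σ) ∘ₗ
      TensorProduct.map LinearMap.id (permPi (fun _ : Fin n => A) σ.symm) =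
    regroup V (fun _ => A) r e := by
  refine tprod_tmul_ext fun c d v w hv hw => ?_
  have hσ : permPi (fun _ : Fin n => A) σ.symm (PiTensorProduct.tprod k w) =
      koszulSign k id σ (fun i => (d i : ZMod 2)) •
        PiTensorProduct.tprod k fun i => w (σ.symm i) := permPi_tprod _ σ.symm d w hw
  rw [LinearMap.comp_apply, TensorProduct.map_tmul, hσ, TensorProduct.tmul_smul, map_smul,
    LinearMap.id_apply, regroup_tmul V (fun _ => A) r e c d v w hv hw,
    regroup_tmul V (fun _ => A) r (e.trans σ) c (fun i => d (σ.symm i)) v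
      (fun i => w (σ.symm i)) hv fun i => hw _, smul_smul]
  congr 1
  · rw [← koszulSign_mul (k := k) (fun t : Fin m ⊕ Fin n => toLex t)
      (fun t => toLex (Equiv.sumCongr (Equiv.refl _) σ t)) (regroupPos r e)
      (fun _ _ h => toLex.injective h)
      (fun _ _ h => (Equiv.sumCongr (Equiv.refl _) σ).injective (toLex.injective h))
      (regroupPos_injective r e), koszulSign_inr]
    congr 1
    rw [← koszulSign_comp_equiv (Equiv.sumCongr (Equiv.refl (Fin m)) σ)]
    congr 1
    · funext t
      rcases t with j | x
      · rfl
      · have : (e.trans σ).symm (σ x) = e.symm x := by simp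
        change toLex _ = toLex _
        rw [this]
    · funext t
      rcases t with j | x <;> simp
  · simp

theorem comulTerm_tmul {m n : ℕ} (r : Fin m → ℕ) (e : (Σ j, Fin (r j)) ≃ Fin n) (c : C.obj n)
    (a : ⨂[k] _ : Fin n, A) :
    comulTerm C A r e (c ⊗ₜ a) =
      TensorProduct.map LinearMap.id (PiTensorProduct.map fun j => cls C A (r j))
        (TensorProduct.map LinearMap.id (regroup (fun j => C.obj (r j)) (fun _ : Fin n => A) r e)
          (TensorProduct.assoc k _ _ _ (C.decomp r e c ⊗ₜ a))) := rfl

theorem comulTerm_permTen {m n : ℕ} (r : Fin m → ℕ) (e : (Σ j, Fin (r j)) ≃ Fin n)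
    (σ : Equiv.Perm (Fin n)) :
    comulTerm C A r (e.trans σ) ∘ₗ permTen C A σ = comulTerm C A r e := by
  refine TensorProduct.ext' fun c a => ?_
  have h : C.decomp r (e.trans σ) (C.act n σ c) = C.decomp r e c :=
    LinearMap.congr_fun (C.decomp_relabel r e σ) c
  have h' : permTen C A σ (c ⊗ₜ a) = C.act n σ c ⊗ₜ permPi (fun _ : Fin n => A) σ.symm a := rfl
  rw [LinearMap.comp_apply, h', comulTerm_tmul, comulTerm_tmul, h]
  generalize C.decomp r e c = z
  induction z using TensorProduct.induction_on with
  | zero => simp only [TensorProduct.zero_tmul, map_zero]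
  | add x y hx hy => simp only [TensorProduct.add_tmul, map_add, hx, hy]
  | tmul γ g =>
    have := LinearMap.congr_fun (regroup_permPi A (fun j => C.obj (r j)) r e σ) (g ⊗ₜ a)
    rw [LinearMap.comp_apply, TensorProduct.map_tmul, LinearMap.id_apply] at this
    simp only [TensorProduct.assoc_tmul, TensorProduct.map_tmul, this]

/-- The comultiplication `C(A) → C(m) ⊗ C(A) ⊗ ⋯ ⊗ C(A)`: the sum over all labelled two-level
trees with `m` upper vertices, up to permutations of the inputs of the upper vertices. -/
def comul (m : ℕ) : cofree C A →ₗ[k] (C.obj m ⊗[k] (⨂[k] _ : Fin m, cofree C A)) :=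
  cofreeElim (fun n => ∑ r : Fin m → Fin (n + 1), (∏ j, ((r j : ℕ).factorial : k))⁻¹ •
      ∑ e : (Σ j, Fin (r j)) ≃ Fin n, comulTerm C A (fun j => r j) e) fun n σ => by
    refine LinearMap.ext fun t => ?_
    simp only [LinearMap.comp_apply, LinearMap.sum_apply, LinearMap.smul_apply]
    refine Finset.sum_congr rfl fun r _ => ?_
    congr 1
    refine Fintype.sum_equiv (Equiv.equivCongr (Equiv.refl _) σ.symm) _ _ fun e => ?_
    have h : ((Equiv.equivCongr (Equiv.refl ((j : Fin m) × Fin (r j))) σ.symm) e).trans σ = e := by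
      ext x; simp
    have := LinearMap.congr_fun (comulTerm_permTen C A (fun j => (r j : ℕ))
      (Equiv.equivCongr (Equiv.refl ((j : Fin m) × Fin (r j))) σ.symm e) σ) t
    rw [h] at this
    exact this

theorem isDeg_comul (m : ℕ) : IsDeg (cofree C A).deg
    (tensorDeg (C.obj m).deg (piDeg fun _ : Fin m => (cofree C A).deg)) (comul C A m) 0 := by
  refine isDeg_cofree C A fun n D t ht => ?_
  rw [LinearMap.comp_apply, comul, cofreeElim_cls]
  exact IsDeg.sum _ (fun r _ => IsDeg.smul _ (IsDeg.sum _ fun e _ =>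
    isDeg_comulTerm C A (fun j => (r j : ℕ)) e)) D t ht

/-- The identification `A ⊗ ⋯ ⊗ A = A` for a single factor. -/
def tensorOne : (⨂[k] _ : Fin 1, A) ≃ₗ[k] A :=
  PiTensorProduct.subsingletonEquiv (s := fun _ => (A : Type w)) (0 : Fin 1)

/-- The component of arity `n` of the canonical projection `C(A) → A`. -/
def projTen : ∀ n, Ten C A n →ₗ[k] A
  | 1 => (TensorProduct.lid k A).toLinearMap ∘ₗ TensorProduct.map C.counit (tensorOne A).toLinearMap
  | _ => 0

theorem permTen_one {n : ℕ} : permTen C A (1 : Equiv.Perm (Fin n)) = LinearMap.id := by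
  refine ten_ext fun i d c a hc ha => ?_
  have : koszulSign k id (1 : Equiv.Perm (Fin n)) (fun j => (d j : ZMod 2)) = 1 := by
    unfold koszulSign
    refine Finset.prod_eq_one fun x _ => Finset.prod_eq_one fun y _ => ?_
    exact if_neg fun h => absurd h.1 h.2.1.not_gt
  rw [permTen_tmul 1 d c a ha, this, map_one, one_smul]
  rfl

/-- The canonical projection `C(A) → A`. -/
def proj : cofree C A →ₗ[k] A :=
  cofreeElim (projTen C A) fun n σ => by
    match n with
    | 0 => simp [projTen]
    | 1 => rw [Subsingleton.elim σ 1, permTen_one, LinearMap.comp_id]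
    | n + 2 => simp [projTen]

theorem projTen_one_tmul (c : C.obj 1) (a : Fin 1 → A) :
    projTen C A 1 (c ⊗ₜ PiTensorProduct.tprod k a) = C.counit c • a 0 := by
  have : tensorOne A (PiTensorProduct.tprod k a) = a 0 :=
    PiTensorProduct.subsingletonEquiv_apply_tprod 0 a
  rw [projTen, LinearMap.comp_apply, TensorProduct.map_tmul]
  simp [this]

theorem isDeg_projTen_one : IsDeg (tenDeg C A 1) A.deg (projTen C A 1) 0 := by
  apply isDeg_of_span
  rintro D _ ⟨i, j, c, a, hc, ha, rfl, rfl⟩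
  induction ha using Submodule.span_induction with
  | zero => rw [TensorProduct.tmul_zero, map_zero]; exact Submodule.zero_mem _
  | add x y _ _ hx hy => rw [TensorProduct.tmul_add, map_add]; exact Submodule.add_mem _ hx hy
  | smul b x _ hx => rw [TensorProduct.tmul_smul, map_smul]; exact Submodule.smul_mem _ _ hx
  | mem a ha =>
    obtain ⟨d, a, ha, rfl, rfl⟩ := ha
    rw [projTen_one_tmul]
    by_cases hi : i = 0
    · subst hi
      have := ha 0
      simpa using Submodule.smul_mem _ _ this
    · rw [C.counit_deg i hi c hc, zero_smul]; exact Submodule.zero_mem _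

theorem isDeg_proj : IsDeg (cofree C A).deg A.deg (proj C A) 0 := by
  refine isDeg_cofree C A fun n D t ht => ?_
  rw [LinearMap.comp_apply, proj, cofreeElim_cls]
  match n, t, ht with
  | 0, t, _ => exact Submodule.zero_mem _
  | n + 2, t, _ => exact Submodule.zero_mem _
  | 1, t, ht => exact isDeg_projTen_one C A D t ht

/-- The embedding `A → C(A)` given by the coaugmentation. -/
def incl : A →ₗ[k] cofree C A :=
  cls C A 1 ∘ₗ TensorProduct.mk k (C.obj 1) (⨂[k] _ : Fin 1, A) C.coaug ∘ₗ
    (tensorOne A).symm.toLinearMap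

/-- The differential on `C(A)` induced by the differential of `C`. -/
def cooperadDiff : cofree C A →ₗ[k] cofree C A :=
  cofreeElim (fun n => cls C A n ∘ₗ TensorProduct.map (C.d n) LinearMap.id) fun n σ => by
    rw [LinearMap.comp_assoc, permTen, ← TensorProduct.map_comp, ← C.act_d, LinearMap.id_comp,
      ← LinearMap.comp_id (permPi _ _), TensorProduct.map_comp, ← LinearMap.comp_assoc]
    congr 1
    exact cls_permTen C A σ

/-- The sum `∑ m, ψ m` of a family of linear maps on `C(A)`, where the `m`-th summand is applied
only to the components of arity at least `m`. -/
def aritySum {M : Type*} [AddCommGroup M] [Module k M] (ψ : ℕ → cofree C A →ₗ[k] M) :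
    cofree C A →ₗ[k] M :=
  cofreeElim (fun n => (∑ m ∈ Finset.range (n + 1), ψ m) ∘ₗ cls C A n) fun n σ => by
    rw [LinearMap.comp_assoc, cls_permTen]

end Cofree

/-! ### Coderivations, coalgebra morphisms and homotopy algebras -/

section HomotopyAlgebras

variable {k : Type u} [Field k] [CharZero k] (C : Cooperad.{u, v} k)

/-- The coderivation of `C(A)` whose projection to `A` is a given map `q` of odd degree:
`∑ m, (1 / m!) ∑ i, (1 ⊗ p ⊗ ⋯ ⊗ q ⊗ ⋯ ⊗ p) Δ m`, where `p` is the projection to `A` and `q`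
stands in the `i`-th place. -/
def coder {A : GrMod.{u, w} k} (q : cofree C A →ₗ[k] A) : cofree C A →ₗ[k] cofree C A :=
  aritySum C A fun m => (m.factorial : k)⁻¹ • (cls C A m ∘ₗ
    TensorProduct.map (C.obj m).eps
      (∑ i : Fin m, PiTensorProduct.map fun j =>
        if j < i then proj C A ∘ₗ (cofree C A).eps else if j = i then q else proj C A) ∘ₗ
    comul C A m)

/-- The morphism of coalgebras `C(A) → C(B)` whose projection to `B` is a given map `f` of degree
zero: `∑ m, (1 / m!) (1 ⊗ f ⊗ ⋯ ⊗ f) Δ m`. -/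
def coalgLift {A : GrMod.{u, w} k} {B : GrMod.{u, w'} k} (f : cofree C A →ₗ[k] B) :
    cofree C A →ₗ[k] cofree C B :=
  aritySum C A fun m => (m.factorial : k)⁻¹ • (cls C B m ∘ₗ
    TensorProduct.map LinearMap.id (PiTensorProduct.map fun _ => f) ∘ₗ comul C A m)

/-- The differential on `C(A)` that comes from the differential of `C` and the differential `d`
of `A`. -/
def cofreeDiff {A : GrMod.{u, w} k} (d : A →ₗ[k] A) : cofree C A →ₗ[k] cofree C A :=
  cooperadDiff C A + coder C (d ∘ₗ proj C A)

/-- `Q` is a coderivation of degree one of the `C`-coalgebra `C(A)`. -/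
structure IsCoderivation {A : GrMod.{u, w} k} (Q : cofree C A →ₗ[k] cofree C A) : Prop where
  deg : IsDeg (cofree C A).deg (cofree C A).deg Q 1
  comul : ∀ m, comul C A m ∘ₗ Q =
    TensorProduct.map (C.obj m).eps (piDer (fun _ : Fin m => cofree C A) fun _ => Q) ∘ₗ
      comul C A m

/-- `U` is a morphism of graded `C`-coalgebras. -/
structure IsCoalgHom {A : GrMod.{u, w} k} {B : GrMod.{u, w'} k}
    (U : cofree C A →ₗ[k] cofree C B) : Prop where
  deg : IsDeg (cofree C A).deg (cofree C B).deg U 0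
  comul : ∀ m, comul C B m ∘ₗ U =
    TensorProduct.map LinearMap.id (PiTensorProduct.map fun _ => U) ∘ₗ comul C A m

/-- `(A, d)` is a cochain complex and `Q` is a coderivation of `C(A)` that makes it a homotopy
algebra of type `C`. -/
structure IsHoAlg {A : GrMod.{u, w} k} (d : A →ₗ[k] A) (Q : cofree C A →ₗ[k] cofree C A) :
    Prop where
  d_deg : IsDeg A.deg A.deg d 1
  d_comp_d : d ∘ₗ d = 0
  coderivation : IsCoderivation C Q
  comp_incl : Q ∘ₗ incl C A = 0
  maurer_cartan : cofreeDiff C d ∘ₗ Q + Q ∘ₗ cofreeDiff C d + Q ∘ₗ Q = 0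

/-- A homotopy algebra of type `C`, that is, an algebra over `Cobar(C)`. -/
structure HoAlg where
  space : GrMod.{u, w} k
  d : space →ₗ[k] space
  Q : cofree C space →ₗ[k] cofree C space
  isHoAlg : IsHoAlg C d Q

theorem isDeg_aritySum {A : GrMod.{u, w} k} {M : Type*} [AddCommGroup M] [Module k M]
    {ℳ : ℤ → Submodule k M} {ψ : ℕ → cofree C A →ₗ[k] M} {p : ℤ}
    (h : ∀ m, IsDeg (cofree C A).deg ℳ (ψ m) p) :
    IsDeg (cofree C A).deg ℳ (aritySum C A ψ) p := by
  refine isDeg_cofree C A fun n D t ht => ?_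
  rw [LinearMap.comp_apply, aritySum, cofreeElim_cls]
  exact ((IsDeg.sum _ fun m _ => h m).comp (isDeg_cls C A n) (zero_add p)) D t ht

theorem isDeg_coder {A : GrMod.{u, w} k} {q : cofree C A →ₗ[k] A}
    (hq : IsDeg (cofree C A).deg A.deg q 1) :
    IsDeg (cofree C A).deg (cofree C A).deg (coder C q) 1 := by
  refine isDeg_aritySum C fun m => IsDeg.smul _ ?_
  refine (isDeg_cls C A m).comp (q := 0) (p := 1) (IsDeg.comp (p := 0) (q := 1)
    (((C.obj m).isDeg_eps).tensor (IsDeg.sum _ fun i _ => IsDeg.pi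
      (p := fun j => if j = i then 1 else 0) (fun j => ?_) (by simp)) (zero_add 1))
      (isDeg_comul C A m) (zero_add 1)) (add_zero 1)
  by_cases h1 : j < i
  · simpa [h1, h1.ne] using (isDeg_proj C A).comp (cofree C A).isDeg_eps (add_zero 0)
  · by_cases h2 : j = i
    · simpa [h1, h2] using hq
    · simpa [h1, h2] using isDeg_proj C A

theorem isDeg_cooperadDiff (A : GrMod.{u, w} k) :
    IsDeg (cofree C A).deg (cofree C A).deg (cooperadDiff C A) 1 := by
  refine isDeg_cofree C A fun n D t ht => ?_
  rw [LinearMap.comp_apply, cooperadDiff, cofreeElim_cls]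
  exact ((isDeg_cls C A n).comp ((C.d_deg n).tensor IsDeg.id (add_zero 1)) (add_zero 1)) D t ht

theorem isDeg_cofreeDiff {A : GrMod.{u, w} k} {d : A →ₗ[k] A} (hd : IsDeg A.deg A.deg d 1) :
    IsDeg (cofree C A).deg (cofree C A).deg (cofreeDiff C d) 1 :=
  (isDeg_cooperadDiff C A).add (isDeg_coder C (hd.comp (isDeg_proj C A) (zero_add 1)))

end HomotopyAlgebras

/-! ### The cooperad of cocommutative coalgebras -/

section Cocommutative

variable (k : Type u) [Field k] [CharZero k]

/-- A vector space, placed in degree zero. -/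
def GrMod.inDegZero (V : Type w) [AddCommGroup V] [Module k V] : GrMod.{u, w} k where
  carrier := V
  deg i := if i = 0 then ⊤ else ⊥
  internal := by
    refine GrMod.isInternal_of_weight _ ?_ LinearMap.id ?_
    · rw [eq_top_iff]
      exact le_iSup_of_le 0 (by simp)
    · intro i x hx
      by_cases hi : i = 0
      · simp [hi]
      · rw [if_neg hi, Submodule.mem_bot] at hx
        simp [hx]

theorem GrMod.mem_inDegZero (V : Type w) [AddCommGroup V] [Module k V] (x : V) :
    x ∈ (GrMod.inDegZero k V).deg 0 := by
  change x ∈ (if (0 : ℤ) = 0 then ⊤ else ⊥ : Submodule k V)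
  simp

/-- The underlying graded vector spaces of `coCom`: zero in arity zero, and `k` in positive
arities. -/
def coComObj (n : ℕ) : GrMod.{u, u} k :=
  GrMod.inDegZero k (if n = 0 then ⊥ else ⊤ : Submodule k k)

/-- The canonical generator of `coCom(n)`. -/
def coComGen (n : ℕ) : coComObj k n :=
  show (if n = 0 then ⊥ else ⊤ : Submodule k k) from
    ⟨if n = 0 then 0 else 1, by split_ifs <;> simp⟩

/-- The coefficient of an element of `coCom(n)` with respect to the canonical generator. -/
def coComCoeff (n : ℕ) : coComObj k n →ₗ[k] k :=
  (if n = 0 then ⊥ else ⊤ : Submodule k k).subtype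

theorem coComGen_mem (n : ℕ) : coComGen k n ∈ (coComObj k n).deg 0 :=
  GrMod.mem_inDegZero k (if n = 0 then ⊥ else ⊤ : Submodule k k) _

theorem coComCoeff_gen (n : ℕ) : coComCoeff k n (coComGen k n) = if n = 0 then 0 else 1 := rfl

theorem coComCoeff_gen_pos {n : ℕ} (hn : n ≠ 0) : coComCoeff k n (coComGen k n) = 1 := by
  rw [coComCoeff_gen, if_neg hn]

theorem coComCoeff_smul {n : ℕ} (x : coComObj k n) : coComCoeff k n x • coComGen k n = x := by
  apply Subtype.ext
  obtain ⟨x, hx⟩ := x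
  change x * (if n = 0 then 0 else 1) = x
  split_ifs with h
  · rw [if_pos h, Submodule.mem_bot] at hx
    simp [hx]
  · simp

theorem coCom_zero (x : coComObj k 0) : x = 0 := by
  rw [← coComCoeff_smul k x]
  have : coComGen k 0 = 0 := Subtype.ext (by rfl)
  rw [this, smul_zero]

theorem coComDeg_eq_zero {n : ℕ} {i : ℤ} (hi : i ≠ 0) {x : coComObj k n}
    (hx : x ∈ (coComObj k n).deg i) : x = 0 := by
  change x ∈ (if i = 0 then ⊤ else ⊥ : Submodule k (coComObj k n)) at hx
  rwa [if_neg hi, Submodule.mem_bot] at hx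

/-- The decomposition maps of `coCom`, which send generators to generators. -/
def coComDecomp {m : ℕ} (r : Fin m → ℕ) (n : ℕ) :
    coComObj k n →ₗ[k] coComObj k m ⊗[k] (⨂[k] j, coComObj k (r j)) :=
  (LinearMap.toSpanSingleton k _
    (coComGen k m ⊗ₜ PiTensorProduct.tprod k fun j => coComGen k (r j))) ∘ₗ coComCoeff k n

theorem coComDecomp_gen {m : ℕ} (r : Fin m → ℕ) {n : ℕ} (x : coComObj k n) :
    coComDecomp k r n x =
      coComCoeff k n x • (coComGen k m ⊗ₜ PiTensorProduct.tprod k fun j => coComGen k (r j)) := rfl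

/-- The cooperad `coCom` that governs cocommutative coalgebras without counit. -/
def coCom : Cooperad.{u, u} k where
  obj := coComObj k
  obj_zero := coCom_zero k
  d _ := 0
  d_deg n i x _ := Submodule.zero_mem _
  d_comp_d n := LinearMap.comp_zero _
  act n := 1
  act_deg n σ := IsDeg.id
  act_d n σ := by simp
  decomp {m n} r _ := coComDecomp k r n
  decomp_deg {m n} r e := by
    intro i x hx
    rw [add_zero, coComDecomp_gen]
    by_cases hi : i = 0
    · subst hi
      exact Submodule.smul_mem _ _ (Submodule.subset_span ⟨0, 0, _, _, coComGen_mem k m,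
        Submodule.subset_span ⟨fun _ => 0, _, fun j => coComGen_mem k (r j), by simp, rfl⟩,
        by simp, rfl⟩)
    · rw [coComDeg_eq_zero k hi hx, map_zero, zero_smul]
      exact Submodule.zero_mem _
  decomp_d {m n} r e := by
    have h : piDer (fun j => coComObj k (r j)) (fun j => 0) = 0 := by
      refine Finset.sum_eq_zero fun i _ => ?_
      refine PiTensorProduct.ext (MultilinearMap.ext fun v => ?_)
      simp only [LinearMap.compMultilinearMap_apply, PiTensorProduct.map_tprod]
      exact (PiTensorProduct.tprod k).map_coord_zero i (by simp)
    rw [h]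
    simp
  decomp_relabel r e σ := LinearMap.comp_id _
  decomp_inner {m n} r e τ := by
    simp [Module.End.one_eq_id]
  decomp_outer {m n} r e ρ := by
    refine LinearMap.ext fun x => ?_
    have h : permPi (fun j => coComObj k (r j)) ρ
        (PiTensorProduct.tprod k fun j => coComGen k (r j)) =
        PiTensorProduct.tprod k fun j => coComGen k (r (ρ j)) := by
      rw [permPi_tprod _ ρ (fun _ => 0) _ fun j => coComGen_mem k (r j)]
      simp [koszulSign_zero]
    rw [LinearMap.comp_apply, LinearMap.comp_apply, coComDecomp_gen, coComDecomp_gen, map_smul,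
      map_smul, TensorProduct.map_tmul, TensorProduct.map_tmul, h]
    rfl
  coassoc {m K N} r e l E a f F h := by
    refine LinearMap.ext fun x => ?_
    have hg : regroup (fun j => coComObj k (r j)) (fun x => coComObj k (l x)) r e
        ((PiTensorProduct.tprod k fun j => coComGen k (r j)) ⊗ₜ
          PiTensorProduct.tprod k fun x => coComGen k (l x)) =
        PiTensorProduct.tprod k fun j => coComGen k (r j) ⊗ₜ
          PiTensorProduct.tprod k fun s => coComGen k (l (e ⟨j, s⟩)) := by
      rw [regroup_tmul _ _ r e (fun _ => 0) (fun _ => 0) _ _ (fun j => coComGen_mem k (r j))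
        (fun x => coComGen_mem k (l x))]
      have : (Sum.elim (fun _ : Fin m => ((0 : ℤ) : ZMod 2)) fun _ : Fin K => ((0 : ℤ) : ZMod 2)) =
          fun _ => 0 := by
        funext t; rcases t with t | t <;> simp
      rw [this, koszulSign_zero, one_smul]
    rw [LinearMap.comp_apply, LinearMap.comp_apply, LinearMap.comp_apply, LinearMap.comp_apply,
      coComDecomp_gen, coComDecomp_gen, map_smul, map_smul, map_smul, map_smul,
      TensorProduct.map_tmul, TensorProduct.map_tmul, coComDecomp_gen, ← TensorProduct.smul_tmul',
      map_smul, map_smul, LinearEquiv.coe_coe, LinearMap.id_apply, LinearMap.id_apply,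
      TensorProduct.assoc_tmul, TensorProduct.map_tmul, hg, LinearMap.id_apply,
      PiTensorProduct.map_tprod]
    simp only [coComDecomp_gen]
    rw [MultilinearMap.map_smul_univ, TensorProduct.tmul_smul]
    rcases eq_or_ne N 0 with rfl | hN
    · rw [coCom_zero k x, map_zero, zero_smul, zero_smul]
    have hK : K ≠ 0 := by
      rintro rfl
      exact (E.symm ⟨0, Nat.pos_of_ne_zero hN⟩).1.elim0
    rw [coComCoeff_gen_pos k hK, one_smul]
    congr 1
    by_cases ha : ∃ j, a j = 0
    · obtain ⟨j, hj⟩ := ha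
      have : (coComGen k (r j) ⊗ₜ[k] PiTensorProduct.tprod k fun s => coComGen k (l (e ⟨j, s⟩))) =
          0 := by
        have h0 : ∀ n, n = 0 → coComGen k n = 0 := by
          rintro _ rfl
          exact coCom_zero k _
        rcases eq_or_ne (r j) 0 with hr | hr
        · rw [h0 _ hr, TensorProduct.zero_tmul]
        · have hl : l (e ⟨j, ⟨0, Nat.pos_of_ne_zero hr⟩⟩) = 0 := by
            by_contra hl
            have := (f j ⟨⟨0, Nat.pos_of_ne_zero hr⟩, ⟨0, Nat.pos_of_ne_zero hl⟩⟩).2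
            omega
          rw [(PiTensorProduct.tprod k (s := fun s : Fin (r j) =>
              (coComObj k (l (e ⟨j, s⟩)) : Type u))).map_coord_zero
            (⟨0, Nat.pos_of_ne_zero hr⟩ : Fin (r j)) (h0 _ hl), TensorProduct.tmul_zero]
      rw [(PiTensorProduct.tprod k).map_coord_zero j this, TensorProduct.tmul_zero, smul_zero]
    · push Not at ha
      rw [Finset.prod_eq_one fun j _ => coComCoeff_gen_pos k (ha j), one_smul]
  counit := coComCoeff k 1
  counit_deg i hi x hx := by rw [coComDeg_eq_zero k hi hx, map_zero]
  counit_d := LinearMap.comp_zero _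
  counit_left n := by
    refine LinearMap.ext fun x => ?_
    have : PiTensorProduct.subsingletonEquiv (R := k) (s := fun _ => (coComObj k n : Type u))
      (0 : Fin 1) (PiTensorProduct.tprod k fun _ => coComGen k n) = coComGen k n :=
      PiTensorProduct.subsingletonEquiv_apply_tprod 0 _
    rw [LinearMap.comp_apply, LinearMap.comp_apply, coComDecomp_gen, map_smul,
      TensorProduct.map_tmul, map_smul, LinearEquiv.coe_coe, TensorProduct.lid_tmul,
      coComCoeff_gen_pos k one_ne_zero, one_smul]
    exact (congrArg _ this).trans (coComCoeff_smul k x)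
  counit_right n := by
    refine LinearMap.ext fun x => ?_
    rw [LinearMap.comp_apply, LinearMap.comp_apply, coComDecomp_gen, map_smul,
      TensorProduct.map_tmul, map_smul, LinearEquiv.coe_coe, TensorProduct.rid_tmul,
      PiTensorProduct.lift.tprod]
    simp only [MultilinearMap.compLinearMap_apply, MultilinearMap.mkPiAlgebra_apply,
      coComCoeff_gen_pos k one_ne_zero, Finset.prod_const_one, LinearMap.id_apply, one_smul,
      coComCoeff_smul]
  coaug := coComGen k 1
  coaug_deg := coComGen_mem k 1
  coaug_d := rfl
  counit_coaug := coComCoeff_gen_pos k one_ne_zero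
  decomp_coaug e := by
    rw [coComDecomp_gen, coComCoeff_gen_pos k one_ne_zero, one_smul]

/-- The canonical generator of `coCom(n)`. -/
def gen (n : ℕ) : (coCom k).obj n := coComGen k n

/-- The coefficient of an element of `coCom(n)` with respect to the canonical generator. -/
def coeff (n : ℕ) : (coCom k).obj n →ₗ[k] k := coComCoeff k n

end Cocommutative

/-! ### Filtered shifted Lie-infinity algebras and infinity-morphisms -/

namespace GrMod

variable {k : Type u} [Field k] [CharZero k]

/-- The projection `V ⊕ W → V`. -/
def fst (V : GrMod.{u, v} k) (W : GrMod.{u, w} k) : V.prod W →ₗ[k] V := LinearMap.fst k V W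

/-- The projection `V ⊕ W → W`. -/
def snd (V : GrMod.{u, v} k) (W : GrMod.{u, w} k) : V.prod W →ₗ[k] W := LinearMap.snd k V W

/-- The inclusion `V → V ⊕ W`. -/
def inl (V : GrMod.{u, v} k) (W : GrMod.{u, w} k) : V →ₗ[k] V.prod W := LinearMap.inl k V W

/-- The inclusion `W → V ⊕ W`. -/
def inr (V : GrMod.{u, v} k) (W : GrMod.{u, w} k) : W →ₗ[k] V.prod W := LinearMap.inr k V W

/-- The map to `V ⊕ W` with given components. -/
def pair {M : Type*} [AddCommGroup M] [Module k M] {V : GrMod.{u, v} k} {W : GrMod.{u, w} k}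
    (f : M →ₗ[k] V) (g : M →ₗ[k] W) : M →ₗ[k] V.prod W := LinearMap.prod f g

end GrMod

section ShiftedLie

variable {k : Type u} [Field k] [CharZero k]

/-- The symmetric coalgebra without counit `S(L)`, that is, the cofree `coCom`-coalgebra. -/
abbrev sym (L : GrMod.{u, w} k) : GrMod.{u, max u w} k := cofree (coCom k) L

/-- The element `x 0 ⋯ x (n - 1)` of `S(L)`. -/
def word {L : GrMod.{u, w} k} {n : ℕ} (x : Fin n → L) : sym L :=
  cls (coCom k) L n (gen k n ⊗ₜ PiTensorProduct.tprod k x)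

/-- A graded vector space `L` with a differential, a map `S(L) → L` (the multibrackets with at
least two arguments) and a descending filtration; no axioms are imposed. -/
structure SLieData (k : Type u) [Field k] [CharZero k] where
  space : GrMod.{u, w} k
  d : space →ₗ[k] space
  q : sym space →ₗ[k] space
  F : ℕ → Submodule k space

namespace SLieData

variable (L : SLieData.{u, w} k) (M : SLieData.{u, w'} k)

/-- The coderivation of `S(L)` given by the multibrackets with at least two arguments. -/
def Q : sym L.space →ₗ[k] sym L.space := coder (coCom k) L.q

/-- The codifferential of `S(L)`. -/
def codiff : sym L.space →ₗ[k] sym L.space := cofreeDiff (coCom k) L.d + L.Q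

/-- The multibracket `{x 0, …, x (n - 1)}` for `n ≥ 2`. -/
def bracket {n : ℕ} (x : Fin n → L.space) : L.space := proj (coCom k) L.space (L.Q (word x))

/-- The filtration on `S(L)` induced by the filtration of `L`. -/
def symF (m : ℕ) : Submodule k (sym L.space) :=
  Submodule.span k {y | ∃ (n : ℕ) (i : Fin n → ℕ) (x : Fin n → L.space),
    (∀ j, 1 ≤ i j ∧ x j ∈ L.F (i j)) ∧ m ≤ ∑ j, i j ∧ y = word x}

/-- The direct sum, with componentwise operations. -/
def prod : SLieData.{u, max w w'} k where
  space := L.space.prod M.space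
  d := GrMod.pair (L.d ∘ₗ GrMod.fst L.space M.space) (M.d ∘ₗ GrMod.snd L.space M.space)
  q := GrMod.pair
    (L.q ∘ₗ coalgLift (coCom k) (GrMod.fst L.space M.space ∘ₗ proj (coCom k) _))
    (M.q ∘ₗ coalgLift (coCom k) (GrMod.snd L.space M.space ∘ₗ proj (coCom k) _))
  F n := (L.F n).comap (GrMod.fst L.space M.space) ⊓ (M.F n).comap (GrMod.snd L.space M.space)

/-- `L` is a filtered shifted Lie-infinity algebra, i.e. a homotopy algebra of type `coCom` with a
complete descending filtration `L = F 1 ⊇ F 2 ⊇ ⋯` by graded subcomplexes that is compatible with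
the multibrackets. -/
structure IsFilteredSLie : Prop where
  isHoAlg : IsHoAlg (coCom k) L.d L.Q
  F_one : L.F 1 = ⊤
  F_antitone : Antitone L.F
  F_graded : ∀ n, L.F n = ⨆ p, L.F n ⊓ L.space.deg p
  d_mem : ∀ n, ∀ x ∈ L.F n, L.d x ∈ L.F n
  /-- completeness of every homogeneous component -/
  complete : ∀ (p : ℤ) (x : ℕ → L.space), (∀ n, x n ∈ L.space.deg p) →
    (∀ n, x (n + 1) - x n ∈ L.F n) → ∃! y, y ∈ L.space.deg p ∧ ∀ n, y - x n ∈ L.F n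
  bracket_mem : ∀ m ≥ 2, ∀ (i : Fin m → ℕ) (x : Fin m → L.space),
    (∀ j, 1 ≤ i j ∧ x j ∈ L.F (i j)) → L.bracket x ∈ L.F (∑ j, i j)

variable {L M}

/-- `U` is a continuous infinity-morphism from `L` to `M`. -/
structure IsInfinityMorphism (U : sym L.space →ₗ[k] sym M.space) : Prop where
  coalgHom : IsCoalgHom (coCom k) U
  comm : M.codiff ∘ₗ U = U ∘ₗ L.codiff
  continuous : ∀ m, ∃ r, ∀ x ∈ L.symF r, U x ∈ M.symF m

variable {L' : SLieData.{u, v} k} {M' : SLieData.{u, v'} k}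

/-- The tensor product `U ⊗ U' : L ⊕ L' → M ⊕ M'` of infinity-morphisms. -/
def tens (U : sym L.space →ₗ[k] sym M.space) (U' : sym L'.space →ₗ[k] sym M'.space) :
    sym (L.prod L').space →ₗ[k] sym (M.prod M').space :=
  coalgLift (coCom k) <| GrMod.pair
    (proj (coCom k) M.space ∘ₗ U ∘ₗ
      coalgLift (coCom k) (GrMod.fst L.space L'.space ∘ₗ proj (coCom k) _))
    (proj (coCom k) M'.space ∘ₗ U' ∘ₗ
      coalgLift (coCom k) (GrMod.snd L.space L'.space ∘ₗ proj (coCom k) _))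

/-- The associativity isomorphism `L ⊕ (M ⊕ L') ≅ (L ⊕ M) ⊕ L'`. -/
def assoc (L : SLieData.{u, w} k) (M : SLieData.{u, w'} k) (L' : SLieData.{u, v} k) :
    sym (L.prod (M.prod L')).space →ₗ[k] sym ((L.prod M).prod L').space :=
  coalgLift (coCom k) <| GrMod.pair
    (GrMod.pair (GrMod.fst L.space (M.prod L').space)
      (GrMod.fst M.space L'.space ∘ₗ GrMod.snd L.space (M.prod L').space))
    (GrMod.snd M.space L'.space ∘ₗ GrMod.snd L.space (M.prod L').space) ∘ₗ proj (coCom k) _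

end SLieData

theorem permPi_comp (L : GrMod.{u, w} k) {n : ℕ} (σ τ : Equiv.Perm (Fin n)) :
    permPi (fun _ => L) σ ∘ₗ permPi (fun _ => L) τ = permPi (fun _ => L) (τ * σ) := by
  refine PiTensorProduct.ext (MultilinearMap.ext fun v => ?_)
  rw [LinearMap.compMultilinearMap_apply, LinearMap.compMultilinearMap_apply]
  suffices h : ∀ (d : Fin n → ℤ) (v : Fin n → L), (∀ i, v i ∈ L.deg (d i)) →
      (permPi (fun _ => L) σ ∘ₗ permPi (fun _ => L) τ - permPi (fun _ => L) (τ * σ))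
        (PiTensorProduct.tprod k v) ∈ (⊥ : Submodule k (⨂[k] _ : Fin n, L)) by
    have := multilinear_mem (𝒱 := fun _ => L.deg)
      ((permPi (fun _ => L) σ ∘ₗ permPi (fun _ => L) τ -
        permPi (fun _ => L) (τ * σ)).compMultilinearMap (PiTensorProduct.tprod k)) ⊥ h v
      fun j => by rw [L.iSup_deg]; trivial
    exact sub_eq_zero.1 this
  intro d v hv
  rw [Submodule.mem_bot, LinearMap.sub_apply, sub_eq_zero, LinearMap.comp_apply,
    permPi_tprod _ τ d v hv, map_smul,
    permPi_tprod _ σ (fun i => d (τ i)) (fun i => v (τ i)) fun i => hv _,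
    permPi_tprod _ (τ * σ) d v hv, smul_smul]
  congr 1
  rw [← koszulSign_mul (k := k) id τ.symm (τ * σ).symm Function.injective_id τ.symm.injective
    (τ * σ).symm.injective]
  congr 1
  rw [← koszulSign_comp_equiv τ τ.symm]
  congr 1
  · funext i; simp
  · funext i; simp [Equiv.Perm.mul_def]

/-- The symmetrization of a map on `L ⊗ ⋯ ⊗ L`. -/
def symTen {L : GrMod.{u, w} k} {N : Type*} [AddCommGroup N] [Module k N] {n : ℕ}
    (φ : (⨂[k] _ : Fin n, L) →ₗ[k] N) : Ten (coCom k) L n →ₗ[k] N :=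
  (TensorProduct.lid k N).toLinearMap ∘ₗ TensorProduct.map (coeff k n)
    ((n.factorial : k)⁻¹ • ∑ σ : Equiv.Perm (Fin n), φ ∘ₗ permPi (fun _ => L) σ)

theorem symTen_tmul {L : GrMod.{u, w} k} {N : Type*} [AddCommGroup N] [Module k N] {n : ℕ}
    (φ : (⨂[k] _ : Fin n, L) →ₗ[k] N) (c : (coCom k).obj n) (x : ⨂[k] _ : Fin n, L) :
    symTen φ (c ⊗ₜ x) = coeff k n c • (n.factorial : k)⁻¹ •
      ∑ σ : Equiv.Perm (Fin n), φ (permPi (fun _ => L) σ x) := by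
  rw [symTen, LinearMap.comp_apply, TensorProduct.map_tmul, LinearEquiv.coe_coe,
    TensorProduct.lid_tmul, LinearMap.smul_apply, LinearMap.sum_apply]
  rfl

/-- The map on `S(L)` given by the symmetrizations of maps on the spaces `L ⊗ ⋯ ⊗ L`. -/
def symElim {L : GrMod.{u, w} k} {N : Type*} [AddCommGroup N] [Module k N]
    (φ : ∀ n, (⨂[k] _ : Fin n, L) →ₗ[k] N) : sym L →ₗ[k] N :=
  cofreeElim (fun n => symTen (φ n)) fun n τ => by
    refine TensorProduct.ext' fun c x => ?_
    have h : permTen (coCom k) L τ (c ⊗ₜ x) = c ⊗ₜ permPi (fun _ => L) τ.symm x := rfl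
    rw [LinearMap.comp_apply, h, symTen_tmul, symTen_tmul]
    congr 2
    refine Fintype.sum_equiv (Equiv.mulLeft τ.symm) _ _ fun σ => ?_
    have := LinearMap.congr_fun (permPi_comp L σ τ.symm) x
    exact congrArg (φ n) this

end ShiftedLie

/-! ### Mapping spaces and their composition -/

section Maps

variable {k : Type u} [Field k] [CharZero k]

/-- The linear map that underlies an element of `Hom(V, W)`. -/
def homMap (V : GrMod.{u, v} k) (W : GrMod.{u, w} k) : GrMod.hom V W →ₗ[k] (V →ₗ[k] W) :=
  (GrMod.homSpan V W).subtype

theorem homMap_mem {V : GrMod.{u, v} k} {W : GrMod.{u, w} k} {p : ℤ} {f : GrMod.hom V W}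
    (hf : f ∈ (GrMod.hom V W).deg p) : IsDeg V.deg W.deg (homMap V W f) p := hf

/-- A linear map to `Hom(V, W)`. -/
def homCod {V : GrMod.{u, v} k} {W : GrMod.{u, w} k} {M : GrMod.{u, w'} k}
    (φ : M →ₗ[k] (V →ₗ[k] W)) (h : ∀ p, ∀ x ∈ M.deg p, ∃ q, IsDeg V.deg W.deg (φ x) q) :
    M →ₗ[k] GrMod.hom V W :=
  φ.codRestrict (GrMod.homSpan V W) fun x => by
    have : (⨆ p, M.deg p) ≤ (GrMod.homSpan V W).comap φ :=
      iSup_le fun p x hx => Submodule.subset_span (h p x hx)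
    rw [M.iSup_deg] at this
    exact this trivial

/-- A multilinear map to `Hom(V, W)`. -/
def homMulti {V : GrMod.{u, v} k} {W : GrMod.{u, w} k} {M : GrMod.{u, w'} k} {n : ℕ}
    (φ : MultilinearMap k (fun _ : Fin n => M) (V →ₗ[k] W))
    (h : ∀ (p : Fin n → ℤ) (x : Fin n → M), (∀ i, x i ∈ M.deg (p i)) →
      ∃ q, IsDeg V.deg W.deg (φ x) q) :
    MultilinearMap k (fun _ : Fin n => M) (GrMod.hom V W) :=
  φ.codRestrict (GrMod.homSpan V W) fun x =>
    multilinear_mem (𝒱 := fun _ => M.deg) φ _ (fun p x hx => Submodule.subset_span (h p x hx)) x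
      fun i => by rw [M.iSup_deg]; trivial

variable {C : Cooperad.{u, v} k}

/-- The map `X ↦ g ((1 ⊗ f 0 ⊗ ⋯ ⊗ f (n - 1)) (Δ n X))` from `C(A)` to `D`, for maps
`g : C(B) → D` and `f i : C(A) → B`. -/
def plug (A B D : GrMod.{u, w} k) (n : ℕ) :
    (cofree C B →ₗ[k] D) →ₗ[k]
      MultilinearMap k (fun _ : Fin n => cofree C A →ₗ[k] B) (cofree C A →ₗ[k] D) where
  toFun g := (LinearMap.lcomp k D (comul C A n) ∘ₗ
    LinearMap.llcomp k _ _ _ (g ∘ₗ cls C B n)).compMultilinearMap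
      (tensorMap (C.obj n) (cofree C A) B n)
  map_add' g g' := by ext; rfl
  map_smul' c g := by ext; rfl

theorem plug_apply (A B D : GrMod.{u, w} k) (n : ℕ) (g : cofree C B →ₗ[k] D)
    (f : Fin n → cofree C A →ₗ[k] B) :
    plug A B D n g f =
      g ∘ₗ cls C B n ∘ₗ tensorMap (C.obj n) (cofree C A) B n f ∘ₗ comul C A n := rfl

theorem isDeg_plug (A B D : GrMod.{u, w} k) (n : ℕ) {g : cofree C B →ₗ[k] D}
    {f : Fin n → cofree C A →ₗ[k] B} {q : ℤ} {p : Fin n → ℤ}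
    (hg : IsDeg (cofree C B).deg D.deg g q)
    (hf : ∀ i, IsDeg (cofree C A).deg B.deg (f i) (p i)) :
    IsDeg (cofree C A).deg D.deg (plug A B D n g f) ((∑ i, p i) + q) := by
  rw [plug_apply]
  exact hg.comp ((isDeg_cls C B n).comp ((isDeg_tensorMap (C.obj n) (cofree C A) B n f p hf).comp
    (isDeg_comul C A n) (zero_add _)) (add_zero _)) rfl

variable (A B D : HoAlg.{u, v, w} C)

/-- The graded vector space `Hom(C(A), B)`. -/
abbrev homSpace : GrMod.{u, max u v w} k := GrMod.hom (cofree C A.space) B.space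

/-- The map `C(A) → B` that underlies an element of `Hom(C(A), B)`. -/
abbrev und : homSpace A B →ₗ[k] (cofree C A.space →ₗ[k] B.space) :=
  homMap (cofree C A.space) B.space

theorem isDeg_proj_Q :
    IsDeg (cofree C B.space).deg B.space.deg (proj C B.space ∘ₗ B.Q) 1 :=
  (isDeg_proj C B.space).comp B.isHoAlg.coderivation.deg (add_zero 1)

/-- The differential `f ↦ d f - (-1) ^ |f| f (∂ + Q) + p Q (1 ⊗ f) Δ 1` on `Hom(C(A), B)`. -/
def homDiff : homSpace A B →ₗ[k] homSpace A B :=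
  homCod
    (LinearMap.llcomp k _ _ _ B.d ∘ₗ und A B -
      LinearMap.lcomp k _ (cofreeDiff C A.d + A.Q) ∘ₗ und A B ∘ₗ (homSpace A B).eps +
      (MultilinearMap.ofSubsingleton k _ _ (0 : Fin 1)).symm
        (plug A.space B.space B.space 1 (proj C B.space ∘ₗ B.Q)) ∘ₗ und A B)
    fun p f hf => ⟨p + 1, by
      have hf' : IsDeg (cofree C A.space).deg B.space.deg (und A B ((homSpace A B).eps f)) p := by
        have := (homSpace A B).isDeg_eps p f hf
        rw [add_zero] at this
        exact homMap_mem this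
      refine IsDeg.add (IsDeg.sub ?_ ?_) ?_
      · exact B.isHoAlg.d_deg.comp (homMap_mem hf) rfl
      · exact hf'.comp ((isDeg_cofreeDiff C A.isHoAlg.d_deg).add A.isHoAlg.coderivation.deg)
          (add_comm 1 p)
      · have := isDeg_plug A.space B.space B.space 1 (isDeg_proj_Q B) (f := fun _ => und A B f)
          (p := fun _ => p) fun _ => homMap_mem hf
        rw [Fin.sum_univ_one] at this
        exact this⟩

/-- The multibracket `p Q (1 ⊗ f 0 ⊗ ⋯ ⊗ f (n - 1)) Δ n` on `Hom(C(A), B)`. -/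
def homBracket (n : ℕ) : MultilinearMap k (fun _ : Fin n => homSpace A B) (homSpace A B) :=
  homMulti ((plug A.space B.space B.space n (proj C B.space ∘ₗ B.Q)).compLinearMap
      fun _ => und A B)
    fun _ _ hf => ⟨_, isDeg_plug A.space B.space B.space n (isDeg_proj_Q B)
      fun i => homMap_mem (hf i)⟩

/-- The convolution algebra `map(A, B) = Hom(C(A), B)`, with the filtration by arity. -/
def mapSpace : SLieData.{u, max u v w} k where
  space := homSpace A B
  d := homDiff A B
  q := symElim fun n => match n with
    | 0 => 0
    | 1 => 0
    | n + 2 => PiTensorProduct.lift (homBracket A B (n + 2))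
  F n := ⨅ m ∈ Finset.range n,
    LinearMap.ker (LinearMap.lcomp k _ (cls C A.space m) ∘ₗ und A B)

/-- The operation `(g 0 ⊕ f 0), …, (g n ⊕ f n) ↦ g 0 ((1 ⊗ f 1 ⊗ ⋯ ⊗ f n) Δ n)`. -/
def compMulti (n : ℕ) :
    MultilinearMap k (fun _ : Fin (n + 1) => ((mapSpace B D).prod (mapSpace A B)).space) (homSpace A D) :=
  homMulti
    (LinearMap.uncurryLeft (MultilinearMap.compLinearMapₗ (fun _ : Fin n =>
        und A B ∘ₗ GrMod.snd (homSpace B D) (homSpace A B)) ∘ₗ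
      plug A.space B.space D.space n ∘ₗ und B D ∘ₗ GrMod.fst (homSpace B D) (homSpace A B)))
    fun _ _ hx => ⟨_, isDeg_plug A.space B.space D.space n (homMap_mem (hx 0).1)
      fun i => homMap_mem (hx i.succ).2⟩

/-- The map `S(map(B, D) ⊕ map(A, B)) → map(A, D)` that defines the composition: `n` times the
symmetrization of `compMulti` on words of length `n ≥ 2`. On a word `g f 1 ⋯ f n` with `n ≥ 1` its
value is `X ↦ g ((1 ⊗ f 1 ⊗ ⋯ ⊗ f n) (Δ n X))`. -/
def compPre : sym ((mapSpace B D).prod (mapSpace A B)).space →ₗ[k] homSpace A D :=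
  symElim fun n => match n with
    | 0 => 0
    | 1 => 0
    | n + 2 => ((n + 2 : ℕ) : k) • PiTensorProduct.lift (compMulti A B D (n + 1))

/-- The composition `map(B, D) ⊕ map(A, B) → map(A, D)`, as a morphism of coalgebras. -/
def compMap : sym ((mapSpace B D).prod (mapSpace A B)).space →ₗ[k] sym (mapSpace A D).space :=
  coalgLift (coCom k) (compPre A B D)

end Maps


end HomotopyAlg

end

open HomotopyAlg

/-!
# The enriched category of homotopy algebras of type `C`

All three statements are obtained from one object: the convolution `C(A) → C(B)`,
`(1 ⊗ f 0 ⊗ ⋯ ⊗ f (n - 1)) Δ n` of maps `f i : C(A) → B` (`conv`).  It is symmetric in the `f i` up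
to the Koszul sign, so it defines a linear map `convSym : S(Hom(C(A), B)) → Hom(C(A), C(B))`.  The
comultiplication of `C(B)` after a convolution is a sum of convolutions over all distributions of
the `f i` (`comul_conv`).  In other words, the adjoint map `S(Hom(C(A), B)) ⊗ C(A) → C(B)` is a
morphism of graded coalgebras; such families of maps are called `IsCoalgFam`.  As with coalgebra
morphisms and coderivations, families of morphisms (`IsCoalgFam.ext`) and families of coderivations
along them (`eq_zero_of_derLift`) are determined by their projections to the cogenerators.

*The convolution algebra.*  Let `∂ + Q` be the codifferential of `S(Hom(C(A), B))` given by the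
brackets.  By `convSym_mapCodiff`, the map `convSym` sends it to the commutator with the
codifferentials of `C(A)` and `C(B)`: both sides are coderivations along `convSym`, and their
projections to `B` agree by the definition of the brackets.  The commutator squares to zero because
the codifferentials do.  Since an element of `Hom(C(A), B)` can be recovered from its image under
`convSym`, it follows that `(∂ + Q) ^ 2 = 0`.  The arity filtration is compatible with the brackets
because `Δ n` splits an arity into `n` arities with the same sum, and it is complete because a
map on `C(A)` is given by its components of the single arities.

*The composition.*  Families of maps can be composed along the comultiplication of their parameter
coalgebra (`star`).  A composite of families of coalgebra morphisms is again one
(`IsCoalgFam.star`); this rests on the coassociativity and cocommutativity of `S(L)` and on the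
interchange law for tensor products of odd maps (`tensorLift_starLift`).  The morphism `U` of the
statement is characterized by the equation `convSym ∘ U = star (convSym ∘ S(pr₁)) (convSym ∘ S(pr₂))`
(`convSym_comp_compLift`): both sides are families of coalgebra morphisms, and their projections to
the cogenerators agree by `proj_comp_compFam`.  Commutators are derivations for `star`
(`star_codiff`), and so `U` commutes with the codifferentials.  Since `star` is associative
(`star_assoc`), so is the composition.

*Continuity.*  In a composite `g ((1 ⊗ f 1 ⊗ ⋯ ⊗ f n) Δ n)` with all letters in positive filtration,
a nonzero value in arity `N` requires that `N` is at least the sum of the filtration degrees of the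
`f i`, and that `N ≥ n` is at least the filtration degree of `g`.  Hence the filtration degree of
the composite is at least half of the sum of all filtration degrees, and `U` maps the step `2 m` of
the filtration to the step `m` (`compLift_mem_wordF`).
-/

set_option linter.unusedSectionVars false

universe v'' w''

noncomputable section

namespace HomotopyAlg

/-! ### Signs -/

section SignCharacter

variable (k : Type u) [Field k]

/-- The sign character `p ↦ (-1) ^ p`. -/
def ks (p : ZMod 2) : k := if p = 1 then -1 else 1

variable {k}

@[simp] theorem ks_zero : ks k 0 = 1 := by simp [ks]

theorem zmod2_cases (p : ZMod 2) : p = 0 ∨ p = 1 := by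
  fin_cases p
  exacts [Or.inl rfl, Or.inr rfl]

theorem ks_one : ks k 1 = -1 := by simp [ks]

theorem ks_add (p q : ZMod 2) : ks k (p + q) = ks k p * ks k q := by
  have h : (1 : ZMod 2) + 1 = 0 := rfl
  rcases zmod2_cases p with rfl | rfl <;> rcases zmod2_cases q with rfl | rfl <;>
    simp [h, ks_one]

theorem ks_mul_self (p : ZMod 2) : ks k p * ks k p = 1 := by
  rw [← ks_add, CharTwo.add_self_eq_zero, ks_zero]

theorem ks_sum {ι : Type*} (s : Finset ι) (p : ι → ZMod 2) :
    ks k (∑ i ∈ s, p i) = ∏ i ∈ s, ks k (p i) := by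
  classical
  induction s using Finset.induction_on with
  | empty => simp
  | insert a s ha ih => rw [Finset.sum_insert ha, Finset.prod_insert ha, ks_add, ih]

theorem neg_one_zpow_eq_ks (d : ℤ) : (-1 : k) ^ d = ks k (d : ZMod 2) := by
  rcases Int.even_or_odd d with h | h
  · rw [h.neg_one_zpow, (ZMod.intCast_zmod_eq_zero_iff_dvd d 2).2 (by exact_mod_cast h.two_dvd)]
    simp
  · rw [h.neg_one_zpow]
    obtain ⟨e, rfl⟩ := h
    have : (((2 * e + 1 : ℤ)) : ZMod 2) = 1 := by
      push_cast
      have : (2 : ZMod 2) = 0 := rfl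
      rw [this]; simp
    rw [this, ks_one]

/-- The exponent of a Koszul sign: the number of inverted pairs of odd factors. -/
theorem koszulSign_eq_ks {T α β : Type} [Fintype T] [LinearOrder α] [LinearOrder β]
    (old : T → α) (new : T → β) (p : T → ZMod 2) :
    koszulSign k old new p =
      ks k (∑ x, ∑ y, if old x < old y ∧ new y < new x then p x * p y else 0) := by
  rw [koszulSign, ks_sum]
  refine Finset.prod_congr rfl fun x _ => ?_
  rw [ks_sum]
  refine Finset.prod_congr rfl fun y _ => ?_
  rcases zmod2_cases (p x) with h | h <;> rcases zmod2_cases (p y) with h' | h' <;>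
    simp [h, h', apply_ite (ks k), ks_one]

/-- The exponent of the Koszul sign of `regroup`. -/
def regroupExp {m n : ℕ} (r : Fin m → ℕ) (e : (Σ j, Fin (r j)) ≃ Fin n) (c : Fin m → ZMod 2)
    (d : Fin n → ZMod 2) : ZMod 2 :=
  (∑ j, ∑ i : (Σ j, Fin (r j)), if i.1 < j then c j * d (e i) else 0) +
    ∑ i : (Σ j, Fin (r j)), ∑ i' : (Σ j, Fin (r j)),
      if e i < e i' ∧ (i'.1 < i.1 ∨ i'.1 = i.1 ∧ (i'.2 : ℕ) < i.2) then d (e i) * d (e i') else 0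

theorem koszulSign_regroupPos {m n : ℕ} (r : Fin m → ℕ) (e : (Σ j, Fin (r j)) ≃ Fin n)
    (c : Fin m → ZMod 2) (d : Fin n → ZMod 2) :
    koszulSign k (fun t : Fin m ⊕ Fin n => toLex t) (regroupPos r e) (Sum.elim c d) =
      ks k (regroupExp r e c d) := by
  have hs : ∀ i, ((e.symm (e i)).2 : ℕ) = i.2 := fun i => by rw [e.symm_apply_apply]
  rw [koszulSign_eq_ks, regroupExp]
  congr 1
  simp only [Fintype.sum_sum_type, Sum.elim_inl, Sum.elim_inr, Sum.Lex.toLex_lt_toLex,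
    Sum.lex_inl_inl, Sum.Lex.sep, Sum.lex_inr_inl, Sum.lex_inr_inr, Prod.Lex.toLex_lt_toLex,
    true_and, false_and, if_false, Finset.sum_const_zero, zero_add]
  rw [Finset.sum_add_distrib]
  have h0 : ∑ x : Fin m, ∑ y : Fin m, (if x < y ∧ ((y : ℕ) < x ∨ (y : ℕ) = x ∧ 0 < 0) then
      c x * c y else 0) = 0 :=
    Finset.sum_eq_zero fun x _ => Finset.sum_eq_zero fun y _ => if_neg (by
      rintro ⟨h, h' | h'⟩
      · exact absurd h (not_lt.2 (le_of_lt (Fin.lt_def.2 h')))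
      · exact absurd h'.2 (lt_irrefl _))
  rw [h0, zero_add]
  congr 1
  · refine Finset.sum_congr rfl fun j _ => ?_
    rw [← e.sum_comp]
    refine Finset.sum_congr rfl fun i _ => ?_
    simp
  · rw [← e.sum_comp]
    refine Finset.sum_congr rfl fun i _ => ?_
    rw [← e.sum_comp]
    refine Finset.sum_congr rfl fun i' _ => ?_
    simp [hs, Fin.ext_iff]

end SignCharacter

/-! ### Tensor products of graded vector spaces -/

namespace GrMod

section Graded

variable {k : Type u} [Field k]

theorem sgn_of_mem (V : GrMod.{u, v} k) (p : ZMod 2) {d : ℤ} {x : V} (hx : x ∈ V.deg d) :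
    V.sgn p x = ks k (p * d) • x := by
  rcases zmod2_cases p with rfl | rfl
  · simp [sgn]
  · rw [sgn, if_pos rfl, eps, V.diag_of_mem _ hx, neg_one_zpow_eq_ks, one_mul]

theorem eps_of_mem (V : GrMod.{u, v} k) {d : ℤ} {x : V} (hx : x ∈ V.deg d) :
    V.eps x = ks k d • x := by
  rw [eps, V.diag_of_mem _ hx, neg_one_zpow_eq_ks]

theorem sgn_zero (V : GrMod.{u, v} k) : V.sgn 0 = LinearMap.id := by simp [sgn]

theorem sgn_one (V : GrMod.{u, v} k) : V.sgn 1 = V.eps := by simp [sgn]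

theorem sgn_comp_sgn (V : GrMod.{u, v} k) (p q : ZMod 2) :
    V.sgn p ∘ₗ V.sgn q = V.sgn (p + q) := by
  refine V.ext_deg fun d x hx => ?_
  rw [LinearMap.comp_apply, V.sgn_of_mem q hx, map_smul, V.sgn_of_mem p hx, V.sgn_of_mem _ hx,
    smul_smul, ← ks_add]
  congr 2; ring

theorem eps_comp_eps (V : GrMod.{u, v} k) : V.eps ∘ₗ V.eps = LinearMap.id := by
  rw [← V.sgn_one, V.sgn_comp_sgn, CharTwo.add_self_eq_zero, V.sgn_zero]

theorem sgn_comp_of_isDeg {V : GrMod.{u, v} k} {W : GrMod.{u, w} k} {f : V →ₗ[k] W} {p : ℤ}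
    (hf : IsDeg V.deg W.deg f p) (q : ZMod 2) :
    W.sgn q ∘ₗ f = ks k (q * p) • (f ∘ₗ V.sgn q) := by
  refine V.ext_deg fun d x hx => ?_
  rw [LinearMap.comp_apply, LinearMap.smul_apply, LinearMap.comp_apply, V.sgn_of_mem q hx,
    W.sgn_of_mem q (hf d x hx), map_smul, smul_smul, ← ks_add]
  congr 2; push_cast; ring

theorem eps_comp_of_isDeg {V : GrMod.{u, v} k} {W : GrMod.{u, w} k} {f : V →ₗ[k] W} {p : ℤ}
    (hf : IsDeg V.deg W.deg f p) : W.eps ∘ₗ f = ks k p • (f ∘ₗ V.eps) := by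
  rw [← sgn_one, ← sgn_one, sgn_comp_of_isDeg hf, one_mul]

variable [CharZero k]

/-- Tensor products of homogeneous vectors of total degree `n`, for all `n`, span `V ⊗ W`. -/
theorem mem_iSup_tensorDeg (V : GrMod.{u, v} k) (W : GrMod.{u, w} k) (x : V ⊗[k] W) :
    x ∈ ⨆ D, tensorDeg V.deg W.deg D := by
  induction x using TensorProduct.induction_on with
  | zero => exact Submodule.zero_mem _
  | add x y hx hy => exact Submodule.add_mem _ hx hy
  | tmul x y =>
    have hx : (⨆ i, V.deg i) ≤ (⨆ D, tensorDeg V.deg W.deg D).comap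
        ((TensorProduct.mk k V W).flip y) := by
      refine iSup_le fun i x hx => ?_
      have hy : (⨆ j, W.deg j) ≤ (⨆ D, tensorDeg V.deg W.deg D).comap
          (TensorProduct.mk k V W x) :=
        iSup_le fun j y hy => Submodule.mem_iSup_of_mem (i + j)
          (Submodule.subset_span ⟨i, j, x, y, hx, hy, rfl, rfl⟩)
      rw [iSup_deg] at hy
      exact hy (Submodule.mem_top : y ∈ (⊤ : Submodule k W))
    rw [iSup_deg] at hx
    exact hx (Submodule.mem_top : x ∈ (⊤ : Submodule k V))

/-- The tensor product of two graded vector spaces. -/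
abbrev tensor (V : GrMod.{u, v} k) (W : GrMod.{u, w} k) : GrMod.{u, max v w} k where
  carrier := V ⊗[k] W
  deg := tensorDeg V.deg W.deg
  internal := by
    refine isInternal_of_weight _ (eq_top_iff.2 fun x _ => mem_iSup_tensorDeg V W x)
      (TensorProduct.map (V.diag (2 ^ ·)) (W.diag (2 ^ ·))) fun D x hx => ?_
    induction hx using Submodule.span_induction with
    | zero => simp
    | add x y _ _ hx hy => rw [map_add, hx, hy, smul_add]
    | smul c x _ hx => rw [map_smul, hx, smul_comm]
    | mem x hx =>
      obtain ⟨i, j, x, y, hx, hy, rfl, rfl⟩ := hx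
      rw [TensorProduct.map_tmul, V.diag_of_mem _ hx, W.diag_of_mem _ hy,
        TensorProduct.smul_tmul_smul, zpow_add₀ two_ne_zero]

/-- The tensor product of a finite family of graded vector spaces. -/
abbrev pi {n : ℕ} (V : Fin n → GrMod.{u, v} k) : GrMod.{u, max u v} k where
  carrier := ⨂[k] i, V i
  deg := piDeg fun i => (V i).deg
  internal := by
    refine isInternal_of_weight _ (eq_top_iff.2 fun x _ => ?_)
      (PiTensorProduct.map fun i => (V i).diag (2 ^ ·)) fun D x hx => ?_
    · have hx : x ∈ Submodule.span k (Set.range (PiTensorProduct.tprod k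
          (s := fun i => (V i : Type v)))) := by
        rw [PiTensorProduct.span_tprod_eq_top]; trivial
      refine Submodule.span_le.2 ?_ hx
      rintro _ ⟨v, rfl⟩
      exact multilinear_mem (𝒱 := fun i => (V i).deg) (PiTensorProduct.tprod k)
        (⨆ D, piDeg (fun i => (V i).deg) D)
        (fun d v hv => Submodule.mem_iSup_of_mem (∑ i, d i)
          (Submodule.subset_span ⟨d, v, hv, rfl, rfl⟩)) v
        fun i => by rw [(V i).iSup_deg]; trivial
    · induction hx using Submodule.span_induction with
      | zero => simp
      | add x y _ _ hx hy => rw [map_add, hx, hy, smul_add]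
      | smul c x _ hx => rw [map_smul, hx, smul_comm]
      | mem x hx =>
        obtain ⟨d, v, hv, rfl, rfl⟩ := hx
        simp only [PiTensorProduct.map_tprod, (V _).diag_of_mem _ (hv _),
          MultilinearMap.map_smul_univ, prod_two_zpow]

theorem tmul_mem {V : GrMod.{u, v} k} {W : GrMod.{u, w} k} {i j : ℤ} {x : V} {y : W}
    (hx : x ∈ V.deg i) (hy : y ∈ W.deg j) :
    x ⊗ₜ[k] y ∈ tensorDeg V.deg W.deg (i + j) :=
  Submodule.subset_span ⟨i, j, x, y, hx, hy, rfl, rfl⟩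

theorem tprod_mem {n : ℕ} {V : Fin n → GrMod.{u, v} k} {d : Fin n → ℤ} {x : ∀ i, V i}
    (hx : ∀ i, x i ∈ (V i).deg (d i)) :
    PiTensorProduct.tprod k x ∈ piDeg (fun i => (V i).deg) (∑ i, d i) :=
  Submodule.subset_span ⟨d, x, hx, rfl, rfl⟩

end Graded

end GrMod

/-! ### Checking identities on homogeneous tensors -/

section Ext

variable {k : Type u} [Field k] {M : Type*} [AddCommGroup M] [Module k M]

theorem pi_mem_of_homogeneous {n : ℕ} {V : Fin n → GrMod.{u, v} k}
    (N : Submodule k (⨂[k] i, V i))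
    (h : ∀ (d : Fin n → ℤ) (v : ∀ i, V i), (∀ i, v i ∈ (V i).deg (d i)) →
      PiTensorProduct.tprod k v ∈ N) (x : ⨂[k] i, V i) : x ∈ N := by
  have hx : x ∈ Submodule.span k (Set.range (PiTensorProduct.tprod k
      (s := fun i => (V i : Type v)))) := by
    rw [PiTensorProduct.span_tprod_eq_top]; trivial
  refine Submodule.span_le.2 ?_ hx
  rintro _ ⟨v, rfl⟩
  exact multilinear_mem (𝒱 := fun i => (V i).deg) (PiTensorProduct.tprod k) N h v
    fun i => by rw [(V i).iSup_deg]; trivial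

theorem pi_ext_deg {n : ℕ} {V : Fin n → GrMod.{u, v} k} {f g : (⨂[k] i, V i) →ₗ[k] M}
    (h : ∀ (d : Fin n → ℤ) (v : ∀ i, V i), (∀ i, v i ∈ (V i).deg (d i)) →
      f (PiTensorProduct.tprod k v) = g (PiTensorProduct.tprod k v)) : f = g :=
  LinearMap.ext fun x => pi_mem_of_homogeneous (LinearMap.eqLocus f g) h x

end Ext

/-! ### Tensor products of homogeneous maps -/

section HomogeneousMaps

variable {k : Type u} [Field k]

theorem parPart_of_isDeg (V : GrMod.{u, v} k) (W : GrMod.{u, w} k) (q : ZMod 2) {f : V →ₗ[k] W}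
    {p : ℤ} (hf : IsDeg V.deg W.deg f p) : parPart V W q f = if (p : ZMod 2) = q then f else 0 := by
  refine V.ext_deg fun d x hx => ?_
  rw [parPart, LinearMap.sum_apply, LinearMap.sum_apply, Finset.sum_eq_single (d : ZMod 2)]
  · simp only [LinearMap.comp_apply, LinearMap.lcomp_apply', LinearMap.llcomp_apply',
      V.par_of_mem hx, if_true, W.par_of_mem (hf d x hx)]
    push_cast
    by_cases h : (p : ZMod 2) = q
    · simp [h]
    · rw [if_neg fun h' => h (add_left_cancel h'), if_neg h]; rfl
  · intro b _ hb
    simp [LinearMap.lcomp_apply', V.par_of_mem hx, Ne.symm hb]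
  · simp

/-- The operator `1 ⊗ f 0 ⊗ ⋯ ⊗ f (n - 1)` for maps `f j` of parity `p j`, with the Koszul sign
rule. -/
def hmap (M : GrMod.{u, v'} k) {n : ℕ} (V : Fin n → GrMod.{u, v} k) (W : Fin n → GrMod.{u, w} k)
    (p : Fin n → ZMod 2) (f : ∀ j, V j →ₗ[k] W j) :
    (M ⊗[k] (⨂[k] j, V j)) →ₗ[k] (M ⊗[k] (⨂[k] j, W j)) :=
  TensorProduct.map (M.sgn (∑ j, p j))
    (PiTensorProduct.map fun j => f j ∘ₗ (V j).sgn (∑ i with j < i, p i))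

/-- On homogeneous maps, `tensorMap` is the operator `hmap` with the parities of the maps. -/
theorem tensorMap_eq_hmap (M : GrMod.{u, v'} k) (V : GrMod.{u, v} k) (W : GrMod.{u, w} k) {n : ℕ}
    {f : Fin n → V →ₗ[k] W} {p : Fin n → ℤ} (hf : ∀ j, IsDeg V.deg W.deg (f j) (p j)) :
    tensorMap M V W n f =
      hmap M (fun _ => V) (fun _ => W) (fun j => (p j : ZMod 2)) f := by
  rw [tensorMap, sum_apply, Finset.sum_eq_single fun j => (p j : ZMod 2)]
  · simp only [LinearMap.compMultilinearMap_apply, MultilinearMap.compLinearMap_apply,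
      LinearMap.comp_apply, parPart_of_isDeg V W _ (hf _), if_true]
    rfl
  · intro q _ hq
    obtain ⟨j, hj⟩ := Function.ne_iff.1 hq
    rw [LinearMap.compMultilinearMap_apply, MultilinearMap.compLinearMap_apply,
      MultilinearMap.map_coord_zero _ j, map_zero]
    rw [LinearMap.comp_apply, parPart_of_isDeg V W _ (hf j), if_neg (Ne.symm hj), map_zero]
  · simp

theorem hmap_tmul (M : GrMod.{u, v'} k) {n : ℕ} (V : Fin n → GrMod.{u, v} k)
    (W : Fin n → GrMod.{u, w} k) (p : Fin n → ZMod 2) (f : ∀ j, V j →ₗ[k] W j) {i : ℤ}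
    {d : Fin n → ℤ} {x : M} {y : ∀ j, V j} (hx : x ∈ M.deg i) (hy : ∀ j, y j ∈ (V j).deg (d j)) :
    hmap M V W p f (x ⊗ₜ PiTensorProduct.tprod k y) =
      ks k ((∑ j, p j) * i + ∑ j, ∑ j', if j < j' then (d j : ZMod 2) * p j' else 0) •
        (x ⊗ₜ PiTensorProduct.tprod k fun j => f j (y j)) := by
  rw [hmap, TensorProduct.map_tmul, M.sgn_of_mem _ hx, PiTensorProduct.map_tprod]
  simp only [LinearMap.comp_apply, (V _).sgn_of_mem _ (hy _), map_smul]
  rw [MultilinearMap.map_smul_univ, TensorProduct.smul_tmul_smul, ← ks_sum, ← ks_add]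
  congr 3
  refine Finset.sum_congr rfl fun j _ => ?_
  rw [Finset.sum_mul, Finset.sum_filter]
  exact Finset.sum_congr rfl fun j' _ => by split_ifs <;> ring

theorem hmap_zero (M : GrMod.{u, v'} k) {n : ℕ} (V : Fin n → GrMod.{u, v} k)
    (W : Fin n → GrMod.{u, w} k) (f : ∀ j, V j →ₗ[k] W j) :
    hmap M V W 0 f = TensorProduct.map LinearMap.id (PiTensorProduct.map f) := by
  simp [hmap, GrMod.sgn_zero]

/-- The composition rule, with the sign that moves `g j` past `f i` for `i < j`. -/
theorem hmap_comp_hmap (M : GrMod.{u, v'} k) {n : ℕ} {V W X : Fin n → GrMod.{u, v} k}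
    {p : Fin n → ℤ} {f : ∀ j, V j →ₗ[k] W j}
    (hf : ∀ j, IsDeg (V j).deg (W j).deg (f j) (p j)) (q : Fin n → ZMod 2)
    (g : ∀ j, W j →ₗ[k] X j) :
    hmap M W X q g ∘ₗ hmap M V W (fun j => (p j : ZMod 2)) f =
      ks k (∑ i, ∑ j, if i < j then (p i : ZMod 2) * q j else 0) •
        hmap M V X (fun j => p j + q j) fun j => g j ∘ₗ f j := by
  have h : ∀ j, (g j ∘ₗ (W j).sgn (∑ i with j < i, q i)) ∘ₗ
      (f j ∘ₗ (V j).sgn (∑ i with j < i, (p i : ZMod 2))) =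
      ks k (∑ i, if j < i then (p j : ZMod 2) * q i else 0) •
        ((g j ∘ₗ f j) ∘ₗ (V j).sgn (∑ i with j < i, ((p i : ZMod 2) + q i))) := by
    intro j
    rw [LinearMap.comp_assoc, ← LinearMap.comp_assoc _ (f j), GrMod.sgn_comp_of_isDeg (hf j),
      LinearMap.smul_comp, LinearMap.comp_smul, LinearMap.comp_assoc, (V j).sgn_comp_sgn,
      ← LinearMap.comp_assoc, Finset.sum_add_distrib, add_comm (∑ i with j < i, q i)]
    congr 2
    rw [Finset.sum_filter, Finset.sum_mul]
    exact Finset.sum_congr rfl fun i _ => by split_ifs <;> ring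
  rw [hmap, hmap, ← TensorProduct.map_comp, ← PiTensorProduct.map_comp, M.sgn_comp_sgn, hmap]
  simp only [h]
  have h2 := (PiTensorProduct.mapMultilinear k (fun j => (V j : Type v))
    (fun j => (X j : Type v))).map_smul_univ
      (fun j => ks k (∑ i, if j < i then (p j : ZMod 2) * q i else 0))
      (fun j => (g j ∘ₗ f j) ∘ₗ (V j).sgn (∑ i with j < i, ((p i : ZMod 2) + q i)))
  simp only [PiTensorProduct.mapMultilinear_apply] at h2
  rw [h2, ← ks_sum, TensorProduct.map_smul_right, Finset.sum_add_distrib, add_comm (∑ j, q j)]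

end HomogeneousMaps

/-! ### Signs of iterated rearrangements -/

section NestedSigns

/-- A sum over ordered pairs of elements of `T` without diagonal terms is a sum over the pairs that
are increasing with respect to a labelling `N`. -/
theorem sum_sum_eq_of_injective {T : Type} [Fintype T] {α : Type} [LinearOrder α] (N : T → α)
    (hN : Function.Injective N) (g : T → T → ZMod 2) (hg : ∀ x, g x x = 0) :
    ∑ x, ∑ y, g x y = ∑ x, ∑ y, if N x < N y then g x y + g y x else 0 := by
  have h1 : ∀ x y, g x y = (if N x < N y then g x y else 0) + if N y < N x then g x y else 0 := by
    intro x y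
    rcases lt_trichotomy (N x) (N y) with h | h | h
    · simp [h, h.not_gt]
    · simp [hN h, hg]
    · simp [h, h.not_gt]
  have h2 : ∑ x, ∑ y, (if N y < N x then g x y else 0) =
      ∑ x, ∑ y, if N x < N y then g y x else 0 := by rw [Finset.sum_comm]
  calc ∑ x, ∑ y, g x y
      = ∑ x, ∑ y, ((if N x < N y then g x y else 0) + if N y < N x then g x y else 0) :=
        Finset.sum_congr rfl fun x _ => Finset.sum_congr rfl fun y _ => h1 x y
    _ = _ := by
        simp only [Finset.sum_add_distrib]
        rw [h2]
        simp only [← Finset.sum_add_distrib]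
        refine Finset.sum_congr rfl fun x _ => Finset.sum_congr rfl fun y _ => ?_
        split_ifs <;> simp

/-- Reindexing of the inputs of a tree along a labelling `e` of its vertices. -/
theorem sum_sigma_comp {m K : ℕ} {r : Fin m → ℕ} (e : (Σ j, Fin (r j)) ≃ Fin K) {l : Fin K → ℕ}
    (g : (Σ x, Fin (l x)) → ZMod 2) :
    ∑ v, g v = ∑ i : (Σ j, Fin (r j)), ∑ t : Fin (l (e i)), g ⟨e i, t⟩ := by
  rw [Fintype.sum_sigma, ← e.sum_comp]

/-- Regrouping of a sum along labellings `f j` of the inputs of the blocks. -/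
theorem sum_sigma_block {m : ℕ} {r a : Fin m → ℕ} {l : (Σ j, Fin (r j)) → ℕ}
    (f : ∀ j, (Σ s : Fin (r j), Fin (l ⟨j, s⟩)) ≃ Fin (a j))
    (g : (Σ j, Fin (a j)) → ZMod 2) :
    ∑ y, g y = ∑ i : (Σ j, Fin (r j)), ∑ t : Fin (l i), g ⟨i.1, f i.1 ⟨i.2, t⟩⟩ := by
  rw [Fintype.sum_sigma, Fintype.sum_sigma]
  refine Finset.sum_congr rfl fun j _ => ?_
  rw [← (f j).sum_comp, Fintype.sum_sigma]

theorem sum_sum_sigma_diag {m : ℕ} {r : Fin m → ℕ} (g : (Σ j, Fin (r j)) → (Σ j, Fin (r j)) → ZMod 2)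
    (hg : ∀ i i', i'.1 ≠ i.1 → g i i' = 0) :
    ∑ i, ∑ i', g i i' = ∑ j, ∑ s : Fin (r j), ∑ s' : Fin (r j), g ⟨j, s⟩ ⟨j, s'⟩ := by
  rw [Fintype.sum_sigma]
  refine Finset.sum_congr rfl fun j _ => Finset.sum_congr rfl fun s _ => ?_
  rw [Fintype.sum_sigma, Finset.sum_eq_single j]
  · intro j' _ hj'
    exact Finset.sum_eq_zero fun s' _ => hg _ _ hj'
  · simp

/-- The pairs of positions that are inverted between the order of the labels `x` and the
lexicographic order of `(j, s)`, counted modulo two together with the pairs that are ordered by the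
labels. -/
theorem inversion_pair (j j' s s' x x' : ℕ) (h : x = x' ↔ j = j' ∧ s = s') (z : ZMod 2) :
    (if x' < x then z else 0) + ((if x < x' ∧ (j' < j ∨ j' = j ∧ s' < s) then z else 0) +
      if x' < x ∧ (j < j' ∨ j = j' ∧ s < s') then z else 0) =
    (if j' < j then z else 0) + if j' = j ∧ s' < s then z else 0 := by
  rcases zmod2_cases z with rfl | rfl
  · simp
  · split_ifs <;> first | rfl | (exfalso; omega)

/-- Inversions of a rearrangement in two steps, modulo two: from the order of the labels to the
lexicographic order of `(x, t)` and then to that of `(j, s, t)`, or first to the blocks `j` with the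
intermediate order `y` and then within each block. -/
theorem inversion_nested (j j' s s' t t' x x' y y' : ℕ) (h : x = x' ↔ j = j' ∧ s = s')
    (h' : ¬(x = x' ∧ t = t')) (h'' : j = j' → y ≠ y') (z : ZMod 2) :
    (if x' < x ∨ x' = x ∧ t' < t then z else 0) +
      ((if x < x' ∧ (j' < j ∨ j' = j ∧ s' < s) then z else 0) +
        if x' < x ∧ (j < j' ∨ j = j' ∧ s < s') then z else 0) =
    (if j' < j ∨ j' = j ∧ y' < y then z else 0) +
      ((if j' = j ∧ y < y' ∧ (s' < s ∨ s' = s ∧ t' < t) then z else 0) +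
        if j = j' ∧ y' < y ∧ (s < s' ∨ s = s' ∧ t < t') then z else 0) := by
  rcases zmod2_cases z with rfl | rfl
  · simp
  · by_cases hj : j = j'
    · by_cases hs : s = s'
      · obtain rfl := hj
        obtain rfl := hs
        obtain rfl : x = x' := h.2 ⟨rfl, rfl⟩
        have := h'' rfl
        simp only [lt_irrefl, true_and, false_or, false_and, if_false, true_and, zero_add]
        split_ifs <;> first | rfl | (exfalso; omega)
      · obtain rfl := hj
        have := h'' rfl
        have hx : x ≠ x' := fun hx => hs (h.1 hx).2
        simp only [lt_irrefl, true_and, false_or, hx.symm, hs, Ne.symm hs, false_and, or_false]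
        split_ifs <;> first | rfl | (exfalso; omega)
    · have hx : x ≠ x' := fun hx => hj (h.1 hx).1
      simp only [hj, Ne.symm hj, hx.symm, false_and, or_false, if_false, add_zero]
      split_ifs <;> first | rfl | (exfalso; omega)

/-- Rearranging along a three-level tree in two ways gives the same sign. -/
theorem regroupExp_nested {m K N : ℕ} (r : Fin m → ℕ) (e : (Σ j, Fin (r j)) ≃ Fin K)
    (l : Fin K → ℕ) (E : (Σ x, Fin (l x)) ≃ Fin N) (a : Fin m → ℕ)
    (f : ∀ j, (Σ s : Fin (r j), Fin (l (e ⟨j, s⟩))) ≃ Fin (a j)) (F : (Σ j, Fin (a j)) ≃ Fin N)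
    (h : ∀ j s t, E ⟨e ⟨j, s⟩, t⟩ = F ⟨j, f j ⟨s, t⟩⟩) (c : Fin m → ZMod 2) (b : Fin K → ZMod 2)
    (d : Fin N → ZMod 2) :
    regroupExp l E b d + regroupExp r e c (fun x => b x + ∑ t, d (E ⟨x, t⟩)) =
      regroupExp r e c b + regroupExp a F (fun j => c j + ∑ s, b (e ⟨j, s⟩)) d +
        ∑ j, regroupExp (fun s => l (e ⟨j, s⟩)) (f j) (fun s => b (e ⟨j, s⟩))
          fun y => d (F ⟨j, y⟩) := by
  have he : ∀ i i' : (Σ j, Fin (r j)), ((e i : ℕ) = e i' ↔ (i.1 : ℕ) = i'.1 ∧ (i.2 : ℕ) = i'.2) := by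
    rintro ⟨j, s⟩ ⟨j', s'⟩
    rw [Fin.val_inj, e.apply_eq_iff_eq]
    constructor
    · rintro h; cases h; exact ⟨rfl, rfl⟩
    · rintro ⟨h1, h2⟩
      obtain rfl := Fin.ext h1
      obtain rfl := Fin.ext h2
      rfl
  -- the part that is bilinear in `c` and `d`
  have h1 : ∑ j, ∑ i : (Σ j, Fin (r j)), (if i.1 < j then c j * ∑ t, d (E ⟨e i, t⟩) else 0) =
      ∑ j, ∑ y : (Σ j, Fin (a j)), if y.1 < j then c j * d (F y) else 0 := by
    refine Finset.sum_congr rfl fun j _ => ?_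
    rw [sum_sigma_block (l := fun i => l (e i)) f]
    refine Finset.sum_congr rfl fun i _ => ?_
    split_ifs
    · rw [Finset.mul_sum]
      exact Finset.sum_congr rfl fun t _ => by rw [← h]
    · simp
  -- the part that is bilinear in `b` and `d`
  have h2 : (∑ x, ∑ v : (Σ x, Fin (l x)), if v.1 < x then b x * d (E v) else 0) +
      ∑ i : (Σ j, Fin (r j)), ∑ i' : (Σ j, Fin (r j)),
        (if e i < e i' ∧ (i'.1 < i.1 ∨ i'.1 = i.1 ∧ (i'.2 : ℕ) < i.2) then
          b (e i) * (∑ t, d (E ⟨e i', t⟩)) + (∑ t, d (E ⟨e i, t⟩)) * b (e i') else 0) =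
      (∑ j, ∑ y : (Σ j, Fin (a j)), if y.1 < j then (∑ s, b (e ⟨j, s⟩)) * d (F y) else 0) +
      ∑ j, ∑ s : Fin (r j), ∑ w : (Σ s : Fin (r j), Fin (l (e ⟨j, s⟩))),
        if w.1 < s then b (e ⟨j, s⟩) * d (F ⟨j, f j w⟩) else 0 := by
    have k1 : (∑ x, ∑ v : (Σ x, Fin (l x)), if v.1 < x then b x * d (E v) else 0) =
        ∑ i : (Σ j, Fin (r j)), ∑ i' : (Σ j, Fin (r j)),
          if (e i' : ℕ) < e i then b (e i) * (∑ t, d (E ⟨e i', t⟩)) else 0 := by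
      rw [← e.sum_comp]
      refine Finset.sum_congr rfl fun i _ => ?_
      rw [sum_sigma_comp e]
      refine Finset.sum_congr rfl fun i' _ => ?_
      simp only [Fin.lt_def]
      split_ifs
      · rw [Finset.mul_sum]
      · simp
    have k2 : ∑ i : (Σ j, Fin (r j)), ∑ i' : (Σ j, Fin (r j)),
        (if e i < e i' ∧ (i'.1 < i.1 ∨ i'.1 = i.1 ∧ (i'.2 : ℕ) < i.2) then
          b (e i) * (∑ t, d (E ⟨e i', t⟩)) + (∑ t, d (E ⟨e i, t⟩)) * b (e i') else 0) =
        ∑ i : (Σ j, Fin (r j)), ∑ i' : (Σ j, Fin (r j)),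
          ((if (e i : ℕ) < e i' ∧ ((i'.1 : ℕ) < i.1 ∨ (i'.1 : ℕ) = i.1 ∧ (i'.2 : ℕ) < i.2) then
            b (e i) * (∑ t, d (E ⟨e i', t⟩)) else 0) +
          if (e i' : ℕ) < e i ∧ ((i.1 : ℕ) < i'.1 ∨ (i.1 : ℕ) = i'.1 ∧ (i.2 : ℕ) < i'.2) then
            b (e i) * (∑ t, d (E ⟨e i', t⟩)) else 0) := by
      simp only [Finset.sum_add_distrib]
      rw [Finset.sum_comm (f := fun i i' => if (e i' : ℕ) < e i ∧ ((i.1 : ℕ) < i'.1 ∨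
        (i.1 : ℕ) = i'.1 ∧ (i.2 : ℕ) < i'.2) then b (e i) * (∑ t, d (E ⟨e i', t⟩)) else 0)]
      simp only [← Finset.sum_add_distrib]
      refine Finset.sum_congr rfl fun i _ => Finset.sum_congr rfl fun i' _ => ?_
      simp only [Fin.lt_def, Fin.ext_iff]
      split_ifs
      · ring
      · simp
    have k3 : (∑ j, ∑ y : (Σ j, Fin (a j)), if y.1 < j then (∑ s, b (e ⟨j, s⟩)) * d (F y) else 0) =
        ∑ i : (Σ j, Fin (r j)), ∑ i' : (Σ j, Fin (r j)),
          if (i'.1 : ℕ) < i.1 then b (e i) * (∑ t, d (E ⟨e i', t⟩)) else 0 := by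
      rw [Fintype.sum_sigma]
      refine Finset.sum_congr rfl fun j _ => ?_
      rw [sum_sigma_block (l := fun i => l (e i)) f, Finset.sum_comm]
      refine Finset.sum_congr rfl fun i' _ => ?_
      simp only [Fin.lt_def]
      split_ifs
      · rw [← Finset.sum_mul, Finset.mul_sum]
        exact Finset.sum_congr rfl fun t _ => by rw [← h]
      · simp
    have k4 : (∑ j, ∑ s : Fin (r j), ∑ w : (Σ s : Fin (r j), Fin (l (e ⟨j, s⟩))),
        if w.1 < s then b (e ⟨j, s⟩) * d (F ⟨j, f j w⟩) else 0) =
        ∑ i : (Σ j, Fin (r j)), ∑ i' : (Σ j, Fin (r j)),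
          if (i'.1 : ℕ) = i.1 ∧ (i'.2 : ℕ) < i.2 then b (e i) * (∑ t, d (E ⟨e i', t⟩)) else 0 := by
      rw [sum_sum_sigma_diag _ fun i i' hi => if_neg fun hh => hi (Fin.ext hh.1)]
      refine Finset.sum_congr rfl fun j _ => Finset.sum_congr rfl fun s _ => ?_
      rw [Fintype.sum_sigma]
      refine Finset.sum_congr rfl fun s' _ => ?_
      simp only [Fin.lt_def, true_and]
      split_ifs
      · rw [Finset.mul_sum]
        exact Finset.sum_congr rfl fun t _ => by rw [← h]
      · simp
    rw [k1, k2, k3, k4]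
    simp only [← Finset.sum_add_distrib]
    exact Finset.sum_congr rfl fun i _ => Finset.sum_congr rfl fun i' _ =>
      inversion_pair _ _ _ _ _ _ (he i i') _
  -- the part that is quadratic in `d`
  have h3 : (∑ v : (Σ x, Fin (l x)), ∑ v' : (Σ x, Fin (l x)),
        if E v < E v' ∧ (v'.1 < v.1 ∨ v'.1 = v.1 ∧ (v'.2 : ℕ) < v.2) then d (E v) * d (E v')
        else 0) +
      ∑ i : (Σ j, Fin (r j)), ∑ i' : (Σ j, Fin (r j)),
        (if e i < e i' ∧ (i'.1 < i.1 ∨ i'.1 = i.1 ∧ (i'.2 : ℕ) < i.2) then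
          (∑ t, d (E ⟨e i, t⟩)) * (∑ t, d (E ⟨e i', t⟩)) else 0) =
      (∑ y : (Σ j, Fin (a j)), ∑ y' : (Σ j, Fin (a j)),
        if F y < F y' ∧ (y'.1 < y.1 ∨ y'.1 = y.1 ∧ (y'.2 : ℕ) < y.2) then d (F y) * d (F y')
        else 0) +
      ∑ j, ∑ w : (Σ s : Fin (r j), Fin (l (e ⟨j, s⟩))),
        ∑ w' : (Σ s : Fin (r j), Fin (l (e ⟨j, s⟩))),
        if f j w < f j w' ∧ (w'.1 < w.1 ∨ w'.1 = w.1 ∧ (w'.2 : ℕ) < w.2) then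
          d (F ⟨j, f j w⟩) * d (F ⟨j, f j w'⟩) else 0 := by
    -- all four sums run over pairs of inputs `w` of the three-level tree, with labels `n w`
    let T := Σ i : (Σ j, Fin (r j)), Fin (l (e i))
    have hT : ∀ g : T → ZMod 2, ∑ w, g w = ∑ i, ∑ t, g ⟨i, t⟩ := fun g => Fintype.sum_sigma g
    let n : T → Fin N := fun w => E ⟨e w.1, w.2⟩
    have hn : Function.Injective n := by
      rintro ⟨i, t⟩ ⟨i', t'⟩ hh
      have := E.injective hh
      rw [Sigma.mk.injEq] at this
      obtain ⟨h1, h2⟩ := this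
      obtain rfl := e.injective h1
      obtain rfl := eq_of_heq h2
      rfl
    let y2 : T → ℕ := fun w => f w.1.1 ⟨w.1.2, w.2⟩
    have hy2 : ∀ w w' : T, w ≠ w' → (w.1.1 : ℕ) = w'.1.1 → y2 w ≠ y2 w' := by
      rintro ⟨⟨j, s⟩, t⟩ ⟨⟨j', s'⟩, t'⟩ hne hj hy
      obtain rfl := Fin.ext hj
      apply hne
      have := (f j).injective (Fin.ext hy)
      cases this
      rfl
    have hx2 : ∀ w w' : T, w ≠ w' → ¬((e w.1 : ℕ) = e w'.1 ∧ (w.2 : ℕ) = w'.2) := by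
      rintro ⟨i, t⟩ ⟨i', t'⟩ hne ⟨hj, ht⟩
      obtain rfl := e.injective (Fin.ext hj)
      obtain rfl := Fin.ext ht
      exact hne rfl
    have k1 : (∑ v : (Σ x, Fin (l x)), ∑ v' : (Σ x, Fin (l x)),
        if E v < E v' ∧ (v'.1 < v.1 ∨ v'.1 = v.1 ∧ (v'.2 : ℕ) < v.2) then d (E v) * d (E v')
        else 0) = ∑ w : T, ∑ w' : T, if n w < n w' then
          if (e w'.1 : ℕ) < e w.1 ∨ (e w'.1 : ℕ) = e w.1 ∧ (w'.2 : ℕ) < w.2 then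
            d (n w) * d (n w') else 0 else 0 := by
      rw [sum_sigma_comp e, hT]
      refine Finset.sum_congr rfl fun i _ => Finset.sum_congr rfl fun t _ => ?_
      rw [sum_sigma_comp e, hT]
      refine Finset.sum_congr rfl fun i' _ => Finset.sum_congr rfl fun t' _ => ?_
      simp only [← ite_and, Fin.lt_def, Fin.ext_iff]
      rfl
    have k2 : ∑ i : (Σ j, Fin (r j)), ∑ i' : (Σ j, Fin (r j)),
        (if e i < e i' ∧ (i'.1 < i.1 ∨ i'.1 = i.1 ∧ (i'.2 : ℕ) < i.2) then
          (∑ t, d (E ⟨e i, t⟩)) * (∑ t, d (E ⟨e i', t⟩)) else 0) =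
        ∑ w : T, ∑ w' : T, if n w < n w' then
          ((if (e w.1 : ℕ) < e w'.1 ∧ ((w'.1.1 : ℕ) < w.1.1 ∨
              (w'.1.1 : ℕ) = w.1.1 ∧ (w'.1.2 : ℕ) < w.1.2) then d (n w) * d (n w') else 0) +
          if (e w'.1 : ℕ) < e w.1 ∧ ((w.1.1 : ℕ) < w'.1.1 ∨
              (w.1.1 : ℕ) = w'.1.1 ∧ (w.1.2 : ℕ) < w'.1.2) then d (n w) * d (n w') else 0)
          else 0 := by
      have := sum_sum_eq_of_injective n hn (fun w w' => if (e w.1 : ℕ) < e w'.1 ∧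
        ((w'.1.1 : ℕ) < w.1.1 ∨ (w'.1.1 : ℕ) = w.1.1 ∧ (w'.1.2 : ℕ) < w.1.2) then
          d (n w) * d (n w') else 0) fun w => if_neg fun hh => lt_irrefl _ hh.1
      have this2 : ∀ w w' : T, d (n w') * d (n w) = d (n w) * d (n w') := fun _ _ => mul_comm _ _
      calc _ = _ := ?_
        _ = _ := this
        _ = _ := Finset.sum_congr rfl fun w _ => Finset.sum_congr rfl fun w' _ => by
          rw [this2 w w']
      rw [hT]
      refine Finset.sum_congr rfl fun i _ => ?_
      rw [Finset.sum_comm, hT]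
      refine Finset.sum_congr rfl fun i' _ => ?_
      simp only [Fin.lt_def, Fin.ext_iff]
      split_ifs
      · rw [mul_comm, Finset.sum_mul_sum]
        exact Finset.sum_congr rfl fun t _ => Finset.sum_congr rfl fun t' _ => mul_comm _ _
      · simp
    have k3 : (∑ y : (Σ j, Fin (a j)), ∑ y' : (Σ j, Fin (a j)),
        if F y < F y' ∧ (y'.1 < y.1 ∨ y'.1 = y.1 ∧ (y'.2 : ℕ) < y.2) then d (F y) * d (F y')
        else 0) = ∑ w : T, ∑ w' : T, if n w < n w' then
          if (w'.1.1 : ℕ) < w.1.1 ∨ (w'.1.1 : ℕ) = w.1.1 ∧ y2 w' < y2 w then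
            d (n w) * d (n w') else 0 else 0 := by
      rw [sum_sigma_block (l := fun i => l (e i)) f, hT]
      refine Finset.sum_congr rfl fun i _ => Finset.sum_congr rfl fun t _ => ?_
      rw [sum_sigma_block (l := fun i => l (e i)) f, hT]
      refine Finset.sum_congr rfl fun i' _ => Finset.sum_congr rfl fun t' _ => ?_
      have e1 : n ⟨i, t⟩ = F ⟨i.1, f i.1 ⟨i.2, t⟩⟩ := h _ _ _
      have e2 : n ⟨i', t'⟩ = F ⟨i'.1, f i'.1 ⟨i'.2, t'⟩⟩ := h _ _ _
      rw [e1, e2]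
      simp only [← ite_and, Fin.lt_def, Fin.ext_iff]
      rfl
    have k4 : (∑ j, ∑ w : (Σ s : Fin (r j), Fin (l (e ⟨j, s⟩))),
        ∑ w' : (Σ s : Fin (r j), Fin (l (e ⟨j, s⟩))),
        if f j w < f j w' ∧ (w'.1 < w.1 ∨ w'.1 = w.1 ∧ (w'.2 : ℕ) < w.2) then
          d (F ⟨j, f j w⟩) * d (F ⟨j, f j w'⟩) else 0) =
        ∑ w : T, ∑ w' : T, if n w < n w' then
          ((if (w'.1.1 : ℕ) = w.1.1 ∧ y2 w < y2 w' ∧ ((w'.1.2 : ℕ) < w.1.2 ∨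
              (w'.1.2 : ℕ) = w.1.2 ∧ (w'.2 : ℕ) < w.2) then d (n w) * d (n w') else 0) +
          if (w.1.1 : ℕ) = w'.1.1 ∧ y2 w' < y2 w ∧ ((w.1.2 : ℕ) < w'.1.2 ∨
              (w.1.2 : ℕ) = w'.1.2 ∧ (w.2 : ℕ) < w'.2) then d (n w) * d (n w') else 0)
          else 0 := by
      have := sum_sum_eq_of_injective n hn (fun w w' => if (w'.1.1 : ℕ) = w.1.1 ∧ y2 w < y2 w' ∧
        ((w'.1.2 : ℕ) < w.1.2 ∨ (w'.1.2 : ℕ) = w.1.2 ∧ (w'.2 : ℕ) < w.2) then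
          d (n w) * d (n w') else 0) fun w => if_neg fun hh => lt_irrefl _ hh.2.1
      have this2 : ∀ w w' : T, d (n w') * d (n w) = d (n w) * d (n w') := fun _ _ => mul_comm _ _
      calc _ = ∑ w : T, ∑ w' : T, if (w'.1.1 : ℕ) = w.1.1 ∧ y2 w < y2 w' ∧
        ((w'.1.2 : ℕ) < w.1.2 ∨ (w'.1.2 : ℕ) = w.1.2 ∧ (w'.2 : ℕ) < w.2) then
          d (n w) * d (n w') else 0 := by
            rw [hT, Finset.sum_congr rfl fun i _ => (Finset.sum_comm.trans (hT _)),
              sum_sum_sigma_diag]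
            · refine Finset.sum_congr rfl fun j _ => ?_
              rw [Fintype.sum_sigma]
              refine Finset.sum_congr rfl fun s _ => ?_
              rw [Finset.sum_comm, Fintype.sum_sigma]
              refine Finset.sum_congr rfl fun s' _ => Finset.sum_congr rfl fun t' _ =>
                Finset.sum_congr rfl fun t _ => ?_
              have e1 : n ⟨⟨j, s⟩, t⟩ = F ⟨j, f j ⟨s, t⟩⟩ := h _ _ _
              have e2 : n ⟨⟨j, s'⟩, t'⟩ = F ⟨j, f j ⟨s', t'⟩⟩ := h _ _ _
              rw [e1, e2]
              simp only [Fin.lt_def, Fin.ext_iff, true_and]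
              rfl
            · intro i i' hi
              exact Finset.sum_eq_zero fun t _ => Finset.sum_eq_zero fun t' _ =>
                if_neg fun hh => hi (Fin.ext hh.1)
        _ = _ := by
            rw [this]
            refine Finset.sum_congr rfl fun w _ => Finset.sum_congr rfl fun w' _ => ?_
            rw [this2 w w']
    rw [k1, k2, k3, k4]
    simp only [← Finset.sum_add_distrib]
    refine Finset.sum_congr rfl fun w _ => Finset.sum_congr rfl fun w' _ => ?_
    by_cases hw : n w < n w'
    · have hne : w ≠ w' := fun hh => by rw [hh] at hw; exact lt_irrefl _ hw
      simp only [if_pos hw]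
      exact inversion_nested _ _ _ _ _ _ _ _ _ _ (he w.1 w'.1) (hx2 w w' hne) (hy2 w w' hne) _
    · simp only [if_neg hw, add_zero]
  -- expansion of the exponents into the parts above
  have q1 : regroupExp r e c (fun x => b x + ∑ t, d (E ⟨x, t⟩)) = regroupExp r e c b +
      (∑ j, ∑ i : (Σ j, Fin (r j)), (if i.1 < j then c j * ∑ t, d (E ⟨e i, t⟩) else 0) +
      (∑ i : (Σ j, Fin (r j)), ∑ i' : (Σ j, Fin (r j)),
        (if e i < e i' ∧ (i'.1 < i.1 ∨ i'.1 = i.1 ∧ (i'.2 : ℕ) < i.2) then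
          b (e i) * (∑ t, d (E ⟨e i', t⟩)) + (∑ t, d (E ⟨e i, t⟩)) * b (e i') else 0) +
       ∑ i : (Σ j, Fin (r j)), ∑ i' : (Σ j, Fin (r j)),
        (if e i < e i' ∧ (i'.1 < i.1 ∨ i'.1 = i.1 ∧ (i'.2 : ℕ) < i.2) then
          (∑ t, d (E ⟨e i, t⟩)) * (∑ t, d (E ⟨e i', t⟩)) else 0))) := by
    have p1 : ∀ (P : Prop) [Decidable P] (x y : ZMod 2),
        (if P then x + y else 0) = (if P then x else 0) + if P then y else 0 := by
      intro P _ x y; split_ifs <;> simp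
    have p2 : ∀ x y z t : ZMod 2, (x + y) * (z + t) = x * z + ((x * t + y * z) + y * t) := by
      intros; ring
    have p3 : ∀ j (x y : ZMod 2), c j * (x + y) = c j * x + c j * y := fun j x y => mul_add _ _ _
    simp only [regroupExp, p3, p2, p1, Finset.sum_add_distrib]
    ring
  have q2 : regroupExp a F (fun j => c j + ∑ s, b (e ⟨j, s⟩)) d =
      (∑ j, ∑ y : (Σ j, Fin (a j)), if y.1 < j then c j * d (F y) else 0) +
      (∑ j, ∑ y : (Σ j, Fin (a j)), if y.1 < j then (∑ s, b (e ⟨j, s⟩)) * d (F y) else 0) +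
      (∑ y : (Σ j, Fin (a j)), ∑ y' : (Σ j, Fin (a j)),
        if F y < F y' ∧ (y'.1 < y.1 ∨ y'.1 = y.1 ∧ (y'.2 : ℕ) < y.2) then d (F y) * d (F y')
        else 0) := by
    have p1 : ∀ (P : Prop) [Decidable P] (x y : ZMod 2),
        (if P then x + y else 0) = (if P then x else 0) + if P then y else 0 := by
      intro P _ x y; split_ifs <;> simp
    simp only [regroupExp, add_mul, p1, Finset.sum_add_distrib]
  rw [q1, q2, h1]
  have q3 : ∑ j, regroupExp (fun s => l (e ⟨j, s⟩)) (f j) (fun s => b (e ⟨j, s⟩))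
      (fun y => d (F ⟨j, y⟩)) = _ + _ := Finset.sum_add_distrib
  rw [q3, regroupExp]
  linear_combination h2 + h3

end NestedSigns

/-! ### Coassociativity of the cofree coalgebra -/

section Coassociativity

variable {k : Type u} [Field k]

/-- Linear maps on `(⨂ V i) ⊗ X` agree if they do so on tensor products of homogeneous vectors. -/
theorem pi_tmul_ext_deg {n : ℕ} {V : Fin n → GrMod.{u, v} k} {X M : Type*} [AddCommGroup X]
    [Module k X] [AddCommGroup M] [Module k M] {f g : ((⨂[k] i, V i) ⊗[k] X) →ₗ[k] M}
    (h : ∀ (d : Fin n → ℤ) (v : ∀ i, V i), (∀ i, v i ∈ (V i).deg (d i)) →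
      f ∘ₗ TensorProduct.mk k _ X (PiTensorProduct.tprod k v) =
        g ∘ₗ TensorProduct.mk k _ X (PiTensorProduct.tprod k v)) : f = g :=
  TensorProduct.ext (pi_ext_deg h)

theorem regroup_tmul' {m n : ℕ} (V : Fin m → GrMod.{u, v} k) (W : Fin n → GrMod.{u, w} k)
    (r : Fin m → ℕ) (e : (Σ j, Fin (r j)) ≃ Fin n) (c : Fin m → ℤ) (d : Fin n → ℤ)
    (v : ∀ j, V j) (w : ∀ x, W x) (hv : ∀ j, v j ∈ (V j).deg (c j))
    (hw : ∀ x, w x ∈ (W x).deg (d x)) :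
    regroup V W r e (PiTensorProduct.tprod k v ⊗ₜ PiTensorProduct.tprod k w) =
      ks k (regroupExp r e (fun j => (c j : ZMod 2)) fun x => (d x : ZMod 2)) •
      PiTensorProduct.tprod k fun j =>
        v j ⊗ₜ[k] PiTensorProduct.tprod k fun s => w (e ⟨j, s⟩) := by
  rw [regroup_tmul V W r e c d v w hv hw, koszulSign_regroupPos]

variable [CharZero k]

/-- Rearrangements are natural with respect to maps of degree zero. -/
theorem regroup_map {m n : ℕ} {V : Fin m → GrMod.{u, v} k} {V' : Fin m → GrMod.{u, v'} k}
    {W : Fin n → GrMod.{u, w} k} {W' : Fin n → GrMod.{u, w'} k} (r : Fin m → ℕ)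
    (e : (Σ j, Fin (r j)) ≃ Fin n) {f : ∀ j, V j →ₗ[k] V' j} {g : ∀ x, W x →ₗ[k] W' x}
    (hf : ∀ j, IsDeg (V j).deg (V' j).deg (f j) 0) (hg : ∀ x, IsDeg (W x).deg (W' x).deg (g x) 0) :
    regroup V' W' r e ∘ₗ TensorProduct.map (PiTensorProduct.map f) (PiTensorProduct.map g) =
      PiTensorProduct.map (fun j => TensorProduct.map (f j)
        (PiTensorProduct.map fun s => g (e ⟨j, s⟩))) ∘ₗ regroup V W r e := by
  refine tprod_tmul_ext fun c d v w hv hw => ?_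
  have hv' : ∀ j, f j (v j) ∈ (V' j).deg (c j) := fun j => by simpa using hf j _ _ (hv j)
  have hw' : ∀ j, g j (w j) ∈ (W' j).deg (d j) := fun j => by simpa using hg j _ _ (hw j)
  rw [LinearMap.comp_apply, LinearMap.comp_apply, TensorProduct.map_tmul,
    PiTensorProduct.map_tprod, PiTensorProduct.map_tprod, regroup_tmul' _ _ r e c d _ _ hv' hw',
    regroup_tmul' _ _ r e c d _ _ hv hw, LinearMap.map_smul, PiTensorProduct.map_tprod]
  simp only [TensorProduct.map_tmul, PiTensorProduct.map_tprod]

variable (C : Cooperad.{u, v} k)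

/-- The decomposition of `C(n) ⊗ V ⊗ ⋯ ⊗ V` along a labelled two-level tree. -/
def treeMap (V : GrMod.{u, w} k) {m n : ℕ} (r : Fin m → ℕ) (e : (Σ j, Fin (r j)) ≃ Fin n) :
    Ten C V n →ₗ[k] (C.obj m ⊗[k] (⨂[k] j, Ten C V (r j))) :=
  TensorProduct.map LinearMap.id (regroup (fun j => C.obj (r j)) (fun _ : Fin n => V) r e) ∘ₗ
    (TensorProduct.assoc k (C.obj m) (⨂[k] j, C.obj (r j)) (⨂[k] _ : Fin n, V)).toLinearMap ∘ₗ
    TensorProduct.map (C.decomp r e) LinearMap.id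

theorem treeMap_tmul (V : GrMod.{u, w} k) {m n : ℕ} (r : Fin m → ℕ)
    (e : (Σ j, Fin (r j)) ≃ Fin n) (c : C.obj n) (x : ⨂[k] _ : Fin n, V) :
    treeMap C V r e (c ⊗ₜ x) =
      TensorProduct.map LinearMap.id (regroup (fun j => C.obj (r j)) (fun _ : Fin n => V) r e)
        (TensorProduct.assoc k _ _ _ (C.decomp r e c ⊗ₜ x)) := rfl

/-- A term of the comultiplication is the decomposition along a tree, followed by the projections of
the factors to the coinvariants. -/
theorem comulTerm_eq (A : GrMod.{u, w} k) {m n : ℕ} (r : Fin m → ℕ)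
    (e : (Σ j, Fin (r j)) ≃ Fin n) :
    comulTerm C A r e =
      TensorProduct.map LinearMap.id (PiTensorProduct.map fun j => cls C A (r j)) ∘ₗ
        treeMap C A r e := rfl

variable {C}

theorem cls_tmul_mem {A : GrMod.{u, w} k} {n : ℕ} {i : ℤ} {d : Fin n → ℤ} {c : C.obj n}
    {a : Fin n → A} (hc : c ∈ (C.obj n).deg i) (ha : ∀ j, a j ∈ A.deg (d j)) :
    cls C A n (c ⊗ₜ PiTensorProduct.tprod k a) ∈ (cofree C A).deg (i + ∑ j, d j) := by
  have := isDeg_cls C A n (i + ∑ j, d j) _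
    (GrMod.tmul_mem (W := GrMod.pi fun _ => A) hc (GrMod.tprod_mem ha))
  rwa [add_zero] at this

/-- `regroup` for the family of graded vector spaces `X j ⊗ ⨂ s, Y j s`. -/
def regroupTensor {m N : ℕ} {r : Fin m → ℕ} (X : Fin m → GrMod.{u, v} k)
    (Y : ∀ j, Fin (r j) → GrMod.{u, v'} k) (A : GrMod.{u, w} k) (a : Fin m → ℕ)
    (F : (Σ j, Fin (a j)) ≃ Fin N) :
    ((⨂[k] j, (X j ⊗[k] (⨂[k] s, Y j s))) ⊗[k] (⨂[k] _ : Fin N, A)) →ₗ[k]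
      ⨂[k] j, ((X j ⊗[k] (⨂[k] s, Y j s)) ⊗[k] (⨂[k] _ : Fin (a j), A)) :=
  regroup (fun j => (X j).tensor (GrMod.pi (Y j))) (fun _ : Fin N => A) a F

theorem regroupTensor_tmul {m N : ℕ} {r : Fin m → ℕ} (X : Fin m → GrMod.{u, v} k)
    (Y : ∀ j, Fin (r j) → GrMod.{u, v'} k) (A : GrMod.{u, w} k) (a : Fin m → ℕ)
    (F : (Σ j, Fin (a j)) ≃ Fin N) (γ : Fin m → ℤ) (β : ∀ j, Fin (r j) → ℤ) (δ : Fin N → ℤ)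
    (c : ∀ j, X j) (b : ∀ j s, Y j s) (w : Fin N → A) (hc : ∀ j, c j ∈ (X j).deg (γ j))
    (hb : ∀ j s, b j s ∈ (Y j s).deg (β j s)) (hw : ∀ x, w x ∈ A.deg (δ x)) :
    regroupTensor X Y A a F
      ((PiTensorProduct.tprod k fun j => c j ⊗ₜ[k] PiTensorProduct.tprod k (b j)) ⊗ₜ[k]
        PiTensorProduct.tprod k w) =
      ks k (regroupExp a F (fun j => ((γ j + ∑ s, β j s : ℤ) : ZMod 2))
        fun x => (δ x : ZMod 2)) •
      PiTensorProduct.tprod k fun j =>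
        (c j ⊗ₜ[k] PiTensorProduct.tprod k (b j)) ⊗ₜ[k]
          PiTensorProduct.tprod k fun s => w (F ⟨j, s⟩) :=
  regroup_tmul' (fun j => (X j).tensor (GrMod.pi (Y j))) (fun _ : Fin N => A) a F _ δ _ w
    (fun j => GrMod.tmul_mem (W := GrMod.pi (Y j)) (hc j) (GrMod.tprod_mem (hb j))) hw

theorem regroupTensor_map {m N : ℕ} {r : Fin m → ℕ} {V : Fin m → GrMod.{u, w'} k}
    (X : Fin m → GrMod.{u, v} k)
    (Y : ∀ j, Fin (r j) → GrMod.{u, v'} k) (A : GrMod.{u, w} k) (a : Fin m → ℕ)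
    (F : (Σ j, Fin (a j)) ≃ Fin N) {f : ∀ j, V j →ₗ[k] (X j ⊗[k] (⨂[k] s, Y j s))}
    (hf : ∀ j, IsDeg (V j).deg (tensorDeg (X j).deg (piDeg fun s => (Y j s).deg)) (f j) 0) :
    regroupTensor X Y A a F ∘ₗ TensorProduct.map (PiTensorProduct.map f) LinearMap.id =
      PiTensorProduct.map (fun j => TensorProduct.map (f j) LinearMap.id) ∘ₗ
        regroup V (fun _ : Fin N => A) a F := by
  have := regroup_map (V' := fun j => (X j).tensor (GrMod.pi (Y j)))
    (W := fun _ : Fin N => A) (W' := fun _ : Fin N => A) a F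
    (f := f) (g := fun _ => LinearMap.id) hf fun _ => IsDeg.id
  simp only [PiTensorProduct.map_id] at this
  exact this

/-- The compatibility of the two ways of distributing the factors along a three-level tree. -/
theorem regroup_nested (A : GrMod.{u, w} k) {m K N : ℕ} (r : Fin m → ℕ)
    (e : (Σ j, Fin (r j)) ≃ Fin K) (l : Fin K → ℕ) (E : (Σ x, Fin (l x)) ≃ Fin N) (a : Fin m → ℕ)
    (f : ∀ j, (Σ s : Fin (r j), Fin (l (e ⟨j, s⟩))) ≃ Fin (a j)) (F : (Σ j, Fin (a j)) ≃ Fin N)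
    (h : ∀ j s t, E ⟨e ⟨j, s⟩, t⟩ = F ⟨j, f j ⟨s, t⟩⟩) :
    regroup (fun j => C.obj (r j)) (fun _ : Fin K => cofree C A) r e ∘ₗ
      TensorProduct.map LinearMap.id (PiTensorProduct.map (fun x => cls C A (l x)) ∘ₗ
        regroup (fun x => C.obj (l x)) (fun _ : Fin N => A) l E) =
    PiTensorProduct.map (fun j =>
        TensorProduct.map LinearMap.id (PiTensorProduct.map fun s => cls C A (l (e ⟨j, s⟩))) ∘ₗ
        TensorProduct.map LinearMap.id
          (regroup (fun s => C.obj (l (e ⟨j, s⟩))) (fun _ => A) (fun s => l (e ⟨j, s⟩)) (f j)) ∘ₗ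
        (TensorProduct.assoc k (C.obj (r j)) (⨂[k] s, C.obj (l (e ⟨j, s⟩)))
          (⨂[k] _ : Fin (a j), A)).toLinearMap) ∘ₗ
      regroupTensor (fun j => C.obj (r j)) (fun j s => C.obj (l (e ⟨j, s⟩))) A a F ∘ₗ
      TensorProduct.map (regroup (fun j => C.obj (r j)) (fun x => C.obj (l x)) r e)
        LinearMap.id ∘ₗ
      (TensorProduct.assoc k (⨂[k] j, C.obj (r j)) (⨂[k] x, C.obj (l x))
        (⨂[k] _ : Fin N, A)).symm.toLinearMap := by
  refine pi_tmul_ext_deg fun γ c hc => pi_tmul_ext_deg fun β b hb => pi_ext_deg fun δ w hw => ?_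
  simp only [LinearMap.comp_apply, TensorProduct.mk_apply, TensorProduct.map_tmul,
    LinearMap.id_apply, LinearEquiv.coe_coe, TensorProduct.assoc_symm_tmul]
  have hz : ∀ x, cls C A (l x) (b x ⊗ₜ PiTensorProduct.tprod k fun t => w (E ⟨x, t⟩)) ∈
      (cofree C A).deg (β x + ∑ t, δ (E ⟨x, t⟩)) :=
    fun x => cls_tmul_mem (hb x) fun t => hw _
  rw [regroup_tmul' _ _ l E β δ b w hb hw, LinearMap.map_smul, PiTensorProduct.map_tprod,
    TensorProduct.tmul_smul, LinearMap.map_smul,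
    regroup_tmul' (fun j => C.obj (r j)) (fun _ : Fin K => cofree C A) r e γ _ c _ hc hz,
    regroup_tmul' _ _ r e γ β c b hc hb, ← TensorProduct.smul_tmul', LinearMap.map_smul, LinearMap.map_smul]
  rw [regroupTensor_tmul (fun j => C.obj (r j)) (fun j s => C.obj (l (e ⟨j, s⟩))) A a F γ
    (fun j s => β (e ⟨j, s⟩)) δ c (fun j s => b (e ⟨j, s⟩)) w hc (fun j s => hb _) hw,
    LinearMap.map_smul, PiTensorProduct.map_tprod]
  have h2 : ∀ j, (TensorProduct.map LinearMap.id (PiTensorProduct.map fun s =>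
        cls C A (l (e ⟨j, s⟩))) ∘ₗ
      TensorProduct.map LinearMap.id
        (regroup (fun s => C.obj (l (e ⟨j, s⟩))) (fun _ => A) (fun s => l (e ⟨j, s⟩)) (f j)) ∘ₗ
      (TensorProduct.assoc k (C.obj (r j)) (⨂[k] s, C.obj (l (e ⟨j, s⟩)))
          (⨂[k] _ : Fin (a j), A)).toLinearMap)
      ((c j ⊗ₜ[k] (PiTensorProduct.tprod k fun s => b (e ⟨j, s⟩))) ⊗ₜ[k]
        PiTensorProduct.tprod k fun y => w (F ⟨j, y⟩)) =
      ks k (regroupExp (fun s => l (e ⟨j, s⟩)) (f j) (fun s => (β (e ⟨j, s⟩) : ZMod 2))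
        fun y => (δ (F ⟨j, y⟩) : ZMod 2)) • (c j ⊗ₜ[k] PiTensorProduct.tprod k fun s =>
          cls C A (l (e ⟨j, s⟩)) (b (e ⟨j, s⟩) ⊗ₜ PiTensorProduct.tprod k fun t =>
            w (E ⟨e ⟨j, s⟩, t⟩))) := by
    intro j
    simp only [LinearMap.comp_apply, LinearEquiv.coe_coe, TensorProduct.assoc_tmul,
      TensorProduct.map_tmul, LinearMap.id_apply]
    rw [regroup_tmul' (fun s => C.obj (l (e ⟨j, s⟩))) (fun _ => A) _ (f j)
      (fun s => β (e ⟨j, s⟩)) (fun y => δ (F ⟨j, y⟩)) _ _ (fun s => hb _) fun y => hw _,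
      LinearMap.map_smul, PiTensorProduct.map_tprod, TensorProduct.tmul_smul]
    simp only [h]
  refine Eq.trans ?_ (congrArg (fun z => _ • _ • PiTensorProduct.tprod k z) (funext h2)).symm
  rw [MultilinearMap.map_smul_univ, smul_smul, smul_smul, smul_smul, ← ks_sum, ← ks_add, ← ks_add,
    ← ks_add]
  congr 2
  have := regroupExp_nested r e l E a f F h (fun j => (γ j : ZMod 2)) (fun x => (β x : ZMod 2))
    fun y => (δ y : ZMod 2)
  push_cast
  rw [this, add_assoc]

section Abstract

variable {M R X W P Q Z K B B' P' Q' : Type*} [AddCommMonoid M] [Module k M] [AddCommMonoid R]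
  [Module k R] [AddCommMonoid X] [Module k X] [AddCommMonoid W] [Module k W] [AddCommMonoid P]
  [Module k P] [AddCommMonoid Q] [Module k Q] [AddCommMonoid Z] [Module k Z] [AddCommMonoid K]
  [Module k K] [AddCommMonoid B] [Module k B] [AddCommMonoid B'] [Module k B']
  [AddCommMonoid P'] [Module k P'] [AddCommMonoid Q'] [Module k Q']

theorem map_assoc_left (D : K →ₗ[k] M ⊗[k] R) (ρ : (X ⊗[k] W) →ₗ[k] P) (κ : P →ₗ[k] Q)
    (ρ' : (R ⊗[k] Q) →ₗ[k] Z) (σ : K ⊗[k] X) (w : W) :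
    TensorProduct.map LinearMap.id ρ' (TensorProduct.assoc k _ _ _ (TensorProduct.map D
      LinearMap.id (TensorProduct.map LinearMap.id κ (TensorProduct.map LinearMap.id ρ
        (TensorProduct.assoc k _ _ _ (σ ⊗ₜ w)))))) =
    TensorProduct.map LinearMap.id (ρ' ∘ₗ TensorProduct.map LinearMap.id (κ ∘ₗ ρ))
      (TensorProduct.assoc k M _ _ (TensorProduct.assoc k _ _ _
        (TensorProduct.map D LinearMap.id σ ⊗ₜ w))) := by
  induction σ using TensorProduct.induction_on with
  | zero => simp only [TensorProduct.zero_tmul, map_zero]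
  | add x y hx hy => simp only [TensorProduct.add_tmul, map_add, hx, hy]
  | tmul x z =>
    simp only [TensorProduct.assoc_tmul, TensorProduct.map_tmul, LinearMap.id_apply]
    generalize D x = y
    induction y using TensorProduct.induction_on with
    | zero => simp only [TensorProduct.zero_tmul, map_zero]
    | add x y hx hy => simp only [TensorProduct.add_tmul, map_add, hx, hy]
    | tmul x y => simp

theorem map_assoc_right (D : B →ₗ[k] B') (ρ : (B ⊗[k] W) →ₗ[k] P) (φ : P →ₗ[k] Z)
    (ρ' : (B' ⊗[k] W) →ₗ[k] Q) (ψ : Q →ₗ[k] Z)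
    (h : φ ∘ₗ ρ = ψ ∘ₗ ρ' ∘ₗ TensorProduct.map D LinearMap.id) (σ : M ⊗[k] B) (w : W) :
    TensorProduct.map LinearMap.id φ (TensorProduct.map LinearMap.id ρ
      (TensorProduct.assoc k _ _ _ (σ ⊗ₜ w))) =
    TensorProduct.map LinearMap.id (ψ ∘ₗ ρ') (TensorProduct.assoc k _ _ _
      (TensorProduct.map LinearMap.id D σ ⊗ₜ w)) := by
  induction σ using TensorProduct.induction_on with
  | zero => simp only [TensorProduct.zero_tmul, map_zero]
  | add x y hx hy => simp only [TensorProduct.add_tmul, map_add, hx, hy]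
  | tmul x z =>
    have := LinearMap.congr_fun h (z ⊗ₜ w)
    simp only [LinearMap.comp_apply, TensorProduct.map_tmul, LinearMap.id_apply] at this
    simp [this]

theorem map_assoc_middle (ρ : (R ⊗[k] X) →ₗ[k] B') (ρ' : (B' ⊗[k] W) →ₗ[k] Q) (ψ : Q →ₗ[k] Z)
    (τ : (M ⊗[k] R) ⊗[k] X) (w : W) :
    TensorProduct.map LinearMap.id (ψ ∘ₗ ρ' ∘ₗ TensorProduct.map ρ LinearMap.id ∘ₗ
      (TensorProduct.assoc k R X W).symm.toLinearMap)
      (TensorProduct.assoc k M _ _ (TensorProduct.assoc k _ _ _ (τ ⊗ₜ w))) =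
    TensorProduct.map LinearMap.id (ψ ∘ₗ ρ') (TensorProduct.assoc k _ _ _
      (TensorProduct.map LinearMap.id ρ (TensorProduct.assoc k _ _ _ τ) ⊗ₜ w)) := by
  induction τ using TensorProduct.induction_on with
  | zero => simp only [TensorProduct.zero_tmul, map_zero]
  | add x y hx hy => simp only [TensorProduct.add_tmul, map_add, hx, hy]
  | tmul ρ z =>
    induction ρ using TensorProduct.induction_on with
    | zero => simp only [TensorProduct.zero_tmul, map_zero]
    | add x y hx hy => simp only [TensorProduct.add_tmul, map_add, hx, hy]
    | tmul x y => simp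

/-- The formal part of coassociativity: naturality of the associators reduces it to the
coassociativity of the cooperad (`h₃`) and the compatibility of the rearrangements (`h₁`, `h₂`). -/
theorem map_assoc_coassoc {D : K →ₗ[k] M ⊗[k] R} {ρ₁ : (X ⊗[k] W) →ₗ[k] P} {κ : P →ₗ[k] Q}
    {ρ₂ : (R ⊗[k] Q) →ₗ[k] Z} {β : (R ⊗[k] X) →ₗ[k] B'} {ρ₃ : (B' ⊗[k] W) →ₗ[k] Q'}
    {ψ : Q' →ₗ[k] Z} {φ : P' →ₗ[k] Z} {ρ₄ : (B ⊗[k] W) →ₗ[k] P'} {D' : B →ₗ[k] B'}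
    {σ : K ⊗[k] X} {σ' : M ⊗[k] B}
    (h₁ : ρ₂ ∘ₗ TensorProduct.map LinearMap.id (κ ∘ₗ ρ₁) =
      ψ ∘ₗ ρ₃ ∘ₗ TensorProduct.map β LinearMap.id ∘ₗ
        (TensorProduct.assoc k R X W).symm.toLinearMap)
    (h₂ : φ ∘ₗ ρ₄ = ψ ∘ₗ ρ₃ ∘ₗ TensorProduct.map D' LinearMap.id)
    (h₃ : TensorProduct.map LinearMap.id D' σ' = TensorProduct.map LinearMap.id β
      (TensorProduct.assoc k _ _ _ (TensorProduct.map D LinearMap.id σ))) (w : W) :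
    TensorProduct.map LinearMap.id ρ₂ (TensorProduct.assoc k _ _ _ (TensorProduct.map D
      LinearMap.id (TensorProduct.map LinearMap.id κ (TensorProduct.map LinearMap.id ρ₁
        (TensorProduct.assoc k _ _ _ (σ ⊗ₜ w)))))) =
    TensorProduct.map LinearMap.id φ (TensorProduct.map LinearMap.id ρ₄
      (TensorProduct.assoc k _ _ _ (σ' ⊗ₜ w))) := by
  rw [map_assoc_left, h₁, map_assoc_middle, ← h₃, map_assoc_right D' ρ₄ φ ρ₃ ψ h₂]

end Abstract

/-- Coassociativity for a single three-level tree: splitting first at the lower and then at the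
upper vertices, or the other way round. -/
theorem treeMap_comulTerm (A : GrMod.{u, w} k) {m K N : ℕ} (r : Fin m → ℕ)
    (e : (Σ j, Fin (r j)) ≃ Fin K) (l : Fin K → ℕ) (E : (Σ x, Fin (l x)) ≃ Fin N) (a : Fin m → ℕ)
    (f : ∀ j, (Σ s : Fin (r j), Fin (l (e ⟨j, s⟩))) ≃ Fin (a j)) (F : (Σ j, Fin (a j)) ≃ Fin N)
    (h : ∀ j s t, E ⟨e ⟨j, s⟩, t⟩ = F ⟨j, f j ⟨s, t⟩⟩) :
    treeMap C (cofree C A) r e ∘ₗ comulTerm C A l E =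
      TensorProduct.map LinearMap.id
        (PiTensorProduct.map fun j => comulTerm C A (fun s => l (e ⟨j, s⟩)) (f j)) ∘ₗ
        treeMap C A a F := by
  refine TensorProduct.ext' fun c w => ?_
  have key := regroup_nested (C := C) A r e l E a f F h
  have hN := regroupTensor_map (V := fun j => C.obj (a j)) (fun j => C.obj (r j))
    (fun j s => C.obj (l (e ⟨j, s⟩))) A a F
    (f := fun j => C.decomp (fun s => l (e ⟨j, s⟩)) (f j)) fun j => C.decomp_deg _ _
  have hC := LinearMap.congr_fun (C.coassoc r e l E a f F h) c
  have hP : (PiTensorProduct.map fun j => comulTerm C A (fun s => l (e ⟨j, s⟩)) (f j)) =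
      (PiTensorProduct.map (fun j =>
        TensorProduct.map LinearMap.id (PiTensorProduct.map fun s => cls C A (l (e ⟨j, s⟩))) ∘ₗ
        TensorProduct.map LinearMap.id
          (regroup (fun s => C.obj (l (e ⟨j, s⟩))) (fun _ => A) (fun s => l (e ⟨j, s⟩)) (f j)) ∘ₗ
        (TensorProduct.assoc k (C.obj (r j)) (⨂[k] s, C.obj (l (e ⟨j, s⟩)))
          (⨂[k] _ : Fin (a j), A)).toLinearMap)) ∘ₗ
      PiTensorProduct.map (fun j => TensorProduct.map (C.decomp (fun s => l (e ⟨j, s⟩)) (f j))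
        LinearMap.id) := by
    rw [← PiTensorProduct.map_comp]
    rfl
  refine map_assoc_coassoc key ?_ hC w
  rw [hP, LinearMap.comp_assoc, ← hN]

theorem le_of_sigma_equiv {m n : ℕ} {r : Fin m → ℕ} (e : (Σ j, Fin (r j)) ≃ Fin n) (j : Fin m) :
    r j ≤ n := by
  have := Fintype.card_le_of_injective (fun s : Fin (r j) => e ⟨j, s⟩) fun s t h => by
    have := e.injective h
    cases this; rfl
  simpa using this

theorem sum_eq_of_sigma_equiv {m n : ℕ} {r : Fin m → ℕ} (e : (Σ j, Fin (r j)) ≃ Fin n) :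
    ∑ j, r j = n := by
  have := Fintype.card_congr e
  simpa using this

variable (C)

/-- The comultiplication on elements of arity `n`, as a sum over all trees whose upper vertices
have at most `K` inputs. -/
theorem comul_cls (A : GrMod.{u, w} k) (m : ℕ) {n K : ℕ} (hK : n ≤ K) (t : Ten C A n) :
    comul C A m (cls C A n t) = ∑ r : Fin m → Fin (K + 1), (∏ j, ((r j : ℕ).factorial : k))⁻¹ •
      ∑ e : (Σ j, Fin (r j)) ≃ Fin n, comulTerm C A (fun j => r j) e t := by
  rw [comul, cofreeElim_cls, LinearMap.sum_apply]
  refine Fintype.sum_of_injective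
    (fun (r : Fin m → Fin (n + 1)) j => Fin.castLE (by omega) (r j)) ?_ _ _ ?_ ?_
  · intro r r' h
    funext j
    exact Fin.castLE_injective _ (congrFun h j)
  · intro r hr
    have : IsEmpty ((Σ j, Fin (r j)) ≃ Fin n) := by
      refine ⟨fun e => hr ⟨fun j => ⟨r j, ?_⟩, rfl⟩⟩
      have := le_of_sigma_equiv e j
      omega
    rw [Finset.univ_eq_empty (α := (Σ j, Fin (r j)) ≃ Fin n), Finset.sum_empty, smul_zero]
  · intro r
    rw [LinearMap.smul_apply, LinearMap.sum_apply]
    rfl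

theorem cofree_ext {A : GrMod.{u, w} k} {M : Type*} [AddCommGroup M] [Module k M]
    {f g : cofree C A →ₗ[k] M} (h : ∀ n t, f (cls C A n t) = g (cls C A n t)) : f = g := by
  refine LinearMap.ext fun x => ?_
  change CofreeSpace C A at x
  induction x using aux_induction with
  | h0 => exact (map_zero f).trans (map_zero g).symm
  | hadd x y hx hy => exact (map_add f x y).trans ((congrArg₂ _ hx hy).trans (map_add g x y).symm)
  | hcls n t => exact h n t

theorem map_id_sum {ι : Type*} {X Y Z : Type*} [AddCommGroup X] [Module k X] [AddCommGroup Y]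
    [Module k Y] [AddCommGroup Z] [Module k Z] (s : Finset ι) (f : ι → Y →ₗ[k] Z) :
    TensorProduct.map (LinearMap.id : X →ₗ[k] X) (∑ i ∈ s, f i) =
      ∑ i ∈ s, TensorProduct.map LinearMap.id (f i) :=
  map_sum (LinearMap.lTensorHom X) f s

/-- The number of ways of distributing along blocks of given sizes, divided by factorials. -/
theorem sum_card_equiv {m N : ℕ} (b : Fin m → ℕ) (hb : ∀ j, b j ≤ N) {T : Fin m → Type}
    [∀ j, Fintype (T j)] [∀ j, DecidableEq (T j)] (hT : ∀ j, Fintype.card (T j) = b j) :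
    ∑ a : Fin m → Fin (N + 1), ∑ _f : (∀ j, T j ≃ Fin (a j)),
      (∏ j, ((a j : ℕ).factorial : k))⁻¹ = 1 := by
  rw [Finset.sum_eq_single fun j => (⟨b j, Nat.lt_succ_of_le (hb j)⟩ : Fin (N + 1))]
  · rw [Finset.sum_const, Finset.card_univ, Fintype.card_pi, nsmul_eq_mul]
    have : ∀ j, Fintype.card (T j ≃ Fin (b j)) = (b j).factorial := fun j => by
      rw [Fintype.card_equiv (Fintype.equivFinOfCardEq (hT j)), hT]
    simp only [this]
    push_cast
    exact mul_inv_cancel₀ (Finset.prod_ne_zero_iff.2 fun j _ =>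
      Nat.cast_ne_zero.2 (Nat.factorial_ne_zero _))
  · intro a _ ha
    obtain ⟨j, hj⟩ := Function.ne_iff.1 ha
    have : IsEmpty (∀ j, T j ≃ Fin (a j)) := by
      refine ⟨fun f => hj (Fin.ext ?_)⟩
      have := Fintype.card_congr (f j)
      rw [hT, Fintype.card_fin] at this
      exact this.symm
    rw [Finset.univ_eq_empty (α := ∀ j, T j ≃ Fin (a j)), Finset.sum_empty]
  · simp

/-- Coassociativity of the comultiplication of `C(A)`. -/
theorem treeMap_comul (A : GrMod.{u, w} k) {m n : ℕ} (r : Fin m → ℕ)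
    (e : (Σ j, Fin (r j)) ≃ Fin n) :
    treeMap C (cofree C A) r e ∘ₗ comul C A n =
      TensorProduct.map LinearMap.id (PiTensorProduct.map fun j => comul C A (r j)) ∘ₗ
        comul C A m := by
  refine cofree_ext C fun N t => ?_
  rw [LinearMap.comp_apply, LinearMap.comp_apply, comul_cls C A n le_rfl,
    comul_cls C A m le_rfl, map_sum, map_sum]
  -- the inner comultiplications are expanded as sums over labelled trees `(l, f)`
  have hR : ∀ (a : Fin m → Fin (N + 1)) (F : (Σ j, Fin (a j)) ≃ Fin N),
      TensorProduct.map LinearMap.id (PiTensorProduct.map fun j => comul C A (r j))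
        (comulTerm C A (fun j => (a j : ℕ)) F t) =
      ∑ l : Fin n → Fin (N + 1), (∏ x, ((l x : ℕ).factorial : k))⁻¹ •
        ∑ f : (∀ j, (Σ s : Fin (r j), Fin (l (e ⟨j, s⟩))) ≃ Fin (a j)),
          TensorProduct.map LinearMap.id (PiTensorProduct.map fun j =>
            comulTerm C A (fun s => (l (e ⟨j, s⟩) : ℕ)) (f j))
            (treeMap C A (fun j => (a j : ℕ)) F t) := by
    intro a F
    rw [comulTerm_eq, LinearMap.comp_apply, ← LinearMap.comp_apply, ← TensorProduct.map_comp,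
      ← PiTensorProduct.map_comp, LinearMap.id_comp]
    have h1 : ∀ j, comul C A (r j) ∘ₗ cls C A (a j) =
        ∑ l : Fin (r j) → Fin (N + 1), (∏ s, ((l s : ℕ).factorial : k))⁻¹ •
          ∑ f : (Σ s, Fin (l s)) ≃ Fin (a j), comulTerm C A (fun s => (l s : ℕ)) f := by
      intro j
      refine LinearMap.ext fun t => ?_
      rw [LinearMap.comp_apply, comul_cls C A (r j) (Nat.le_of_lt_succ (a j).2)]
      simp only [LinearMap.sum_apply, LinearMap.smul_apply]
    have h2 : (PiTensorProduct.map fun j => comul C A (r j) ∘ₗ cls C A (a j)) =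
        ∑ l : (∀ j, Fin (r j) → Fin (N + 1)), (∏ j, (∏ s, ((l j s : ℕ).factorial : k))⁻¹) •
          ∑ f : (∀ j, (Σ s, Fin (l j s)) ≃ Fin (a j)), PiTensorProduct.map fun j =>
            comulTerm C A (fun s => (l j s : ℕ)) (f j) := by
      simp only [h1, ← PiTensorProduct.mapMultilinear_apply]
      rw [MultilinearMap.map_sum]
      refine Finset.sum_congr rfl fun l _ => ?_
      rw [MultilinearMap.map_smul_univ, MultilinearMap.map_sum]
    let φ : (Fin n → Fin (N + 1)) ≃ (∀ j, Fin (r j) → Fin (N + 1)) :=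
      (Equiv.arrowCongr e.symm (Equiv.refl _)).trans (Equiv.piCurry fun _ _ => Fin (N + 1))
    rw [h2, ← φ.sum_comp, map_id_sum, LinearMap.sum_apply]
    refine Finset.sum_congr rfl fun l _ => ?_
    rw [TensorProduct.map_smul_right, LinearMap.smul_apply, map_id_sum, LinearMap.sum_apply]
    have h3 : ∏ j, (∏ s, ((φ l j s : ℕ).factorial : k))⁻¹ =
        (∏ x, ((l x : ℕ).factorial : k))⁻¹ := by
      rw [← e.prod_comp, Finset.prod_inv_distrib, Fintype.prod_sigma]
      rfl
    rw [h3]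
    rfl
  -- for fixed `l` and `f`, the labellings `F` of the blocks and `E` of the inputs correspond
  have hR2 : ∀ a : Fin m → Fin (N + 1),
      TensorProduct.map LinearMap.id (PiTensorProduct.map fun j => comul C A (r j))
        ((∏ j, ((a j : ℕ).factorial : k))⁻¹ •
          ∑ F : (Σ j, Fin (a j)) ≃ Fin N, comulTerm C A (fun j => (a j : ℕ)) F t) =
      ∑ l : Fin n → Fin (N + 1), ∑ f : (∀ j, (Σ s : Fin (r j), Fin (l (e ⟨j, s⟩))) ≃ Fin (a j)),
        (∏ j, ((a j : ℕ).factorial : k))⁻¹ • (∏ x, ((l x : ℕ).factorial : k))⁻¹ •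
          ∑ E : (Σ x, Fin (l x)) ≃ Fin N, treeMap C (cofree C A) r e (comulTerm C A (fun x => (l x : ℕ)) E t) := by
    intro a
    rw [LinearMap.map_smul, map_sum]
    simp only [hR]
    rw [Finset.sum_comm, Finset.smul_sum]
    refine Finset.sum_congr rfl fun l _ => ?_
    rw [← Finset.smul_sum, Finset.sum_comm, Finset.smul_sum, Finset.smul_sum]
    refine Finset.sum_congr rfl fun f _ => ?_
    congr 2
    let φ : (Σ x, Fin (l x)) ≃ (Σ j, Fin (a j)) :=
      (Equiv.sigmaCongrLeft (β := fun x => Fin (l x)) e).symm.trans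
        ((Equiv.sigmaAssoc fun j s => Fin (l (e ⟨j, s⟩))).trans (Equiv.sigmaCongrRight f))
    have hφ : ∀ j s t, φ ⟨e ⟨j, s⟩, t⟩ = ⟨j, f j ⟨s, t⟩⟩ := by
      intro j s t
      have : (Equiv.sigmaCongrLeft (β := fun x => Fin (l x)) e).symm ⟨e ⟨j, s⟩, t⟩ =
          ⟨⟨j, s⟩, t⟩ := by
        rw [Equiv.symm_apply_eq]; rfl
      simp only [φ, Equiv.trans_apply, this]
      rfl
    refine Fintype.sum_equiv (Equiv.equivCongr φ.symm (Equiv.refl _)) _ _ fun F => ?_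
    have := LinearMap.congr_fun (treeMap_comulTerm (C := C) A r e (fun x => (l x : ℕ))
      (Equiv.equivCongr φ.symm (Equiv.refl _) F) (fun j => (a j : ℕ)) f F fun j s t => by
        simp [Equiv.equivCongr, hφ]) t
    exact this.symm
  -- the number of pairs `(a, f)` for a fixed `l` cancels the factorials of `a`
  simp only [hR2]
  rw [Finset.sum_comm]
  refine Finset.sum_congr rfl fun l _ => ?_
  simp only [← Finset.sum_smul]
  by_cases hE : Nonempty ((Σ x, Fin (l x)) ≃ Fin N)
  · obtain ⟨E⟩ := hE
    have hs := sum_eq_of_sigma_equiv E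
    rw [sum_card_equiv (k := k) (fun j => ∑ s, (l (e ⟨j, s⟩) : ℕ)), one_smul, LinearMap.map_smul, map_sum]
    · intro j
      refine le_trans ?_ hs.le
      rw [← e.sum_comp, Fintype.sum_sigma]
      exact Finset.single_le_sum (f := fun j => ∑ s, (l (e ⟨j, s⟩) : ℕ)) (fun _ _ => Nat.zero_le _)
        (Finset.mem_univ j)
    · intro j
      simp
  · rw [not_nonempty_iff] at hE
    rw [Finset.univ_eq_empty (α := (Σ x, Fin (l x)) ≃ Fin N), Finset.sum_empty, Finset.sum_empty,
      smul_zero, smul_zero, map_zero, smul_zero]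

end Coassociativity

/-! ### Rearrangements and homogeneous maps -/

section SignExponent

/-- Inversions for the block order and for the order of the labels `x` differ, modulo two, by the
pairs that are ordered by the labels and those that are ordered lexicographically. -/
theorem block_pair (j j' s s' x x' : ℕ) (h : x = x' ↔ j = j' ∧ s = s') (z : ZMod 2) :
    (if x < x' ∧ (j' < j ∨ j' = j ∧ s' < s) then z else 0) +
      (if x' < x ∧ (j < j' ∨ j = j' ∧ s < s') then z else 0) + (if x < x' then z else 0) =
    (if j < j' then z else 0) + if j = j' ∧ s < s' then z else 0 := by
  rcases zmod2_cases z with rfl | rfl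
  · simp
  · split_ifs <;> first | rfl | (exfalso; omega)

/-- The signs in the naturality of `regroup` with respect to homogeneous maps of parities `p`. -/
theorem regroupExp_add {m n : ℕ} (r : Fin m → ℕ) (e : (Σ j, Fin (r j)) ≃ Fin n)
    (c : Fin m → ZMod 2) (d p : Fin n → ZMod 2) :
    regroupExp r e c (fun x => d x + p x) + (∑ x, p x) * (∑ j, c j) +
        ∑ x, ∑ y, (if x < y then d x * p y else 0) =
      regroupExp r e 0 p + regroupExp r e c d +
        (∑ j, ∑ j', (if j < j' then (c j + ∑ s, d (e ⟨j, s⟩)) * ∑ s, p (e ⟨j', s⟩) else 0) +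
        ∑ j, ((∑ s, p (e ⟨j, s⟩)) * c j +
          ∑ s, ∑ s', if s < s' then d (e ⟨j, s⟩) * p (e ⟨j, s'⟩) else 0)) := by
  -- the terms with `c` and `p`
  have hA : ∑ j, ∑ i : (Σ j, Fin (r j)), (if i.1 < j then c j * (d (e i) + p (e i)) else 0) +
      (∑ x, p x) * (∑ j, c j) =
      ∑ j, ∑ i : (Σ j, Fin (r j)), (if i.1 < j then c j * d (e i) else 0) +
        ∑ j, ∑ i : (Σ j, Fin (r j)), (if j < i.1 then c j * p (e i) else 0) +
        ∑ j, (∑ s, p (e ⟨j, s⟩)) * c j := by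
    have h1 : ∑ j, (∑ s, p (e ⟨j, s⟩)) * c j =
        ∑ j, ∑ i : (Σ j, Fin (r j)), if j = i.1 then c j * p (e i) else 0 := by
      refine Finset.sum_congr rfl fun j _ => ?_
      rw [Fintype.sum_sigma, Finset.sum_eq_single j, Finset.sum_mul]
      · exact Finset.sum_congr rfl fun s _ => by simp [mul_comm]
      · intro j' _ hj
        exact Finset.sum_eq_zero fun s _ => if_neg fun h => hj h.symm
      · simp
    rw [h1, ← e.sum_comp, mul_comm, Finset.sum_mul_sum]
    simp only [← Finset.sum_add_distrib]
    refine Finset.sum_congr rfl fun j _ => Finset.sum_congr rfl fun i _ => ?_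
    rcases lt_trichotomy i.1 j with h | h | h
    · simp only [h, if_true, h.not_gt, if_false, h.ne', mul_add]
      have := CharTwo.add_self_eq_zero (c j * p (e i))
      linear_combination this
    · simp [h]
    · simp [h, h.not_gt, h.ne]
  -- the terms that come from different blocks
  have hC : ∑ j, ∑ j', (if j < j' then (c j + ∑ s, d (e ⟨j, s⟩)) * ∑ s, p (e ⟨j', s⟩) else 0) =
      ∑ j, ∑ i : (Σ j, Fin (r j)), (if j < i.1 then c j * p (e i) else 0) +
        ∑ i : (Σ j, Fin (r j)), ∑ i' : (Σ j, Fin (r j)),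
          if i.1 < i'.1 then d (e i) * p (e i') else 0 := by
    rw [Fintype.sum_sigma (fun i : (Σ j, Fin (r j)) => ∑ i' : (Σ j, Fin (r j)),
      if i.1 < i'.1 then d (e i) * p (e i') else 0), ← Finset.sum_add_distrib]
    refine Finset.sum_congr rfl fun j _ => ?_
    rw [Finset.sum_comm (γ := Fin (r j)), Fintype.sum_sigma, Fintype.sum_sigma,
      ← Finset.sum_add_distrib]
    refine Finset.sum_congr rfl fun j' _ => ?_
    split_ifs with h
    · simp only [add_mul, Finset.mul_sum, Finset.sum_mul, ← Finset.sum_add_distrib]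
    · simp
  -- the terms that come from a single block
  have hD : ∑ j, ∑ s, ∑ s', (if s < s' then d (e ⟨j, s⟩) * p (e ⟨j, s'⟩) else 0) =
      ∑ i : (Σ j, Fin (r j)), ∑ i' : (Σ j, Fin (r j)),
        if (i.1 : ℕ) = i'.1 ∧ (i.2 : ℕ) < i'.2 then d (e i) * p (e i') else 0 := by
    rw [sum_sum_sigma_diag]
    · simp only [true_and, Fin.lt_def]
    · exact fun i i' h => if_neg fun h' => h (Fin.ext h'.1.symm)
  -- the terms with `d` and `p`, for pairs of inputs
  have hB : ∑ i : (Σ j, Fin (r j)), ∑ i' : (Σ j, Fin (r j)),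
        (if e i < e i' ∧ (i'.1 < i.1 ∨ i'.1 = i.1 ∧ (i'.2 : ℕ) < i.2) then
          (d (e i) + p (e i)) * (d (e i') + p (e i')) else 0) +
        ∑ x, ∑ y, (if x < y then d x * p y else 0) =
      ∑ i : (Σ j, Fin (r j)), ∑ i' : (Σ j, Fin (r j)),
        (if e i < e i' ∧ (i'.1 < i.1 ∨ i'.1 = i.1 ∧ (i'.2 : ℕ) < i.2) then
          p (e i) * p (e i') else 0) +
      ∑ i : (Σ j, Fin (r j)), ∑ i' : (Σ j, Fin (r j)),
        (if e i < e i' ∧ (i'.1 < i.1 ∨ i'.1 = i.1 ∧ (i'.2 : ℕ) < i.2) then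
          d (e i) * d (e i') else 0) +
      (∑ i : (Σ j, Fin (r j)), ∑ i' : (Σ j, Fin (r j)),
          (if i.1 < i'.1 then d (e i) * p (e i') else 0) +
        ∑ i : (Σ j, Fin (r j)), ∑ i' : (Σ j, Fin (r j)),
        if (i.1 : ℕ) = i'.1 ∧ (i.2 : ℕ) < i'.2 then d (e i) * p (e i') else 0) := by
    have h1 : ∑ x, ∑ y, (if x < y then d x * p y else 0) =
        ∑ i : (Σ j, Fin (r j)), ∑ i' : (Σ j, Fin (r j)),
          if e i < e i' then d (e i) * p (e i') else 0 := by
      rw [← e.sum_comp]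
      exact Finset.sum_congr rfl fun i _ => (e.sum_comp _).symm
    have h2 : ∑ i : (Σ j, Fin (r j)), ∑ i' : (Σ j, Fin (r j)),
        (if e i < e i' ∧ (i'.1 < i.1 ∨ i'.1 = i.1 ∧ (i'.2 : ℕ) < i.2) then
          (d (e i) + p (e i)) * (d (e i') + p (e i')) else 0) =
        ∑ i : (Σ j, Fin (r j)), ∑ i' : (Σ j, Fin (r j)),
        (if e i < e i' ∧ (i'.1 < i.1 ∨ i'.1 = i.1 ∧ (i'.2 : ℕ) < i.2) then
          p (e i) * p (e i') else 0) +
        ∑ i : (Σ j, Fin (r j)), ∑ i' : (Σ j, Fin (r j)),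
        (if e i < e i' ∧ (i'.1 < i.1 ∨ i'.1 = i.1 ∧ (i'.2 : ℕ) < i.2) then
          d (e i) * d (e i') else 0) +
        (∑ i : (Σ j, Fin (r j)), ∑ i' : (Σ j, Fin (r j)),
        (if e i < e i' ∧ (i'.1 < i.1 ∨ i'.1 = i.1 ∧ (i'.2 : ℕ) < i.2) then
          d (e i) * p (e i') else 0) +
        ∑ i : (Σ j, Fin (r j)), ∑ i' : (Σ j, Fin (r j)),
        (if e i' < e i ∧ (i.1 < i'.1 ∨ i.1 = i'.1 ∧ (i.2 : ℕ) < i'.2) then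
          d (e i) * p (e i') else 0)) := by
      rw [Finset.sum_comm (f := fun i i' : (Σ j, Fin (r j)) =>
        if e i' < e i ∧ (i.1 < i'.1 ∨ i.1 = i'.1 ∧ (i.2 : ℕ) < i'.2) then
          d (e i) * p (e i') else 0)]
      simp only [← Finset.sum_add_distrib]
      refine Finset.sum_congr rfl fun i _ => Finset.sum_congr rfl fun i' _ => ?_
      split_ifs <;> ring
    rw [h1, h2, add_assoc (_ + _)]
    congr 1
    simp only [← Finset.sum_add_distrib]
    refine Finset.sum_congr rfl fun i _ => Finset.sum_congr rfl fun i' _ => ?_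
    have hinj : ((e i : Fin n) : ℕ) = (e i' : Fin n) ↔
        (i.1 : ℕ) = i'.1 ∧ (i.2 : ℕ) = i'.2 := by
      rw [← Fin.ext_iff, e.apply_eq_iff_eq]
      constructor
      · rintro rfl; exact ⟨rfl, rfl⟩
      · obtain ⟨a, s⟩ := i
        obtain ⟨b, t⟩ := i'
        rintro ⟨h, h'⟩
        obtain rfl := Fin.ext h
        obtain rfl := Fin.ext h'
        rfl
    have := block_pair i.1 i'.1 i.2 i'.2 (e i : Fin n) (e i' : Fin n) hinj (d (e i) * p (e i'))
    simpa only [Fin.lt_def, Fin.ext_iff] using this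
  have hcongr : regroupExp r e c (fun x => d x + p x) =
      ∑ j, ∑ i : (Σ j, Fin (r j)), (if i.1 < j then c j * (d (e i) + p (e i)) else 0) +
      ∑ i : (Σ j, Fin (r j)), ∑ i' : (Σ j, Fin (r j)),
        (if e i < e i' ∧ (i'.1 < i.1 ∨ i'.1 = i.1 ∧ (i'.2 : ℕ) < i.2) then
          (d (e i) + p (e i)) * (d (e i') + p (e i')) else 0) := rfl
  have h0 : ∑ j : Fin m, ∑ i : (Σ j, Fin (r j)),
      (if i.1 < j then (0 : Fin m → ZMod 2) j * p (e i) else 0) = 0 := by simp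
  rw [hcongr, Finset.sum_add_distrib, hC, hD]
  unfold regroupExp
  rw [h0]
  linear_combination hA + hB

end SignExponent

section Naturality

variable {k : Type u} [Field k] [CharZero k]

theorem GrMod.tensor_sgn (V : GrMod.{u, v} k) (W : GrMod.{u, w} k) (q : ZMod 2) :
    (V.tensor W).sgn q = TensorProduct.map (V.sgn q) (W.sgn q) := by
  refine (V.tensor W).ext_deg fun D x hx => ?_
  induction hx using Submodule.span_induction with
  | zero => rw [LinearMap.map_zero, LinearMap.map_zero]
  | add x y _ _ hx hy => rw [LinearMap.map_add, LinearMap.map_add, hx, hy]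
  | smul c x _ hx => rw [LinearMap.map_smul, LinearMap.map_smul, hx]
  | mem x hx =>
    obtain ⟨i, j, x, y, hx, hy, rfl, rfl⟩ := hx
    rw [GrMod.sgn_of_mem _ q (GrMod.tmul_mem hx hy), TensorProduct.map_tmul, V.sgn_of_mem q hx,
      W.sgn_of_mem q hy, TensorProduct.smul_tmul_smul, ← ks_add]
    push_cast
    rw [mul_add]

theorem GrMod.pi_sgn {n : ℕ} (V : Fin n → GrMod.{u, v} k) (q : ZMod 2) :
    (GrMod.pi V).sgn q = PiTensorProduct.map fun i => (V i).sgn q := by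
  refine pi_ext_deg fun d v hv => ?_
  rw [GrMod.sgn_of_mem _ q (GrMod.tprod_mem hv), PiTensorProduct.map_tprod]
  simp only [(V _).sgn_of_mem q (hv _)]
  rw [MultilinearMap.map_smul_univ, ← ks_sum]
  push_cast
  rw [Finset.mul_sum]

variable (C : Cooperad.{u, v} k)

/-- The graded vector space `C(n) ⊗ V ⊗ ⋯ ⊗ V`. -/
abbrev tenMod (V : GrMod.{u, w} k) (n : ℕ) : GrMod.{u, max u v w} k :=
  (C.obj n).tensor (GrMod.pi fun _ : Fin n => V)

variable {C}

/-- The operator `hmap` for the family of graded vector spaces `C(r j) ⊗ V ⊗ ⋯ ⊗ V`. -/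
def hmapTen (M : GrMod.{u, v'} k) (V : GrMod.{u, w} k) (W : GrMod.{u, w'} k) {m : ℕ}
    (r : Fin m → ℕ) (p : Fin m → ZMod 2) (g : ∀ j, Ten C V (r j) →ₗ[k] Ten C W (r j)) :
    (M ⊗[k] (⨂[k] j, Ten C V (r j))) →ₗ[k] (M ⊗[k] (⨂[k] j, Ten C W (r j))) :=
  TensorProduct.map (M.sgn (∑ j, p j)) (PiTensorProduct.map fun j => g j ∘ₗ
    TensorProduct.map ((C.obj (r j)).sgn (∑ i with j < i, p i))
      (PiTensorProduct.map fun _ => V.sgn (∑ i with j < i, p i)))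

theorem hmap_eq_hmapTen (M : GrMod.{u, v'} k) {V : GrMod.{u, w} k} {W : GrMod.{u, w'} k}
    {A : GrMod.{u, v''} k} {B : GrMod.{u, w''} k} {m : ℕ}
    (r : Fin m → ℕ) (p : Fin m → ZMod 2) (g : ∀ j, Ten C V (r j) →ₗ[k] Ten C W (r j))
    {b : ∀ j, A →ₗ[k] Ten C V (r j)} (hb : ∀ j, IsDeg A.deg (tenDeg C V (r j)) (b j) 0)
    (a : ∀ j, Ten C W (r j) →ₗ[k] B) :
    TensorProduct.map LinearMap.id (PiTensorProduct.map a) ∘ₗ hmapTen M V W r p g ∘ₗ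
      TensorProduct.map LinearMap.id (PiTensorProduct.map b) =
    hmap M (fun _ => A) (fun _ => B) p fun j => a j ∘ₗ g j ∘ₗ b j := by
  rw [hmapTen, hmap, ← TensorProduct.map_comp, ← TensorProduct.map_comp, LinearMap.id_comp,
    LinearMap.comp_id, ← PiTensorProduct.map_comp, ← PiTensorProduct.map_comp]
  congr 2
  funext j
  have h := GrMod.sgn_comp_of_isDeg (W := tenMod C V (r j)) (hb j) (∑ i with j < i, p i)
  rw [GrMod.tensor_sgn, GrMod.pi_sgn, Int.cast_zero, mul_zero, ks_zero, one_smul] at h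
  simp only [LinearMap.comp_assoc]
  rw [h]

/-- Rearrangements commute with the operators `1 ⊗ f 0 ⊗ ⋯ ⊗ f (n - 1)` up to sign. -/
theorem regroup_hmap {m n : ℕ} (r : Fin m → ℕ) (e : (Σ j, Fin (r j)) ≃ Fin n)
    (V : GrMod.{u, w} k) (W : GrMod.{u, w'} k)
    {f : Fin n → V →ₗ[k] W} {p : Fin n → ℤ} (hf : ∀ x, IsDeg V.deg W.deg (f x) (p x)) :
    regroup (fun j => C.obj (r j)) (fun _ => W) r e ∘ₗ
      TensorProduct.map (PiTensorProduct.map fun j => (C.obj (r j)).sgn (∑ x, (p x : ZMod 2)))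
        (PiTensorProduct.map fun x => f x ∘ₗ V.sgn (∑ y with x < y, (p y : ZMod 2))) =
    ks k (regroupExp r e 0 fun x => (p x : ZMod 2)) •
      (PiTensorProduct.map fun j =>
        hmap (C.obj (r j)) (fun _ => V) (fun _ => W) (fun s => (p (e ⟨j, s⟩) : ZMod 2))
          (fun s => f (e ⟨j, s⟩)) ∘ₗ
        TensorProduct.map ((C.obj (r j)).sgn (∑ i with j < i, ∑ s, (p (e ⟨i, s⟩) : ZMod 2)))
          (PiTensorProduct.map fun _ => V.sgn (∑ i with j < i, ∑ s, (p (e ⟨i, s⟩) : ZMod 2)))) ∘ₗ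
      regroup (fun j => C.obj (r j)) (fun _ => V) r e := by
  refine tprod_tmul_ext fun c d b v hb hv => ?_
  rw [LinearMap.smul_apply, LinearMap.comp_apply, LinearMap.comp_apply, TensorProduct.map_tmul,
    PiTensorProduct.map_tprod, PiTensorProduct.map_tprod,
    regroup_tmul' (fun j => C.obj (r j)) (fun _ => V) r e c d b v hb hv, LinearMap.map_smul,
    PiTensorProduct.map_tprod]
  simp only [LinearMap.comp_apply, (C.obj (r _)).sgn_of_mem _ (hb _), V.sgn_of_mem _ (hv _),
    LinearMap.map_smul, TensorProduct.map_tmul, PiTensorProduct.map_tprod,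
    MultilinearMap.map_smul_univ, TensorProduct.smul_tmul_smul]
  have hfv : ∀ x, f x (v x) ∈ W.deg (d x + p x) := fun x => hf x _ _ (hv x)
  have h1 : ∀ j, hmap (C.obj (r j)) (fun _ => V) (fun _ => W)
      (fun s => (p (e ⟨j, s⟩) : ZMod 2)) (fun s => f (e ⟨j, s⟩))
      (b j ⊗ₜ PiTensorProduct.tprod k fun s => v (e ⟨j, s⟩)) = _ := fun j =>
    hmap_tmul (C.obj (r j)) (fun _ => V) (fun _ => W)
      (fun s => (p (e ⟨j, s⟩) : ZMod 2)) (fun s => f (e ⟨j, s⟩)) (hb j)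
      (d := fun s => d (e ⟨j, s⟩)) fun s => hv _
  simp only [h1, MultilinearMap.map_smul_univ]
  rw [regroup_tmul' (fun j => C.obj (r j)) (fun _ => W) r e c (fun x => d x + p x) b
    (fun x => f x (v x)) hb hfv]
  simp only [smul_smul, ← ks_sum, ← ks_add, ← Finset.mul_sum]
  congr 2
  have := regroupExp_add r e (fun j => (c j : ZMod 2)) (fun x => (d x : ZMod 2))
    fun x => (p x : ZMod 2)
  push_cast
  have h2 : ∑ x, (∑ y with x < y, (p y : ZMod 2)) * d x =
      ∑ x, ∑ y, if x < y then (d x : ZMod 2) * p y else 0 := by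
    refine Finset.sum_congr rfl fun x _ => ?_
    rw [Finset.sum_filter, Finset.sum_mul]
    exact Finset.sum_congr rfl fun y _ => by split_ifs <;> ring
  have h3 : ∑ j, ((∑ i with j < i, ∑ s, (p (e ⟨i, s⟩) : ZMod 2)) * c j +
      (∑ i with j < i, ∑ s, (p (e ⟨i, s⟩) : ZMod 2)) * ∑ s, (d (e ⟨j, s⟩) : ZMod 2)) =
      ∑ j, ∑ j', if j < j' then ((c j : ZMod 2) + ∑ s, (d (e ⟨j, s⟩) : ZMod 2)) *
        ∑ s, (p (e ⟨j', s⟩) : ZMod 2) else 0 := by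
    refine Finset.sum_congr rfl fun j _ => ?_
    rw [← mul_add, Finset.sum_filter, Finset.sum_mul]
    exact Finset.sum_congr rfl fun y _ => by split_ifs <;> ring
  rw [h2, h3]
  linear_combination this

theorem map_assoc_natural {M R W W' Z : Type*} [AddCommMonoid M] [Module k M] [AddCommMonoid R]
    [Module k R] [AddCommMonoid W] [Module k W] [AddCommMonoid W'] [Module k W'] [AddCommMonoid Z]
    [Module k Z] (S : M →ₗ[k] M) (S' : R →ₗ[k] R) (F : W →ₗ[k] W') (ρ : (R ⊗[k] W') →ₗ[k] Z)
    (σ : M ⊗[k] R) (w : W) :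
    TensorProduct.map LinearMap.id ρ (TensorProduct.assoc k _ _ _
      (TensorProduct.map S S' σ ⊗ₜ F w)) =
    TensorProduct.map S (ρ ∘ₗ TensorProduct.map S' F) (TensorProduct.assoc k _ _ _ (σ ⊗ₜ w)) := by
  induction σ using TensorProduct.induction_on with
  | zero => simp only [TensorProduct.zero_tmul, map_zero]
  | add x y hx hy => simp only [TensorProduct.add_tmul, map_add, hx, hy]
  | tmul x z => simp

/-- The decomposition maps of a cooperad have degree zero, in terms of the sign operators. -/
theorem decomp_sgn {m n : ℕ} (r : Fin m → ℕ) (e : (Σ j, Fin (r j)) ≃ Fin n) (q : ZMod 2)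
    (c : C.obj n) : C.decomp r e ((C.obj n).sgn q c) =
      TensorProduct.map ((C.obj m).sgn q) (PiTensorProduct.map fun j => (C.obj (r j)).sgn q)
        (C.decomp r e c) := by
  have h := GrMod.sgn_comp_of_isDeg (W := (C.obj m).tensor (GrMod.pi fun j => C.obj (r j)))
    (C.decomp_deg r e) q
  rw [GrMod.tensor_sgn, GrMod.pi_sgn, Int.cast_zero, mul_zero, ks_zero, one_smul] at h
  exact (LinearMap.congr_fun h c).symm

theorem map_smul_map {M R Z Z' : Type*} [AddCommMonoid M] [Module k M] [AddCommMonoid R]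
    [Module k R] [AddCommMonoid Z] [Module k Z] [AddCommMonoid Z'] [Module k Z']
    (S : M →ₗ[k] M) (G : Z →ₗ[k] Z') (ρ : R →ₗ[k] Z) (a : k) (z : M ⊗[k] R) :
    TensorProduct.map S (a • G ∘ₗ ρ) z =
      a • TensorProduct.map S G (TensorProduct.map LinearMap.id ρ z) := by
  rw [TensorProduct.map_smul_right, LinearMap.smul_apply, ← LinearMap.comp_apply,
    ← TensorProduct.map_comp, LinearMap.comp_id]

/-- The decomposition along a tree commutes with the operators `1 ⊗ f 0 ⊗ ⋯ ⊗ f (n - 1)` up to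
sign. -/
theorem treeMap_hmap {m n : ℕ} (r : Fin m → ℕ) (e : (Σ j, Fin (r j)) ≃ Fin n)
    (V : GrMod.{u, w} k) (W : GrMod.{u, w'} k)
    {f : Fin n → V →ₗ[k] W} {p : Fin n → ℤ} (hf : ∀ x, IsDeg V.deg W.deg (f x) (p x)) :
    treeMap C W r e ∘ₗ hmap (C.obj n) (fun _ => V) (fun _ => W) (fun x => (p x : ZMod 2)) f =
    ks k (regroupExp r e 0 fun x => (p x : ZMod 2)) •
      hmapTen (C.obj m) V W r (fun j => ∑ s, (p (e ⟨j, s⟩) : ZMod 2))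
        (fun j => hmap (C.obj (r j)) (fun _ => V) (fun _ => W)
          (fun s => (p (e ⟨j, s⟩) : ZMod 2)) fun s => f (e ⟨j, s⟩)) ∘ₗ
      treeMap C V r e := by
  refine TensorProduct.ext' fun c x => ?_
  have hp : ∑ j, ∑ s, (p (e ⟨j, s⟩) : ZMod 2) = ∑ x, (p x : ZMod 2) := by
    rw [← e.sum_comp, Fintype.sum_sigma]
  rw [LinearMap.comp_apply, hmap, TensorProduct.map_tmul, treeMap_tmul, decomp_sgn,
    map_assoc_natural, regroup_hmap r e V W hf, map_smul_map, LinearMap.smul_apply,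
    LinearMap.comp_apply, treeMap_tmul, hmapTen, hp]

end Naturality

/-! ### Convolution of maps to cogenerators -/

section Convolution

variable {k : Type u} [Field k] [CharZero k] {C : Cooperad.{u, v} k}

/-- The multilinear map `f ↦ g ∘ T f ∘ h`. -/
def sandwich {ι : Type} {X : ι → Type*} {U V W Z : Type*} [∀ i, AddCommMonoid (X i)]
    [∀ i, Module k (X i)] [AddCommMonoid U] [Module k U] [AddCommMonoid V] [Module k V]
    [AddCommMonoid W] [Module k W] [AddCommMonoid Z] [Module k Z] (g : W →ₗ[k] Z)
    (T : MultilinearMap k X (V →ₗ[k] W)) (h : U →ₗ[k] V) : MultilinearMap k X (U →ₗ[k] Z) :=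
  (LinearMap.lcomp k Z h ∘ₗ LinearMap.llcomp k _ _ _ g).compMultilinearMap T

variable (C) in
/-- The operator `(1 ⊗ f 0 ⊗ ⋯ ⊗ f (n - 1)) Δ n` from `C(A)` to `C(B)`, for maps
`f i : C(A) → B`. -/
def conv (A : GrMod.{u, w} k) (B : GrMod.{u, w'} k) (n : ℕ) :
    MultilinearMap k (fun _ : Fin n => cofree C A →ₗ[k] B) (cofree C A →ₗ[k] cofree C B) :=
  sandwich (cls C B n) (tensorMap (C.obj n) (cofree C A) B n) (comul C A n)

variable {A : GrMod.{u, w} k} {B : GrMod.{u, w'} k}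

theorem conv_apply {n : ℕ} (f : Fin n → cofree C A →ₗ[k] B) :
    conv C A B n f = cls C B n ∘ₗ tensorMap (C.obj n) (cofree C A) B n f ∘ₗ comul C A n := rfl

theorem isDeg_conv {n : ℕ} {f : Fin n → cofree C A →ₗ[k] B} {p : Fin n → ℤ}
    (hf : ∀ i, IsDeg (cofree C A).deg B.deg (f i) (p i)) :
    IsDeg (cofree C A).deg (cofree C B).deg (conv C A B n f) (∑ i, p i) := by
  rw [conv_apply]
  exact (isDeg_cls C B n).comp ((isDeg_tensorMap (C.obj n) (cofree C A) B n f p hf).comp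
    (isDeg_comul C A n) (zero_add _)) (add_zero _)

/-- Composition of two commutation relations, evaluated at a vector. -/
theorem apply_eq_smul_of_comp_eq {X X₁ X₂ X₃ X₄ X₅ Z : Type*} [AddCommMonoid X] [Module k X]
    [AddCommMonoid X₁] [Module k X₁] [AddCommMonoid X₂] [Module k X₂] [AddCommMonoid X₃]
    [Module k X₃] [AddCommMonoid X₄] [Module k X₄] [AddCommMonoid X₅] [Module k X₅]
    [AddCommMonoid Z] [Module k Z] {T : X₂ →ₗ[k] X₃} {H : X₁ →ₗ[k] X₂} {a : k}
    {G : X₄ →ₗ[k] X₃} {T' : X₁ →ₗ[k] X₄} {δ : X →ₗ[k] X₁} {S : X₅ →ₗ[k] X₄} {δ' : X →ₗ[k] X₅}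
    (h : T ∘ₗ H = a • G ∘ₗ T') (h' : T' ∘ₗ δ = S ∘ₗ δ') {κ : X₃ →ₗ[k] Z} {x : X} :
    κ (T (H (δ x))) = a • (κ ∘ₗ G ∘ₗ S) (δ' x) := by
  have h1 := LinearMap.congr_fun h (δ x)
  have h2 := LinearMap.congr_fun h' x
  simp only [LinearMap.comp_apply, LinearMap.smul_apply] at h1 h2 ⊢
  rw [h1, h2, map_smul]

/-- The comultiplication of `C(B)` after a convolution, as a sum over the ways of distributing the
factors. -/
theorem comul_conv (m : ℕ) {n K : ℕ} (hK : n ≤ K) {f : Fin n → cofree C A →ₗ[k] B}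
    {p : Fin n → ℤ} (hf : ∀ i, IsDeg (cofree C A).deg B.deg (f i) (p i)) :
    comul C B m ∘ₗ conv C A B n f =
      ∑ r : Fin m → Fin (K + 1), (∏ j, ((r j : ℕ).factorial : k))⁻¹ •
        ∑ e : (Σ j, Fin (r j)) ≃ Fin n,
          ks k (regroupExp (fun j => (r j : ℕ)) e 0 fun x => (p x : ZMod 2)) •
            (hmap (C.obj m) (fun _ => cofree C A) (fun _ => cofree C B)
              (fun j => ∑ s, (p (e ⟨j, s⟩) : ZMod 2))
              (fun j => conv C A B (r j) fun s => f (e ⟨j, s⟩)) ∘ₗ comul C A m) := by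
  refine LinearMap.ext fun x => ?_
  rw [conv_apply, LinearMap.comp_apply, LinearMap.comp_apply, LinearMap.comp_apply,
    comul_cls C B m hK, LinearMap.sum_apply]
  refine Finset.sum_congr rfl fun r _ => ?_
  rw [LinearMap.smul_apply, LinearMap.sum_apply]
  congr 1
  refine Finset.sum_congr rfl fun e _ => ?_
  rw [tensorMap_eq_hmap _ _ _ hf, comulTerm_eq, LinearMap.comp_apply,
    apply_eq_smul_of_comp_eq (treeMap_hmap (C := C) (fun j => (r j : ℕ)) e _ _ hf)
      (treeMap_comul C A (fun j => (r j : ℕ)) e), LinearMap.smul_apply]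
  congr 1
  have h := hmap_eq_hmapTen (C := C) (C.obj m) (fun j => (r j : ℕ))
    (fun j => ∑ s, (p (e ⟨j, s⟩) : ZMod 2))
    (fun j => hmap (C.obj (r j)) (fun _ => cofree C A) (fun _ => B)
          (fun s => (p (e ⟨j, s⟩) : ZMod 2)) fun s => f (e ⟨j, s⟩))
    (fun j => isDeg_comul C A (r j)) (fun j => cls C B (r j))
  have h2 : ∀ j, conv C A B (r j) (fun s => f (e ⟨j, s⟩)) =
      cls C B (r j) ∘ₗ hmap (C.obj (r j)) (fun _ => cofree C A) (fun _ => B)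
          (fun s => (p (e ⟨j, s⟩) : ZMod 2)) (fun s => f (e ⟨j, s⟩)) ∘ₗ comul C A (r j) := by
    intro j
    rw [conv_apply, tensorMap_eq_hmap _ _ _ fun s => hf (e ⟨j, s⟩)]
  simp only [h2]
  rw [← h]
  rfl

end Convolution

/-! ### The comultiplication and the arity grading -/

section Arity

variable {k : Type u} [Field k] [CharZero k] {C : Cooperad.{u, v} k} {A : GrMod.{u, w} k}

/-- `C(0) = 0`, hence `C(A)` has no component of arity zero. -/
theorem ten_zero (t : Ten C A 0) : t = 0 := by
  induction t using TensorProduct.induction_on with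
  | zero => rfl
  | add x y hx hy => rw [hx, hy, add_zero]
  | tmul x y => rw [C.obj_zero x, TensorProduct.zero_tmul]

theorem cls_zero (t : Ten C A 0) : cls C A 0 t = 0 := by
  rw [ten_zero t, LinearMap.map_zero]

theorem piMap_eq_zero {m : ℕ} {X Y : Fin m → Type*} [∀ j, AddCommMonoid (X j)]
    [∀ j, Module k (X j)] [∀ j, AddCommMonoid (Y j)] [∀ j, Module k (Y j)]
    (f : ∀ j, X j →ₗ[k] Y j) (j : Fin m) (h : f j = 0) : PiTensorProduct.map f = 0 :=
  (PiTensorProduct.mapMultilinear k X Y).map_coord_zero j h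

theorem map_comulTerm {m n : ℕ} {M : Type*} [AddCommMonoid M] [Module k M] {X : Fin m → Type*}
    [∀ j, AddCommMonoid (X j)] [∀ j, Module k (X j)] (S : C.obj m →ₗ[k] M)
    (G : ∀ j, cofree C A →ₗ[k] X j) (r : Fin m → ℕ) (e : (Σ j, Fin (r j)) ≃ Fin n) :
    TensorProduct.map S (PiTensorProduct.map G) ∘ₗ comulTerm C A r e =
      TensorProduct.map S (PiTensorProduct.map fun j => G j ∘ₗ cls C A (r j)) ∘ₗ
        treeMap C A r e := by
  rw [comulTerm_eq, ← LinearMap.comp_assoc, ← TensorProduct.map_comp, ← PiTensorProduct.map_comp,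
    LinearMap.comp_id]

theorem map_comul_cls {m N : ℕ} {M : Type*} [AddCommMonoid M] [Module k M] {X : Fin m → Type*}
    [∀ j, AddCommMonoid (X j)] [∀ j, Module k (X j)] (S : C.obj m →ₗ[k] M)
    (G : ∀ j, cofree C A →ₗ[k] X j) (t : Ten C A N) :
    TensorProduct.map S (PiTensorProduct.map G) (comul C A m (cls C A N t)) =
      ∑ r : Fin m → Fin (N + 1), (∏ j, ((r j : ℕ).factorial : k))⁻¹ •
        ∑ e : (Σ j, Fin (r j)) ≃ Fin N,
          TensorProduct.map S (PiTensorProduct.map fun j => G j ∘ₗ cls C A (r j))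
            (treeMap C A (fun j => (r j : ℕ)) e t) := by
  rw [comul_cls C A m le_rfl, map_sum]
  refine Finset.sum_congr rfl fun r _ => ?_
  rw [LinearMap.map_smul, map_sum]
  congr 1
  exact Finset.sum_congr rfl fun e _ => LinearMap.congr_fun (map_comulTerm S G _ e) t

/-- The comultiplication does not raise arities. -/
theorem map_comul_cls_congr {m N : ℕ} {M : Type*} [AddCommMonoid M] [Module k M]
    {X : Fin m → Type*} [∀ j, AddCommMonoid (X j)] [∀ j, Module k (X j)] (S : C.obj m →ₗ[k] M)
    {G G' : ∀ j, cofree C A →ₗ[k] X j}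
    (h : ∀ j, ∀ i ≤ N, G j ∘ₗ cls C A i = G' j ∘ₗ cls C A i) (t : Ten C A N) :
    TensorProduct.map S (PiTensorProduct.map G) (comul C A m (cls C A N t)) =
      TensorProduct.map S (PiTensorProduct.map G') (comul C A m (cls C A N t)) := by
  rw [map_comul_cls, map_comul_cls]
  refine Finset.sum_congr rfl fun r _ => ?_
  simp only [h _ _ (Nat.le_of_lt_succ (r _).2)]

/-- The arities of the factors of a comultiplication add up to the given arity. -/
theorem map_comul_cls_eq_zero {m N : ℕ} {M : Type*} [AddCommMonoid M] [Module k M]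
    {X : Fin m → Type*} [∀ j, AddCommMonoid (X j)] [∀ j, Module k (X j)] (S : C.obj m →ₗ[k] M)
    {G : ∀ j, cofree C A →ₗ[k] X j}
    (h : ∀ r : Fin m → ℕ, ∑ j, r j = N → ∃ j, G j ∘ₗ cls C A (r j) = 0) (t : Ten C A N) :
    TensorProduct.map S (PiTensorProduct.map G) (comul C A m (cls C A N t)) = 0 := by
  rw [map_comul_cls]
  refine Finset.sum_eq_zero fun r _ => ?_
  rw [Finset.sum_eq_zero, smul_zero]
  intro e _
  obtain ⟨j, hj⟩ := h (fun j => r j) (sum_eq_of_sigma_equiv e)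
  rw [piMap_eq_zero _ j hj, TensorProduct.map_zero_right, LinearMap.zero_apply]

/-- Since `C(0) = 0`, an element of arity `N` cannot be split into more than `N` factors. -/
theorem comul_cls_eq_zero {m N : ℕ} (h : N < m) (t : Ten C A N) :
    comul C A m (cls C A N t) = 0 := by
  have := map_comul_cls_eq_zero (C := C) (A := A) (m := m) LinearMap.id
    (G := fun _ => LinearMap.id) (fun r hr => ?_) t
  · rwa [PiTensorProduct.map_id, TensorProduct.map_id] at this
  · obtain ⟨j, hj⟩ : ∃ j, r j = 0 := by
      by_contra! h0
      have : m ≤ ∑ j, r j := by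
        calc m = ∑ _j : Fin m, 1 := by simp
          _ ≤ ∑ j, r j := Finset.sum_le_sum fun j _ => Nat.one_le_iff_ne_zero.2 (h0 j)
      omega
    refine ⟨j, ?_⟩
    rw [hj]
    exact LinearMap.ext fun t => cls_zero t

/-- A locally finite sum, on elements of arity `N`, is a sum over `n ≤ K` for every `K ≥ N`. -/
theorem aritySum_cls {M : Type*} [AddCommGroup M] [Module k M] (ψ : ℕ → cofree C A →ₗ[k] M)
    (h : ∀ n i, i < n → ψ n ∘ₗ cls C A i = 0) {N K : ℕ} (hK : N ≤ K) (t : Ten C A N) :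
    aritySum C A ψ (cls C A N t) = ∑ n : Fin (K + 1), ψ n (cls C A N t) := by
  rw [aritySum, cofreeElim_cls, LinearMap.comp_apply, LinearMap.sum_apply,
    Fin.sum_univ_eq_sum_range (fun n => ψ n (cls C A N t)) (K + 1)]
  refine Finset.sum_subset (Finset.range_mono (by omega)) fun n _ hn => ?_
  exact LinearMap.congr_fun (h n N (by simpa using hn)) t

theorem proj_comp_cls {n : ℕ} (hn : n ≠ 1) : proj C A ∘ₗ cls C A n = 0 := by
  refine LinearMap.ext fun t => ?_
  rw [LinearMap.comp_apply, proj, cofreeElim_cls]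
  match n, hn with
  | 0, _ => rfl
  | n + 2, _ => rfl

theorem proj_cls (n : ℕ) (t : Ten C A n) : proj C A (cls C A n t) = projTen C A n t := by
  rw [proj, cofreeElim_cls]

theorem proj_cls_one (c : C.obj 1) (a : Fin 1 → A) :
    proj C A (cls C A 1 (c ⊗ₜ PiTensorProduct.tprod k a)) = C.counit c • a 0 := by
  rw [proj, cofreeElim_cls, projTen_one_tmul]

theorem proj_cls_one' (t : Ten C A 1) :
    proj C A (cls C A 1 t) = TensorProduct.lid k A
      (TensorProduct.map C.counit (tensorOne A).toLinearMap t) := by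
  rw [proj, cofreeElim_cls]
  rfl

theorem tensorOne_tprod (V : GrMod.{u, w} k) (a : Fin 1 → V) :
    tensorOne V (PiTensorProduct.tprod k a) = a 0 :=
  PiTensorProduct.subsingletonEquiv_apply_tprod 0 a

theorem proj_incl (a : A) : proj C A (incl C A a) = a := by
  have h : (tensorOne A).symm a = PiTensorProduct.tprod k fun _ => a := by
    rw [LinearEquiv.symm_apply_eq, tensorOne_tprod]
  have : incl C A a = cls C A 1 (C.coaug ⊗ₜ PiTensorProduct.tprod k fun _ => a) := by
    rw [← h]; rfl
  rw [this, proj_cls_one, C.counit_coaug, one_smul]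

end Arity

/-! ### Counits and reconstruction -/

section Counit

variable {k : Type u} [Field k] [CharZero k] {C : Cooperad.{u, v} k} {A : GrMod.{u, w} k}

theorem regroupExp_of_mono {m n : ℕ} (r : Fin m → ℕ) (e : (Σ j, Fin (r j)) ≃ Fin n)
    (h : ∀ i i', e i < e i' → ¬(i'.1 < i.1 ∨ i'.1 = i.1 ∧ (i'.2 : ℕ) < i.2))
    (c : Fin m → ZMod 2) (d : Fin n → ZMod 2) :
    regroupExp r e c d = ∑ j, ∑ i : (Σ j, Fin (r j)), if i.1 < j then c j * d (e i) else 0 := by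
  rw [regroupExp, add_eq_left]
  exact Finset.sum_eq_zero fun i _ => Finset.sum_eq_zero fun i' _ => if_neg fun h' => h i i' h'.1 h'.2

theorem tensor_rid_assoc {M R X : Type*} [AddCommMonoid M] [Module k M] [AddCommMonoid R]
    [Module k R] [AddCommMonoid X] [Module k X] (κ : R →ₗ[k] k) (σ : M ⊗[k] R) (x : X) :
    TensorProduct.map LinearMap.id ((TensorProduct.lid k X).toLinearMap ∘ₗ
      TensorProduct.map κ LinearMap.id) (TensorProduct.assoc k M R X (σ ⊗ₜ x)) =
    (TensorProduct.rid k M (TensorProduct.map LinearMap.id κ σ)) ⊗ₜ x := by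
  induction σ using TensorProduct.induction_on with
  | zero => simp only [TensorProduct.zero_tmul, map_zero]
  | add x y hx hy => simp only [TensorProduct.add_tmul, map_add, hx, hy]
  | tmul x y => simp [TensorProduct.smul_tmul]

theorem tensor_lid_assoc {M R R' X Y : Type*} [AddCommMonoid M] [Module k M] [AddCommMonoid R]
    [Module k R] [AddCommMonoid R'] [Module k R'] [AddCommMonoid X] [Module k X]
    [AddCommMonoid Y] [Module k Y] (κ : M →ₗ[k] k) (T : (R ⊗[k] X) →ₗ[k] Y) (S : R →ₗ[k] R')
    (T' : (R' ⊗[k] X) →ₗ[k] Y) (h : T = T' ∘ₗ TensorProduct.map S LinearMap.id)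
    (σ : M ⊗[k] R) (x : X) :
    TensorProduct.lid k Y (TensorProduct.map κ T (TensorProduct.assoc k M R X (σ ⊗ₜ x))) =
      T' ((TensorProduct.lid k R' (TensorProduct.map κ S σ)) ⊗ₜ x) := by
  induction σ using TensorProduct.induction_on with
  | zero => simp only [TensorProduct.zero_tmul, map_zero]
  | add x y hx hy => simp only [TensorProduct.add_tmul, map_add, hx, hy]
  | tmul y z => simp [h, ← TensorProduct.smul_tmul']

theorem counit_eq_zero {i : ℤ} {c : C.obj 1} (hc : c ∈ (C.obj 1).deg i) (h : C.counit c ≠ 0) :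
    i = 0 := by
  by_contra hi
  exact h (C.counit_deg i hi c hc)

theorem projTen_comp_regroup (n : ℕ) :
    (PiTensorProduct.map fun _ : Fin n => projTen C A 1) ∘ₗ
      regroup (fun _ => C.obj 1) (fun _ => A) (fun _ => 1)
        (Equiv.sigmaUnique (Fin n) fun _ => Fin 1) =
    (TensorProduct.lid k (⨂[k] _ : Fin n, A)).toLinearMap ∘ₗ
      TensorProduct.map (PiTensorProduct.lift ((MultilinearMap.mkPiAlgebra k (Fin n) k
        ).compLinearMap fun _ => C.counit)) LinearMap.id := by
  refine tprod_tmul_ext fun γ δ c a hc ha => ?_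
  rw [LinearMap.comp_apply, regroup_tmul' _ _ _ _ γ δ c a hc ha, LinearMap.map_smul,
    PiTensorProduct.map_tprod, LinearMap.comp_apply, TensorProduct.map_tmul,
    PiTensorProduct.lift.tprod]
  simp only [projTen_one_tmul, MultilinearMap.map_smul_univ, LinearMap.id_apply,
    LinearEquiv.coe_coe, TensorProduct.lid_tmul, MultilinearMap.compLinearMap_apply,
    MultilinearMap.mkPiAlgebra_apply]
  by_cases h : ∃ j, C.counit (c j) = 0
  · obtain ⟨j, hj⟩ := h
    rw [Finset.prod_eq_zero (Finset.mem_univ j) hj, zero_smul, smul_zero, zero_smul]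
  · push Not at h
    have h0 : ∀ j, γ j = 0 := fun j => counit_eq_zero (hc j) (h j)
    rw [regroupExp_of_mono]
    · simp [h0]
    · rintro ⟨i, s⟩ ⟨i', s'⟩ h (h' | h')
      · exact absurd h (not_lt.2 (le_of_lt h'))
      · exact absurd h'.2 (by rw [Subsingleton.elim s' s]; exact lt_irrefl _)

/-- The right counit axiom for the tree whose upper vertices all have one input. -/
theorem map_proj_comulTerm_one {n : ℕ} (t : Ten C A n) :
    TensorProduct.map LinearMap.id (PiTensorProduct.map fun _ => proj C A)
      (comulTerm C A (fun _ : Fin n => 1) (Equiv.sigmaUnique (Fin n) fun _ => Fin 1) t) = t := by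
  have hp : proj C A ∘ₗ cls C A 1 = projTen C A 1 :=
    LinearMap.ext fun t => proj_cls 1 t
  rw [← LinearMap.comp_apply, map_comulTerm, LinearMap.comp_apply]
  simp only [hp]
  induction t using TensorProduct.induction_on with
  | zero => simp only [LinearMap.map_zero]
  | add x y hx hy => simp only [LinearMap.map_add, hx, hy]
  | tmul c a =>
    have h := LinearMap.congr_fun (C.counit_right n) c
    rw [treeMap_tmul, ← LinearMap.comp_apply, ← TensorProduct.map_comp, LinearMap.comp_id,
      projTen_comp_regroup, tensor_rid_assoc]
    exact congrArg (· ⊗ₜ[k] a) h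

theorem map_proj_comul_cls_of_ne {m n : ℕ} (h : n ≠ m) (t : Ten C A n) :
    TensorProduct.map LinearMap.id (PiTensorProduct.map fun _ => proj C A)
      (comul C A m (cls C A n t)) = 0 := by
  refine map_comul_cls_eq_zero LinearMap.id (fun r hr => ?_) t
  by_contra! h0
  refine h ?_
  have : ∀ j, r j = 1 := fun j => by
    by_contra hj
    exact h0 j (proj_comp_cls hj)
  simpa [this] using hr.symm

theorem sum_equiv_eq_sum_perm {M T : Type*} [AddCommMonoid M] [Fintype T] [DecidableEq T] {n : ℕ}
    (e₀ : T ≃ Fin n) (g : (T ≃ Fin n) → M) :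
    ∑ e, g e = ∑ σ : Equiv.Perm (Fin n), g (e₀.trans σ) :=
  (Fintype.sum_equiv (Equiv.equivCongr e₀ (Equiv.refl _)).symm _ _ fun _ => rfl).symm

theorem comulTerm_trans {m n : ℕ} (r : Fin m → ℕ) (e : (Σ j, Fin (r j)) ≃ Fin n)
    (σ : Equiv.Perm (Fin n)) (t : Ten C A n) :
    comulTerm C A r (e.trans σ) t = comulTerm C A r e (permTen C A σ⁻¹ t) := by
  have := LinearMap.congr_fun (comulTerm_permTen C A r (e.trans σ) σ⁻¹) t
  have he : (e.trans σ).trans σ⁻¹ = e := by ext x; simp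
  rw [he, LinearMap.comp_apply] at this
  exact this.symm

/-- The projection of `Δ n` to `C(n) ⊗ A ⊗ ⋯ ⊗ A` is the symmetrization, on elements of arity `n`.
-/
theorem map_proj_comul_cls_self {n : ℕ} (t : Ten C A n) :
    TensorProduct.map LinearMap.id (PiTensorProduct.map fun _ => proj C A)
      (comul C A n (cls C A n t)) = ∑ σ : Equiv.Perm (Fin n), permTen C A σ t := by
  rcases Nat.eq_zero_or_pos n with rfl | hn
  · rw [ten_zero t, cls_zero]
    simp only [LinearMap.map_zero, Finset.sum_const_zero]
  rw [comul_cls C A n le_rfl, map_sum,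
    Finset.sum_eq_single fun _ => (⟨1, by omega⟩ : Fin (n + 1))]
  · rw [LinearMap.map_smul, map_sum]
    simp only [Nat.factorial_one, Nat.cast_one, Finset.prod_const_one, inv_one, one_smul]
    rw [sum_equiv_eq_sum_perm (Equiv.sigmaUnique (Fin n) fun _ => Fin 1)]
    refine Fintype.sum_equiv (Equiv.inv _) _ _ fun σ => ?_
    rw [comulTerm_trans, map_proj_comulTerm_one]
    rfl
  · intro r _ hr
    obtain ⟨j, hj⟩ := Function.ne_iff.1 hr
    rw [LinearMap.map_smul, map_sum, Finset.sum_eq_zero, smul_zero]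
    intro e _
    rw [← LinearMap.comp_apply, map_comulTerm, piMap_eq_zero _ j, TensorProduct.map_zero_right,
      LinearMap.zero_comp, LinearMap.zero_apply]
    exact proj_comp_cls fun h => hj (Fin.ext h)
  · simp

/-- The component of `C(A)` of arity `n` is the image of `(1 ⊗ p ⊗ ⋯ ⊗ p) Δ n`. -/
theorem cls_map_proj_comul_cls {n : ℕ} (t : Ten C A n) :
    cls C A n (TensorProduct.map LinearMap.id (PiTensorProduct.map fun _ => proj C A)
      (comul C A n (cls C A n t))) = (n.factorial : k) • cls C A n t := by
  rw [map_proj_comul_cls_self, map_sum]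
  have : ∀ σ : Equiv.Perm (Fin n), cls C A n (permTen C A σ t) = cls C A n t := fun σ =>
    LinearMap.congr_fun (cls_permTen C A σ) t
  simp only [this]
  rw [Finset.sum_const, Finset.card_univ, Fintype.card_perm, Fintype.card_fin, Nat.cast_smul_eq_nsmul]

/-- An element of `C(A)` is determined by its images under the maps `(1 ⊗ p ⊗ ⋯ ⊗ p) Δ m`. -/
theorem cofree_eq_of_map_proj {x y : cofree C A}
    (h : ∀ m, TensorProduct.map LinearMap.id (PiTensorProduct.map fun _ : Fin m => proj C A)
      (comul C A m x) = TensorProduct.map LinearMap.id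
        (PiTensorProduct.map fun _ : Fin m => proj C A) (comul C A m y)) : x = y := by
  -- every element is a finite sum of its components, which can be recovered in characteristic zero
  suffices H : ∀ x : cofree C A, ∃ N, ∀ K ≥ N, x = ∑ m ∈ Finset.range K,
      (m.factorial : k)⁻¹ • cls C A m (TensorProduct.map LinearMap.id
        (PiTensorProduct.map fun _ : Fin m => proj C A) (comul C A m x)) by
    obtain ⟨N, hN⟩ := H x
    obtain ⟨N', hN'⟩ := H y
    rw [hN (max N N') (le_max_left _ _), hN' (max N N') (le_max_right _ _)]
    simp only [h]
  intro x
  change CofreeSpace C A at x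
  induction x using aux_induction with
  | h0 => exact ⟨0, fun K _ => by
      refine (Finset.sum_eq_zero fun m _ => ?_).symm
      refine (congrArg _ (congrArg _ ?_)).trans ((congrArg _ (LinearMap.map_zero _)).trans (smul_zero _))
      exact (congrArg _ (LinearMap.map_zero _)).trans (LinearMap.map_zero _)⟩
  | hadd x y hx hy =>
    obtain ⟨N, hN⟩ := hx
    obtain ⟨N', hN'⟩ := hy
    refine ⟨max N N', fun K hK => ?_⟩
    have h1 := hN K (le_trans (le_max_left _ _) hK)
    have h2 := hN' K (le_trans (le_max_right _ _) hK)
    refine (congrArg₂ (fun a b : cofree C A => a + b) h1 h2).trans ?_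
    rw [← Finset.sum_add_distrib]
    refine Finset.sum_congr rfl fun m _ => ?_
    rw [← smul_add]
    refine congrArg _ ?_
    rw [← LinearMap.map_add, ← LinearMap.map_add]
    exact congrArg _ (congrArg _ (LinearMap.map_add _ _ _).symm)
  | hcls n t =>
    refine ⟨n + 1, fun K hK => ?_⟩
    change cls C A n t = ∑ m ∈ Finset.range K, (m.factorial : k)⁻¹ • cls C A m
      (TensorProduct.map LinearMap.id (PiTensorProduct.map fun _ : Fin m => proj C A)
        (comul C A m (cls C A n t)))
    rw [Finset.sum_eq_single n]
    · rw [cls_map_proj_comul_cls, smul_smul, inv_mul_cancel₀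
        (Nat.cast_ne_zero.2 (Nat.factorial_ne_zero _)), one_smul]
    · intro m _ hm
      rw [map_proj_comul_cls_of_ne (Ne.symm hm), LinearMap.map_zero, smul_zero]
    · intro h
      exact absurd (Finset.mem_range.2 (by omega)) h

end Counit

/-! ### Coalgebra morphisms -/

section Morphisms

variable {k : Type u} [Field k] [CharZero k] {C : Cooperad.{u, v} k} {A : GrMod.{u, w} k}
  {B : GrMod.{u, w'} k}

theorem tensorOne_comp_regroup (n : ℕ) :
    (tensorOne (cofree C A)).toLinearMap ∘ₗ (PiTensorProduct.map fun _ : Fin 1 => cls C A n) ∘ₗ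
      regroup (fun _ : Fin 1 => C.obj n) (fun _ => A) (fun _ => n)
        (Equiv.uniqueSigma fun _ : Fin 1 => Fin n) =
    cls C A n ∘ₗ TensorProduct.map (tensorOne (C.obj n)).toLinearMap LinearMap.id := by
  refine tprod_tmul_ext fun γ δ c a hc ha => ?_
  rw [LinearMap.comp_apply, LinearMap.comp_apply, regroup_tmul' _ _ _ _ γ δ c a hc ha,
    LinearMap.map_smul, LinearMap.map_smul, PiTensorProduct.map_tprod, LinearMap.comp_apply,
    TensorProduct.map_tmul, LinearEquiv.coe_coe, LinearEquiv.coe_coe, tensorOne_tprod,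
    tensorOne_tprod, regroupExp_of_mono]
  · rw [Finset.sum_eq_zero, ks_zero, one_smul]
    · rfl
    · intro j _
      exact Finset.sum_eq_zero fun i _ => if_neg (by rw [Subsingleton.elim i.1 j]; exact lt_irrefl _)
  · rintro ⟨i, s⟩ ⟨i', s'⟩ h (h' | h')
    · rw [Subsingleton.elim i' i] at h'
      exact lt_irrefl _ h'
    · obtain rfl := Subsingleton.elim i' i
      have h1 : s < s' := by
        obtain rfl := Subsingleton.elim i' 0
        exact h
      exact absurd h'.2 (not_lt.2 (le_of_lt h1))

theorem counit_comulTerm {n : ℕ} (t : Ten C A n) :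
    TensorProduct.lid k (cofree C A) (TensorProduct.map C.counit
      (tensorOne (cofree C A)).toLinearMap (comulTerm C A (fun _ : Fin 1 => n)
        (Equiv.uniqueSigma fun _ : Fin 1 => Fin n) t)) = cls C A n t := by
  induction t using TensorProduct.induction_on with
  | zero => simp only [map_zero]
  | add x y hx hy => simp only [map_add, hx, hy]
  | tmul c a =>
    have h := LinearMap.congr_fun (C.counit_left n) c
    have h2 := tensor_lid_assoc C.counit _ _ _ (tensorOne_comp_regroup (C := C) (A := A) n)
      (C.decomp (fun _ : Fin 1 => n) (Equiv.uniqueSigma fun _ : Fin 1 => Fin n) c) a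
    rw [comulTerm_tmul]
    refine Eq.trans ?_ (h2.trans (congrArg (fun z => cls C A n (z ⊗ₜ a)) h))
    congr 1
    rw [← LinearMap.comp_apply, ← LinearMap.comp_apply, ← TensorProduct.map_comp,
      ← TensorProduct.map_comp, LinearMap.comp_id, LinearMap.comp_id, LinearMap.comp_assoc]

/-- The left counit axiom of the cofree coalgebra. -/
theorem counit_comul (x : cofree C A) :
    TensorProduct.lid k (cofree C A) (TensorProduct.map C.counit
      (tensorOne (cofree C A)).toLinearMap (comul C A 1 x)) = x := by
  suffices h : (TensorProduct.lid k (cofree C A)).toLinearMap ∘ₗ TensorProduct.map C.counit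
      (tensorOne (cofree C A)).toLinearMap ∘ₗ comul C A 1 = LinearMap.id from
    LinearMap.congr_fun h x
  refine cofree_ext C fun n t => ?_
  simp only [LinearMap.comp_apply, LinearEquiv.coe_coe, LinearMap.id_apply]
  rw [comul_cls C A 1 le_rfl, map_sum, map_sum,
    Finset.sum_eq_single fun _ => (⟨n, by omega⟩ : Fin (n + 1))]
  · rw [LinearMap.map_smul, map_sum, LinearEquiv.map_smul, map_sum,
      sum_equiv_eq_sum_perm (Equiv.uniqueSigma fun _ : Fin 1 => Fin n)]
    have : ∀ σ : Equiv.Perm (Fin n), cls C A n (permTen C A σ⁻¹ t) = cls C A n t := fun σ =>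
      LinearMap.congr_fun (cls_permTen C A σ⁻¹) t
    simp only [comulTerm_trans, counit_comulTerm, this]
    rw [Finset.sum_const, Finset.card_univ, Fintype.card_perm, Fintype.card_fin,
      ← Nat.cast_smul_eq_nsmul k, smul_smul, Fin.prod_univ_one, inv_mul_cancel₀, one_smul]
    exact Nat.cast_ne_zero.2 (Nat.factorial_ne_zero _)
  · intro r _ hr
    have : IsEmpty ((Σ j : Fin 1, Fin (r j)) ≃ Fin n) := ⟨fun e => hr (funext fun j => Fin.ext (by
      have := sum_eq_of_sigma_equiv e
      rw [Fin.sum_univ_one] at this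
      rw [Subsingleton.elim j 0, this]))⟩
    rw [Finset.univ_eq_empty (α := (Σ j : Fin 1, Fin (r j)) ≃ Fin n), Finset.sum_empty, smul_zero,
      LinearMap.map_zero, map_zero]
  · simp

theorem counit_comp_sgn (q : ZMod 2) : C.counit ∘ₗ (C.obj 1).sgn q = C.counit := by
  refine (C.obj 1).ext_deg fun i c hc => ?_
  rw [LinearMap.comp_apply, (C.obj 1).sgn_of_mem q hc, LinearMap.map_smul]
  by_cases h : C.counit c = 0
  · rw [h, smul_zero]
  · rw [counit_eq_zero hc h, Int.cast_zero, mul_zero, ks_zero, one_smul]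

theorem lid_map_hmap_one {V : GrMod.{u, w} k} {W : GrMod.{u, w'} k} (p : Fin 1 → ZMod 2)
    (f : Fin 1 → V →ₗ[k] W) (z : C.obj 1 ⊗[k] (⨂[k] _ : Fin 1, V)) :
    TensorProduct.lid k W (TensorProduct.map C.counit (tensorOne W).toLinearMap
      (hmap (C.obj 1) (fun _ => V) (fun _ => W) p f z)) =
    f 0 (TensorProduct.lid k V (TensorProduct.map C.counit (tensorOne V).toLinearMap z)) := by
  suffices h : ∀ c (y : Fin 1 → V), TensorProduct.lid k W (TensorProduct.map C.counit
      (tensorOne W).toLinearMap (hmap (C.obj 1) (fun _ => V) (fun _ => W) p f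
        (c ⊗ₜ PiTensorProduct.tprod k y))) =
      f 0 (TensorProduct.lid k V (TensorProduct.map C.counit (tensorOne V).toLinearMap
        (c ⊗ₜ PiTensorProduct.tprod k y))) by
    have h' : (TensorProduct.lid k W).toLinearMap ∘ₗ TensorProduct.map C.counit
        (tensorOne W).toLinearMap ∘ₗ hmap (C.obj 1) (fun _ => V) (fun _ => W) p f =
        f 0 ∘ₗ (TensorProduct.lid k V).toLinearMap ∘ₗ TensorProduct.map C.counit
          (tensorOne V).toLinearMap :=
      TensorProduct.ext (LinearMap.ext fun c => PiTensorProduct.ext (MultilinearMap.ext fun y =>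
        h c y))
    exact LinearMap.congr_fun h' z
  intro c y
  have h1 : ∀ j : Fin 1, (∑ i with j < i, p i) = 0 := fun j =>
    Finset.sum_eq_zero fun i hi => absurd (Finset.mem_filter.1 hi).2 (by
      rw [Subsingleton.elim i j]; exact lt_irrefl _)
  have h2 := LinearMap.congr_fun (counit_comp_sgn (C := C) (∑ j, p j)) c
  rw [LinearMap.comp_apply] at h2
  rw [hmap, TensorProduct.map_tmul, TensorProduct.map_tmul, TensorProduct.map_tmul, h2,
    PiTensorProduct.map_tprod, LinearEquiv.coe_coe, LinearEquiv.coe_coe, tensorOne_tprod,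
    tensorOne_tprod, TensorProduct.lid_tmul, TensorProduct.lid_tmul, LinearMap.map_smul, h1,
    GrMod.sgn_zero, LinearMap.comp_id]

/-- Only the convolution of a single map has a component in the cogenerators. -/
theorem proj_conv_of_ne {n : ℕ} (hn : n ≠ 1) (f : Fin n → cofree C A →ₗ[k] B) :
    proj C B ∘ₗ conv C A B n f = 0 := by
  rw [conv_apply, ← LinearMap.comp_assoc, proj_comp_cls hn, LinearMap.zero_comp]

theorem proj_conv_one {f : Fin 1 → cofree C A →ₗ[k] B} {p : ℤ}
    (hf : IsDeg (cofree C A).deg B.deg (f 0) p) : proj C B ∘ₗ conv C A B 1 f = f 0 := by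
  refine LinearMap.ext fun x => ?_
  have hf' : ∀ j, IsDeg (cofree C A).deg B.deg (f j) p := fun j => by
    rwa [Subsingleton.elim j 0]
  rw [conv_apply, LinearMap.comp_apply, LinearMap.comp_apply, LinearMap.comp_apply, proj_cls_one',
    tensorMap_eq_hmap _ _ _ hf', lid_map_hmap_one, counit_comul]

theorem conv_comp_cls_of_lt {n i : ℕ} (h : i < n) (f : Fin n → cofree C A →ₗ[k] B) :
    conv C A B n f ∘ₗ cls C A i = 0 := by
  refine LinearMap.ext fun t => ?_
  rw [conv_apply, LinearMap.comp_apply, LinearMap.comp_apply, LinearMap.comp_apply,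
    comul_cls_eq_zero h, LinearMap.map_zero, LinearMap.map_zero, LinearMap.zero_apply]

theorem conv_of_degree_zero {n : ℕ} {f : Fin n → cofree C A →ₗ[k] B}
    (hf : ∀ i, IsDeg (cofree C A).deg B.deg (f i) 0) :
    conv C A B n f = cls C B n ∘ₗ TensorProduct.map LinearMap.id (PiTensorProduct.map f) ∘ₗ
      comul C A n := by
  have h : (fun _ : Fin n => ((0 : ℤ) : ZMod 2)) = 0 := by funext; simp
  rw [conv_apply, tensorMap_eq_hmap _ _ _ hf, h, hmap_zero]

/-- The morphism of coalgebras with projection `f` is the sum of the convolutions of `n` copies of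
`f`, divided by `n!`. -/
theorem coalgLift_eq_aritySum {f : cofree C A →ₗ[k] B}
    (hf : IsDeg (cofree C A).deg B.deg f 0) : coalgLift C f =
      aritySum C A fun n => (n.factorial : k)⁻¹ • conv C A B n fun _ => f := by
  simp only [conv_of_degree_zero fun _ => hf]
  rfl

theorem coalgLift_cls {f : cofree C A →ₗ[k] B} (hf : IsDeg (cofree C A).deg B.deg f 0) {N K : ℕ}
    (hK : N ≤ K) (t : Ten C A N) : coalgLift C f (cls C A N t) =
      ∑ n : Fin (K + 1), ((n : ℕ).factorial : k)⁻¹ • conv C A B n (fun _ => f) (cls C A N t) := by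
  rw [coalgLift_eq_aritySum hf, aritySum_cls _ _ hK]
  · rfl
  · intro n i h
    rw [LinearMap.smul_comp, conv_comp_cls_of_lt h, smul_zero]

theorem proj_comp_coalgLift {f : cofree C A →ₗ[k] B} (hf : IsDeg (cofree C A).deg B.deg f 0) :
    proj C B ∘ₗ coalgLift C f = f := by
  refine cofree_ext C fun N t => ?_
  rw [LinearMap.comp_apply, coalgLift_cls hf (Nat.le_succ N), map_sum,
    Finset.sum_eq_single (⟨1, by omega⟩ : Fin (N + 1 + 1))]
  · have := LinearMap.congr_fun (proj_conv_one (f := fun _ => f) hf) (cls C A N t)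
    rw [LinearMap.comp_apply] at this
    rw [LinearMap.map_smul]
    change ((Nat.factorial 1 : ℕ) : k)⁻¹ • proj C B (conv C A B 1 (fun _ => f) (cls C A N t)) = _
    rw [this, Nat.factorial_one, Nat.cast_one, inv_one, one_smul]
  · intro n _ hn
    have := LinearMap.congr_fun (proj_conv_of_ne (C := C) (A := A) (n := n)
      (fun h => hn (Fin.ext h)) fun _ => f) (cls C A N t)
    rw [LinearMap.comp_apply] at this
    rw [LinearMap.map_smul, this, LinearMap.zero_apply, smul_zero]
  · simp

theorem coalgLift_proj : coalgLift C (proj C A) = LinearMap.id := by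
  refine cofree_ext C fun N t => ?_
  rw [coalgLift_cls (isDeg_proj C A) le_rfl, Finset.sum_eq_single (Fin.last N)]
  · rw [conv_of_degree_zero fun _ => isDeg_proj C A, LinearMap.comp_apply, LinearMap.comp_apply,
      Fin.val_last, cls_map_proj_comul_cls, smul_smul, inv_mul_cancel₀
        (Nat.cast_ne_zero.2 (Nat.factorial_ne_zero _)), one_smul, LinearMap.id_apply]
  · intro n _ hn
    rw [conv_of_degree_zero fun _ => isDeg_proj C A, LinearMap.comp_apply, LinearMap.comp_apply,
      map_proj_comul_cls_of_ne, LinearMap.map_zero, smul_zero]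
    exact fun h => hn (Fin.ext h.symm)
  · simp

theorem isDeg_coalgLift {f : cofree C A →ₗ[k] B} (hf : IsDeg (cofree C A).deg B.deg f 0) :
    IsDeg (cofree C A).deg (cofree C B).deg (coalgLift C f) 0 := by
  rw [coalgLift_eq_aritySum hf]
  refine isDeg_aritySum C fun m => IsDeg.smul _ ?_
  have := isDeg_conv (C := C) (n := m) fun _ => hf
  simpa using this

/-- Summation over all ways of distributing `n ≤ N` factors over blocks, weighted by factorials. -/
theorem sum_factorial_smul {m N : ℕ} {M : Type*} [AddCommGroup M] [Module k M]
    (X : (Fin m → ℕ) → M) (hX : ∀ r, N < ∑ j, r j → X r = 0) :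
    ∑ n : Fin (N + 1), ((n : ℕ).factorial : k)⁻¹ • ∑ r : Fin m → Fin (N + 1),
      (∏ j, ((r j : ℕ).factorial : k))⁻¹ • ∑ _e : (Σ j, Fin (r j)) ≃ Fin n, X (fun j => r j) =
    ∑ r : Fin m → Fin (N + 1), (∏ j, ((r j : ℕ).factorial : k))⁻¹ • X (fun j => r j) := by
  have h1 : ∀ n : Fin (N + 1), ((n : ℕ).factorial : k)⁻¹ • ∑ r : Fin m → Fin (N + 1),
      (∏ j, ((r j : ℕ).factorial : k))⁻¹ • ∑ _e : (Σ j, Fin (r j)) ≃ Fin n, X (fun j => r j) =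
      ∑ r : Fin m → Fin (N + 1), (∏ j, ((r j : ℕ).factorial : k))⁻¹ • ((n : ℕ).factorial : k)⁻¹ •
        ∑ _e : (Σ j, Fin (r j)) ≃ Fin n, X (fun j => r j) := fun n => by
    rw [Finset.smul_sum]
    exact Finset.sum_congr rfl fun r _ => smul_comm _ _ _
  rw [Finset.sum_congr rfl fun n _ => h1 n, Finset.sum_comm]
  refine Finset.sum_congr rfl fun r _ => ?_
  rw [← Finset.smul_sum]
  congr 1
  by_cases h : N < ∑ j, (r j : ℕ)
  · rw [hX _ h]
    simp only [Finset.sum_const_zero, smul_zero]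
  · rw [Finset.sum_eq_single (⟨(∑ j, (r j : ℕ)), Nat.lt_succ_of_le (not_lt.1 h)⟩ : Fin (N + 1))]
    · have e₀ : (Σ j, Fin (r j)) ≃ Fin (∑ j, (r j : ℕ)) := finSigmaFinEquiv
      rw [Finset.sum_const, Finset.card_univ, Fintype.card_equiv e₀, Fintype.card_sigma,
        ← Nat.cast_smul_eq_nsmul k, smul_smul]
      simp only [Fintype.card_fin]
      rw [inv_mul_cancel₀ (Nat.cast_ne_zero.2 (Nat.factorial_ne_zero _)), one_smul]
    · intro n _ hn
      have : IsEmpty ((Σ j, Fin (r j)) ≃ Fin n) :=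
        ⟨fun e => hn (Fin.ext (sum_eq_of_sigma_equiv e).symm)⟩
      rw [Finset.univ_eq_empty (α := (Σ j, Fin (r j)) ≃ Fin n), Finset.sum_empty, smul_zero]
    · exact fun h => absurd (Finset.mem_univ _) h

/-- An element of arity `N` cannot be split into factors that admit convolutions of `r 0, …, r (m -
1)` maps, if the sum of the `r j` exceeds `N`. -/
theorem map_conv_comul_cls_eq_zero {m N : ℕ} {M : Type*} [AddCommMonoid M] [Module k M]
    (S : C.obj m →ₗ[k] M) (r : Fin m → ℕ) (hr : N < ∑ j, r j)
    (f : ∀ j, Fin (r j) → cofree C A →ₗ[k] B) (t : Ten C A N) :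
    TensorProduct.map S (PiTensorProduct.map fun j => conv C A B (r j) (f j))
      (comul C A m (cls C A N t)) = 0 := by
  refine map_comul_cls_eq_zero S (fun s hs => ?_) t
  obtain ⟨j, -, hj⟩ : ∃ j ∈ Finset.univ, s j < r j :=
    Finset.exists_lt_of_sum_lt (by rw [hs]; exact hr)
  exact ⟨j, conv_comp_cls_of_lt hj _⟩

/-- A map of degree zero to the cogenerators extends to a morphism of coalgebras. -/
theorem isCoalgHom_coalgLift {f : cofree C A →ₗ[k] B} (hf : IsDeg (cofree C A).deg B.deg f 0) :
    IsCoalgHom C (coalgLift C f) := by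
  refine ⟨isDeg_coalgLift hf, fun m => cofree_ext C fun N t => ?_⟩
  have h1 : ∀ n : Fin (N + 1), comul C B m (conv C A B n (fun _ => f) (cls C A N t)) =
      ∑ r : Fin m → Fin (N + 1), (∏ j, ((r j : ℕ).factorial : k))⁻¹ •
        ∑ _e : (Σ j, Fin (r j)) ≃ Fin n, TensorProduct.map LinearMap.id
          (PiTensorProduct.map fun j => conv C A B (r j) fun _ => f)
          (comul C A m (cls C A N t)) := by
    intro n
    have h := LinearMap.congr_fun (comul_conv m (Nat.le_of_lt_succ n.2) (f := fun _ : Fin n => f)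
      (p := fun _ => 0) fun _ => hf) (cls C A N t)
    have h0 : ∀ r : Fin m → ℕ, (fun j => ∑ _s : Fin (r j), ((0 : ℤ) : ZMod 2)) = 0 := fun r => by
      funext; simp
    have h0' : ∀ (r : Fin m → ℕ) (e : (Σ j, Fin (r j)) ≃ Fin n),
        regroupExp r e 0 (fun _ => ((0 : ℤ) : ZMod 2)) = 0 := fun r e => by
      simp [regroupExp]
    rw [LinearMap.comp_apply] at h
    rw [h, LinearMap.sum_apply]
    simp only [LinearMap.smul_apply, LinearMap.sum_apply, h0, h0', hmap_zero, ks_zero, one_smul,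
      LinearMap.comp_apply]
  rw [LinearMap.comp_apply, coalgLift_cls hf le_rfl, map_sum]
  simp only [LinearMap.map_smul, h1]
  rw [sum_factorial_smul (fun r => TensorProduct.map LinearMap.id
    (PiTensorProduct.map fun j => conv C A B (r j) fun _ => f) (comul C A m (cls C A N t)))
    fun r hr => map_conv_comul_cls_eq_zero _ r hr _ t]
  have h2 : ∀ j : Fin m, ∀ i ≤ N, coalgLift C f ∘ₗ cls C A i =
      (∑ n : Fin (N + 1), ((n : ℕ).factorial : k)⁻¹ • conv C A B n fun _ => f) ∘ₗ cls C A i := by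
    intro _ i hi
    refine LinearMap.ext fun t => ?_
    rw [LinearMap.comp_apply, coalgLift_cls hf hi, LinearMap.comp_apply, LinearMap.sum_apply]
    rfl
  rw [LinearMap.comp_apply, map_comul_cls_congr LinearMap.id h2]
  have h3 : (PiTensorProduct.map fun _ : Fin m => ∑ n : Fin (N + 1),
      ((n : ℕ).factorial : k)⁻¹ • conv C A B n fun _ => f) =
      ∑ r : Fin m → Fin (N + 1), (∏ j, ((r j : ℕ).factorial : k))⁻¹ •
        PiTensorProduct.map fun j => conv C A B (r j) fun _ => f := by
    simp only [← PiTensorProduct.mapMultilinear_apply]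
    rw [MultilinearMap.map_sum]
    refine Finset.sum_congr rfl fun r _ => ?_
    rw [MultilinearMap.map_smul_univ, Finset.prod_inv_distrib]
  rw [h3, map_id_sum, LinearMap.sum_apply]
  simp only [TensorProduct.map_smul_right, LinearMap.smul_apply]

/-- Morphisms of coalgebras to `C(B)` are determined by their projections to `B`. -/
theorem IsCoalgHom.ext {U U' : cofree C A →ₗ[k] cofree C B} (hU : IsCoalgHom C U)
    (hU' : IsCoalgHom C U') (h : proj C B ∘ₗ U = proj C B ∘ₗ U') : U = U' := by
  have key : ∀ {V : cofree C A →ₗ[k] cofree C B}, IsCoalgHom C V → ∀ (m : ℕ) (x : cofree C A),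
      TensorProduct.map LinearMap.id (PiTensorProduct.map fun _ : Fin m => proj C B)
        (HomotopyAlg.comul C B m (V x)) = TensorProduct.map LinearMap.id
          (PiTensorProduct.map fun _ => proj C B ∘ₗ V) (HomotopyAlg.comul C A m x) := by
    intro V hV m x
    have := LinearMap.congr_fun (hV.comul m) x
    rw [LinearMap.comp_apply, LinearMap.comp_apply] at this
    rw [this, ← LinearMap.comp_apply, ← TensorProduct.map_comp, ← PiTensorProduct.map_comp,
      LinearMap.id_comp]
  exact LinearMap.ext fun x => cofree_eq_of_map_proj fun m => by rw [key hU, key hU', h]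

theorem IsCoalgHom.comp {D : GrMod.{u, w''} k} {U' : cofree C B →ₗ[k] cofree C D}
    {U : cofree C A →ₗ[k] cofree C B} (hU' : IsCoalgHom C U') (hU : IsCoalgHom C U) :
    IsCoalgHom C (U' ∘ₗ U) := by
  refine ⟨hU'.deg.comp hU.deg (add_zero 0), fun m => ?_⟩
  rw [← LinearMap.comp_assoc, hU'.comul, LinearMap.comp_assoc, hU.comul, ← LinearMap.comp_assoc,
    ← TensorProduct.map_comp, ← PiTensorProduct.map_comp, LinearMap.id_comp]

theorem isCoalgHom_id : IsCoalgHom C (LinearMap.id : cofree C A →ₗ[k] cofree C A) :=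
  ⟨IsDeg.id, fun m => by
    rw [PiTensorProduct.map_id, TensorProduct.map_id, LinearMap.comp_id, LinearMap.id_comp]⟩

end Morphisms

/-! ### Coderivations -/

section Leibniz

variable {k : Type u} [Field k] [CharZero k]

theorem comp_sum {ι X Y Z : Type*} [AddCommMonoid X] [Module k X] [AddCommMonoid Y] [Module k Y]
    [AddCommMonoid Z] [Module k Z] (s : Finset ι) (f : ι → X →ₗ[k] Y) (g : Y →ₗ[k] Z) :
    g ∘ₗ ∑ i ∈ s, f i = ∑ i ∈ s, g ∘ₗ f i :=
  LinearMap.ext fun x => by simp only [LinearMap.comp_apply, LinearMap.sum_apply, map_sum]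

theorem sum_comp {ι X Y Z : Type*} [AddCommMonoid X] [Module k X] [AddCommMonoid Y] [Module k Y]
    [AddCommMonoid Z] [Module k Z] (s : Finset ι) (f : ι → Y →ₗ[k] Z) (g : X →ₗ[k] Y) :
    (∑ i ∈ s, f i) ∘ₗ g = ∑ i ∈ s, f i ∘ₗ g :=
  LinearMap.ext fun x => by simp only [LinearMap.comp_apply, LinearMap.sum_apply]

/-- `hmap`, as a multilinear map in the tensor factors. -/
def hmapMulti (M : GrMod.{u, v'} k) (V : GrMod.{u, v} k) (W : GrMod.{u, w} k) {n : ℕ}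
    (p : Fin n → ZMod 2) :
    MultilinearMap k (fun _ : Fin n => V →ₗ[k] W)
      ((M ⊗[k] (⨂[k] _ : Fin n, V)) →ₗ[k] (M ⊗[k] (⨂[k] _ : Fin n, W))) :=
  (TensorProduct.mapBilinear (RingHom.id k) M (⨂[k] _ : Fin n, V) M (⨂[k] _ : Fin n, W)
      (M.sgn (∑ j, p j))).compMultilinearMap
    ((PiTensorProduct.mapMultilinear k (fun _ : Fin n => (V : Type v))
      (fun _ : Fin n => (W : Type w))).compLinearMap fun j =>
        LinearMap.lcomp k W (V.sgn (∑ i with j < i, p i)))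

theorem hmapMulti_apply (M : GrMod.{u, v'} k) (V : GrMod.{u, v} k) (W : GrMod.{u, w} k) {n : ℕ}
    (p : Fin n → ZMod 2) (f : Fin n → V →ₗ[k] W) :
    hmapMulti M V W p f = hmap M (fun _ => V) (fun _ => W) p f := rfl

theorem map_comp_hmap (M : GrMod.{u, v'} k) {n : ℕ} {V : Fin n → GrMod.{u, v} k}
    {W : Fin n → GrMod.{u, w} k} {X : Fin n → GrMod.{u, w'} k} (p : Fin n → ZMod 2)
    (f : ∀ j, V j →ₗ[k] W j) (g : ∀ j, W j →ₗ[k] X j) :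
    TensorProduct.map LinearMap.id (PiTensorProduct.map g) ∘ₗ hmap M V W p f =
      hmap M V X p fun j => g j ∘ₗ f j := by
  rw [hmap, hmap, ← TensorProduct.map_comp, ← PiTensorProduct.map_comp, LinearMap.id_comp]
  rfl

theorem hmap_comp_map (M : GrMod.{u, v'} k) {n : ℕ} {V : Fin n → GrMod.{u, v} k}
    {W : Fin n → GrMod.{u, w} k} {X : Fin n → GrMod.{u, w'} k} (p : Fin n → ZMod 2)
    {f : ∀ j, V j →ₗ[k] W j} (hf : ∀ j, IsDeg (V j).deg (W j).deg (f j) 0)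
    (g : ∀ j, W j →ₗ[k] X j) :
    hmap M W X p g ∘ₗ TensorProduct.map LinearMap.id (PiTensorProduct.map f) =
      hmap M V X p fun j => g j ∘ₗ f j := by
  rw [hmap, hmap, ← TensorProduct.map_comp, ← PiTensorProduct.map_comp, LinearMap.comp_id]
  congr 2
  funext j
  rw [LinearMap.comp_assoc, GrMod.sgn_comp_of_isDeg (hf j), Int.cast_zero, mul_zero, ks_zero, one_smul,
    LinearMap.comp_assoc]

/-- `hmap` with a single odd factor: the sign operators act on the factors to its left. -/
theorem hmap_single (M : GrMod.{u, v'} k) {n : ℕ} (V : Fin n → GrMod.{u, v} k)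
    (W : Fin n → GrMod.{u, w} k) (i : Fin n) (f : ∀ j, V j →ₗ[k] W j) :
    hmap M V W (Pi.single i 1) f = TensorProduct.map M.eps (PiTensorProduct.map fun j =>
      f j ∘ₗ if j < i then (V j).eps else LinearMap.id) := by
  have h1 : (∑ j, (Pi.single i 1 : Fin n → ZMod 2) j) = 1 := by simp [Pi.single_apply]
  have h2 : ∀ j : Fin n, (∑ x with j < x, (Pi.single i 1 : Fin n → ZMod 2) x) =
      if j < i then 1 else 0 := fun j => by simp [Pi.single_apply]
  rw [hmap, h1, GrMod.sgn_one]
  congr 2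
  funext j
  rw [h2]
  split_ifs
  · rw [GrMod.sgn_one]
  · rw [GrMod.sgn_zero]

theorem cast_single {n : ℕ} (i : Fin n) (a : ℤ) :
    (fun j => ((Pi.single i a : Fin n → ℤ) j : ZMod 2)) = Pi.single i (a : ZMod 2) := by
  funext j
  by_cases h : j = i
  · subst h; rw [Pi.single_eq_same, Pi.single_eq_same]
  · rw [Pi.single_eq_of_ne h, Pi.single_eq_of_ne h, Int.cast_zero]

theorem isDeg_update {V : GrMod.{u, v} k} {W : GrMod.{u, w} k} {n : ℕ} {f g : V →ₗ[k] W} {a : ℤ}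
    (hf : IsDeg V.deg W.deg f 0) (hg : IsDeg V.deg W.deg g a) (i j : Fin n) :
    IsDeg V.deg W.deg (Function.update (fun _ => f) i g j) ((Pi.single i a : Fin n → ℤ) j) := by
  by_cases h : j = i
  · subst h; rwa [Function.update_self, Pi.single_eq_same]
  · rwa [Function.update_of_ne h, Pi.single_eq_of_ne h]

/-- The operator `∑ i, 1 ⊗ f ⊗ ⋯ ⊗ g ⊗ ⋯ ⊗ f`, with `g` in the `i`-th place and the signs for a map
`f` of even degree and a map `g` of parity `p`. -/
def leib (M : GrMod.{u, v'} k) (n : ℕ) {V : GrMod.{u, v} k} {W : GrMod.{u, w} k} (p : ZMod 2)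
    (f g : V →ₗ[k] W) : (M ⊗[k] (⨂[k] _ : Fin n, V)) →ₗ[k] (M ⊗[k] (⨂[k] _ : Fin n, W)) :=
  ∑ i, hmap M (fun _ => V) (fun _ => W) (Pi.single i p) (Function.update (fun _ => f) i g)

theorem leib_add (M : GrMod.{u, v'} k) (n : ℕ) {V : GrMod.{u, v} k} {W : GrMod.{u, w} k}
    (p : ZMod 2) (f g g' : V →ₗ[k] W) :
    leib M n p f (g + g') = leib M n p f g + leib M n p f g' := by
  simp only [leib, ← hmapMulti_apply, MultilinearMap.map_update_add, Finset.sum_add_distrib]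

theorem leib_smul (M : GrMod.{u, v'} k) (n : ℕ) {V : GrMod.{u, v} k} {W : GrMod.{u, w} k}
    (p : ZMod 2) (c : k) (f g : V →ₗ[k] W) :
    leib M n p f (c • g) = c • leib M n p f g := by
  simp only [leib, ← hmapMulti_apply, MultilinearMap.map_update_smul, Finset.smul_sum]

theorem leib_sub (M : GrMod.{u, v'} k) (n : ℕ) {V : GrMod.{u, v} k} {W : GrMod.{u, w} k}
    (p : ZMod 2) (f g g' : V →ₗ[k] W) :
    leib M n p f (g - g') = leib M n p f g - leib M n p f g' := by
  simp only [leib, ← hmapMulti_apply, MultilinearMap.map_update_sub, Finset.sum_sub_distrib]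

theorem leib_zero (M : GrMod.{u, v'} k) (n : ℕ) {V : GrMod.{u, v} k} {W : GrMod.{u, w} k}
    (p : ZMod 2) (f : V →ₗ[k] W) : leib M n p f 0 = 0 := by
  have := leib_smul M n p (0 : k) f 0
  rwa [zero_smul, zero_smul] at this

theorem map_eps_piDer (M : GrMod.{u, v'} k) (n : ℕ) {V : GrMod.{u, v} k} (D : V →ₗ[k] V) :
    TensorProduct.map M.eps (piDer (fun _ : Fin n => V) fun _ => D) =
      leib M n 1 LinearMap.id D := by
  rw [leib, piDer]
  have : ∀ {ι : Type} (s : Finset ι) (f : ι → (⨂[k] _ : Fin n, V) →ₗ[k] ⨂[k] _ : Fin n, V),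
      TensorProduct.map M.eps (∑ i ∈ s, f i) = ∑ i ∈ s, TensorProduct.map M.eps (f i) :=
    fun s f => map_sum (TensorProduct.mapBilinear (RingHom.id k) M (⨂[k] _ : Fin n, V) M
      (⨂[k] _ : Fin n, V) M.eps) f s
  rw [this]
  refine Finset.sum_congr rfl fun i _ => ?_
  rw [hmap_single]
  congr 2
  funext j
  by_cases h : j = i
  · subst h
    rw [if_neg (lt_irrefl _), if_neg (lt_irrefl _), if_pos rfl, Function.update_self,
      LinearMap.comp_id]
  · rw [Function.update_of_ne h, LinearMap.id_comp, if_neg h]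

theorem map_comp_leib (M : GrMod.{u, v'} k) (n : ℕ) {V : GrMod.{u, v} k} {W : GrMod.{u, w} k}
    {X : GrMod.{u, w'} k} (p : ZMod 2) (f g : V →ₗ[k] W) (h : W →ₗ[k] X) :
    TensorProduct.map LinearMap.id (PiTensorProduct.map fun _ => h) ∘ₗ leib M n p f g =
      leib M n p (h ∘ₗ f) (h ∘ₗ g) := by
  rw [leib, leib, comp_sum]
  refine Finset.sum_congr rfl fun i _ => ?_
  rw [map_comp_hmap]
  congr 1
  funext j
  by_cases hj : j = i
  · subst hj; rw [Function.update_self, Function.update_self]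
  · rw [Function.update_of_ne hj, Function.update_of_ne hj]

theorem leib_comp_map (M : GrMod.{u, v'} k) (n : ℕ) {V : GrMod.{u, v} k} {W : GrMod.{u, w} k}
    {X : GrMod.{u, w'} k} (p : ZMod 2) (f g : W →ₗ[k] X) {h : V →ₗ[k] W}
    (hh : IsDeg V.deg W.deg h 0) :
    leib M n p f g ∘ₗ TensorProduct.map LinearMap.id (PiTensorProduct.map fun _ => h) =
      leib M n p (f ∘ₗ h) (g ∘ₗ h) := by
  rw [leib, leib, sum_comp]
  refine Finset.sum_congr rfl fun i _ => ?_
  rw [hmap_comp_map _ _ fun _ => hh]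
  congr 1
  funext j
  by_cases hj : j = i
  · subst hj; rw [Function.update_self, Function.update_self]
  · rw [Function.update_of_ne hj, Function.update_of_ne hj]

end Leibniz

section Coderivations

variable {k : Type u} [Field k] [CharZero k] {C : Cooperad.{u, v} k} {A : GrMod.{u, w} k}
  {B : GrMod.{u, w'} k}

/-- A map `V` to `C(B)` that satisfies the co-Leibniz rule along `U` is determined by its
projection to `B`. -/
theorem eq_zero_of_leib {p : ZMod 2} {U V : cofree C A →ₗ[k] cofree C B}
    (hV : ∀ m, comul C B m ∘ₗ V = leib (C.obj m) m p U V ∘ₗ comul C A m)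
    (h : proj C B ∘ₗ V = 0) : V = 0 := by
  refine LinearMap.ext fun x => cofree_eq_of_map_proj fun m => ?_
  have h1 := LinearMap.congr_fun (hV m) x
  rw [LinearMap.comp_apply, LinearMap.comp_apply] at h1
  rw [h1, ← LinearMap.comp_apply, map_comp_leib, h, leib_zero, LinearMap.zero_apply,
    LinearMap.zero_apply, LinearMap.map_zero, LinearMap.map_zero]

/-- The co-Leibniz rule in terms of the operators `leib`. -/
theorem isCoderivation_iff {Q : cofree C A →ₗ[k] cofree C A} :
    IsCoderivation C Q ↔ IsDeg (cofree C A).deg (cofree C A).deg Q 1 ∧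
      ∀ m, comul C A m ∘ₗ Q = leib (C.obj m) m 1 LinearMap.id Q ∘ₗ comul C A m :=
  ⟨fun h => ⟨h.deg, fun m => by rw [h.comul, map_eps_piDer]⟩,
    fun h => ⟨h.1, fun m => by rw [h.2, map_eps_piDer]⟩⟩

theorem sgn_comp_cls (n : ℕ) (p : ZMod 2) :
    (cofree C A).sgn p ∘ₗ cls C A n = cls C A n ∘ₗ (tenMod C A n).sgn p := by
  have : IsDeg (tenMod C A n).deg (cofree C A).deg (cls C A n) 0 := isDeg_cls C A n
  rw [GrMod.sgn_comp_of_isDeg this, Int.cast_zero, mul_zero, ks_zero, one_smul]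

theorem hmap_comul_cls_congr {m N : ℕ} (p : Fin m → ZMod 2)
    {f g : Fin m → cofree C A →ₗ[k] B}
    (h : ∀ j, ∀ i ≤ N, f j ∘ₗ cls C A i = g j ∘ₗ cls C A i) (t : Ten C A N) :
    hmap (C.obj m) (fun _ => cofree C A) (fun _ => B) p f (comul C A m (cls C A N t)) =
      hmap (C.obj m) (fun _ => cofree C A) (fun _ => B) p g
        (comul C A m (cls C A N t)) := by
  rw [hmap, hmap]
  refine map_comul_cls_congr _ (fun j i hi => ?_) t
  rw [LinearMap.comp_assoc, LinearMap.comp_assoc, sgn_comp_cls, ← LinearMap.comp_assoc,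
    ← LinearMap.comp_assoc, h j i hi]

theorem hmap_comul_cls_eq_zero {m N : ℕ} (p : Fin m → ZMod 2)
    {f : Fin m → cofree C A →ₗ[k] B}
    (h : ∀ r : Fin m → ℕ, ∑ j, r j = N → ∃ j, f j ∘ₗ cls C A (r j) = 0) (t : Ten C A N) :
    hmap (C.obj m) (fun _ => cofree C A) (fun _ => B) p f (comul C A m (cls C A N t)) =
      0 := by
  rw [hmap]
  refine map_comul_cls_eq_zero _ (fun r hr => ?_) t
  obtain ⟨j, hj⟩ := h r hr
  refine ⟨j, ?_⟩
  rw [LinearMap.comp_assoc, sgn_comp_cls, ← LinearMap.comp_assoc, hj, LinearMap.zero_comp]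

/-- The coderivation with projection `q` is the sum of the convolutions of `n - 1` copies of the
projection with `q`, divided by `n!`. -/
theorem coder_eq_aritySum {q : cofree C A →ₗ[k] A} (hq : IsDeg (cofree C A).deg A.deg q 1) :
    coder C q = aritySum C A fun n => (n.factorial : k)⁻¹ •
      ∑ i, conv C A A n (Function.update (fun _ => proj C A) i q) := by
  rw [coder]
  congr 1
  funext m
  congr 1
  have h1 : ∀ i : Fin m, conv C A A m (Function.update (fun _ => proj C A) i q) =
      cls C A m ∘ₗ TensorProduct.map (C.obj m).eps (PiTensorProduct.map fun j =>
        if j < i then proj C A ∘ₗ (cofree C A).eps else if j = i then q else proj C A) ∘ₗ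
      comul C A m := by
    intro i
    rw [conv_apply, tensorMap_eq_hmap _ _ _ (isDeg_update (isDeg_proj C A) hq i), cast_single,
      Int.cast_one, hmap_single]
    congr 3
    refine congrArg _ (funext fun j => ?_)
    by_cases h : j = i
    · subst h
      rw [if_neg (lt_irrefl _), if_neg (lt_irrefl _), if_pos rfl, Function.update_self,
        LinearMap.comp_id]
    · rw [Function.update_of_ne h, if_neg h]
      split_ifs
      · rfl
      · rw [LinearMap.comp_id]
  simp only [h1]
  rw [← comp_sum, ← sum_comp]
  congr 2
  exact map_sum (TensorProduct.mapBilinear (RingHom.id k) _ _ _ _ (C.obj m).eps) _ _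

theorem coder_cls {q : cofree C A →ₗ[k] A} (hq : IsDeg (cofree C A).deg A.deg q 1) {N K : ℕ}
    (hK : N ≤ K) (t : Ten C A N) : coder C q (cls C A N t) =
      (∑ n : Fin (K + 1), ((n : ℕ).factorial : k)⁻¹ •
        ∑ i, conv C A A n (Function.update (fun _ => proj C A) i q)) (cls C A N t) := by
  rw [coder_eq_aritySum hq, aritySum_cls _ _ hK, LinearMap.sum_apply]
  intro n i h
  rw [LinearMap.smul_comp, sum_comp, Finset.sum_eq_zero, smul_zero]
  exact fun _ _ => conv_comp_cls_of_lt h _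

/-- The identity as the sum of convolutions of copies of the projection, divided by factorials. -/
theorem cls_eq_sum_conv {N K : ℕ} (hK : N ≤ K) (t : Ten C A N) : cls C A N t =
      (∑ n : Fin (K + 1), ((n : ℕ).factorial : k)⁻¹ • conv C A A n fun _ => proj C A)
        (cls C A N t) := by
  have := coalgLift_cls (isDeg_proj C A) hK t
  rw [coalgLift_proj, LinearMap.id_apply] at this
  rw [LinearMap.sum_apply]
  exact this

theorem proj_comp_coder {q : cofree C A →ₗ[k] A} (hq : IsDeg (cofree C A).deg A.deg q 1) :
    proj C A ∘ₗ coder C q = q := by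
  refine cofree_ext C fun N t => ?_
  rw [LinearMap.comp_apply, coder_cls hq (Nat.le_succ N), LinearMap.sum_apply, map_sum,
    Finset.sum_eq_single (⟨1, by omega⟩ : Fin (N + 1 + 1))]
  · have h0 : (Function.update (fun _ : Fin 1 => proj C A) 0 q) 0 = q := Function.update_self _ _ _
    have h1 := LinearMap.congr_fun (proj_conv_one (p := 1)
      (f := Function.update (fun _ : Fin 1 => proj C A) 0 q) (by rw [h0]; exact hq)) (cls C A N t)
    rw [h0, LinearMap.comp_apply] at h1
    rw [LinearMap.smul_apply, LinearMap.map_smul, LinearMap.sum_apply]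
    change ((Nat.factorial 1 : ℕ) : k)⁻¹ • proj C A (∑ i : Fin 1, conv C A A 1
      (Function.update (fun _ => proj C A) i q) (cls C A N t)) = _
    rw [Fin.sum_univ_one, h1, Nat.factorial_one, Nat.cast_one, inv_one, one_smul]
  · intro n _ hn
    rw [LinearMap.smul_apply, LinearMap.map_smul, LinearMap.sum_apply, map_sum,
      Finset.sum_eq_zero, smul_zero]
    intro i _
    exact LinearMap.congr_fun (proj_conv_of_ne (C := C) (A := A) (n := n)
      (fun h => hn (Fin.ext h)) _) (cls C A N t)
  · simp

/-- The span of the components of `C(A)` of arity at most `N`. -/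
def arityLE (C : Cooperad.{u, v} k) (A : GrMod.{u, w} k) (N : ℕ) : Submodule k (cofree C A) :=
  ⨆ i ∈ Set.Iic N, LinearMap.range (cls C A i)

theorem cls_mem_arityLE {i N : ℕ} (h : i ≤ N) (t : Ten C A i) : cls C A i t ∈ arityLE C A N :=
  Submodule.mem_iSup_of_mem i (Submodule.mem_iSup_of_mem h (LinearMap.mem_range_self _ t))

theorem eq_zero_of_mem_arityLE {M : Type*} [AddCommGroup M] [Module k M] {f : cofree C A →ₗ[k] M}
    {N : ℕ} (hf : ∀ i ≤ N, f ∘ₗ cls C A i = 0) {x : cofree C A} (hx : x ∈ arityLE C A N) :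
    f x = 0 := by
  have : arityLE C A N ≤ LinearMap.ker f := by
    refine iSup₂_le fun i hi => ?_
    rintro _ ⟨t, rfl⟩
    exact LinearMap.congr_fun (hf i hi) t
  exact this hx

/-- Coderivations do not raise arities. -/
theorem coder_cls_mem {q : cofree C A →ₗ[k] A} (hq : IsDeg (cofree C A).deg A.deg q 1) {N : ℕ}
    (t : Ten C A N) : coder C q (cls C A N t) ∈ arityLE C A N := by
  rw [coder_cls hq le_rfl, LinearMap.sum_apply]
  refine Submodule.sum_mem _ fun n _ => ?_
  rw [LinearMap.smul_apply, LinearMap.sum_apply]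
  refine Submodule.smul_mem _ _ (Submodule.sum_mem _ fun i _ => ?_)
  rw [conv_apply]
  exact cls_mem_arityLE (Nat.le_of_lt_succ n.2) _

theorem regroupExp_single {m n : ℕ} (r : Fin m → ℕ) (e : (Σ j, Fin (r j)) ≃ Fin n) (i : Fin n)
    (a : ZMod 2) : regroupExp r e 0 (Pi.single i a) = 0 := by
  unfold regroupExp
  simp only [Pi.zero_apply, zero_mul, ite_self, Finset.sum_const_zero, zero_add]
  refine Finset.sum_eq_zero fun x _ => Finset.sum_eq_zero fun y _ => ?_
  split_ifs with h
  · by_cases hx : e x = i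
    · rw [Pi.single_eq_of_ne (fun hy : e y = i => h.1.ne (hx.trans hy.symm)), mul_zero]
    · rw [Pi.single_eq_of_ne hx, zero_mul]
  · rfl

theorem sum_single_sigma {m n : ℕ} {r : Fin m → ℕ} (e : (Σ j, Fin (r j)) ≃ Fin n)
    (y : Σ j, Fin (r j)) (a : ZMod 2) :
    (fun j => ∑ s, (Pi.single (e y) a : Fin n → ZMod 2) (e ⟨j, s⟩)) = Pi.single y.1 a := by
  funext j
  have h : ∀ s, (Pi.single (e y) a : Fin n → ZMod 2) (e ⟨j, s⟩) =
      if (⟨j, s⟩ : Σ j, Fin (r j)) = y then a else 0 := fun s => by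
    rw [Pi.single_apply]
    exact if_congr e.injective.eq_iff rfl rfl
  simp only [h]
  obtain ⟨j₀, s₀⟩ := y
  by_cases hj : j = j₀
  · subst hj
    rw [Pi.single_eq_same, Finset.sum_eq_single s₀]
    · rw [if_pos rfl]
    · intro s _ hs
      refine if_neg fun h => hs ?_
      simpa using h
    · exact fun h => absurd (Finset.mem_univ _) h
  · rw [Pi.single_eq_of_ne hj]
    exact Finset.sum_eq_zero fun s _ => if_neg fun h => hj (congrArg Sigma.fst h)

theorem update_sigma {m n : ℕ} {X X' : Type*} {r : Fin m → ℕ} (e : (Σ j, Fin (r j)) ≃ Fin n)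
    (x x' : X) (T : ∀ n, (Fin n → X) → X') (j₀ : Fin m) (s₀ : Fin (r j₀)) :
    (fun j => T (r j) fun s => Function.update (fun _ => x) (e ⟨j₀, s₀⟩) x' (e ⟨j, s⟩)) =
      Function.update (fun j => T (r j) fun _ => x) j₀
        (T (r j₀) (Function.update (fun _ => x) s₀ x')) := by
  funext j
  by_cases hj : j = j₀
  · subst hj
    rw [Function.update_self]
    congr 1
    funext s
    by_cases hs : s = s₀
    · subst hs; rw [Function.update_self, Function.update_self]
    · rw [Function.update_of_ne hs, Function.update_of_ne fun h => hs ?_]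
      simpa using e.injective h
  · rw [Function.update_of_ne hj]
    congr 1
    funext s
    rw [Function.update_of_ne fun h => hj (congrArg Sigma.fst (e.injective h))]

/-- A map of degree one to the cogenerators extends to a coderivation. -/
theorem isCoderivation_coder {q : cofree C A →ₗ[k] A}
    (hq : IsDeg (cofree C A).deg A.deg q 1) : IsCoderivation C (coder C q) := by
  refine isCoderivation_iff.2 ⟨isDeg_coder C hq, fun m => cofree_ext C fun N t => ?_⟩
  -- the contribution of the trees whose upper vertices have `r 0, …, r (m - 1)` inputs
  let X : (Fin m → ℕ) → C.obj m ⊗[k] (⨂[k] _ : Fin m, cofree C A) := fun r =>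
    ∑ y : (Σ j, Fin (r j)), hmap (C.obj m) (fun _ => cofree C A) (fun _ => cofree C A)
      (Pi.single y.1 1) (Function.update (fun j => conv C A A (r j) fun _ => proj C A) y.1
        (conv C A A (r y.1) (Function.update (fun _ => proj C A) y.2 q)))
      (comul C A m (cls C A N t))
  have h1 : ∀ n : Fin (N + 1), comul C A m ((∑ i, conv C A A n
      (Function.update (fun _ => proj C A) i q)) (cls C A N t)) =
      ∑ r : Fin m → Fin (N + 1), (∏ j, ((r j : ℕ).factorial : k))⁻¹ •
        ∑ _e : (Σ j, Fin (r j)) ≃ Fin n, X fun j => r j := by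
    intro n
    have h : ∀ i, comul C A m (conv C A A n (Function.update (fun _ => proj C A) i q)
        (cls C A N t)) = ∑ r : Fin m → Fin (N + 1), (∏ j, ((r j : ℕ).factorial : k))⁻¹ •
        ∑ e : (Σ j, Fin (r j)) ≃ Fin n,
          hmap (C.obj m) (fun _ => cofree C A) (fun _ => cofree C A)
            (fun j => ∑ s, (Pi.single i 1 : Fin n → ZMod 2) (e ⟨j, s⟩))
            (fun j => conv C A A (r j) fun s =>
              Function.update (fun _ => proj C A) i q (e ⟨j, s⟩))
            (comul C A m (cls C A N t)) := by
      intro i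
      have h := LinearMap.congr_fun (comul_conv m (Nat.le_of_lt_succ n.2)
        (isDeg_update (isDeg_proj C A) hq i)) (cls C A N t)
      have hc : ∀ x, (((Pi.single i 1 : Fin n → ℤ) x : ℤ) : ZMod 2) =
          (Pi.single i 1 : Fin n → ZMod 2) x := fun x => by
        rw [congrFun (cast_single i 1) x, Int.cast_one]
      simp only [hc, regroupExp_single, ks_zero, one_smul] at h
      rw [LinearMap.comp_apply] at h
      rw [h, LinearMap.sum_apply]
      simp only [LinearMap.smul_apply, LinearMap.sum_apply, LinearMap.comp_apply]
    rw [LinearMap.sum_apply, map_sum]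
    simp only [h]
    rw [Finset.sum_comm]
    refine Finset.sum_congr rfl fun r _ => ?_
    rw [← Finset.smul_sum, Finset.sum_comm]
    congr 1
    refine Finset.sum_congr rfl fun e _ => ?_
    rw [← e.sum_comp]
    refine Finset.sum_congr rfl fun y _ => ?_
    rw [sum_single_sigma, update_sigma e _ _ (fun n => conv C A A n)]
  have h2 : ∀ r : Fin m → ℕ, N < ∑ j, r j → X r = 0 := by
    intro r hr
    refine Finset.sum_eq_zero fun y _ => ?_
    refine hmap_comul_cls_eq_zero _ (fun s hs => ?_) t
    obtain ⟨j, -, hj⟩ : ∃ j ∈ Finset.univ, s j < r j :=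
      Finset.exists_lt_of_sum_lt (by rw [hs]; exact hr)
    refine ⟨j, ?_⟩
    by_cases h : j = y.1
    · subst h
      rw [Function.update_self]
      exact conv_comp_cls_of_lt hj _
    · rw [Function.update_of_ne h]
      exact conv_comp_cls_of_lt hj _
  -- the weights by which the identity and the coderivation are sums of convolutions
  let w : Fin m → Fin m → ℕ → (cofree C A →ₗ[k] cofree C A) := fun i j n =>
    (n.factorial : k)⁻¹ • if j = i then
      ∑ s, conv C A A n (Function.update (fun _ => proj C A) s q) else
      conv C A A n fun _ => proj C A
  have h3 : ∀ i : Fin m, hmap (C.obj m) (fun _ => cofree C A) (fun _ => cofree C A)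
      (Pi.single i 1) (Function.update (fun _ => LinearMap.id) i (coder C q))
      (comul C A m (cls C A N t)) = ∑ r : Fin m → Fin (N + 1),
        (∏ j, ((r j : ℕ).factorial : k))⁻¹ • ∑ s : Fin (r i),
          hmap (C.obj m) (fun _ => cofree C A) (fun _ => cofree C A)
          (Pi.single i 1) (Function.update (fun j => conv C A A (r j) fun _ => proj C A) i
            (conv C A A (r i) (Function.update (fun _ => proj C A) s q)))
          (comul C A m (cls C A N t)) := by
    intro i
    have hw : ∀ j, ∀ l ≤ N, Function.update (fun _ => LinearMap.id) i (coder C q) j ∘ₗ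
        cls C A l = (∑ n : Fin (N + 1), w i j n) ∘ₗ cls C A l := by
      intro j l hl
      refine LinearMap.ext fun t => ?_
      rw [LinearMap.comp_apply, LinearMap.comp_apply]
      by_cases h : j = i
      · subst h
        simp only [w, if_true]
        rw [Function.update_self, coder_cls hq hl]
      · simp only [w, if_neg h]
        rw [Function.update_of_ne h, LinearMap.id_apply, ← cls_eq_sum_conv hl]
    have hw' : ∀ r : Fin m → ℕ, (fun j => w i j (r j)) = fun j => ((r j).factorial : k)⁻¹ •
        Function.update (fun j => conv C A A (r j) fun _ => proj C A) i
          (∑ s, conv C A A (r i) (Function.update (fun _ => proj C A) s q)) j := by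
      intro r
      funext j
      simp only [w]
      congr 1
      by_cases h : j = i
      · subst h; rw [Function.update_self, if_pos rfl]
      · rw [Function.update_of_ne h, if_neg h]
    rw [hmap_comul_cls_congr _ hw, ← hmapMulti_apply, MultilinearMap.map_sum, LinearMap.sum_apply]
    refine Finset.sum_congr rfl fun r _ => ?_
    rw [hw' fun j => r j, MultilinearMap.map_smul_univ, MultilinearMap.map_update_sum,
      LinearMap.smul_apply, LinearMap.sum_apply, Finset.prod_inv_distrib]
    rfl
  rw [LinearMap.comp_apply, coder_cls hq le_rfl, LinearMap.sum_apply, map_sum]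
  simp only [LinearMap.smul_apply, LinearMap.map_smul, h1]
  rw [sum_factorial_smul X h2, LinearMap.comp_apply, leib, LinearMap.sum_apply,
    Finset.sum_congr rfl fun i _ => h3 i, Finset.sum_comm]
  refine Finset.sum_congr rfl fun r _ => ?_
  rw [← Finset.smul_sum]
  congr 1
  exact Fintype.sum_sigma _

theorem coder_eq_of_proj {Q : cofree C A →ₗ[k] cofree C A} (hQ : IsCoderivation C Q) :
    coder C (proj C A ∘ₗ Q) = Q := by
  have hq : IsDeg (cofree C A).deg A.deg (proj C A ∘ₗ Q) 1 :=
    (isDeg_proj C A).comp hQ.deg (add_zero 1)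
  have h1 := (isCoderivation_iff.1 (isCoderivation_coder hq)).2
  have h2 := (isCoderivation_iff.1 hQ).2
  refine sub_eq_zero.1 (eq_zero_of_leib (p := 1) (U := LinearMap.id) (fun m => ?_) ?_)
  · rw [LinearMap.comp_sub, leib_sub, LinearMap.sub_comp, h1, h2]
  · rw [LinearMap.comp_sub, proj_comp_coder hq, sub_self]

theorem coder_comp_cls_eq_zero {q : cofree C A →ₗ[k] A} (hq : IsDeg (cofree C A).deg A.deg q 1)
    {N : ℕ} (h : ∀ i ≤ N, q ∘ₗ cls C A i = 0) : coder C q ∘ₗ cls C A N = 0 := by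
  refine LinearMap.ext fun t => cofree_eq_of_map_proj fun m => ?_
  have h1 := LinearMap.congr_fun ((isCoderivation_iff.1 (isCoderivation_coder hq)).2 m)
    (cls C A N t)
  rw [LinearMap.comp_apply, LinearMap.comp_apply] at h1
  rw [LinearMap.comp_apply, h1, ← LinearMap.comp_apply, map_comp_leib, leib, LinearMap.sum_apply,
    LinearMap.zero_apply, map_zero, map_zero]
  refine Finset.sum_eq_zero fun i _ => hmap_comul_cls_eq_zero _ (fun r hr => ⟨i, ?_⟩) t
  rw [Function.update_self, proj_comp_coder hq]
  exact h _ (hr ▸ Finset.single_le_sum (fun _ _ => Nat.zero_le _) (Finset.mem_univ i))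

end Coderivations

/-! ### Codifferentials -/

section CooperadDifferential

variable {k : Type u} [Field k] [CharZero k] {C : Cooperad.{u, v} k}

theorem regroupExp_add_single {m n : ℕ} (r : Fin m → ℕ) (e : (Σ j, Fin (r j)) ≃ Fin n)
    (c : Fin m → ZMod 2) (d : Fin n → ZMod 2) (i : Fin m) :
    regroupExp r e (fun j => c j + (Pi.single i 1 : Fin m → ZMod 2) j) d +
        ∑ j, (if j < i then c j else 0) =
      regroupExp r e c d + ∑ j, if j < i then c j + ∑ s, d (e ⟨j, s⟩) else 0 := by
  have h : ∑ j, ∑ x : (Σ j, Fin (r j)),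
      (if x.1 < j then (Pi.single i 1 : Fin m → ZMod 2) j * d (e x) else 0) =
      ∑ j, if j < i then ∑ s, d (e ⟨j, s⟩) else 0 := by
    rw [Finset.sum_eq_single i]
    · rw [Fintype.sum_sigma]
      refine Finset.sum_congr rfl fun j _ => ?_
      split_ifs <;> simp
    · intro j _ hj
      exact Finset.sum_eq_zero fun x _ => by rw [Pi.single_eq_of_ne hj, zero_mul, ite_self]
    · exact fun h => absurd (Finset.mem_univ _) h
  have h1 : ∀ j, ∀ x : (Σ j, Fin (r j)),
      (if x.1 < j then (c j + (Pi.single i 1 : Fin m → ZMod 2) j) * d (e x) else 0) =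
      (if x.1 < j then c j * d (e x) else 0) +
        if x.1 < j then (Pi.single i 1 : Fin m → ZMod 2) j * d (e x) else 0 := by
    intro j x
    split_ifs
    · rw [add_mul]
    · rw [add_zero]
  have h2 : ∀ j, (if j < i then c j + ∑ s, d (e ⟨j, s⟩) else 0) =
      (if j < i then c j else 0) + if j < i then ∑ s, d (e ⟨j, s⟩) else 0 := by
    intro j
    split_ifs
    · rfl
    · rw [add_zero]
  unfold regroupExp
  simp only [h1, h2, Finset.sum_add_distrib, h]
  abel

theorem piMap_eps_tprod {n : ℕ} (V : Fin n → GrMod.{u, v} k) (D : ∀ j, V j →ₗ[k] V j) (i : Fin n)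
    {d : Fin n → ℤ} {v : ∀ j, V j} (hv : ∀ j, v j ∈ (V j).deg (d j)) :
    PiTensorProduct.map (fun j => if j < i then (V j).eps else if j = i then D j else
      LinearMap.id) (PiTensorProduct.tprod k v) =
      ks k (∑ j, if j < i then (d j : ZMod 2) else 0) •
        PiTensorProduct.tprod k (Function.update v i (D i (v i))) := by
  have h : (fun j => (if j < i then (V j).eps else if j = i then D j else LinearMap.id) (v j)) =
      fun j => ks k (if j < i then (d j : ZMod 2) else 0) •
        Function.update v i (D i (v i)) j := by
    funext j
    by_cases h1 : j < i
    · rw [if_pos h1, if_pos h1, Function.update_of_ne h1.ne, GrMod.eps_of_mem _ (hv j)]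
    · rw [if_neg h1, if_neg h1, ks_zero, one_smul]
      by_cases h2 : j = i
      · subst h2; rw [if_pos rfl, Function.update_self]
      · rw [if_neg h2, Function.update_of_ne h2, LinearMap.id_apply]
  rw [PiTensorProduct.map_tprod, h, MultilinearMap.map_smul_univ, ks_sum]

theorem update_mem {n : ℕ} {V : Fin n → GrMod.{u, v} k} {D : ∀ j, V j →ₗ[k] V j}
    (hD : ∀ j, IsDeg (V j).deg (V j).deg (D j) 1) (i : Fin n) {d : Fin n → ℤ} {v : ∀ j, V j}
    (hv : ∀ j, v j ∈ (V j).deg (d j)) (j : Fin n) :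
    Function.update v i (D i (v i)) j ∈ (V j).deg (d j + (Pi.single i 1 : Fin n → ℤ) j) := by
  by_cases h : j = i
  · subst h
    rw [Function.update_self, Pi.single_eq_same]
    exact hD j _ _ (hv j)
  · rw [Function.update_of_ne h, Pi.single_eq_of_ne h, add_zero]
    exact hv j

/-- The differential of `C(n) ⊗ A ⊗ ⋯ ⊗ A` induced by the differential of `C(n)`. -/
def dTen (C : Cooperad.{u, v} k) (V : GrMod.{u, w} k) (n : ℕ) : Ten C V n →ₗ[k] Ten C V n :=
  TensorProduct.map (C.d n) LinearMap.id

/-- Rearrangements are compatible with the differentials of the factors `C(r j)`. -/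
theorem regroup_piDer {m n : ℕ} (V : GrMod.{u, w} k) (r : Fin m → ℕ)
    (e : (Σ j, Fin (r j)) ≃ Fin n) :
    regroup (fun j => C.obj (r j)) (fun _ => V) r e ∘ₗ
      TensorProduct.map (piDer (fun j => C.obj (r j)) fun j => C.d (r j)) LinearMap.id =
    piDer (fun j => tenMod C V (r j)) (fun j => dTen C V (r j)) ∘ₗ
      regroup (fun j => C.obj (r j)) (fun _ => V) r e := by
  refine tprod_tmul_ext fun γ δ c a hc ha => ?_
  have hca : ∀ j, c j ⊗ₜ[k] PiTensorProduct.tprod k (fun s => a (e ⟨j, s⟩)) ∈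
      (tenMod C V (r j)).deg (γ j + ∑ s, δ (e ⟨j, s⟩)) := fun j =>
    GrMod.tmul_mem (V := C.obj (r j)) (W := GrMod.pi fun _ : Fin (r j) => V) (hc j)
      (GrMod.tprod_mem fun s => ha _)
  rw [LinearMap.comp_apply, LinearMap.comp_apply, TensorProduct.map_tmul, piDer, piDer,
    LinearMap.sum_apply, LinearMap.sum_apply, TensorProduct.sum_tmul, map_sum]
  refine Finset.sum_congr rfl fun i _ => ?_
  rw [piMap_eps_tprod _ _ i hc, ← TensorProduct.smul_tmul', LinearMap.map_smul, LinearMap.id_apply,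
    regroup_tmul' _ _ _ _ _ _ _ _ (update_mem (fun j => C.d_deg (r j)) i hc) ha,
    regroup_tmul' _ _ _ _ γ δ c a hc ha, LinearMap.map_smul]
  have h3 := piMap_eps_tprod (fun j => tenMod C V (r j)) (fun j => dTen C V (r j)) i hca
  refine Eq.trans ?_ (congrArg _ h3).symm
  have h4 : (fun j => Function.update c i (C.d (r i) (c i)) j ⊗ₜ[k]
      PiTensorProduct.tprod k fun s => a (e ⟨j, s⟩)) =
      Function.update (fun j => c j ⊗ₜ[k] PiTensorProduct.tprod k fun s => a (e ⟨j, s⟩)) i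
        (dTen C V (r i) (c i ⊗ₜ[k] PiTensorProduct.tprod k fun s => a (e ⟨i, s⟩))) := by
    funext j
    by_cases h : j = i
    · subst h; rw [Function.update_self, Function.update_self]; rfl
    · rw [Function.update_of_ne h, Function.update_of_ne h]
  have h5 := regroupExp_add_single r e (fun j => (γ j : ZMod 2)) (fun x => (δ x : ZMod 2)) i
  have h6 : (fun j => ((γ j + (Pi.single i 1 : Fin m → ℤ) j : ℤ) : ZMod 2)) =
      fun j => (γ j : ZMod 2) + (Pi.single i 1 : Fin m → ZMod 2) j := by
    funext j
    rw [Int.cast_add, congrFun (cast_single i 1) j, Int.cast_one]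
  have h7 : ∀ j, ((γ j + ∑ s, δ (e ⟨j, s⟩) : ℤ) : ZMod 2) =
      (γ j : ZMod 2) + ∑ s, (δ (e ⟨j, s⟩) : ZMod 2) := fun j => by push_cast; rfl
  simp only [h7]
  rw [h4, h6, smul_smul, smul_smul, ← ks_add, ← ks_add, add_comm, h5]

theorem map_assoc_add {M R W Z : Type*} [AddCommMonoid M] [Module k M] [AddCommMonoid R]
    [Module k R] [AddCommMonoid W] [Module k W] [AddCommMonoid Z] [Module k Z]
    (S S' : M →ₗ[k] M) (T : R →ₗ[k] R) (T' : Z →ₗ[k] Z) (ρ : (R ⊗[k] W) →ₗ[k] Z)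
    (h : ρ ∘ₗ TensorProduct.map T LinearMap.id = T' ∘ₗ ρ) (σ : M ⊗[k] R) (w : W) :
    TensorProduct.map LinearMap.id ρ (TensorProduct.assoc k _ _ _
      ((TensorProduct.map S LinearMap.id + TensorProduct.map S' T : M ⊗[k] R →ₗ[k] M ⊗[k] R) σ
        ⊗ₜ w)) =
    (TensorProduct.map S LinearMap.id + TensorProduct.map S' T' : M ⊗[k] Z →ₗ[k] M ⊗[k] Z)
      (TensorProduct.map LinearMap.id ρ (TensorProduct.assoc k _ _ _ (σ ⊗ₜ w))) := by
  induction σ using TensorProduct.induction_on with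
  | zero => simp only [TensorProduct.zero_tmul, map_zero]
  | add x y hx hy => simp only [TensorProduct.add_tmul, map_add, hx, hy]
  | tmul c b =>
    have h' := LinearMap.congr_fun h (b ⊗ₜ w)
    simp only [LinearMap.comp_apply, TensorProduct.map_tmul, LinearMap.id_apply] at h'
    simp only [LinearMap.add_apply, TensorProduct.map_tmul, LinearMap.id_apply,
      TensorProduct.add_tmul, map_add, TensorProduct.assoc_tmul, h']

/-- The decomposition along a tree is compatible with the differential of the cooperad. -/
theorem treeMap_dTen {m n : ℕ} (V : GrMod.{u, w} k) (r : Fin m → ℕ)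
    (e : (Σ j, Fin (r j)) ≃ Fin n) :
    treeMap C V r e ∘ₗ dTen C V n =
      (TensorProduct.map (C.d m) LinearMap.id + TensorProduct.map (C.obj m).eps
        (piDer (fun j => tenMod C V (r j)) fun j => dTen C V (r j))) ∘ₗ treeMap C V r e := by
  refine TensorProduct.ext' fun c a => ?_
  have h : C.decomp r e (C.d n c) = _ := LinearMap.congr_fun (C.decomp_d r e) c
  have h' : dTen C V n (c ⊗ₜ a) = C.d n c ⊗ₜ a := rfl
  rw [LinearMap.comp_apply, LinearMap.comp_apply, h', treeMap_tmul, treeMap_tmul, h]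
  exact map_assoc_add _ _ _ _ _ (regroup_piDer V r e) _ a

theorem piMap_comp_piDer {n : ℕ} {V : Fin n → GrMod.{u, v} k} {W : Fin n → GrMod.{u, w} k}
    {D : ∀ j, V j →ₗ[k] V j} {D' : ∀ j, W j →ₗ[k] W j} {f : ∀ j, V j →ₗ[k] W j}
    (hf : ∀ j, IsDeg (V j).deg (W j).deg (f j) 0) (h : ∀ j, f j ∘ₗ D j = D' j ∘ₗ f j) :
    PiTensorProduct.map f ∘ₗ piDer V D = piDer W D' ∘ₗ PiTensorProduct.map f := by
  rw [piDer, piDer, comp_sum, sum_comp]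
  refine Finset.sum_congr rfl fun i _ => ?_
  rw [← PiTensorProduct.map_comp, ← PiTensorProduct.map_comp]
  congr 1
  funext j
  split_ifs
  · rw [GrMod.eps_comp_of_isDeg (hf j), Int.cast_zero, ks_zero, one_smul]
  · exact h j
  · rfl

variable {A : GrMod.{u, w} k}

theorem cooperadDiff_comp_cls (n : ℕ) :
    cooperadDiff C A ∘ₗ cls C A n = cls C A n ∘ₗ dTen C A n :=
  LinearMap.ext fun t => by rw [LinearMap.comp_apply, cooperadDiff, cofreeElim_cls]; rfl

theorem map_comp_add {M P Q : Type*} [AddCommMonoid M] [Module k M] [AddCommMonoid P] [Module k P]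
    [AddCommMonoid Q] [Module k Q] (S S' : M →ₗ[k] M) {T : P →ₗ[k] P} {T' : Q →ₗ[k] Q}
    {κ : P →ₗ[k] Q} (h : κ ∘ₗ T = T' ∘ₗ κ) :
    (TensorProduct.map LinearMap.id κ ∘ₗ (TensorProduct.map S LinearMap.id +
        TensorProduct.map S' T : M ⊗[k] P →ₗ[k] M ⊗[k] P) : M ⊗[k] P →ₗ[k] M ⊗[k] Q) =
      (TensorProduct.map S LinearMap.id + TensorProduct.map S' T' : M ⊗[k] Q →ₗ[k] M ⊗[k] Q) ∘ₗ
        TensorProduct.map LinearMap.id κ := by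
  refine TensorProduct.ext' fun c b => ?_
  have h' := LinearMap.congr_fun h b
  rw [LinearMap.comp_apply, LinearMap.comp_apply] at h'
  simp only [LinearMap.comp_apply, LinearMap.add_apply, TensorProduct.map_tmul,
    LinearMap.id_apply, map_add, h']

theorem comulTerm_dTen {m n : ℕ} (r : Fin m → ℕ) (e : (Σ j, Fin (r j)) ≃ Fin n) :
    comulTerm C A r e ∘ₗ dTen C A n =
      (TensorProduct.map (C.d m) LinearMap.id + TensorProduct.map (C.obj m).eps
        (piDer (fun _ => cofree C A) fun _ => cooperadDiff C A)) ∘ₗ comulTerm C A r e := by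
  have h := piMap_comp_piDer (V := fun j => tenMod C A (r j)) (W := fun _ => cofree C A)
    (f := fun j => cls C A (r j)) (D := fun j => dTen C A (r j))
    (D' := fun _ => cooperadDiff C A) (fun j => isDeg_cls C A (r j)) fun j =>
      (cooperadDiff_comp_cls (r j)).symm
  rw [comulTerm_eq, LinearMap.comp_assoc, treeMap_dTen, ← LinearMap.comp_assoc,
    map_comp_add (C.d m) (C.obj m).eps h, LinearMap.comp_assoc]

/-- `D` is a coderivation of degree one of the dg `C`-coalgebra `C(A)`: it satisfies the co-Leibniz
rule that involves the differential of `C`. -/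
structure IsDgCoderivation (D : cofree C A →ₗ[k] cofree C A) : Prop where
  deg : IsDeg (cofree C A).deg (cofree C A).deg D 1
  comul : ∀ m, comul C A m ∘ₗ D =
    (TensorProduct.map (C.d m) LinearMap.id + leib (C.obj m) m 1 LinearMap.id D) ∘ₗ comul C A m

/-- The differential of `C(A)` that is induced by that of `C` satisfies the dg co-Leibniz rule. -/
theorem isDgCoderivation_cooperadDiff : IsDgCoderivation (cooperadDiff C A) := by
  refine ⟨isDeg_cooperadDiff C A, fun m => cofree_ext C fun n t => ?_⟩
  have h := LinearMap.congr_fun (cooperadDiff_comp_cls (C := C) (A := A) n) t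
  rw [LinearMap.comp_apply, LinearMap.comp_apply] at h
  have h' : ∀ (r : Fin m → ℕ) (e : (Σ j, Fin (r j)) ≃ Fin n), comulTerm C A r e (dTen C A n t) =
      _ := fun r e => LinearMap.congr_fun (comulTerm_dTen (C := C) (A := A) r e) t
  rw [← map_eps_piDer, LinearMap.comp_apply, LinearMap.comp_apply, h, comul_cls C A m le_rfl,
    comul_cls C A m le_rfl, map_sum]
  refine Finset.sum_congr rfl fun r _ => ?_
  rw [LinearMap.map_smul, map_sum]
  congr 1
  exact Finset.sum_congr rfl fun e _ => h' _ e

theorem proj_comp_cooperadDiff : proj C A ∘ₗ cooperadDiff C A = 0 := by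
  refine cofree_ext C fun n t => ?_
  have h := LinearMap.congr_fun (cooperadDiff_comp_cls (C := C) (A := A) n) t
  rw [LinearMap.comp_apply, LinearMap.comp_apply] at h
  rw [LinearMap.comp_apply, h, LinearMap.zero_apply]
  by_cases hn : n = 1
  · subst hn
    rw [proj_cls_one', dTen, ← LinearMap.comp_apply (TensorProduct.map _ _),
      ← TensorProduct.map_comp, C.counit_d, TensorProduct.map_zero_left, LinearMap.zero_apply,
      map_zero]
  · exact LinearMap.congr_fun (proj_comp_cls hn) _

theorem IsDgCoderivation.add_coderivation {D Q : cofree C A →ₗ[k] cofree C A}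
    (hD : IsDgCoderivation D) (hQ : IsCoderivation C Q) : IsDgCoderivation (D + Q) :=
  ⟨hD.deg.add hQ.deg, fun m => by
    rw [LinearMap.comp_add, hD.comul, (isCoderivation_iff.1 hQ).2, leib_add, ← add_assoc,
      LinearMap.add_comp _ (leib (C.obj m) m 1 LinearMap.id Q)]⟩

theorem isDgCoderivation_cofreeDiff {d : A →ₗ[k] A} (hd : IsDeg A.deg A.deg d 1) :
    IsDgCoderivation (cofreeDiff C d) :=
  isDgCoderivation_cooperadDiff.add_coderivation
    (isCoderivation_coder (hd.comp (isDeg_proj C A) (zero_add 1)))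

theorem proj_comp_cofreeDiff {d : A →ₗ[k] A} (hd : IsDeg A.deg A.deg d 1) :
    proj C A ∘ₗ cofreeDiff C d = d ∘ₗ proj C A := by
  rw [cofreeDiff, LinearMap.comp_add, proj_comp_cooperadDiff, zero_add,
    proj_comp_coder (hd.comp (isDeg_proj C A) (zero_add 1))]

/-- Off-diagonal terms that are antisymmetric cancel. -/
theorem sum_eq_sum_diag_of_antisymm {M : Type*} [AddCommGroup M] [Module k M] {n : ℕ}
    (T : Fin n → Fin n → M) (h : ∀ i j, i ≠ j → T i j + T j i = 0) :
    ∑ i, ∑ j, T i j = ∑ i, T i i := by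
  have h1 : (∑ i, ∑ j, T i j) + ∑ i, ∑ j, T i j = ∑ i, T i i + ∑ i, T i i := by
    nth_rewrite 2 [Finset.sum_comm]
    simp only [← Finset.sum_add_distrib]
    refine Finset.sum_congr rfl fun i _ => ?_
    rw [Finset.sum_eq_single i]
    · exact fun j _ hj => h i j hj.symm
    · exact fun h => absurd (Finset.mem_univ _) h
  rw [← two_smul k, ← two_smul k] at h1
  exact smul_right_injective M (two_ne_zero (α := k)) h1

/-- The square of an odd derivation of the tensor powers: the mixed terms cancel, and `D ∘ D` is
left in each factor. -/
theorem leib_comp_leib (M : GrMod.{u, v'} k) (n : ℕ) {V : GrMod.{u, v} k} {D : V →ₗ[k] V}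
    (hD : IsDeg V.deg V.deg D 1) :
    leib M n 1 LinearMap.id D ∘ₗ leib M n 1 LinearMap.id D =
      leib M n 0 LinearMap.id (D ∘ₗ D) := by
  have h : ∀ i j : Fin n, hmap M (fun _ => V) (fun _ => V) (Pi.single i 1)
      (Function.update (fun _ => LinearMap.id) i D) ∘ₗ hmap M (fun _ => V) (fun _ => V)
      (Pi.single j 1) (Function.update (fun _ => LinearMap.id) j D) =
      ks k (if j < i then 1 else 0) • hmap M (fun _ => V) (fun _ => V)
        (fun l => (Pi.single j 1 : Fin n → ZMod 2) l + (Pi.single i 1 : Fin n → ZMod 2) l)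
        fun l => Function.update (fun _ => LinearMap.id) i D l ∘ₗ
          Function.update (fun _ => LinearMap.id) j D l := by
    intro i j
    have h1 := hmap_comp_hmap M (isDeg_update IsDeg.id hD j) (Pi.single i 1)
      (Function.update (fun _ => LinearMap.id) i D)
    have h2 : ∀ l, (((Pi.single j 1 : Fin n → ℤ) l : ℤ) : ZMod 2) =
        (Pi.single j 1 : Fin n → ZMod 2) l := fun l => by
      rw [congrFun (cast_single j 1) l, Int.cast_one]
    simp only [h2] at h1
    refine h1.trans ?_
    congr 2
    rw [Finset.sum_eq_single j, Finset.sum_eq_single i]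
    · rw [Pi.single_eq_same, Pi.single_eq_same, mul_one]
    · intro l _ hl
      rw [Pi.single_eq_of_ne hl, mul_zero, ite_self]
    · exact fun h => absurd (Finset.mem_univ _) h
    · intro l _ hl
      exact Finset.sum_eq_zero fun x _ => by rw [Pi.single_eq_of_ne hl, zero_mul, ite_self]
    · exact fun h => absurd (Finset.mem_univ _) h
  rw [leib, leib, sum_comp]
  simp only [comp_sum, h]
  rw [sum_eq_sum_diag_of_antisymm (k := k)]
  · refine Finset.sum_congr rfl fun i _ => ?_
    rw [if_neg (lt_irrefl i), ks_zero, one_smul]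
    congr 1
    · funext l
      rw [← Pi.add_apply, ← Pi.single_add]
      rfl
    · funext l
      by_cases hl : l = i
      · subst hl; rw [Function.update_self, Function.update_self]
      · rw [Function.update_of_ne hl, Function.update_of_ne hl, LinearMap.id_comp]
  · intro i j hij
    have h1 : (fun l => Function.update (fun _ => LinearMap.id) i D l ∘ₗ
        Function.update (fun _ => LinearMap.id) j D l) = fun l =>
        Function.update (fun _ => LinearMap.id) j D l ∘ₗ
          Function.update (fun _ => (LinearMap.id : V →ₗ[k] V)) i D l := by
      funext l
      by_cases hl : l = i
      · subst hl
        rw [Function.update_self, Function.update_of_ne hij, LinearMap.id_comp, LinearMap.comp_id]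
      · rw [Function.update_of_ne hl, LinearMap.id_comp, LinearMap.comp_id]
    have h2 : (fun l => (Pi.single j 1 : Fin n → ZMod 2) l + (Pi.single i 1 : Fin n → ZMod 2) l) =
        fun l => (Pi.single i 1 : Fin n → ZMod 2) l + (Pi.single j 1 : Fin n → ZMod 2) l :=
      funext fun l => add_comm _ _
    rw [h1, h2, ← add_smul]
    have h3 : ks k (if j < i then 1 else 0) + ks k (if i < j then 1 else 0) = 0 := by
      rcases lt_or_gt_of_ne hij with h | h
      · rw [if_neg h.not_gt, if_pos h, ks_zero, ks_one, add_neg_cancel]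
      · rw [if_neg h.not_gt, if_pos h, ks_zero, ks_one, neg_add_cancel]
    rw [h3, zero_smul]

/-- The differential of `C(m)` and an odd derivation of the tensor factors anticommute. -/
theorem map_d_comp_leib (m : ℕ) {V : GrMod.{u, w} k} (D : V →ₗ[k] V) :
    TensorProduct.map (C.d m) LinearMap.id ∘ₗ leib (C.obj m) m 1 LinearMap.id D +
      leib (C.obj m) m 1 LinearMap.id D ∘ₗ TensorProduct.map (C.d m) LinearMap.id = 0 := by
  have h : (C.obj m).eps ∘ₗ C.d m = -(C.d m ∘ₗ (C.obj m).eps) := by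
    rw [GrMod.eps_comp_of_isDeg (C.d_deg m), Int.cast_one, ks_one, neg_one_smul]
  rw [← map_eps_piDer, ← TensorProduct.map_comp, ← TensorProduct.map_comp, LinearMap.id_comp,
    LinearMap.comp_id, h, ← TensorProduct.map_add_left, add_neg_cancel,
    TensorProduct.map_zero_left]

/-- The square of an odd coderivation is an even coderivation, hence vanishes if its projection to
the cogenerators does. -/
theorem IsDgCoderivation.comp_self {D : cofree C A →ₗ[k] cofree C A} (hD : IsDgCoderivation D)
    (h : proj C A ∘ₗ D ∘ₗ D = 0) : D ∘ₗ D = 0 := by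
  refine eq_zero_of_leib (p := 0) (U := LinearMap.id) (fun m => ?_) h
  have h1 : TensorProduct.map (C.d m) (LinearMap.id : (⨂[k] _ : Fin m, cofree C A) →ₗ[k] _) ∘ₗ
      TensorProduct.map (C.d m) LinearMap.id = 0 := by
    rw [← TensorProduct.map_comp, C.d_comp_d, TensorProduct.map_zero_left]
  rw [← LinearMap.comp_assoc, hD.comul, LinearMap.comp_assoc, hD.comul, ← LinearMap.comp_assoc]
  congr 1
  rw [LinearMap.add_comp, LinearMap.comp_add, LinearMap.comp_add, h1, zero_add,
    leib_comp_leib _ _ hD.deg, ← add_assoc, map_d_comp_leib, zero_add]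

theorem cofreeDiff_comp_self {d : A →ₗ[k] A} (hd : IsDeg A.deg A.deg d 1) (h : d ∘ₗ d = 0) :
    cofreeDiff C d ∘ₗ cofreeDiff C d = 0 := by
  refine (isDgCoderivation_cofreeDiff hd).comp_self ?_
  rw [← LinearMap.comp_assoc, proj_comp_cofreeDiff hd, LinearMap.comp_assoc,
    proj_comp_cofreeDiff hd, ← LinearMap.comp_assoc, h, LinearMap.zero_comp]

namespace HoAlg

variable (A : HoAlg.{u, v, w} C)

/-- The codifferential `∂ + Q` of `C(A)`. -/
def codiff : cofree C A.space →ₗ[k] cofree C A.space := cofreeDiff C A.d + A.Q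

theorem isDgCoderivation_codiff : IsDgCoderivation A.codiff :=
  (isDgCoderivation_cofreeDiff A.isHoAlg.d_deg).add_coderivation A.isHoAlg.coderivation

theorem codiff_comp_codiff : A.codiff ∘ₗ A.codiff = 0 := by
  have h := A.isHoAlg.maurer_cartan
  have h1 := cofreeDiff_comp_self (C := C) A.isHoAlg.d_deg A.isHoAlg.d_comp_d
  rw [codiff, LinearMap.add_comp, LinearMap.comp_add, LinearMap.comp_add, h1, zero_add,
    ← add_assoc, h]

theorem proj_comp_codiff : proj C A.space ∘ₗ A.codiff =
    A.d ∘ₗ proj C A.space + proj C A.space ∘ₗ A.Q := by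
  rw [codiff, LinearMap.comp_add, proj_comp_cofreeDiff A.isHoAlg.d_deg]

end HoAlg

end CooperadDifferential

/-! ### The symmetric coalgebra -/

section Words

variable {k : Type u} [Field k] [CharZero k] {L : GrMod.{u, w} k} {L' : GrMod.{u, w'} k}

theorem gen_mem (n : ℕ) : gen k n ∈ ((coCom k).obj n).deg 0 := coComGen_mem k n

theorem coeff_gen {n : ℕ} (hn : n ≠ 0) : coeff k n (gen k n) = 1 := coComCoeff_gen_pos k hn

theorem coeff_smul_gen {n : ℕ} (c : (coCom k).obj n) : coeff k n c • gen k n = c :=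
  coComCoeff_smul k c

/-- `word`, as a multilinear map. -/
def wordMulti (L : GrMod.{u, w} k) (n : ℕ) : MultilinearMap k (fun _ : Fin n => L) (sym L) :=
  (cls (coCom k) L n ∘ₗ TensorProduct.mk k _ _ (gen k n)).compMultilinearMap
    (PiTensorProduct.tprod k)

theorem wordMulti_apply {n : ℕ} (x : Fin n → L) : wordMulti L n x = word x := rfl

theorem word_mem {n : ℕ} {x : Fin n → L} {p : Fin n → ℤ} (hx : ∀ i, x i ∈ L.deg (p i)) :
    word x ∈ (sym L).deg (∑ i, p i) := by
  have := cls_tmul_mem (C := coCom k) (gen_mem n) hx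
  rwa [zero_add] at this

theorem word_zero (x : Fin 0 → L) : word x = 0 := cls_zero _

theorem multilinear_ext_deg {n : ℕ} {M : Type*} [AddCommGroup M] [Module k M]
    {f g : MultilinearMap k (fun _ : Fin n => L) M}
    (h : ∀ (p : Fin n → ℤ) (x : Fin n → L), (∀ i, x i ∈ L.deg (p i)) → f x = g x) : f = g := by
  refine MultilinearMap.ext fun x => sub_eq_zero.1 ?_
  have := multilinear_mem (𝒱 := fun _ => L.deg) (f - g) ⊥ (fun p x hx => by
    change f x - g x ∈ _; rw [h p x hx, sub_self]; exact Submodule.zero_mem _) x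
    fun i => by rw [L.iSup_deg]; trivial
  exact (Submodule.mem_bot k).1 this

/-- Linear maps on `S(L)` are determined by their values on nonempty words of homogeneous
elements. -/
theorem sym_ext {M : Type*} [AddCommGroup M] [Module k M] {f g : sym L →ₗ[k] M}
    (h : ∀ (n : ℕ) (p : Fin n → ℤ) (x : Fin n → L), n ≠ 0 → (∀ i, x i ∈ L.deg (p i)) →
      f (word x) = g (word x)) : f = g := by
  refine cofree_ext _ fun n t => ?_
  have : f ∘ₗ cls (coCom k) L n = g ∘ₗ cls (coCom k) L n := by
    refine ten_ext fun i p c x _ hx => ?_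
    rw [← coeff_smul_gen c, ← TensorProduct.smul_tmul', LinearMap.map_smul, LinearMap.map_smul]
    congr 1
    rcases eq_or_ne n 0 with rfl | hn
    · have h0 := ten_zero (C := coCom k) (A := L) (gen k 0 ⊗ₜ PiTensorProduct.tprod k x)
      rw [h0, map_zero, map_zero]
    · exact h n p x hn hx
  exact LinearMap.congr_fun this t

/-- Degrees of linear maps on `S(L)` can be checked on words of homogeneous elements. -/
theorem isDeg_sym {M : Type*} [AddCommGroup M] [Module k M] {ℳ : ℤ → Submodule k M}
    {f : sym L →ₗ[k] M} {q : ℤ}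
    (h : ∀ (n : ℕ) (p : Fin n → ℤ) (x : Fin n → L), (∀ i, x i ∈ L.deg (p i)) →
      f (word x) ∈ ℳ ((∑ i, p i) + q)) : IsDeg (sym L).deg ℳ f q := by
  refine isDeg_cofree _ _ fun n => isDeg_of_span ?_
  rintro D _ ⟨i, j, c, a, hc, ha, rfl, rfl⟩
  rcases eq_or_ne i 0 with rfl | hi
  · rw [← coeff_smul_gen c, ← TensorProduct.smul_tmul', LinearMap.map_smul, zero_add]
    refine Submodule.smul_mem _ _ ?_
    induction ha using Submodule.span_induction with
    | zero => rw [TensorProduct.tmul_zero, map_zero]; exact Submodule.zero_mem _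
    | add x y _ _ hx hy => rw [TensorProduct.tmul_add, map_add]; exact Submodule.add_mem _ hx hy
    | smul b x _ hx => rw [TensorProduct.tmul_smul, map_smul]; exact Submodule.smul_mem _ _ hx
    | mem a ha =>
      obtain ⟨p, x, hx, rfl, rfl⟩ := ha
      exact h n p x hx
  · have : c = 0 := coComDeg_eq_zero k hi hc
    rw [this, TensorProduct.zero_tmul, map_zero]
    exact Submodule.zero_mem _

/-- A map given by symmetrizations, on a word of homogeneous elements. -/
theorem symElim_word {N : Type*} [AddCommGroup N] [Module k N]
    (φ : ∀ n, (⨂[k] _ : Fin n, L) →ₗ[k] N) {n : ℕ} (hn : n ≠ 0) {p : Fin n → ℤ} {x : Fin n → L}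
    (hx : ∀ i, x i ∈ L.deg (p i)) : symElim φ (word x) = (n.factorial : k)⁻¹ •
      ∑ σ : Equiv.Perm (Fin n), koszulSign k id σ.symm (fun i => (p i : ZMod 2)) •
        φ n (PiTensorProduct.tprod k fun i => x (σ i)) := by
  rw [symElim, word, cofreeElim_cls, symTen_tmul, coeff_gen hn, one_smul]
  congr 1
  refine Finset.sum_congr rfl fun σ _ => ?_
  rw [permPi_tprod _ σ p x hx, LinearMap.map_smul]

/-- The comultiplication `S(L) → S(L) ⊗ ⋯ ⊗ S(L)` with `m` factors. -/
def cop (L : GrMod.{u, w} k) (m : ℕ) : sym L →ₗ[k] ⨂[k] _ : Fin m, sym L :=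
  (TensorProduct.lid k _).toLinearMap ∘ₗ TensorProduct.map (coeff k m) LinearMap.id ∘ₗ
    comul (coCom k) L m

theorem lid_coeff_map (m : ℕ) {X Y : Type*} [AddCommMonoid X] [Module k X] [AddCommMonoid Y]
    [Module k Y] {S : (coCom k).obj m →ₗ[k] (coCom k).obj m} (hS : coeff k m ∘ₗ S = coeff k m)
    (G : X →ₗ[k] Y) (z : (coCom k).obj m ⊗[k] X) :
    TensorProduct.lid k Y (TensorProduct.map (coeff k m) LinearMap.id (TensorProduct.map S G z)) =
      G (TensorProduct.lid k X (TensorProduct.map (coeff k m) LinearMap.id z)) := by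
  induction z using TensorProduct.induction_on with
  | zero => simp only [map_zero]
  | add x y hx hy => simp only [map_add, hx, hy]
  | tmul c x =>
    have := LinearMap.congr_fun hS c
    rw [LinearMap.comp_apply] at this
    simp only [TensorProduct.map_tmul, TensorProduct.lid_tmul, LinearMap.id_apply, this,
      LinearMap.map_smul]

theorem coeff_comp_eps (m : ℕ) : coeff k m ∘ₗ ((coCom k).obj m).eps = coeff k m := by
  refine GrMod.ext_deg _ fun d c hc => ?_
  rw [LinearMap.comp_apply, GrMod.eps_of_mem _ hc]
  rcases eq_or_ne d 0 with rfl | hd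
  · rw [Int.cast_zero, ks_zero, one_smul]
  · have : c = 0 := coComDeg_eq_zero k hd hc
    rw [this, smul_zero]

theorem cop_eq_of_comul {m : ℕ} {U : sym L →ₗ[k] sym L'} {S : (coCom k).obj m →ₗ[k] (coCom k).obj m}
    (hS : coeff k m ∘ₗ S = coeff k m) {G : (⨂[k] _ : Fin m, sym L) →ₗ[k] ⨂[k] _ : Fin m, sym L'}
    (h : comul (coCom k) L' m ∘ₗ U = TensorProduct.map S G ∘ₗ comul (coCom k) L m) (x : sym L) :
    cop L' m (U x) = G (cop L m x) := by
  have h' := LinearMap.congr_fun h x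
  rw [LinearMap.comp_apply, LinearMap.comp_apply] at h'
  rw [cop, LinearMap.comp_apply, LinearMap.comp_apply, h']
  exact lid_coeff_map m hS G _

theorem cop_coderivation {Q : sym L →ₗ[k] sym L} (hQ : IsCoderivation (coCom k) Q) (m : ℕ)
    (x : sym L) : cop L m (Q x) = piDer (fun _ => sym L) (fun _ => Q) (cop L m x) :=
  cop_eq_of_comul (coeff_comp_eps m) (hQ.comul m) x

theorem cop_coalgHom {U : sym L →ₗ[k] sym L'} (hU : IsCoalgHom (coCom k) U) (m : ℕ)
    (x : sym L) : cop L' m (U x) = PiTensorProduct.map (fun _ => U) (cop L m x) :=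
  cop_eq_of_comul (LinearMap.comp_id _) (hU.comul m) x

theorem cop_eps (m : ℕ) (x : sym L) :
    cop L m ((sym L).eps x) = PiTensorProduct.map (fun _ => (sym L).eps) (cop L m x) := by
  refine cop_eq_of_comul (coeff_comp_eps m) ?_ x
  have h : IsDeg (sym L).deg (GrMod.tensor ((coCom k).obj m) (GrMod.pi fun _ : Fin m => sym L)).deg
      (comul (coCom k) L m) 0 := isDeg_comul (coCom k) L m
  have h1 := GrMod.eps_comp_of_isDeg h
  rw [Int.cast_zero, ks_zero, one_smul, ← GrMod.sgn_one, GrMod.tensor_sgn, GrMod.pi_sgn] at h1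
  rw [← h1]
  simp only [GrMod.sgn_one]

theorem comulTerm_word {m n : ℕ} (hn : n ≠ 0) (r : Fin m → ℕ) (e : (Σ j, Fin (r j)) ≃ Fin n)
    {p : Fin n → ℤ} {x : Fin n → L} (hx : ∀ i, x i ∈ L.deg (p i)) :
    comulTerm (coCom k) L r e (gen k n ⊗ₜ PiTensorProduct.tprod k x) =
      ks k (regroupExp r e 0 fun i => (p i : ZMod 2)) •
        (gen k m ⊗ₜ PiTensorProduct.tprod k fun j => word fun s => x (e ⟨j, s⟩)) := by
  have h : (coCom k).decomp r e (gen k n) =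
      gen k m ⊗ₜ PiTensorProduct.tprod k fun j => gen k (r j) :=
    (congrArg (fun a : k => a • (coComGen k m ⊗ₜ[k] PiTensorProduct.tprod k fun j =>
      coComGen k (r j))) (coComCoeff_gen_pos k hn)).trans (one_smul _ _)
  have h0 : (fun _ : Fin m => ((0 : ℤ) : ZMod 2)) = 0 := by
    funext; exact Int.cast_zero
  rw [comulTerm_tmul, h, TensorProduct.assoc_tmul, TensorProduct.map_tmul,
    regroup_tmul' _ _ r e (fun _ => 0) p _ _ (fun j => gen_mem (r j)) hx, TensorProduct.tmul_smul,
    LinearMap.map_smul, TensorProduct.map_tmul, PiTensorProduct.map_tprod, LinearMap.id_apply,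
    LinearMap.id_apply, h0]
  rfl

/-- The comultiplication of a word: the sum over all ways of distributing its letters. -/
theorem cop_word (m : ℕ) {n K : ℕ} (hn : n ≠ 0) (hK : n ≤ K) {p : Fin n → ℤ} {x : Fin n → L}
    (hx : ∀ i, x i ∈ L.deg (p i)) :
    cop L m (word x) = ∑ r : Fin m → Fin (K + 1), (∏ j, ((r j : ℕ).factorial : k))⁻¹ •
      ∑ e : (Σ j, Fin (r j)) ≃ Fin n,
        ks k (regroupExp (fun j => (r j : ℕ)) e 0 fun i => (p i : ZMod 2)) •
          PiTensorProduct.tprod k fun j => word fun s => x (e ⟨j, s⟩) := by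
  rw [cop, word, LinearMap.comp_apply, LinearMap.comp_apply, comul_cls _ _ _ hK, map_sum, map_sum]
  refine Finset.sum_congr rfl fun r _ => ?_
  rw [LinearMap.map_smul, LinearMap.map_smul, map_sum, map_sum]
  congr 1
  refine Finset.sum_congr rfl fun e _ => ?_
  have hm : m ≠ 0 := by
    rintro rfl
    exact (e.symm ⟨0, Nat.pos_of_ne_zero hn⟩).1.elim0
  rw [comulTerm_word hn _ e hx, LinearMap.map_smul, LinearMap.map_smul, TensorProduct.map_tmul,
    LinearEquiv.coe_coe, TensorProduct.lid_tmul, coeff_gen hm, one_smul, LinearMap.id_apply]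

end Words

/-! ### Families of coalgebra morphisms -/

section Families

variable {k : Type u} [Field k] [CharZero k] {C : Cooperad.{u, v} k} {A : GrMod.{u, w} k}
  {B : GrMod.{u, w'} k}

theorem regroupExp_trans_of_mono {m n : ℕ} (r : Fin m → ℕ) (e₀ : (Σ j, Fin (r j)) ≃ Fin n)
    (h : ∀ i i' : (Σ j, Fin (r j)), i.1 < i'.1 ∨ i.1 = i'.1 ∧ (i.2 : ℕ) < i'.2 ↔ e₀ i < e₀ i')
    (σ : Equiv.Perm (Fin n)) (p : Fin n → ZMod 2) :
    ks k (regroupExp r (e₀.trans σ) 0 p) = koszulSign k id σ.symm p := by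
  rw [koszulSign_eq_ks]
  congr 1
  unfold regroupExp
  simp only [Pi.zero_apply, zero_mul, ite_self, Finset.sum_const_zero, zero_add]
  rw [← (e₀.trans σ).sum_comp]
  refine Finset.sum_congr rfl fun i _ => ?_
  rw [← (e₀.trans σ).sum_comp]
  refine Finset.sum_congr rfl fun i' _ => ?_
  refine if_congr (and_congr Iff.rfl ((h i' i).trans ?_)) rfl rfl
  rw [Equiv.trans_apply, Equiv.trans_apply, Equiv.symm_apply_apply, Equiv.symm_apply_apply]

/-- The convolution is symmetric, up to Koszul signs. The factor `n!` comes from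
`cls_map_proj_comul_cls`, and the sum over permutations from the trees in `comul_conv` whose upper
vertices have one input. -/
theorem conv_symm {n : ℕ} {f : Fin n → cofree C A →ₗ[k] B} {p : Fin n → ℤ}
    (hf : ∀ i, IsDeg (cofree C A).deg B.deg (f i) (p i)) :
    conv C A B n f = (n.factorial : k)⁻¹ • ∑ σ : Equiv.Perm (Fin n),
      koszulSign k id σ.symm (fun i => (p i : ZMod 2)) • conv C A B n fun i => f (σ i) := by
  refine LinearMap.ext fun x => ?_
  have h1 : cls C B n (TensorProduct.map LinearMap.id (PiTensorProduct.map fun _ => proj C B)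
      (comul C B n (conv C A B n f x))) = (n.factorial : k) • conv C A B n f x := by
    rw [conv_apply, LinearMap.comp_apply]
    exact cls_map_proj_comul_cls _
  have h2 := LinearMap.congr_fun (comul_conv n (Nat.le_succ n) hf) x
  rw [LinearMap.comp_apply, LinearMap.sum_apply] at h2
  have h3 : ∀ (r : Fin n → ℕ) (e : (Σ j, Fin (r j)) ≃ Fin n),
      TensorProduct.map LinearMap.id (PiTensorProduct.map fun _ => proj C B)
        (hmap (C.obj n) (fun _ => cofree C A) (fun _ => cofree C B)
          (fun j => ∑ s, (p (e ⟨j, s⟩) : ZMod 2))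
          (fun j => conv C A B (r j) fun s => f (e ⟨j, s⟩)) (comul C A n x)) =
      hmap (C.obj n) (fun _ => cofree C A) (fun _ => B)
          (fun j => ∑ s, (p (e ⟨j, s⟩) : ZMod 2))
          (fun j => proj C B ∘ₗ conv C A B (r j) fun s => f (e ⟨j, s⟩)) (comul C A n x) :=
    fun r e => LinearMap.congr_fun (map_comp_hmap _ _ _ _) _
  rw [LinearMap.smul_apply, ← inv_smul_smul₀ (Nat.cast_ne_zero.2 (Nat.factorial_ne_zero n) :
    (n.factorial : k) ≠ 0) (conv C A B n f x), ← h1, h2, LinearMap.sum_apply]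
  congr 1
  simp only [LinearMap.smul_apply, LinearMap.sum_apply, map_sum, LinearMap.map_smul,
    LinearMap.comp_apply, h3]
  rw [Finset.sum_eq_single fun _ => (⟨1, by omega⟩ : Fin (n + 1 + 1))]
  · rw [sum_equiv_eq_sum_perm (Equiv.sigmaUnique (Fin n) fun _ => Fin 1)]
    have h4 : (∏ _j : Fin n, ((Nat.factorial 1 : ℕ) : k))⁻¹ = 1 := by simp
    refine (congrArg (· • _) h4).trans ((one_smul _ _).trans ?_)
    refine Finset.sum_congr rfl fun σ _ => ?_
    congr 1
    · refine regroupExp_trans_of_mono _ _ (fun i i' => ?_) σ _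
      obtain ⟨i, s⟩ := i
      obtain ⟨i', s'⟩ := i'
      change i < i' ∨ i = i' ∧ (s : ℕ) < s' ↔ i < i'
      refine ⟨fun h => h.elim id fun h => absurd h.2 ?_, Or.inl⟩
      have h1 : (s : ℕ) < 1 := s.2
      have h2 : (s' : ℕ) < 1 := s'.2
      omega
    · rw [conv_apply, LinearMap.comp_apply, LinearMap.comp_apply,
        tensorMap_eq_hmap _ _ _ fun i => hf (σ i)]
      congr 1
      have h5 : (fun j => ∑ s : Fin 1, (p (((Equiv.sigmaUnique (Fin n) fun _ => Fin 1).trans σ)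
          ⟨j, s⟩) : ZMod 2)) = fun j => (p (σ j) : ZMod 2) :=
        funext fun j => Fin.sum_univ_one _
      have h6 : (fun j => proj C B ∘ₗ conv C A B 1 fun s => f
          (((Equiv.sigmaUnique (Fin n) fun _ => Fin 1).trans σ) ⟨j, s⟩)) = fun j => f (σ j) :=
        funext fun j => proj_conv_one (f := fun _ => f (σ j)) (hf (σ j))
      exact congrArg₂ (fun a b => hmap (C.obj n) (fun _ => cofree C A) (fun _ => B) a b
        (comul C A n x)) h5 h6
  · intro r _ hr
    obtain ⟨j, hj⟩ := Function.ne_iff.1 hr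
    have hj' : (r j : ℕ) ≠ 1 := fun h => hj (Fin.ext h)
    rw [Finset.sum_eq_zero, smul_zero]
    intro e _
    rw [hmap, piMap_eq_zero _ j (by rw [proj_conv_of_ne hj', LinearMap.zero_comp]),
      TensorProduct.map_zero_right, LinearMap.zero_apply, map_zero, smul_zero]
  · exact fun h => absurd (Finset.mem_univ _) h

variable (C A B) in
/-- The linear map `S(Hom(C(A), B)) → Hom(C(A), C(B))` that sends a word `f 0 ⋯ f (n - 1)` to
`(1 ⊗ f 0 ⊗ ⋯ ⊗ f (n - 1)) Δ n`. -/
def convSym : sym (GrMod.hom (cofree C A) B) →ₗ[k] (cofree C A →ₗ[k] cofree C B) :=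
  symElim fun n => PiTensorProduct.lift
    ((conv C A B n).compLinearMap fun _ => homMap (cofree C A) B)

theorem conv_zero (f : Fin 0 → cofree C A →ₗ[k] B) : conv C A B 0 f = 0 :=
  LinearMap.ext fun _ => cls_zero _

/-- No symmetrization is visible on words, as the convolution is itself symmetric. -/
theorem convSym_word {n : ℕ} (f : Fin n → GrMod.hom (cofree C A) B) :
    convSym C A B (word f) = conv C A B n fun i => homMap (cofree C A) B (f i) := by
  rcases eq_or_ne n 0 with rfl | hn
  · rw [word_zero, map_zero, conv_zero]
  have : (convSym C A B).compMultilinearMap (wordMulti _ n) =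
      (conv C A B n).compLinearMap fun _ => homMap (cofree C A) B := by
    refine multilinear_ext_deg fun p f hf => ?_
    have h := conv_symm (C := C) (A := A) (B := B) (f := fun i => homMap (cofree C A) B (f i))
      fun i => homMap_mem (hf i)
    rw [LinearMap.compMultilinearMap_apply, wordMulti_apply, convSym, symElim_word _ hn hf,
      MultilinearMap.compLinearMap_apply, h]
    simp only [PiTensorProduct.lift.tprod]
    rfl
  exact congrArg (fun g => g f) this

/-- The maps of degree `p`, as a submodule. -/
def degSub (V : GrMod.{u, v} k) (W : GrMod.{u, w} k) (p : ℤ) : Submodule k (V →ₗ[k] W) where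
  carrier := {f | IsDeg V.deg W.deg f p}
  add_mem' hf hg := hf.add hg
  zero_mem' := fun _ _ _ => Submodule.zero_mem _
  smul_mem' c _ hf := hf.smul c

theorem mem_degSub {V : GrMod.{u, v} k} {W : GrMod.{u, w} k} {p : ℤ} {f : V →ₗ[k] W} :
    f ∈ degSub V W p ↔ IsDeg V.deg W.deg f p := Iff.rfl

theorem isDeg_convSym :
    IsDeg (sym (GrMod.hom (cofree C A) B)).deg (degSub (cofree C A) (cofree C B))
      (convSym C A B) 0 := by
  refine isDeg_sym fun n p f hf => ?_
  rw [convSym_word, add_zero]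
  exact isDeg_conv fun i => homMap_mem (hf i)

variable (C A B) in
/-- `tensorMap` on `C(m) ⊗ C(A) ⊗ ⋯ ⊗ C(A)`, as a linear map. -/
def tensorLift (m : ℕ) : (⨂[k] _ : Fin m, (cofree C A →ₗ[k] cofree C B)) →ₗ[k]
    ((C.obj m ⊗[k] (⨂[k] _ : Fin m, cofree C A)) →ₗ[k]
      (C.obj m ⊗[k] (⨂[k] _ : Fin m, cofree C B))) :=
  PiTensorProduct.lift (tensorMap (C.obj m) (cofree C A) (cofree C B) m)

theorem tensorLift_tprod {m : ℕ} (f : Fin m → cofree C A →ₗ[k] cofree C B) :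
    tensorLift C A B m (PiTensorProduct.tprod k f) =
      tensorMap (C.obj m) (cofree C A) (cofree C B) m f := PiTensorProduct.lift.tprod f

/-- A family `Θ` of maps `C(A) → C(B)`, parametrized by `S(L)`, is a family of coalgebra morphisms
if `S(L) ⊗ C(A) → C(B)` is a morphism of graded `C`-coalgebras. -/
structure IsCoalgFam {L : GrMod.{u, w''} k} (Θ : sym L →ₗ[k] (cofree C A →ₗ[k] cofree C B)) :
    Prop where
  deg : IsDeg (sym L).deg (degSub (cofree C A) (cofree C B)) Θ 0
  comul : ∀ m y, comul C B m ∘ₗ Θ y =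
    tensorLift C A B m (PiTensorProduct.map (fun _ => Θ) (cop L m y)) ∘ₗ comul C A m

/-- The map `S(Hom(C(A), B)) ⊗ C(A) → C(B)` is a morphism of coalgebras. -/
theorem isCoalgFam_convSym : IsCoalgFam (convSym C A B) := by
  refine ⟨isDeg_convSym, fun m y => ?_⟩
  have key : LinearMap.llcomp k _ _ _ (comul C B m) ∘ₗ convSym C A B =
      LinearMap.lcomp k _ (comul C A m) ∘ₗ tensorLift C A B m ∘ₗ
        PiTensorProduct.map (fun _ => convSym C A B) ∘ₗ cop _ m := by
    refine sym_ext fun n p f hn hf => ?_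
    have h1 := comul_conv m le_rfl (f := fun i => homMap (cofree C A) B (f i))
      fun i => homMap_mem (hf i)
    refine ((congrArg (fun g => comul C B m ∘ₗ g) (convSym_word f)).trans h1).trans ?_
    simp only [LinearMap.comp_apply]
    rw [cop_word m hn le_rfl hf, map_sum, map_sum, map_sum]
    refine Finset.sum_congr rfl fun r _ => ?_
    rw [LinearMap.map_smul, LinearMap.map_smul, LinearMap.map_smul, map_sum, map_sum, map_sum]
    congr 1
    refine Finset.sum_congr rfl fun e _ => ?_
    rw [LinearMap.map_smul, LinearMap.map_smul, LinearMap.map_smul, PiTensorProduct.map_tprod,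
      tensorLift_tprod]
    congr 1
    have h2 : (fun j => convSym C A B (word fun s : Fin (r j) => f (e ⟨j, s⟩))) =
        fun j => conv C A B (r j) fun s => homMap (cofree C A) B (f (e ⟨j, s⟩)) :=
      funext fun j => convSym_word _
    have h3 := tensorMap_eq_hmap (C.obj m) (cofree C A) (cofree C B)
      (f := fun j => conv C A B (r j) fun s => homMap (cofree C A) B (f (e ⟨j, s⟩)))
      (p := fun j => ∑ s, p (e ⟨j, s⟩)) fun j => isDeg_conv fun s => homMap_mem (hf _)
    rw [h2, h3]
    simp only [Int.cast_sum]
    rfl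
  exact LinearMap.congr_fun key y

end Families

/-! ### Families of coderivations -/

section TensorMaps

variable {k : Type u} [Field k] [CharZero k] {M : GrMod.{u, v'} k} {V : GrMod.{u, v} k}
  {W : GrMod.{u, v} k} {n : ℕ} {f : Fin n → V →ₗ[k] W} {p : Fin n → ℤ}

/-- An odd map composed with homogeneous maps on the left is moved past the maps to its left. -/
theorem leib_comp_tensorMap (hf : ∀ j, IsDeg V.deg W.deg (f j) (p j)) {D : W →ₗ[k] W}
    (hD : IsDeg W.deg W.deg D 1) :
    leib M n 1 LinearMap.id D ∘ₗ tensorMap M V W n f =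
      ∑ i, ks k (∑ j, if j < i then (p j : ZMod 2) else 0) •
        tensorMap M V W n (Function.update f i (D ∘ₗ f i)) := by
  rw [leib, sum_comp]
  refine Finset.sum_congr rfl fun i _ => ?_
  have h1 : ∀ j, IsDeg V.deg W.deg (Function.update f i (D ∘ₗ f i) j)
      (p j + (Pi.single i 1 : Fin n → ℤ) j) := by
    intro j
    by_cases h : j = i
    · subst h
      rw [Function.update_self, Pi.single_eq_same]
      exact hD.comp (hf j) rfl
    · rw [Function.update_of_ne h, Pi.single_eq_of_ne h, add_zero]
      exact hf j
  have h2 : (fun j => Function.update (fun _ => LinearMap.id) i D j ∘ₗ f j) =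
      Function.update f i (D ∘ₗ f i) := by
    funext j
    by_cases h : j = i
    · subst h; rw [Function.update_self, Function.update_self]
    · rw [Function.update_of_ne h, Function.update_of_ne h, LinearMap.id_comp]
  have h3 : (fun j => ((p j + (Pi.single i 1 : Fin n → ℤ) j : ℤ) : ZMod 2)) =
      fun j => (p j : ZMod 2) + (Pi.single i 1 : Fin n → ZMod 2) j := by
    funext j
    rw [Int.cast_add, congrFun (cast_single i 1) j, Int.cast_one]
  rw [tensorMap_eq_hmap _ _ _ h1, tensorMap_eq_hmap _ _ _ hf, h3]
  refine (hmap_comp_hmap M hf (Pi.single i 1) _).trans ?_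
  rw [h2]
  congr 2
  refine Finset.sum_congr rfl fun j _ => ?_
  rw [Finset.sum_eq_single i]
  · rw [Pi.single_eq_same, mul_one]
  · intro l _ hl
    rw [Pi.single_eq_of_ne hl, mul_zero, ite_self]
  · exact fun h => absurd (Finset.mem_univ _) h

/-- An odd map composed with homogeneous maps on the right is moved past the maps to its right. -/
theorem tensorMap_comp_leib (hf : ∀ j, IsDeg V.deg W.deg (f j) (p j)) {D : V →ₗ[k] V}
    (hD : IsDeg V.deg V.deg D 1) :
    tensorMap M V W n f ∘ₗ leib M n 1 LinearMap.id D =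
      ∑ i, ks k (∑ j, if i < j then (p j : ZMod 2) else 0) •
        tensorMap M V W n (Function.update f i (f i ∘ₗ D)) := by
  rw [leib, comp_sum]
  refine Finset.sum_congr rfl fun i _ => ?_
  have h1 : ∀ j, IsDeg V.deg W.deg (Function.update f i (f i ∘ₗ D) j)
      ((Pi.single i 1 : Fin n → ℤ) j + p j) := by
    intro j
    by_cases h : j = i
    · subst h
      rw [Function.update_self, Pi.single_eq_same]
      exact (hf j).comp hD rfl
    · rw [Function.update_of_ne h, Pi.single_eq_of_ne h, zero_add]
      exact hf j
  have h2 : (fun j => f j ∘ₗ Function.update (fun _ => LinearMap.id) i D j) =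
      Function.update f i (f i ∘ₗ D) := by
    funext j
    by_cases h : j = i
    · subst h; rw [Function.update_self, Function.update_self]
    · rw [Function.update_of_ne h, Function.update_of_ne h, LinearMap.comp_id]
  have h3 : (fun j => (((Pi.single i 1 : Fin n → ℤ) j + p j : ℤ) : ZMod 2)) =
      fun j => (((Pi.single i 1 : Fin n → ℤ) j : ℤ) : ZMod 2) + (p j : ZMod 2) := by
    funext j
    rw [Int.cast_add]
  rw [tensorMap_eq_hmap _ _ _ h1, tensorMap_eq_hmap _ _ _ hf, h3, ← Int.cast_one (R := ZMod 2),
    ← cast_single]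
  refine (hmap_comp_hmap M (isDeg_update IsDeg.id hD i) _ _).trans ?_
  rw [h2]
  congr 2
  rw [Finset.sum_eq_single i]
  · refine Finset.sum_congr rfl fun j _ => ?_
    rw [Pi.single_eq_same, Int.cast_one, one_mul]
  · intro l _ hl
    refine Finset.sum_eq_zero fun j _ => ?_
    rw [Pi.single_eq_of_ne hl, Int.cast_zero, zero_mul, ite_self]
  · exact fun h => absurd (Finset.mem_univ _) h

theorem map_comp_tensorMap_left (hf : ∀ j, IsDeg V.deg W.deg (f j) (p j)) {d : M →ₗ[k] M}
    (hd : IsDeg M.deg M.deg d 1) :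
    TensorProduct.map d LinearMap.id ∘ₗ tensorMap M V W n f =
      ks k (∑ j, (p j : ZMod 2)) • tensorMap M V W n f ∘ₗ TensorProduct.map d LinearMap.id := by
  rw [tensorMap_eq_hmap _ _ _ hf, hmap, ← TensorProduct.map_comp, ← TensorProduct.map_comp,
    LinearMap.id_comp, LinearMap.comp_id, GrMod.sgn_comp_of_isDeg hd, Int.cast_one, mul_one,
    TensorProduct.map_smul_left, smul_smul, ks_mul_self, one_smul]

theorem parPart_comp {X : GrMod.{u, w'} k} {h : W →ₗ[k] X} (hh : IsDeg W.deg X.deg h 0)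
    (q : ZMod 2) (g : V →ₗ[k] W) : parPart V X q (h ∘ₗ g) = h ∘ₗ parPart V W q g := by
  have h1 : ∀ q, X.par q ∘ₗ h = h ∘ₗ W.par q := by
    intro q
    refine W.ext_deg fun d x hx => ?_
    have hx' := hh d x hx
    rw [add_zero] at hx'
    rw [LinearMap.comp_apply, LinearMap.comp_apply, GrMod.par_of_mem _ hx, GrMod.par_of_mem _ hx',
      apply_ite h, map_zero]
  rw [parPart, parPart, LinearMap.sum_apply, LinearMap.sum_apply, comp_sum]
  refine Finset.sum_congr rfl fun i _ => ?_
  change (X.par (i + q) ∘ₗ h ∘ₗ g) ∘ₗ V.par i = h ∘ₗ (W.par (i + q) ∘ₗ g) ∘ₗ V.par i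
  have h2 : X.par (i + q) ∘ₗ h ∘ₗ g = h ∘ₗ W.par (i + q) ∘ₗ g := by
    rw [← LinearMap.comp_assoc, h1, LinearMap.comp_assoc]
  rw [h2]
  rfl

theorem map_comp_tensorMap {X : GrMod.{u, w'} k} {h : W →ₗ[k] X} (hh : IsDeg W.deg X.deg h 0)
    (f : Fin n → V →ₗ[k] W) :
    TensorProduct.map LinearMap.id (PiTensorProduct.map fun _ => h) ∘ₗ tensorMap M V W n f =
      tensorMap M V X n fun j => h ∘ₗ f j := by
  rw [tensorMap, tensorMap, sum_apply, sum_apply, comp_sum]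
  refine Finset.sum_congr rfl fun q _ => ?_
  change _ ∘ₗ TensorProduct.map (M.sgn _) (PiTensorProduct.map fun j => parPart V W (q j) (f j) ∘ₗ
    V.sgn _) = TensorProduct.map (M.sgn _) (PiTensorProduct.map fun j =>
      parPart V X (q j) (h ∘ₗ f j) ∘ₗ V.sgn _)
  rw [← TensorProduct.map_comp, ← PiTensorProduct.map_comp, LinearMap.id_comp]
  simp only [parPart_comp hh]
  rfl

end TensorMaps

/-! ### Derivations along families -/

section FamilyDerivations

variable {k : Type u} [Field k] [CharZero k] {C : Cooperad.{u, v} k} {A : GrMod.{u, w} k}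
  {B : GrMod.{u, w} k} {L : GrMod.{u, w''} k}

/-- The operators `∑ i, 1 ⊗ Θ ⊗ ⋯ ⊗ V ⊗ ⋯ ⊗ Θ`, with `V` of odd degree in the `i`-th place, for
families `Θ` and `V` parametrized by `S(L)`. -/
def derLift (Θ V : sym L →ₗ[k] (cofree C A →ₗ[k] cofree C B)) (m : ℕ) :
    (⨂[k] _ : Fin m, sym L) →ₗ[k]
      ((C.obj m ⊗[k] (⨂[k] _ : Fin m, cofree C A)) →ₗ[k]
        (C.obj m ⊗[k] (⨂[k] _ : Fin m, cofree C B))) :=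
  ∑ i, tensorLift C A B m ∘ₗ PiTensorProduct.map fun j =>
    if j < i then Θ ∘ₗ (sym L).eps else if j = i then V else Θ

theorem derLift_tprod (Θ V : sym L →ₗ[k] (cofree C A →ₗ[k] cofree C B)) {m : ℕ} {p : Fin m → ℤ}
    {y : Fin m → sym L} (hy : ∀ j, y j ∈ (sym L).deg (p j)) :
    derLift Θ V m (PiTensorProduct.tprod k y) =
      ∑ i, ks k (∑ j, if j < i then (p j : ZMod 2) else 0) •
        tensorMap (C.obj m) (cofree C A) (cofree C B) m
          (Function.update (fun j => Θ (y j)) i (V (y i))) := by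
  rw [derLift, LinearMap.sum_apply]
  refine Finset.sum_congr rfl fun i _ => ?_
  have h : (fun j => (if j < i then Θ ∘ₗ (sym L).eps else if j = i then V else Θ) (y j)) =
      fun j => ks k (if j < i then (p j : ZMod 2) else 0) •
        Function.update (fun j => Θ (y j)) i (V (y i)) j := by
    funext j
    by_cases h1 : j < i
    · rw [if_pos h1, if_pos h1, Function.update_of_ne h1.ne, LinearMap.comp_apply,
        GrMod.eps_of_mem _ (hy j), LinearMap.map_smul]
    · rw [if_neg h1, if_neg h1, ks_zero, one_smul]
      by_cases h2 : j = i
      · subst h2; rw [if_pos rfl, Function.update_self]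
      · rw [if_neg h2, Function.update_of_ne h2]
  rw [LinearMap.comp_apply, PiTensorProduct.map_tprod, h, tensorLift_tprod,
    MultilinearMap.map_smul_univ, ks_sum]

theorem derLift_sub (Θ V V' : sym L →ₗ[k] (cofree C A →ₗ[k] cofree C B)) (m : ℕ) :
    derLift Θ (V - V') m = derLift Θ V m - derLift Θ V' m := by
  refine pi_ext_deg fun p y hy => ?_
  rw [LinearMap.sub_apply, derLift_tprod Θ _ hy, derLift_tprod Θ _ hy, derLift_tprod Θ _ hy,
    ← Finset.sum_sub_distrib]
  refine Finset.sum_congr rfl fun i _ => ?_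
  rw [LinearMap.sub_apply, MultilinearMap.map_update_sub, smul_sub]

variable {Θ : sym L →ₗ[k] (cofree C A →ₗ[k] cofree C B)}

theorem IsDeg.apply_of_degSub (hΘ : IsDeg (sym L).deg (degSub (cofree C A) (cofree C B)) Θ 0)
    {p : ℤ} {y : sym L} (hy : y ∈ (sym L).deg p) :
    IsDeg (cofree C A).deg (cofree C B).deg (Θ y) p := by
  have := hΘ p y hy
  rwa [add_zero] at this

theorem leib_comp_tensorLift (hΘ : IsDeg (sym L).deg (degSub (cofree C A) (cofree C B)) Θ 0)
    {D : cofree C B →ₗ[k] cofree C B} (hD : IsDeg (cofree C B).deg (cofree C B).deg D 1) (m : ℕ)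
    (z : ⨂[k] _ : Fin m, sym L) :
    leib (C.obj m) m 1 LinearMap.id D ∘ₗ tensorLift C A B m (PiTensorProduct.map (fun _ => Θ) z) =
      derLift Θ (LinearMap.llcomp k _ _ _ D ∘ₗ Θ) m z := by
  suffices h : LinearMap.llcomp k _ _ _ (leib (C.obj m) m 1 LinearMap.id D) ∘ₗ
      tensorLift C A B m ∘ₗ PiTensorProduct.map (fun _ => Θ) =
        derLift Θ (LinearMap.llcomp k _ _ _ D ∘ₗ Θ) m from LinearMap.congr_fun h z
  refine pi_ext_deg fun p y hy => ?_
  rw [derLift_tprod Θ _ hy, LinearMap.comp_apply, LinearMap.comp_apply, PiTensorProduct.map_tprod,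
    tensorLift_tprod]
  exact leib_comp_tensorMap (fun j => hΘ.apply_of_degSub (hy j)) hD

theorem map_eps_tprod {m : ℕ} {p : Fin m → ℤ} {y : Fin m → sym L}
    (hy : ∀ j, y j ∈ (sym L).deg (p j)) :
    PiTensorProduct.map (fun _ => (sym L).eps) (PiTensorProduct.tprod k y) =
      ks k (∑ j, (p j : ZMod 2)) • PiTensorProduct.tprod k y := by
  rw [PiTensorProduct.map_tprod, ks_sum, ← MultilinearMap.map_smul_univ]
  congr 1
  funext j
  exact GrMod.eps_of_mem _ (hy j)

/-- Precomposition of a family with an odd derivation of the tensor factors, as a derivation along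
the family; the degree involution of the parameters accounts for the signs. -/
theorem tensorLift_comp_leib (hΘ : IsDeg (sym L).deg (degSub (cofree C A) (cofree C B)) Θ 0)
    {D : cofree C A →ₗ[k] cofree C A} (hD : IsDeg (cofree C A).deg (cofree C A).deg D 1) (m : ℕ)
    (z : ⨂[k] _ : Fin m, sym L) :
    tensorLift C A B m (PiTensorProduct.map (fun _ => Θ)
        (PiTensorProduct.map (fun _ => (sym L).eps) z)) ∘ₗ leib (C.obj m) m 1 LinearMap.id D =
      derLift Θ (LinearMap.lcomp k _ D ∘ₗ Θ ∘ₗ (sym L).eps) m z := by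
  suffices h : LinearMap.lcomp k _ (leib (C.obj m) m 1 LinearMap.id D) ∘ₗ
      tensorLift C A B m ∘ₗ PiTensorProduct.map (fun _ => Θ) ∘ₗ
        PiTensorProduct.map (fun _ => (sym L).eps) =
        derLift Θ (LinearMap.lcomp k _ D ∘ₗ Θ ∘ₗ (sym L).eps) m from LinearMap.congr_fun h z
  refine pi_ext_deg fun p y hy => ?_
  have h1 := tensorMap_comp_leib (M := C.obj m) (fun j => hΘ.apply_of_degSub (hy j)) hD
  rw [derLift_tprod Θ _ hy, LinearMap.comp_apply, LinearMap.comp_apply, LinearMap.comp_apply,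
    map_eps_tprod hy, LinearMap.map_smul, LinearMap.map_smul, LinearMap.map_smul,
    PiTensorProduct.map_tprod, tensorLift_tprod]
  refine (congrArg _ h1).trans ?_
  rw [Finset.smul_sum]
  refine Finset.sum_congr rfl fun i _ => ?_
  have h2 : (LinearMap.lcomp k (cofree C B) D ∘ₗ Θ ∘ₗ (sym L).eps) (y i) =
      ks k (p i : ZMod 2) • (Θ (y i) ∘ₗ D) := by
    rw [LinearMap.comp_apply, LinearMap.comp_apply, GrMod.eps_of_mem _ (hy i), LinearMap.map_smul,
      LinearMap.map_smul]
    rfl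
  rw [h2, MultilinearMap.map_update_smul, smul_smul, smul_smul, ← ks_add, ← ks_add]
  congr 2
  -- `∑ p j + ∑_{j > i} p j = ∑_{j < i} p j + p i` modulo two
  have h3 : (p i : ZMod 2) = ∑ j, if j = i then (p j : ZMod 2) else 0 := by simp
  rw [h3, ← Finset.sum_add_distrib, ← Finset.sum_add_distrib]
  refine Finset.sum_congr rfl fun j _ => ?_
  rcases lt_trichotomy i j with h | h | h
  · rw [if_pos h, if_neg h.not_gt, if_neg h.ne', add_zero, CharTwo.add_self_eq_zero]
  · rw [if_neg h.not_lt, if_neg h.not_gt, if_pos h.symm, add_zero, zero_add]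
  · rw [if_neg h.not_gt, if_pos h, if_neg h.ne, add_zero]

theorem map_comp_tensorLift (hΘ : IsDeg (sym L).deg (degSub (cofree C A) (cofree C B)) Θ 0) (m : ℕ)
    (z : ⨂[k] _ : Fin m, sym L) :
    TensorProduct.map (C.d m) LinearMap.id ∘ₗ
        tensorLift C A B m (PiTensorProduct.map (fun _ => Θ) z) =
      tensorLift C A B m (PiTensorProduct.map (fun _ => Θ)
        (PiTensorProduct.map (fun _ => (sym L).eps) z)) ∘ₗ
          TensorProduct.map (C.d m) LinearMap.id := by
  suffices h : LinearMap.llcomp k _ _ _ (TensorProduct.map (C.d m) LinearMap.id) ∘ₗ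
      tensorLift C A B m ∘ₗ PiTensorProduct.map (fun _ => Θ) =
        LinearMap.lcomp k _ (TensorProduct.map (C.d m) LinearMap.id) ∘ₗ
          tensorLift C A B m ∘ₗ PiTensorProduct.map (fun _ => Θ) ∘ₗ
            PiTensorProduct.map (fun _ => (sym L).eps) from LinearMap.congr_fun h z
  refine pi_ext_deg fun p y hy => ?_
  have h1 := map_comp_tensorMap_left (M := C.obj m) (fun j => hΘ.apply_of_degSub (hy j))
    (C.d_deg m)
  simp only [LinearMap.comp_apply]
  rw [map_eps_tprod hy, LinearMap.map_smul, LinearMap.map_smul, LinearMap.map_smul,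
    PiTensorProduct.map_tprod, tensorLift_tprod]
  exact h1

theorem tensorLift_piDer (Θ : sym L →ₗ[k] (cofree C A →ₗ[k] cofree C B)) (T : sym L →ₗ[k] sym L)
    (m : ℕ) (z : ⨂[k] _ : Fin m, sym L) :
    tensorLift C A B m (PiTensorProduct.map (fun _ => Θ) (piDer (fun _ => sym L) (fun _ => T) z)) =
      derLift Θ (Θ ∘ₗ T) m z := by
  rw [piDer, derLift, LinearMap.sum_apply, LinearMap.sum_apply, map_sum, map_sum]
  refine Finset.sum_congr rfl fun i _ => ?_
  rw [LinearMap.comp_apply, ← LinearMap.comp_apply (PiTensorProduct.map _),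
    ← PiTensorProduct.map_comp]
  congr 3
  funext j
  split_ifs <;> rfl

/-- A family of maps that satisfies the co-Leibniz rule along `Θ` is determined by its projection to
the cogenerators. -/
theorem eq_zero_of_derLift {V : sym L →ₗ[k] (cofree C A →ₗ[k] cofree C B)}
    (h : ∀ m y, comul C B m ∘ₗ V y = derLift Θ V m (cop L m y) ∘ₗ comul C A m)
    (hV : ∀ y, proj C B ∘ₗ V y = 0) : V = 0 := by
  refine LinearMap.ext fun y => LinearMap.ext fun x => cofree_eq_of_map_proj fun m => ?_
  have h1 : ∀ z, TensorProduct.map LinearMap.id (PiTensorProduct.map fun _ => proj C B) ∘ₗ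
      derLift Θ V m z = 0 := by
    suffices h : LinearMap.llcomp k _ _ _ (TensorProduct.map LinearMap.id
        (PiTensorProduct.map fun _ => proj C B)) ∘ₗ derLift Θ V m = 0 from
      LinearMap.congr_fun h
    refine pi_ext_deg fun p y hy => ?_
    rw [LinearMap.comp_apply, derLift_tprod Θ V hy, map_sum, LinearMap.zero_apply]
    refine Finset.sum_eq_zero fun i _ => ?_
    rw [LinearMap.map_smul]
    refine (congrArg _ (map_comp_tensorMap (isDeg_proj C B) _)).trans ?_
    rw [MultilinearMap.map_coord_zero _ i, smul_zero]
    rw [Function.update_self, hV]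
  have h2 := LinearMap.congr_fun (h m y) x
  have h3 := LinearMap.congr_fun (h1 (cop L m y)) (comul C A m x)
  rw [LinearMap.comp_apply, LinearMap.comp_apply] at h2
  rw [LinearMap.comp_apply] at h3
  rw [h2, h3, LinearMap.zero_apply, LinearMap.zero_apply, LinearMap.zero_apply, map_zero, map_zero]

/-- Families of coalgebra morphisms to `C(B)` are determined by their projections to `B`. -/
theorem IsCoalgFam.ext {Θ' : sym L →ₗ[k] (cofree C A →ₗ[k] cofree C B)} (hΘ : IsCoalgFam Θ)
    (hΘ' : IsCoalgFam Θ') (h : ∀ y, proj C B ∘ₗ Θ y = proj C B ∘ₗ Θ' y) : Θ = Θ' := by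
  refine LinearMap.ext fun y => LinearMap.ext fun x => cofree_eq_of_map_proj fun m => ?_
  have h1 : ∀ z, TensorProduct.map LinearMap.id (PiTensorProduct.map fun _ => proj C B) ∘ₗ
      tensorLift C A B m (PiTensorProduct.map (fun _ => Θ) z) =
      TensorProduct.map LinearMap.id (PiTensorProduct.map fun _ => proj C B) ∘ₗ
      tensorLift C A B m (PiTensorProduct.map (fun _ => Θ') z) := by
    suffices h : LinearMap.llcomp k _ _ _ (TensorProduct.map LinearMap.id
        (PiTensorProduct.map fun _ => proj C B)) ∘ₗ tensorLift C A B m ∘ₗ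
          PiTensorProduct.map (fun _ => Θ) = LinearMap.llcomp k _ _ _ (TensorProduct.map
        LinearMap.id (PiTensorProduct.map fun _ => proj C B)) ∘ₗ tensorLift C A B m ∘ₗ
          PiTensorProduct.map (fun _ => Θ') from LinearMap.congr_fun h
    refine pi_ext_deg fun p y _ => ?_
    simp only [LinearMap.comp_apply]
    rw [PiTensorProduct.map_tprod, PiTensorProduct.map_tprod, tensorLift_tprod, tensorLift_tprod]
    refine (map_comp_tensorMap (isDeg_proj C B) _).trans
      (Eq.trans ?_ (map_comp_tensorMap (isDeg_proj C B) _).symm)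
    simp only [h]
  have h2 := LinearMap.congr_fun (hΘ.comul m y) x
  have h2' := LinearMap.congr_fun (hΘ'.comul m y) x
  have h3 := LinearMap.congr_fun (h1 (cop L m y)) (HomotopyAlg.comul C A m x)
  rw [LinearMap.comp_apply, LinearMap.comp_apply] at h2 h2' h3
  rw [h2, h2', h3]

theorem IsCoalgFam.comp {L' : GrMod.{u, w'} k} (hΘ : IsCoalgFam Θ) {U : sym L' →ₗ[k] sym L}
    (hU : IsCoalgHom (coCom k) U) : IsCoalgFam (Θ ∘ₗ U) :=
  ⟨hΘ.deg.comp hU.deg (add_zero 0), fun m y => by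
    rw [LinearMap.comp_apply, hΘ.comul, cop_coalgHom hU, PiTensorProduct.map_comp,
      LinearMap.comp_apply]⟩

/-- A family of coalgebra morphisms commutes with codifferentials if it does so after projection to
the cogenerators. -/
theorem IsCoalgFam.codiff (hΘ : IsCoalgFam Θ) {T : sym L →ₗ[k] sym L}
    (hT : IsCoderivation (coCom k) T) {D : cofree C A →ₗ[k] cofree C A} (hD : IsDgCoderivation D)
    {D' : cofree C B →ₗ[k] cofree C B} (hD' : IsDgCoderivation D')
    (h : ∀ y, proj C B ∘ₗ Θ (T y) =
      proj C B ∘ₗ D' ∘ₗ Θ y - proj C B ∘ₗ Θ ((sym L).eps y) ∘ₗ D) (y : sym L) :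
    Θ (T y) = D' ∘ₗ Θ y - Θ ((sym L).eps y) ∘ₗ D := by
  have key : LinearMap.llcomp k _ _ _ D' ∘ₗ Θ - LinearMap.lcomp k _ D ∘ₗ Θ ∘ₗ (sym L).eps -
      Θ ∘ₗ T = 0 := by
    refine eq_zero_of_derLift (Θ := Θ) (fun m y => ?_) fun y => ?_
    · have h1 : (HomotopyAlg.comul C B m ∘ₗ D') ∘ₗ Θ y = (TensorProduct.map (C.d m) LinearMap.id ∘ₗ
          tensorLift C A B m (PiTensorProduct.map (fun _ => Θ) (cop L m y)) +
          leib (C.obj m) m 1 LinearMap.id D' ∘ₗ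
            tensorLift C A B m (PiTensorProduct.map (fun _ => Θ) (cop L m y))) ∘ₗ
          HomotopyAlg.comul C A m := by
        rw [hD'.comul, LinearMap.comp_assoc, hΘ.comul, ← LinearMap.comp_assoc, LinearMap.add_comp]
      have h2 : (HomotopyAlg.comul C B m ∘ₗ Θ ((sym L).eps y)) ∘ₗ D = (
          tensorLift C A B m (PiTensorProduct.map (fun _ => Θ)
            (PiTensorProduct.map (fun _ => (sym L).eps) (cop L m y))) ∘ₗ
              TensorProduct.map (C.d m) LinearMap.id +
          tensorLift C A B m (PiTensorProduct.map (fun _ => Θ)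
            (PiTensorProduct.map (fun _ => (sym L).eps) (cop L m y))) ∘ₗ
              leib (C.obj m) m 1 LinearMap.id D) ∘ₗ HomotopyAlg.comul C A m := by
        rw [hΘ.comul, cop_eps, LinearMap.comp_assoc, hD.comul, ← LinearMap.comp_assoc,
          LinearMap.comp_add]
      have h3 : HomotopyAlg.comul C B m ∘ₗ Θ (T y) =
          derLift Θ (Θ ∘ₗ T) m (cop L m y) ∘ₗ HomotopyAlg.comul C A m := by
        rw [hΘ.comul, cop_coderivation hT, tensorLift_piDer]
      rw [← map_comp_tensorLift hΘ.deg, tensorLift_comp_leib hΘ.deg hD.deg] at h2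
      rw [leib_comp_tensorLift hΘ.deg hD'.deg] at h1
      have h4 : HomotopyAlg.comul C B m ∘ₗ (LinearMap.llcomp k _ _ _ D' ∘ₗ Θ -
          LinearMap.lcomp k _ D ∘ₗ Θ ∘ₗ (sym L).eps - Θ ∘ₗ T) y =
          (HomotopyAlg.comul C B m ∘ₗ D') ∘ₗ Θ y -
            (HomotopyAlg.comul C B m ∘ₗ Θ ((sym L).eps y)) ∘ₗ D -
              HomotopyAlg.comul C B m ∘ₗ Θ (T y) := by
        rw [LinearMap.sub_apply, LinearMap.sub_apply, LinearMap.comp_sub, LinearMap.comp_sub]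
        rfl
      rw [h4, h1, h2, h3, derLift_sub, derLift_sub, LinearMap.sub_apply, LinearMap.sub_apply,
        ← LinearMap.sub_comp, ← LinearMap.sub_comp]
      congr 1
      abel
    · rw [LinearMap.sub_apply, LinearMap.sub_apply, LinearMap.comp_sub, LinearMap.comp_sub]
      refine sub_eq_zero.2 (Eq.trans ?_ (h y).symm)
      rfl
  have h1 := LinearMap.congr_fun key y
  rw [LinearMap.sub_apply, LinearMap.zero_apply, sub_eq_zero] at h1
  exact h1.symm

end FamilyDerivations

/-! ### Shifted Lie-infinity algebras -/

section CoCom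

variable {k : Type u} [Field k] [CharZero k] {L : GrMod.{u, w} k}

theorem proj_word_of_ne {n : ℕ} (hn : n ≠ 1) (x : Fin n → L) : proj (coCom k) L (word x) = 0 :=
  LinearMap.congr_fun (proj_comp_cls hn) _

theorem proj_word_one (x : Fin 1 → L) : proj (coCom k) L (word x) = x 0 := by
  rw [word, proj_cls_one]
  exact (congrArg (· • x 0) (coeff_gen one_ne_zero)).trans (one_smul _ _)

theorem symElim_cls {N : Type*} [AddCommGroup N] [Module k N]
    (φ : ∀ n, (⨂[k] _ : Fin n, L) →ₗ[k] N) {n : ℕ} (t : Ten (coCom k) L n) :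
    symElim φ (cls (coCom k) L n t) = symTen (φ n) t :=
  cofreeElim_cls (fun n => symTen (φ n)) _ n t

theorem IsCoderivation.add {C : Cooperad.{u, v} k} {Q Q' : cofree C L →ₗ[k] cofree C L}
    (hQ : IsCoderivation C Q) (hQ' : IsCoderivation C Q') : IsCoderivation C (Q + Q') := by
  rw [isCoderivation_iff] at *
  refine ⟨hQ.1.add hQ'.1, fun m => ?_⟩
  rw [LinearMap.comp_add, hQ.2, hQ'.2, leib_add, LinearMap.add_comp]

/-- As `coCom` has no differential, the differential of `S(L)` is the coderivation that extends `d`.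
-/
theorem cofreeDiff_coCom (d : L →ₗ[k] L) :
    cofreeDiff (coCom k) d = coder (coCom k) (d ∘ₗ proj (coCom k) L) := by
  have : cooperadDiff (coCom k) L = 0 := by
    refine cofree_ext (C := coCom k) fun n t => ?_
    have h1 : dTen (coCom k) L n = 0 := TensorProduct.map_zero_left _
    have h2 := LinearMap.congr_fun (cooperadDiff_comp_cls (C := coCom k) (A := L) n) t
    rw [h1, LinearMap.comp_zero] at h2
    exact h2
  rw [cofreeDiff, this, zero_add]

theorem eps_apply_of_isDeg {V : GrMod.{u, v} k} {W : GrMod.{u, w} k} {f : V →ₗ[k] W}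
    (hf : IsDeg V.deg W.deg f 0) (x : V) : W.eps (f x) = f (V.eps x) := by
  have := LinearMap.congr_fun (GrMod.eps_comp_of_isDeg hf) x
  rwa [Int.cast_zero, ks_zero, one_smul] at this

theorem eps_apply_of_isDeg_one {V : GrMod.{u, v} k} {W : GrMod.{u, w} k} {f : V →ₗ[k] W}
    (hf : IsDeg V.deg W.deg f 1) (x : V) : W.eps (f x) = -f (V.eps x) := by
  have := LinearMap.congr_fun (GrMod.eps_comp_of_isDeg hf) x
  rwa [Int.cast_one, ks_one, neg_one_smul] at this

variable {d : L →ₗ[k] L} {q : sym L →ₗ[k] L}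

theorem isCoderivation_cofreeDiff_add_coder (hd : IsDeg L.deg L.deg d 1)
    (hq : IsDeg (sym L).deg L.deg q 1) :
    IsCoderivation (coCom k) (cofreeDiff (coCom k) d + coder (coCom k) q) := by
  rw [cofreeDiff_coCom]
  exact (isCoderivation_coder (hd.comp (isDeg_proj _ _) (zero_add 1))).add
    (isCoderivation_coder hq)

theorem proj_cofreeDiff_add_coder (hd : IsDeg L.deg L.deg d 1)
    (hq : IsDeg (sym L).deg L.deg q 1) (y : sym L) :
    proj (coCom k) L ((cofreeDiff (coCom k) d + coder (coCom k) q) y) =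
      d (proj (coCom k) L y) + q y := by
  rw [LinearMap.add_apply, map_add]
  exact congrArg₂ (· + ·) (LinearMap.congr_fun (proj_comp_cofreeDiff hd) y)
    (LinearMap.congr_fun (proj_comp_coder hq) y)

/-- A codifferential of square zero whose brackets have at least two arguments makes `L` a
homotopy algebra. -/
theorem isHoAlg_of_comp_self (hd : IsDeg L.deg L.deg d 1) (hq : IsDeg (sym L).deg L.deg q 1)
    (hq' : ∀ n ≤ 1, q ∘ₗ cls (coCom k) L n = 0)
    (h : (cofreeDiff (coCom k) d + coder (coCom k) q) ∘ₗ
      (cofreeDiff (coCom k) d + coder (coCom k) q) = 0) :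
    IsHoAlg (coCom k) d (coder (coCom k) q) := by
  have hd2 : d ∘ₗ d = 0 := by
    ext x
    have h1 : (cofreeDiff (coCom k) d + coder (coCom k) q) (incl (coCom k) L x) ∈
        arityLE (coCom k) L 1 := by
      rw [cofreeDiff_coCom]
      exact Submodule.add_mem _ (coder_cls_mem (hd.comp (isDeg_proj _ _) (zero_add 1)) _)
        (coder_cls_mem hq _)
    have h2 := proj_cofreeDiff_add_coder hd hq (incl (coCom k) L x)
    have h3 := proj_cofreeDiff_add_coder hd hq
      ((cofreeDiff (coCom k) d + coder (coCom k) q) (incl (coCom k) L x))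
    have h4 : q (incl (coCom k) L x) = 0 := LinearMap.congr_fun (hq' 1 le_rfl) _
    rw [h4, add_zero, proj_incl] at h2
    rw [← LinearMap.comp_apply (cofreeDiff (coCom k) d + coder (coCom k) q), h,
      LinearMap.zero_apply, map_zero, h2, eq_zero_of_mem_arityLE hq' h1, add_zero] at h3
    exact h3.symm
  refine ⟨hd, hd2, isCoderivation_coder hq, ?_, ?_⟩
  · ext x
    exact LinearMap.congr_fun (coder_comp_cls_eq_zero hq hq') _
  · rw [LinearMap.comp_add, LinearMap.add_comp, LinearMap.add_comp,
      cofreeDiff_comp_self hd hd2, zero_add] at h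
    rw [← h]
    abel

end CoCom

/-! ### The convolution algebra -/

section MapSpace

variable {k : Type u} [Field k] [CharZero k] {C : Cooperad.{u, v} k} (A B : HoAlg.{u, v, w} C)

theorem und_homDiff (f : homSpace A B) : und A B (homDiff A B f) =
    B.d ∘ₗ und A B f - und A B ((homSpace A B).eps f) ∘ₗ A.codiff +
      (proj C B.space ∘ₗ B.Q) ∘ₗ conv C A.space B.space 1 fun _ => und A B f := rfl

theorem isDeg_eps_und {p : ℤ} {f : homSpace A B} (hf : f ∈ (homSpace A B).deg p) :
    IsDeg (cofree C A.space).deg B.space.deg (und A B ((homSpace A B).eps f)) p := by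
  have := (homSpace A B).isDeg_eps p f hf
  rw [add_zero] at this
  exact homMap_mem this

theorem isDeg_homDiff : IsDeg (homSpace A B).deg (homSpace A B).deg (homDiff A B) 1 := by
  intro p f hf
  change IsDeg _ _ (und A B (homDiff A B f)) (p + 1)
  rw [und_homDiff]
  refine ((B.isHoAlg.d_deg.comp (homMap_mem hf) rfl).sub ((isDeg_eps_und A B hf).comp
    A.isDgCoderivation_codiff.deg (add_comm 1 p))).add ?_
  refine (isDeg_proj_Q B).comp (isDeg_conv (p := fun _ => p) fun _ => homMap_mem hf) ?_
  rw [Fin.sum_univ_one]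

variable {A B}

theorem und_homBracket {n : ℕ} (f : Fin n → homSpace A B) : und A B (homBracket A B n f) =
    (proj C B.space ∘ₗ B.Q) ∘ₗ conv C A.space B.space n fun i => und A B (f i) := rfl

variable (A B)

/-- The multibrackets of the convolution algebra, as a map from `S(Hom(C(A), B))`. -/
def mapQ : sym (homSpace A B) →ₗ[k] homSpace A B :=
  symElim fun n => match n with
    | 0 => 0
    | 1 => 0
    | n + 2 => PiTensorProduct.lift (homBracket A B (n + 2))

/-- The codifferential of the convolution algebra. -/
def mapCodiff : sym (homSpace A B) →ₗ[k] sym (homSpace A B) :=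
  cofreeDiff (coCom k) (homDiff A B) + coder (coCom k) (mapQ A B)

theorem mapQ_comp_cls {n : ℕ} (hn : n ≤ 1) :
    mapQ A B ∘ₗ cls (coCom k) (homSpace A B) n = 0 := by
  refine LinearMap.ext fun t => ?_
  rw [LinearMap.comp_apply, mapQ, symElim_cls]
  interval_cases n <;> simp [symTen]

variable {A B}

/-- No symmetrization is visible on words, as the convolution is itself symmetric. -/
theorem mapQ_word {n : ℕ} (hn : 2 ≤ n) (f : Fin n → homSpace A B) :
    und A B (mapQ A B (word f)) =
      (proj C B.space ∘ₗ B.Q) ∘ₗ conv C A.space B.space n fun i => und A B (f i) := by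
  obtain ⟨n, rfl⟩ : ∃ m, n = m + 2 := ⟨n - 2, by omega⟩
  suffices h : (und A B ∘ₗ mapQ A B).compMultilinearMap (wordMulti (homSpace A B) (n + 2)) =
      (sandwich (proj C B.space ∘ₗ B.Q) (conv C A.space B.space (n + 2))
        LinearMap.id).compLinearMap fun _ => und A B from
    DFunLike.congr_fun h f
  refine multilinear_ext_deg fun p f hf => ?_
  have h1 := symElim_word (fun n => match n with
    | 0 => 0
    | 1 => 0
    | n + 2 => PiTensorProduct.lift (homBracket A B (n + 2))) (by omega : n + 2 ≠ 0) hf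
  refine (congrArg (und A B) h1).trans ?_
  have h2 := conv_symm (f := fun i => und A B (f i)) fun i => homMap_mem (hf i)
  refine Eq.trans ?_ (congrArg (fun g => (proj C B.space ∘ₗ B.Q) ∘ₗ g) h2).symm
  dsimp only
  rw [LinearMap.map_smul, map_sum, LinearMap.comp_smul, comp_sum]
  refine congrArg _ (Finset.sum_congr rfl fun σ _ => ?_)
  rw [LinearMap.map_smul, PiTensorProduct.lift.tprod, und_homBracket, LinearMap.comp_smul]

theorem isDeg_mapQ : IsDeg (sym (homSpace A B)).deg (homSpace A B).deg (mapQ A B) 1 := by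
  refine isDeg_sym fun n p f hf => ?_
  rcases lt_or_ge n 2 with h | h
  · have : mapQ A B (word f) = 0 :=
      LinearMap.congr_fun (mapQ_comp_cls A B (by omega : n ≤ 1)) _
    rw [this]
    exact Submodule.zero_mem _
  · change IsDeg _ _ (und A B (mapQ A B (word f))) _
    rw [mapQ_word h]
    exact (isDeg_proj_Q B).comp (isDeg_conv fun i => homMap_mem (hf i)) rfl

theorem isCoderivation_mapCodiff : IsCoderivation (coCom k) (mapCodiff A B) :=
  isCoderivation_cofreeDiff_add_coder (isDeg_homDiff A B) isDeg_mapQ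

theorem proj_mapCodiff (y : sym (homSpace A B)) :
    proj (coCom k) (homSpace A B) (mapCodiff A B y) =
      homDiff A B (proj (coCom k) (homSpace A B) y) + mapQ A B y :=
  proj_cofreeDiff_add_coder (isDeg_homDiff A B) isDeg_mapQ y

theorem proj_comp_convSym (y : sym (homSpace A B)) :
    proj C B.space ∘ₗ convSym C A.space B.space y =
      und A B (proj (coCom k) (homSpace A B) y) := by
  suffices h : LinearMap.llcomp k _ _ _ (proj C B.space) ∘ₗ convSym C A.space B.space =
      und A B ∘ₗ proj (coCom k) (homSpace A B) from LinearMap.congr_fun h y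
  refine sym_ext fun n p f _ hf => ?_
  change proj C B.space ∘ₗ convSym C A.space B.space (word f) = und A B (proj _ _ (word f))
  rw [convSym_word]
  by_cases h : n = 1
  · subst h
    rw [proj_word_one, proj_conv_one (homMap_mem (hf 0))]
  · rw [proj_word_of_ne h, map_zero, proj_conv_of_ne h]

/-- The brackets of the convolution algebra, together with the term of its differential that comes
from `Q_B`, are `p Q_B` applied to `convSym`. -/
theorem und_mapQ_add (y : sym (homSpace A B)) :
    und A B (mapQ A B y) + (proj C B.space ∘ₗ B.Q) ∘ₗ
      (conv C A.space B.space 1 fun _ => und A B (proj (coCom k) (homSpace A B) y)) =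
      (proj C B.space ∘ₗ B.Q) ∘ₗ convSym C A.space B.space y := by
  let κ : (cofree C A.space →ₗ[k] B.space) →ₗ[k] (cofree C A.space →ₗ[k] cofree C B.space) :=
    (MultilinearMap.ofSubsingleton k _ _ (0 : Fin 1)).symm (conv C A.space B.space 1)
  suffices h : und A B ∘ₗ mapQ A B + LinearMap.llcomp k _ _ _ (proj C B.space ∘ₗ B.Q) ∘ₗ
      κ ∘ₗ und A B ∘ₗ proj (coCom k) (homSpace A B) =
      LinearMap.llcomp k _ _ _ (proj C B.space ∘ₗ B.Q) ∘ₗ convSym C A.space B.space from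
    LinearMap.congr_fun h y
  refine sym_ext fun n p f hn hf => ?_
  change und A B (mapQ A B (word f)) + (proj C B.space ∘ₗ B.Q) ∘ₗ
      κ (und A B (proj (coCom k) (homSpace A B) (word f))) =
      (proj C B.space ∘ₗ B.Q) ∘ₗ convSym C A.space B.space (word f)
  rw [convSym_word]
  rcases lt_or_ge n 2 with h | h
  · obtain rfl : n = 1 := by omega
    have h0 : mapQ A B (word f) = 0 := LinearMap.congr_fun (mapQ_comp_cls A B le_rfl) _
    rw [h0, map_zero, zero_add, proj_word_one]
    refine congrArg (fun g => (proj C B.space ∘ₗ B.Q) ∘ₗ g) ?_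
    refine congrArg (conv C A.space B.space 1) (funext fun i => ?_)
    rw [Subsingleton.elim i 0]
  · rw [mapQ_word h, proj_word_of_ne (by omega), map_zero, map_zero, LinearMap.comp_zero,
      add_zero]

/-- The codifferential of the convolution algebra corresponds to the commutator with the
codifferentials of `C(A)` and `C(B)`. -/
theorem convSym_mapCodiff (y : sym (homSpace A B)) :
    convSym C A.space B.space (mapCodiff A B y) =
      B.codiff ∘ₗ convSym C A.space B.space y -
        convSym C A.space B.space ((sym (homSpace A B)).eps y) ∘ₗ A.codiff := by
  refine isCoalgFam_convSym.codiff isCoderivation_mapCodiff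
    A.isDgCoderivation_codiff B.isDgCoderivation_codiff (fun y => ?_) y
  have h1 := eps_apply_of_isDeg (isDeg_proj (coCom k) (homSpace A B)) y
  have h2 : proj C B.space ∘ₗ B.codiff ∘ₗ convSym C A.space B.space y =
      B.d ∘ₗ und A B (proj (coCom k) (homSpace A B) y) +
        (proj C B.space ∘ₗ B.Q) ∘ₗ convSym C A.space B.space y := by
    rw [← LinearMap.comp_assoc, B.proj_comp_codiff, LinearMap.add_comp, LinearMap.comp_assoc,
      proj_comp_convSym]
  have h3 : proj C B.space ∘ₗ convSym C A.space B.space ((sym (homSpace A B)).eps y) ∘ₗ A.codiff =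
      und A B ((homSpace A B).eps (proj (coCom k) (homSpace A B) y)) ∘ₗ A.codiff := by
    rw [← LinearMap.comp_assoc, proj_comp_convSym, h1]
  rw [proj_comp_convSym, proj_mapCodiff, map_add, und_homDiff, h2, h3, ← und_mapQ_add]
  abel

/-- The codifferential has square zero, because under `convSym` it is the commutator with
codifferentials of square zero. -/
theorem mapCodiff_comp_mapCodiff : mapCodiff A B ∘ₗ mapCodiff A B = 0 := by
  have hT : IsDgCoderivation (mapCodiff A B) :=
    (isDgCoderivation_cofreeDiff (isDeg_homDiff A B)).add_coderivation
      (isCoderivation_coder isDeg_mapQ)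
  refine hT.comp_self (LinearMap.ext fun y => ?_)
  have h1 : convSym C A.space B.space (mapCodiff A B (mapCodiff A B y)) = 0 := by
    have e1 := eps_apply_of_isDeg_one (isCoderivation_mapCodiff (A := A) (B := B)).deg y
    have e2 : (sym (homSpace A B)).eps ((sym (homSpace A B)).eps y) = y :=
      LinearMap.congr_fun (GrMod.eps_comp_eps _) y
    rw [convSym_mapCodiff, convSym_mapCodiff, e1, map_neg, convSym_mapCodiff, e2,
      LinearMap.comp_sub, LinearMap.neg_comp, LinearMap.sub_comp,
      LinearMap.comp_assoc A.codiff A.codiff, A.codiff_comp_codiff, ← LinearMap.comp_assoc,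
      B.codiff_comp_codiff, LinearMap.zero_comp, LinearMap.comp_zero, LinearMap.comp_assoc]
    abel
  refine Subtype.ext ?_
  refine (proj_comp_convSym (mapCodiff A B (mapCodiff A B y))).symm.trans ?_
  rw [h1, LinearMap.comp_zero]
  rfl

theorem isHoAlg_mapSpace : IsHoAlg (coCom k) (homDiff A B) (coder (coCom k) (mapQ A B)) :=
  isHoAlg_of_comp_self (isDeg_homDiff A B) isDeg_mapQ (fun _ hn => mapQ_comp_cls A B hn)
    mapCodiff_comp_mapCodiff

theorem mapSpace_bracket {n : ℕ} (f : Fin n → homSpace A B) :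
    (mapSpace A B).bracket f = mapQ A B (word f) :=
  LinearMap.congr_fun (proj_comp_coder (isDeg_mapQ (A := A) (B := B))) (word f)

end MapSpace

/-! ### The arity filtration -/

section ArityFiltration

variable {k : Type u} [Field k] [CharZero k] {C : Cooperad.{u, v} k}

theorem GrMod.par_comp_of_isDeg {V : GrMod.{u, v} k} {W : GrMod.{u, w} k} {f : V →ₗ[k] W}
    (hf : IsDeg V.deg W.deg f 0) (q : ZMod 2) : W.par q ∘ₗ f = f ∘ₗ V.par q := by
  refine V.ext_deg fun d x hx => ?_
  have h : f x ∈ W.deg d := by simpa using hf d x hx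
  rw [LinearMap.comp_apply, LinearMap.comp_apply, W.par_of_mem h, V.par_of_mem hx]
  split_ifs <;> simp

section

variable {A : GrMod.{u, w} k} {B : GrMod.{u, w'} k}

theorem parPart_comp_cls {f : cofree C A →ₗ[k] B} {i : ℕ} (h : f ∘ₗ cls C A i = 0) (q : ZMod 2) :
    parPart (cofree C A) B q f ∘ₗ cls C A i = 0 := by
  rw [parPart, LinearMap.sum_apply, sum_comp]
  refine Finset.sum_eq_zero fun q' _ => ?_
  change (B.par (q' + q) ∘ₗ f ∘ₗ (cofree C A).par q') ∘ₗ cls C A i = 0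
  have h1 : (cofree C A).par q' ∘ₗ cls C A i = cls C A i ∘ₗ (tenMod C A i).par q' :=
    GrMod.par_comp_of_isDeg (V := tenMod C A i) (isDeg_cls C A i) q'
  rw [LinearMap.comp_assoc, LinearMap.comp_assoc, h1, ← LinearMap.comp_assoc _ (cls C A i) f, h,
    LinearMap.zero_comp, LinearMap.comp_zero]

/-- The operator `(1 ⊗ f 0 ⊗ ⋯ ⊗ f (n - 1)) Δ n` vanishes in arity `N` if every decomposition of
`N` into `n` arities has a part on which the corresponding map vanishes. -/
theorem conv_comp_cls_eq_zero {n N : ℕ} {f : Fin n → cofree C A →ₗ[k] B}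
    (h : ∀ r : Fin n → ℕ, ∑ j, r j = N → ∃ j, f j ∘ₗ cls C A (r j) = 0) :
    conv C A B n f ∘ₗ cls C A N = 0 := by
  refine LinearMap.ext fun t => ?_
  have h1 : ∀ p : Fin n → ZMod 2, hmap (C.obj n) (fun _ => cofree C A) (fun _ => B) p
      (fun j => parPart (cofree C A) B (p j) (f j)) (comul C A n (cls C A N t)) = 0 := by
    intro p
    refine hmap_comul_cls_eq_zero p (fun r hr => ?_) t
    obtain ⟨j, hj⟩ := h r hr
    exact ⟨j, parPart_comp_cls hj _⟩
  rw [conv_apply]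
  have h2 : tensorMap (C.obj n) (cofree C A) B n f (comul C A n (cls C A N t)) = 0 := by
    rw [tensorMap, _root_.sum_apply, LinearMap.sum_apply]
    exact Finset.sum_eq_zero fun p _ => h1 p
  exact (congrArg (cls C B n) h2).trans (map_zero _)

theorem truncGE_invariant (n m : ℕ) (σ : Equiv.Perm (Fin m)) :
    (if m < n then 0 else cls C A m) ∘ₗ permTen C A σ = if m < n then 0 else cls C A m := by
  split_ifs
  · exact LinearMap.zero_comp _
  · exact cls_permTen C A σ

variable (C A) in
/-- The projection of `C(A)` onto the sum of the components of arity at least `n`. -/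
def truncGE (n : ℕ) : cofree C A →ₗ[k] cofree C A :=
  cofreeElim (fun m => if m < n then 0 else cls C A m) (truncGE_invariant n)

theorem truncGE_comp_cls (n m : ℕ) :
    truncGE C A n ∘ₗ cls C A m = if m < n then 0 else cls C A m :=
  LinearMap.ext fun t =>
    cofreeElim_cls (fun m => if m < n then 0 else cls C A m) (truncGE_invariant n) m t

theorem isDeg_truncGE (n : ℕ) : IsDeg (cofree C A).deg (cofree C A).deg (truncGE C A n) 0 := by
  refine isDeg_cofree C A fun m => ?_
  rw [truncGE_comp_cls]
  split_ifs
  · exact fun _ _ _ => Submodule.zero_mem _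
  · exact isDeg_cls C A m

theorem linearMap_cofree_ext {M : Type*} [AddCommGroup M] [Module k M] {f g : cofree C A →ₗ[k] M}
    (h : ∀ n, f ∘ₗ cls C A n = g ∘ₗ cls C A n) : f = g :=
  cofree_ext C fun n t => LinearMap.congr_fun (h n) t

end

/-- A submodule that is the image of a degree-preserving projection is graded. -/
theorem eq_iSup_inf_deg {V : GrMod.{u, w} k} {N : Submodule k V} {R : V →ₗ[k] V}
    (hR : IsDeg V.deg V.deg R 0) (hN : ∀ x, R x ∈ N) (h : ∀ x ∈ N, R x = x) :
    N = ⨆ p, N ⊓ V.deg p := by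
  refine le_antisymm (fun x hx => ?_) (iSup_le fun p => inf_le_left)
  have h1 : (⨆ p, V.deg p) ≤ (⨆ p, N ⊓ V.deg p).comap R :=
    iSup_le fun p y hy => Submodule.mem_iSup_of_mem p ⟨hN y, by simpa using hR p y hy⟩
  rw [V.iSup_deg] at h1
  rw [← h x hx]
  exact h1 trivial

variable (A B : HoAlg.{u, v, w} C)

/-- The arity filtration of `Hom(C(A), B)`. -/
def arityF (n : ℕ) : Submodule k (homSpace A B) :=
  ⨅ m ∈ Finset.range n, LinearMap.ker (LinearMap.lcomp k _ (cls C A.space m) ∘ₗ und A B)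

variable {A B}

theorem mem_arityF {n : ℕ} {f : homSpace A B} :
    f ∈ arityF A B n ↔ ∀ m < n, und A B f ∘ₗ cls C A.space m = 0 := by
  simp only [arityF, Submodule.mem_iInf, Finset.mem_range]
  rfl

theorem arityF_one : arityF A B 1 = ⊤ := by
  refine eq_top_iff.2 fun f _ => mem_arityF.2 fun m hm => ?_
  obtain rfl : m = 0 := by omega
  refine LinearMap.ext fun t => ?_
  rw [LinearMap.comp_apply, cls_zero, map_zero, LinearMap.zero_apply]

theorem antitone_arityF : Antitone (arityF A B) := fun _ _ h _ hf =>
  mem_arityF.2 fun m hm => mem_arityF.1 hf m (hm.trans_le h)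

theorem arityF_eq_iSup (n : ℕ) : arityF A B n = ⨆ p, arityF A B n ⊓ (homSpace A B).deg p := by
  have hdeg : ∀ p, ∀ f ∈ (homSpace A B).deg p,
      IsDeg (cofree C A.space).deg B.space.deg (und A B f ∘ₗ truncGE C A.space n) p :=
    fun p f hf => (homMap_mem hf).comp (isDeg_truncGE n) (zero_add p)
  let R : homSpace A B →ₗ[k] homSpace A B :=
    homCod (LinearMap.lcomp k _ (truncGE C A.space n) ∘ₗ und A B) fun p f hf => ⟨p, hdeg p f hf⟩
  have hR : ∀ f, und A B (R f) = und A B f ∘ₗ truncGE C A.space n := fun f => rfl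
  refine eq_iSup_inf_deg (R := R) (fun p f hf => ?_) (fun f => ?_) fun f hf => ?_
  · change IsDeg _ _ (und A B (R f)) (p + 0)
    rw [hR, add_zero]
    exact hdeg p f hf
  · refine mem_arityF.2 fun m hm => ?_
    rw [hR, LinearMap.comp_assoc, truncGE_comp_cls, if_pos hm, LinearMap.comp_zero]
  · refine Subtype.ext (linearMap_cofree_ext fun m => ?_)
    change und A B (R f) ∘ₗ cls C A.space m = und A B f ∘ₗ cls C A.space m
    rw [hR, LinearMap.comp_assoc, truncGE_comp_cls]
    split_ifs with hm
    · rw [LinearMap.comp_zero, mem_arityF.1 hf m hm]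
    · rfl

theorem HoAlg.codiff_cls_mem (A : HoAlg.{u, v, w} C) {n : ℕ} (t : Ten C A.space n) :
    A.codiff (cls C A.space n t) ∈ arityLE C A.space n := by
  rw [HoAlg.codiff, cofreeDiff, LinearMap.add_apply, LinearMap.add_apply]
  refine Submodule.add_mem _ (Submodule.add_mem _ ?_ ?_) ?_
  · have := LinearMap.congr_fun (cooperadDiff_comp_cls (C := C) (A := A.space) n) t
    rw [LinearMap.comp_apply] at this
    rw [this]
    exact cls_mem_arityLE le_rfl _
  · exact coder_cls_mem (A.isHoAlg.d_deg.comp (isDeg_proj _ _) (zero_add 1)) t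
  · rw [← coder_eq_of_proj A.isHoAlg.coderivation]
    exact coder_cls_mem (isDeg_proj_Q A) t

/-- The differential preserves the arity filtration, since the codifferential of `C(A)` does not
raise arities. -/
theorem homDiff_mem {n : ℕ} {f : homSpace A B} (hf : f ∈ arityF A B n) :
    homDiff A B f ∈ arityF A B n := by
  suffices h : ⨆ p, arityF A B n ⊓ (homSpace A B).deg p ≤ (arityF A B n).comap (homDiff A B) by
    rw [arityF_eq_iSup] at hf
    exact h hf
  refine iSup_le fun p f hf => ?_
  have h1 := mem_arityF.1 hf.1
  have h2 : ∀ m < n, und A B ((homSpace A B).eps f) ∘ₗ cls C A.space m = 0 := fun m hm => by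
    rw [GrMod.eps_of_mem _ hf.2, LinearMap.map_smul, LinearMap.smul_comp, h1 m hm, smul_zero]
  refine mem_arityF.2 fun m hm => LinearMap.ext fun t => ?_
  have h3 : und A B ((homSpace A B).eps f) (A.codiff (cls C A.space m t)) = 0 :=
    eq_zero_of_mem_arityLE (fun i hi => h2 i (hi.trans_lt hm)) (A.codiff_cls_mem t)
  have h4 := LinearMap.congr_fun (conv_comp_cls_eq_zero (N := m) (f := fun _ : Fin 1 => und A B f)
    fun r hr => ⟨0, by
      rw [Fin.sum_univ_one] at hr
      rw [hr]
      exact h1 m hm⟩) t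
  have h5 := LinearMap.congr_fun (h1 m hm) t
  rw [LinearMap.comp_apply, und_homDiff, LinearMap.add_apply, LinearMap.sub_apply]
  rw [LinearMap.comp_apply] at h4 h5
  simp only [LinearMap.comp_apply]
  rw [h3, h4, h5]
  simp

/-- Completeness: a Cauchy sequence is eventually constant in every arity. -/
theorem arityF_complete (p : ℤ) (x : ℕ → homSpace A B) (hx : ∀ n, x n ∈ (homSpace A B).deg p)
    (h : ∀ n, x (n + 1) - x n ∈ arityF A B n) :
    ∃! y, y ∈ (homSpace A B).deg p ∧ ∀ n, y - x n ∈ arityF A B n := by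
  have hcauchy : ∀ m n, m ≤ n → x n - x m ∈ arityF A B m := by
    intro m n hmn
    induction n, hmn using Nat.le_induction with
    | base => rw [sub_self]; exact Submodule.zero_mem _
    | succ n hn ih =>
      rw [← sub_add_sub_cancel]
      exact Submodule.add_mem _ (antitone_arityF hn (h n)) ih
  have hx' : ∀ m n, m < n → und A B (x n) ∘ₗ cls C A.space m =
      und A B (x (m + 1)) ∘ₗ cls C A.space m := fun m n hmn => by
    have h1 := mem_arityF.1 (hcauchy (m + 1) n hmn) m m.lt_succ_self
    rwa [map_sub, LinearMap.sub_comp, sub_eq_zero] at h1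
  -- the component of the limit in arity `m` is that of `x (m + 1)`
  have hinv : ∀ (m : ℕ) (σ : Equiv.Perm (Fin m)),
      (und A B (x (m + 1)) ∘ₗ cls C A.space m) ∘ₗ permTen C A.space σ =
        und A B (x (m + 1)) ∘ₗ cls C A.space m := fun m σ => by
    rw [LinearMap.comp_assoc, cls_permTen]
  let g : cofree C A.space →ₗ[k] B.space :=
    cofreeElim (fun m => und A B (x (m + 1)) ∘ₗ cls C A.space m) hinv
  have hg : ∀ m, g ∘ₗ cls C A.space m = und A B (x (m + 1)) ∘ₗ cls C A.space m := fun m =>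
    LinearMap.ext fun t =>
      cofreeElim_cls (fun m => und A B (x (m + 1)) ∘ₗ cls C A.space m) hinv m t
  have hdeg : IsDeg (cofree C A.space).deg B.space.deg g p := isDeg_cofree _ _ fun m => by
    rw [hg]
    exact (homMap_mem (hx (m + 1))).comp (isDeg_cls _ _ m) (zero_add p)
  let y : homSpace A B := ⟨g, Submodule.subset_span ⟨p, hdeg⟩⟩
  have hy : und A B y = g := rfl
  refine ⟨y, ⟨hdeg, fun n => mem_arityF.2 fun m hm => ?_⟩, fun y' hy' => ?_⟩
  · rw [map_sub, LinearMap.sub_comp, hy, hg, hx' m n hm, sub_self]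
  · refine Subtype.ext (linearMap_cofree_ext fun m => ?_)
    have h1 := mem_arityF.1 (hy'.2 (m + 1)) m m.lt_succ_self
    rw [map_sub, LinearMap.sub_comp, sub_eq_zero] at h1
    exact h1.trans (hg m).symm

theorem exists_lt_of_sum_lt {n : ℕ} {r i : Fin n → ℕ} (h : ∑ j, r j < ∑ j, i j) :
    ∃ j, r j < i j := by
  by_contra! hc
  exact (Finset.sum_le_sum fun j _ => hc j).not_gt h

theorem conv_comp_cls_of_mem_arityF {n : ℕ} {i : Fin n → ℕ} {f : Fin n → homSpace A B}
    (hf : ∀ j, f j ∈ arityF A B (i j)) {N : ℕ} (hN : N < ∑ j, i j) :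
    conv C A.space B.space n (fun j => und A B (f j)) ∘ₗ cls C A.space N = 0 := by
  refine conv_comp_cls_eq_zero fun r hr => ?_
  obtain ⟨j, hj⟩ := exists_lt_of_sum_lt (hr.trans_lt hN)
  exact ⟨j, mem_arityF.1 (hf j) _ hj⟩

theorem mapQ_word_mem {n : ℕ} (hn : 2 ≤ n) (i : Fin n → ℕ) (f : Fin n → homSpace A B)
    (hf : ∀ j, f j ∈ arityF A B (i j)) : mapQ A B (word f) ∈ arityF A B (∑ j, i j) := by
  refine mem_arityF.2 fun m hm => ?_
  rw [mapQ_word hn, LinearMap.comp_assoc, conv_comp_cls_of_mem_arityF hf hm, LinearMap.comp_zero]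

theorem isFilteredSLie_mapSpace : (mapSpace A B).IsFilteredSLie where
  isHoAlg := isHoAlg_mapSpace
  F_one := arityF_one
  F_antitone := antitone_arityF
  F_graded := arityF_eq_iSup
  d_mem _ _ hx := homDiff_mem hx
  complete := arityF_complete
  bracket_mem m hm i x hx := by
    exact (congrArg (· ∈ arityF A B (∑ j, i j)) (mapSpace_bracket x)).mpr
      (mapQ_word_mem hm i x fun j => (hx j).2)

end ArityFiltration

/-! ### Composition of families of coalgebra morphisms -/

section Blocks

variable {k : Type u} [Field k] [CharZero k] {L : GrMod.{u, w} k}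

variable (L) in
/-- The signed rearrangement of the factors of `L ⊗ ⋯ ⊗ L` into blocks. -/
def blockMap {m n : ℕ} (r : Fin m → ℕ) (e : (Σ j, Fin (r j)) ≃ Fin n) :
    (⨂[k] _ : Fin n, L) →ₗ[k] ⨂[k] j, ⨂[k] _ : Fin (r j), L :=
  (PiTensorProduct.map fun j => (TensorProduct.lid k (⨂[k] _ : Fin (r j), L)).toLinearMap ∘ₗ
      TensorProduct.map (coeff k (r j)) LinearMap.id) ∘ₗ
    regroup (fun j => (coCom k).obj (r j)) (fun _ => L) r e ∘ₗ
      TensorProduct.mk k _ _ (PiTensorProduct.tprod k fun j => gen k (r j))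

theorem blockMap_tprod {m n : ℕ} {r : Fin m → ℕ} (hr : ∀ j, r j ≠ 0)
    (e : (Σ j, Fin (r j)) ≃ Fin n) {d : Fin n → ℤ} {x : Fin n → L}
    (hx : ∀ i, x i ∈ L.deg (d i)) :
    blockMap L r e (PiTensorProduct.tprod k x) = ks k (regroupExp r e 0 fun i => (d i : ZMod 2)) •
      PiTensorProduct.tprod k fun j => PiTensorProduct.tprod k fun s => x (e ⟨j, s⟩) := by
  have h0 : (fun _ : Fin m => ((0 : ℤ) : ZMod 2)) = 0 := by
    funext; exact Int.cast_zero
  rw [blockMap, LinearMap.comp_apply, LinearMap.comp_apply, TensorProduct.mk_apply,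
    regroup_tmul' _ _ r e (fun _ => 0) d _ _ (fun j => gen_mem (r j)) hx, LinearMap.map_smul,
    PiTensorProduct.map_tprod, h0]
  congr 2
  funext j
  rw [LinearMap.comp_apply, TensorProduct.map_tmul, coeff_gen (hr j), LinearEquiv.coe_coe,
    TensorProduct.lid_tmul, one_smul, LinearMap.id_apply]

theorem blockMap_const_tprod {m n r : ℕ} (hr : r ≠ 0) (e : (Σ _ : Fin m, Fin r) ≃ Fin n)
    {d : Fin n → ℤ} {x : Fin n → L} (hx : ∀ i, x i ∈ L.deg (d i)) :
    blockMap L (fun _ : Fin m => r) e (PiTensorProduct.tprod k x) =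
      ks k (regroupExp (fun _ : Fin m => r) e 0 fun i => (d i : ZMod 2)) •
        PiTensorProduct.tprod k fun j => PiTensorProduct.tprod k fun s => x (e ⟨j, s⟩) :=
  blockMap_tprod (r := fun _ : Fin m => r) (fun _ => hr) e hx

/-- For `coCom`, the decomposition along a tree is the signed rearrangement into blocks. -/
theorem lid_coeff_treeMap {m n : ℕ} (hm : m ≠ 0) (r : Fin m → ℕ) (e : (Σ j, Fin (r j)) ≃ Fin n)
    (t : Ten (coCom k) L n) :
    TensorProduct.lid k _ (TensorProduct.map (coeff k m)
        (PiTensorProduct.map fun j => (TensorProduct.lid k (⨂[k] _ : Fin (r j), L)).toLinearMap ∘ₗ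
          TensorProduct.map (coeff k (r j)) LinearMap.id) (treeMap (coCom k) L r e t)) =
      blockMap L r e (TensorProduct.lid k _
        (TensorProduct.map (coeff k n) LinearMap.id t)) := by
  induction t using TensorProduct.induction_on with
  | zero => simp only [map_zero]
  | add t t' h h' => simp only [map_add, h, h']
  | tmul c x =>
    have h : (coCom k).decomp r e c =
        coeff k n c • (gen k m ⊗ₜ PiTensorProduct.tprod k fun j => gen k (r j)) := rfl
    rw [treeMap_tmul, h, ← TensorProduct.smul_tmul', LinearEquiv.map_smul, LinearMap.map_smul,
      LinearMap.map_smul, LinearEquiv.map_smul, TensorProduct.assoc_tmul, TensorProduct.map_tmul,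
      TensorProduct.map_tmul, TensorProduct.lid_tmul, LinearMap.id_apply, coeff_gen hm, one_smul,
      TensorProduct.map_tmul, TensorProduct.lid_tmul, LinearMap.map_smul]
    rfl

theorem lid_coeff_map_piMap {m : ℕ} {X : Type*} [AddCommMonoid X] [Module k X] {Y Z : Fin m → Type*}
    [∀ j, AddCommMonoid (Y j)] [∀ j, Module k (Y j)] [∀ j, AddCommMonoid (Z j)]
    [∀ j, Module k (Z j)] (φ : ∀ j, Y j →ₗ[k] Z j) (ψ : ∀ j, X →ₗ[k] Y j)
    (z : (coCom k).obj m ⊗[k] (⨂[k] _ : Fin m, X)) :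
    TensorProduct.lid k _ (TensorProduct.map (coeff k m) (PiTensorProduct.map φ)
      (TensorProduct.map LinearMap.id (PiTensorProduct.map ψ) z)) =
    PiTensorProduct.map (fun j => φ j ∘ₗ ψ j)
      (TensorProduct.lid k _ (TensorProduct.map (coeff k m) LinearMap.id z)) := by
  induction z using TensorProduct.induction_on with
  | zero => simp only [map_zero]
  | add t t' h h' => simp only [map_add, h, h']
  | tmul c x =>
    rw [TensorProduct.map_tmul, TensorProduct.map_tmul, TensorProduct.lid_tmul,
      TensorProduct.map_tmul, TensorProduct.lid_tmul, LinearMap.map_smul, LinearMap.id_apply,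
      LinearMap.id_apply, PiTensorProduct.map_comp, LinearMap.comp_apply]

/-- Coassociativity of the iterated comultiplications of `S(L)`. -/
theorem blockMap_cop {m n : ℕ} (hm : m ≠ 0) (r : Fin m → ℕ) (e : (Σ j, Fin (r j)) ≃ Fin n)
    (y : sym L) : blockMap (sym L) r e (cop L n y) =
      PiTensorProduct.map (fun j => cop L (r j)) (cop L m y) := by
  have h1 := lid_coeff_treeMap hm r e (comul (coCom k) L n y)
  have h2 := LinearMap.congr_fun (treeMap_comul (C := coCom k) L r e) y
  rw [LinearMap.comp_apply, LinearMap.comp_apply] at h2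
  have h3 : (fun j => ((TensorProduct.lid k (⨂[k] _ : Fin (r j), sym L)).toLinearMap ∘ₗ
      TensorProduct.map (coeff k (r j)) LinearMap.id) ∘ₗ comul (coCom k) L (r j)) =
      fun j => cop L (r j) := funext fun j => LinearMap.comp_assoc _ _ _
  rw [h2, lid_coeff_map_piMap, h3] at h1
  exact h1.symm

/-- The multilinear map on two arguments that belongs to a bilinear map. -/
def bilinMulti {M : Fin 2 → Type*} [∀ i, AddCommMonoid (M i)] [∀ i, Module k (M i)] {W : Type*}
    [AddCommMonoid W] [Module k W] (β : M 0 →ₗ[k] M 1 →ₗ[k] W) : MultilinearMap k M W where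
  toFun x := β (x 0) (x 1)
  map_update_add' {inst} x i a b := by
    rw [Subsingleton.elim inst (instDecidableEqFin 2)]
    induction i using Fin.cases with
    | zero => simp
    | succ i => obtain rfl := Subsingleton.elim i 0; simp
  map_update_smul' {inst} x i c a := by
    rw [Subsingleton.elim inst (instDecidableEqFin 2)]
    induction i using Fin.cases with
    | zero => simp
    | succ i => obtain rfl := Subsingleton.elim i 0; simp

end Blocks

section Composition

variable {k : Type u} [Field k] [CharZero k] {C : Cooperad.{u, v} k} {A B D : GrMod.{u, w} k}
  {L : GrMod.{u, w''} k}

/-- The interchange law for tensor products of homogeneous maps. -/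
theorem tensorMap_comp_tensorMap {M : GrMod.{u, v'} k} {V W X : GrMod.{u, v} k} {n : ℕ}
    {f : Fin n → W →ₗ[k] X} {g : Fin n → V →ₗ[k] W} {p q : Fin n → ℤ}
    (hf : ∀ j, IsDeg W.deg X.deg (f j) (p j)) (hg : ∀ j, IsDeg V.deg W.deg (g j) (q j)) :
    tensorMap M W X n f ∘ₗ tensorMap M V W n g =
      ks k (∑ i, ∑ j, if i < j then (q i : ZMod 2) * p j else 0) •
        tensorMap M V X n fun j => f j ∘ₗ g j := by
  rw [tensorMap_eq_hmap M W X hf, tensorMap_eq_hmap M V W hg,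
    tensorMap_eq_hmap M V X (p := fun j => q j + p j) fun j => (hf j).comp (hg j) rfl,
    hmap_comp_hmap M hg]
  congr 2
  funext j
  push_cast
  rfl

/-- The composite of two families of maps, on `S(L) ⊗ S(L)`. -/
def starLift (Θ : sym L →ₗ[k] (cofree C B →ₗ[k] cofree C D))
    (Θ' : sym L →ₗ[k] (cofree C A →ₗ[k] cofree C B)) :
    (⨂[k] _ : Fin 2, sym L) →ₗ[k] (cofree C A →ₗ[k] cofree C D) :=
  PiTensorProduct.lift (bilinMulti (M := fun _ => sym L)
    ((LinearMap.llcomp k (cofree C A) (cofree C B) (cofree C D)).compl₁₂ Θ Θ'))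

theorem starLift_tprod (Θ : sym L →ₗ[k] (cofree C B →ₗ[k] cofree C D))
    (Θ' : sym L →ₗ[k] (cofree C A →ₗ[k] cofree C B)) (x : Fin 2 → sym L) :
    starLift Θ Θ' (PiTensorProduct.tprod k x) = Θ (x 0) ∘ₗ Θ' (x 1) :=
  PiTensorProduct.lift.tprod _

/-- The composite of two families of maps parametrized by the coalgebra `S(L)`, which sends `y` to
the sum of the `Θ y' ∘ Θ' y''`, where `Δ y` is the sum of the `y' ⊗ y''`. -/
def star (Θ : sym L →ₗ[k] (cofree C B →ₗ[k] cofree C D))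
    (Θ' : sym L →ₗ[k] (cofree C A →ₗ[k] cofree C B)) :
    sym L →ₗ[k] (cofree C A →ₗ[k] cofree C D) := starLift Θ Θ' ∘ₗ cop L 2

/-- The composite of families on a word: the letters are distributed over the two families. -/
theorem star_word (Θ : sym L →ₗ[k] (cofree C B →ₗ[k] cofree C D))
    (Θ' : sym L →ₗ[k] (cofree C A →ₗ[k] cofree C B)) {n : ℕ} (hn : n ≠ 0) {p : Fin n → ℤ}
    {x : Fin n → L} (hx : ∀ i, x i ∈ L.deg (p i)) :
    star Θ Θ' (word x) = ∑ r : Fin 2 → Fin (n + 1), (∏ j, ((r j : ℕ).factorial : k))⁻¹ •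
      ∑ e : (Σ j, Fin (r j)) ≃ Fin n,
        ks k (regroupExp (fun j => (r j : ℕ)) e 0 fun i => (p i : ZMod 2)) •
          (Θ (word fun s => x (e ⟨0, s⟩)) ∘ₗ Θ' (word fun s => x (e ⟨1, s⟩))) := by
  rw [star, LinearMap.comp_apply, cop_word 2 hn le_rfl hx, map_sum]
  refine Finset.sum_congr rfl fun r _ => ?_
  rw [LinearMap.map_smul, map_sum]
  refine congrArg _ (Finset.sum_congr rfl fun e _ => ?_)
  rw [LinearMap.map_smul, starLift_tprod]

theorem sum_sigma_equiv {m n : ℕ} {M : Type*} [AddCommMonoid M] {r : Fin m → ℕ}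
    (e : (Σ j, Fin (r j)) ≃ Fin n) (p : Fin n → M) : ∑ j, ∑ s, p (e ⟨j, s⟩) = ∑ i, p i := by
  rw [← e.sum_comp, Fintype.sum_sigma]

theorem isDeg_star {Θ : sym L →ₗ[k] (cofree C B →ₗ[k] cofree C D)}
    {Θ' : sym L →ₗ[k] (cofree C A →ₗ[k] cofree C B)}
    (hΘ : IsDeg (sym L).deg (degSub (cofree C B) (cofree C D)) Θ 0)
    (hΘ' : IsDeg (sym L).deg (degSub (cofree C A) (cofree C B)) Θ' 0) :
    IsDeg (sym L).deg (degSub (cofree C A) (cofree C D)) (star Θ Θ') 0 := by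
  refine isDeg_sym fun n p x hx => ?_
  rcases Nat.eq_zero_or_pos n with rfl | hn
  · rw [word_zero, map_zero]; exact Submodule.zero_mem _
  rw [star_word Θ Θ' hn.ne' hx, add_zero]
  refine Submodule.sum_mem _ fun r _ => Submodule.smul_mem _ _ (Submodule.sum_mem _ fun e _ =>
    Submodule.smul_mem _ _ ?_)
  have h0 := hΘ.apply_of_degSub (word_mem (x := fun s => x (e ⟨0, s⟩)) fun s => hx _)
  have h1 := hΘ'.apply_of_degSub (word_mem (x := fun s => x (e ⟨1, s⟩)) fun s => hx _)
  refine mem_degSub.2 (h0.comp h1 ?_)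
  rw [← sum_sigma_equiv e p, Fin.sum_univ_two, add_comm]

/-- Positions of the letters in `m` consecutive pairs. -/
def pairPos (m : ℕ) : (Σ _ : Fin m, Fin 2) ≃ Fin (m * 2) :=
  (Equiv.sigmaEquivProd _ _).trans finProdFinEquiv

/-- The same positions, where the first letters of the pairs form one block and the second ones
another. -/
def pairPos' (m : ℕ) : (Σ _ : Fin 2, Fin m) ≃ Fin (m * 2) :=
  (Equiv.sigmaEquivProd _ _).trans ((Equiv.prodComm _ _).trans finProdFinEquiv)

theorem regroupExp_pairPos (m : ℕ) (d : Fin (m * 2) → ZMod 2) :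
    regroupExp (fun _ : Fin m => 2) (pairPos m) 0 d = 0 := by
  rw [regroupExp_of_mono]
  · simp
  · rintro ⟨j, s⟩ ⟨j', s'⟩ h h'
    have h : (s : ℕ) + 2 * j < s' + 2 * j' := h
    rcases h' with h' | ⟨h', h''⟩
    · have h' : (j' : ℕ) < j := h'
      omega
    · obtain rfl : j' = j := h'
      have h'' : (s' : ℕ) < s := h''
      omega

/-- The sign of the rearrangement of pairs into first and second letters: the first letter of a pair
moves past the second letters of the earlier pairs. -/
theorem regroupExp_pairPos' (m : ℕ) (d : Fin (m * 2) → ZMod 2) :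
    regroupExp (fun _ : Fin 2 => m) (pairPos' m) 0 d =
      ∑ i, ∑ j, if i < j then d (pairPos m ⟨i, 1⟩) * d (pairPos m ⟨j, 0⟩) else 0 := by
  have h : ∀ (a b : Fin 2) (i j : Fin m),
      (pairPos' m ⟨a, i⟩ < pairPos' m ⟨b, j⟩ ∧ (b < a ∨ b = a ∧ (j : ℕ) < i)) ↔
        (a : ℕ) + 2 * i < b + 2 * j ∧ ((b : ℕ) < a ∨ (b : ℕ) = a ∧ (j : ℕ) < i) := by
    intro a b i j
    rw [← Fin.ext_iff]
    exact Iff.rfl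
  rw [regroupExp]
  simp only [Pi.zero_apply, zero_mul, ite_self, Finset.sum_const_zero, zero_add,
    Fintype.sum_sigma, Fin.sum_univ_two, h]
  rw [Finset.sum_eq_zero (s := Finset.univ) fun i _ => ?_, zero_add]
  · refine Finset.sum_congr rfl fun i _ => ?_
    refine (congrArg₂ (· + ·) (Finset.sum_congr rfl fun j _ => ?_)
      (Finset.sum_eq_zero fun j _ => ?_)).trans (add_zero _)
    · refine if_congr ?_ rfl rfl
      simp only [Fin.val_zero, Fin.val_one, Fin.lt_def]
      omega
    · exact if_neg (by omega)
  · rw [Finset.sum_eq_zero fun j _ => ?_, Finset.sum_eq_zero fun j _ => ?_, add_zero]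
    · exact if_neg (by simp)
    · exact if_neg (by omega)

end Composition

section StarFamilies

theorem blockMap_pairPos_tprod {k : Type u} [Field k] [CharZero k] {V : GrMod.{u, w} k} {m : ℕ}
    {d : Fin (m * 2) → ℤ} {y : Fin (m * 2) → V} (hy : ∀ i, y i ∈ V.deg (d i)) :
    blockMap V (fun _ : Fin m => 2) (pairPos m) (PiTensorProduct.tprod k y) =
      PiTensorProduct.tprod k fun j => PiTensorProduct.tprod k fun s => y (pairPos m ⟨j, s⟩) := by
  rw [blockMap_const_tprod (by decide) _ hy, regroupExp_pairPos, ks_zero, one_smul]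

theorem blockMap_pairPos'_tprod {k : Type u} [Field k] [CharZero k] {V : GrMod.{u, w} k} {m : ℕ}
    (hm : m ≠ 0) {d : Fin (m * 2) → ℤ} {y : Fin (m * 2) → V} (hy : ∀ i, y i ∈ V.deg (d i)) :
    blockMap V (fun _ : Fin 2 => m) (pairPos' m) (PiTensorProduct.tprod k y) =
      ks k (∑ i, ∑ j, if i < j then
          (d (pairPos m ⟨i, 1⟩) : ZMod 2) * d (pairPos m ⟨j, 0⟩) else 0) •
        PiTensorProduct.tprod k fun i => PiTensorProduct.tprod k fun s => y (pairPos' m ⟨i, s⟩) := by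
  rw [blockMap_const_tprod hm _ hy, regroupExp_pairPos']

variable {k : Type u} [Field k] [CharZero k] {C : Cooperad.{u, v} k} {A B D : GrMod.{u, w} k}
  {L : GrMod.{u, w''} k} {Θ : sym L →ₗ[k] (cofree C B →ₗ[k] cofree C D)}
  {Θ' : sym L →ₗ[k] (cofree C A →ₗ[k] cofree C B)}

variable (Θ Θ') in
/-- The composite of the `m`-fold tensor powers of two families of maps. -/
def starTen (m : ℕ) : (⨂[k] _ : Fin 2, ⨂[k] _ : Fin m, sym L) →ₗ[k]
    ((C.obj m ⊗[k] (⨂[k] _ : Fin m, cofree C A)) →ₗ[k]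
      (C.obj m ⊗[k] (⨂[k] _ : Fin m, cofree C D))) :=
  PiTensorProduct.lift (bilinMulti (M := fun _ => ⨂[k] _ : Fin m, sym L)
    ((LinearMap.llcomp k (C.obj m ⊗[k] (⨂[k] _ : Fin m, cofree C A))
      (C.obj m ⊗[k] (⨂[k] _ : Fin m, cofree C B))
      (C.obj m ⊗[k] (⨂[k] _ : Fin m, cofree C D))).compl₁₂
      (tensorLift C B D m ∘ₗ PiTensorProduct.map fun _ => Θ)
      (tensorLift C A B m ∘ₗ PiTensorProduct.map fun _ => Θ')))

theorem starTen_tprod (m : ℕ) (z : Fin 2 → ⨂[k] _ : Fin m, sym L) :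
    starTen Θ Θ' m (PiTensorProduct.tprod k z) =
      tensorLift C B D m (PiTensorProduct.map (fun _ => Θ) (z 0)) ∘ₗ
        tensorLift C A B m (PiTensorProduct.map (fun _ => Θ') (z 1)) :=
  PiTensorProduct.lift.tprod _

theorem comul_starLift (hΘ : IsCoalgFam Θ) (hΘ' : IsCoalgFam Θ') (m : ℕ)
    (u : ⨂[k] _ : Fin 2, sym L) : HomotopyAlg.comul C D m ∘ₗ starLift Θ Θ' u =
      starTen Θ Θ' m (PiTensorProduct.map (fun _ => cop L m) u) ∘ₗ
        HomotopyAlg.comul C A m := by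
  suffices h : LinearMap.llcomp k _ _ _ (HomotopyAlg.comul C D m) ∘ₗ starLift Θ Θ' =
      LinearMap.lcomp k _ (HomotopyAlg.comul C A m) ∘ₗ starTen Θ Θ' m ∘ₗ
        PiTensorProduct.map fun _ => cop L m from LinearMap.congr_fun h u
  refine PiTensorProduct.ext (MultilinearMap.ext fun y => ?_)
  change HomotopyAlg.comul C D m ∘ₗ starLift Θ Θ' (PiTensorProduct.tprod k y) =
    starTen Θ Θ' m (PiTensorProduct.map (fun _ => cop L m) (PiTensorProduct.tprod k y)) ∘ₗ
      HomotopyAlg.comul C A m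
  rw [starLift_tprod, PiTensorProduct.map_tprod, starTen_tprod, ← LinearMap.comp_assoc,
    hΘ.comul m (y 0), LinearMap.comp_assoc, hΘ'.comul m (y 1), LinearMap.comp_assoc]

theorem tensorLift_starLift_tprod {m : ℕ} {d : Fin (m * 2) → ℤ} {y : Fin (m * 2) → sym L}
    (hy : ∀ i, y i ∈ (sym L).deg (d i)) :
    tensorLift C A D m (PiTensorProduct.map (fun _ => starLift Θ Θ')
      (blockMap (sym L) (fun _ : Fin m => 2) (pairPos m) (PiTensorProduct.tprod k y))) =
    tensorMap (C.obj m) (cofree C A) (cofree C D) m fun j =>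
      Θ (y (pairPos m ⟨j, 0⟩)) ∘ₗ Θ' (y (pairPos m ⟨j, 1⟩)) := by
  refine (congrArg (fun z => tensorLift C A D m (PiTensorProduct.map (fun _ => starLift Θ Θ') z))
    (blockMap_pairPos_tprod hy)).trans ?_
  refine (congrArg (tensorLift C A D m) (PiTensorProduct.map_tprod _ _)).trans ?_
  rw [tensorLift_tprod]
  refine congrArg _ (funext fun j => ?_)
  rw [starLift_tprod]

theorem starTen_blockMap_tprod {m : ℕ} (hm : m ≠ 0) {d : Fin (m * 2) → ℤ}
    {y : Fin (m * 2) → sym L} (hy : ∀ i, y i ∈ (sym L).deg (d i)) :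
    starTen Θ Θ' m (blockMap (sym L) (fun _ : Fin 2 => m) (pairPos' m)
      (PiTensorProduct.tprod k y)) =
    ks k (∑ i, ∑ j, if i < j then
        (d (pairPos m ⟨i, 1⟩) : ZMod 2) * d (pairPos m ⟨j, 0⟩) else 0) •
      (tensorMap (C.obj m) (cofree C B) (cofree C D) m (fun j => Θ (y (pairPos m ⟨j, 0⟩))) ∘ₗ
        tensorMap (C.obj m) (cofree C A) (cofree C B) m
          fun j => Θ' (y (pairPos m ⟨j, 1⟩))) := by
  have h1 : PiTensorProduct.map (fun _ : Fin m => Θ)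
      (PiTensorProduct.tprod k fun s => y (pairPos' m ⟨0, s⟩)) =
      PiTensorProduct.tprod k fun j => Θ (y (pairPos m ⟨j, 0⟩)) := PiTensorProduct.map_tprod _ _
  have h2 : PiTensorProduct.map (fun _ : Fin m => Θ')
      (PiTensorProduct.tprod k fun s => y (pairPos' m ⟨1, s⟩)) =
      PiTensorProduct.tprod k fun j => Θ' (y (pairPos m ⟨j, 1⟩)) := PiTensorProduct.map_tprod _ _
  refine (congrArg (starTen Θ Θ' m) (blockMap_pairPos'_tprod hm hy)).trans ?_
  rw [LinearMap.map_smul, starTen_tprod, h1, h2, tensorLift_tprod, tensorLift_tprod]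

/-- The interchange law: the Koszul sign from exchanging the two families with each other is the
sign of the rearrangement of the arguments. -/
theorem tensorLift_starLift
    (hΘ : IsDeg (sym L).deg (degSub (cofree C B) (cofree C D)) Θ 0)
    (hΘ' : IsDeg (sym L).deg (degSub (cofree C A) (cofree C B)) Θ' 0) {m : ℕ} (hm : m ≠ 0)
    (z : ⨂[k] _ : Fin (m * 2), sym L) :
    tensorLift C A D m (PiTensorProduct.map (fun _ => starLift Θ Θ')
        (blockMap (sym L) (fun _ : Fin m => 2) (pairPos m) z)) =
      starTen Θ Θ' m (blockMap (sym L) (fun _ : Fin 2 => m) (pairPos' m) z) := by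
  suffices h : tensorLift C A D m ∘ₗ (PiTensorProduct.map fun _ => starLift Θ Θ') ∘ₗ
      blockMap (sym L) (fun _ : Fin m => 2) (pairPos m) =
      starTen Θ Θ' m ∘ₗ blockMap (sym L) (fun _ : Fin 2 => m) (pairPos' m) from
    LinearMap.congr_fun h z
  refine pi_ext_deg (V := fun _ => sym L) fun d y hy => ?_
  refine (tensorLift_starLift_tprod hy).trans (Eq.trans ?_ (starTen_blockMap_tprod hm hy).symm)
  have h1 := tensorMap_comp_tensorMap (M := C.obj m) (V := cofree C A) (W := cofree C B)
    (X := cofree C D) (f := fun j : Fin m => Θ (y (pairPos m ⟨j, 0⟩)))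
    (g := fun j => Θ' (y (pairPos m ⟨j, 1⟩))) (p := fun j => d (pairPos m ⟨j, 0⟩))
    (q := fun j => d (pairPos m ⟨j, 1⟩)) (fun j => hΘ.apply_of_degSub (hy _))
    fun j => hΘ'.apply_of_degSub (hy _)
  rw [h1, smul_smul, ks_mul_self, one_smul]

/-- Composites of families of coalgebra morphisms are families of coalgebra morphisms, because the
parameter coalgebra `S(L)` is coassociative and cocommutative. -/
theorem IsCoalgFam.star (hΘ : IsCoalgFam Θ) (hΘ' : IsCoalgFam Θ') :
    IsCoalgFam (HomotopyAlg.star Θ Θ') := by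
  refine ⟨isDeg_star hΘ.deg hΘ'.deg, fun m y => ?_⟩
  rcases eq_or_ne m 0 with rfl | hm
  · exact LinearMap.ext fun x =>
      (ten_zero (C := C) (A := cofree C D) _).trans (ten_zero _).symm
  have h1 := comul_starLift hΘ hΘ' m (cop L 2 y)
  have h2 := tensorLift_starLift hΘ.deg hΘ'.deg hm (cop L (m * 2) y)
  have h3 : PiTensorProduct.map (fun _ : Fin m => starLift Θ Θ')
      (PiTensorProduct.map (fun _ => cop L 2) (cop L m y)) =
      PiTensorProduct.map (fun _ => HomotopyAlg.star Θ Θ') (cop L m y) := by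
    rw [← LinearMap.comp_apply, ← PiTensorProduct.map_comp]
    rfl
  rw [blockMap_cop hm, blockMap_cop two_ne_zero, h3] at h2
  rw [h2]
  exact h1

/-- The composite of families is compatible with the pullback along a morphism of coalgebras. -/
theorem star_coalgHom {L' : GrMod.{u, w'} k} {U : sym L' →ₗ[k] sym L}
    (hU : IsCoalgHom (coCom k) U) (y : sym L') :
    star Θ Θ' (U y) = star (Θ ∘ₗ U) (Θ' ∘ₗ U) y := by
  have h : starLift Θ Θ' ∘ₗ (PiTensorProduct.map fun _ => U) =
      starLift (Θ ∘ₗ U) (Θ' ∘ₗ U) := by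
    refine PiTensorProduct.ext (MultilinearMap.ext fun y => ?_)
    change starLift Θ Θ' (PiTensorProduct.map (fun _ => U) (PiTensorProduct.tprod k y)) =
      starLift (Θ ∘ₗ U) (Θ' ∘ₗ U) (PiTensorProduct.tprod k y)
    rw [PiTensorProduct.map_tprod, starLift_tprod, starLift_tprod]
    rfl
  rw [star, star, ← h, LinearMap.comp_apply, LinearMap.comp_apply, LinearMap.comp_apply,
    cop_coalgHom hU]

theorem piDer_tprod_two (T : sym L →ₗ[k] sym L) (y : Fin 2 → sym L) :
    piDer (fun _ : Fin 2 => sym L) (fun _ => T) (PiTensorProduct.tprod k y) =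
      PiTensorProduct.tprod k ![T (y 0), y 1] +
        PiTensorProduct.tprod k ![(sym L).eps (y 0), T (y 1)] := by
  rw [piDer, LinearMap.sum_apply, Fin.sum_univ_two, PiTensorProduct.map_tprod,
    PiTensorProduct.map_tprod]
  congr 2 <;> funext j <;> induction j using Fin.cases with
  | zero => simp
  | succ j => obtain rfl := Subsingleton.elim j 0; simp

/-- If a codifferential on `S(L)` corresponds to the commutator with codifferentials for two
families of maps, then also for their composite. -/
theorem star_codiff {T : sym L →ₗ[k] sym L} (hT : IsCoderivation (coCom k) T)
    {dA : cofree C A →ₗ[k] cofree C A} {dB : cofree C B →ₗ[k] cofree C B}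
    {dD : cofree C D →ₗ[k] cofree C D}
    (hΘ : ∀ y, Θ (T y) = dD ∘ₗ Θ y - Θ ((sym L).eps y) ∘ₗ dB)
    (hΘ' : ∀ y, Θ' (T y) = dB ∘ₗ Θ' y - Θ' ((sym L).eps y) ∘ₗ dA) (y : sym L) :
    star Θ Θ' (T y) = dD ∘ₗ star Θ Θ' y - star Θ Θ' ((sym L).eps y) ∘ₗ dA := by
  suffices h : starLift Θ Θ' ∘ₗ piDer (fun _ : Fin 2 => sym L) (fun _ => T) =
      LinearMap.llcomp k _ _ _ dD ∘ₗ starLift Θ Θ' -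
        LinearMap.lcomp k _ dA ∘ₗ starLift Θ Θ' ∘ₗ
          PiTensorProduct.map fun _ => (sym L).eps by
    have h1 := LinearMap.congr_fun h (cop L 2 y)
    rw [LinearMap.comp_apply, ← cop_coderivation hT] at h1
    refine h1.trans ?_
    rw [star, LinearMap.comp_apply, LinearMap.comp_apply, cop_eps]
    rfl
  refine PiTensorProduct.ext (MultilinearMap.ext fun y => ?_)
  change starLift Θ Θ' (piDer (fun _ : Fin 2 => sym L) (fun _ => T) (PiTensorProduct.tprod k y)) =
    dD ∘ₗ starLift Θ Θ' (PiTensorProduct.tprod k y) -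
      starLift Θ Θ' (PiTensorProduct.map (fun _ => (sym L).eps) (PiTensorProduct.tprod k y)) ∘ₗ dA
  rw [piDer_tprod_two, map_add, starLift_tprod, starLift_tprod, starLift_tprod,
    PiTensorProduct.map_tprod, starLift_tprod]
  simp only [Matrix.cons_val_zero, Matrix.cons_val_one]
  rw [hΘ, hΘ', LinearMap.sub_comp, LinearMap.comp_sub, LinearMap.comp_assoc, LinearMap.comp_assoc,
    LinearMap.comp_assoc]
  abel

end StarFamilies

/-! ### Increasing positions -/

section SigmaPositions

/-- The positions of the letters of consecutive blocks. -/
def sigmaPos {m n : ℕ} (r : Fin m → ℕ) (h : ∑ j, r j = n) : (Σ j, Fin (r j)) ≃ Fin n :=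
  finSigmaFinEquiv.trans (finCongr h)

theorem sigmaPos_val {m n : ℕ} (r : Fin m → ℕ) (h : ∑ j, r j = n) (i : Σ j, Fin (r j)) :
    (sigmaPos r h i : ℕ) = ∑ j with j < i.1, r j + i.2 := by
  obtain ⟨j, s⟩ := i
  rw [sigmaPos, Equiv.trans_apply, finCongr_apply, Fin.val_cast, finSigmaFinEquiv_apply]
  congr 1
  refine Finset.sum_bij' (fun i _ => Fin.castLE j.2.le i) (fun i hi => ⟨i, ?_⟩) ?_ ?_ ?_ ?_ ?_
  · simpa using hi
  · intro i _
    simpa using Fin.lt_def.2 i.2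
  · intro i _
    exact Finset.mem_univ _
  · intro i _
    rfl
  · intro i _
    rfl
  · intro i _
    rfl

theorem sigmaPos_lt_iff {m n : ℕ} (r : Fin m → ℕ) (h : ∑ j, r j = n) (i i' : Σ j, Fin (r j)) :
    i.1 < i'.1 ∨ i.1 = i'.1 ∧ (i.2 : ℕ) < i'.2 ↔ sigmaPos r h i < sigmaPos r h i' := by
  have key : ∀ i i' : Σ j, Fin (r j), i.1 < i'.1 → sigmaPos r h i < sigmaPos r h i' := by
    intro i i' hi
    rw [Fin.lt_def, sigmaPos_val, sigmaPos_val]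
    have h1 : ∑ j with j < i.1, r j + r i.1 ≤ ∑ j with j < i'.1, r j := by
      rw [add_comm, ← Finset.sum_insert (s := Finset.univ.filter (· < i.1)) (by simp)]
      refine Finset.sum_le_sum_of_subset fun j hj => ?_
      simp only [Finset.mem_insert, Finset.mem_filter, Finset.mem_univ, true_and] at hj ⊢
      rcases hj with rfl | hj
      · exact hi
      · exact hj.trans hi
    have h2 := i.2.2
    omega
  constructor
  · rintro (hi | ⟨h1, h2⟩)
    · exact key i i' hi
    · obtain ⟨j, s⟩ := i
      obtain ⟨j', s'⟩ := i'
      obtain rfl : j = j' := h1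
      rw [Fin.lt_def, sigmaPos_val, sigmaPos_val]
      exact Nat.add_lt_add_left h2 _
  · intro hi
    rcases lt_trichotomy i.1 i'.1 with h1 | h1 | h1
    · exact Or.inl h1
    · refine Or.inr ⟨h1, ?_⟩
      obtain ⟨j, s⟩ := i
      obtain ⟨j', s'⟩ := i'
      obtain rfl : j = j' := h1
      rw [Fin.lt_def, sigmaPos_val, sigmaPos_val] at hi
      exact Nat.lt_of_add_lt_add_left hi
    · exact absurd (key i' i h1) hi.asymm

end SigmaPositions

/-! ### Associativity of the composition of families -/

section StarAssociativity

variable {k : Type u} [Field k] [CharZero k] {C : Cooperad.{u, v} k}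
  {A₁ A₂ A₃ A₄ : GrMod.{u, w} k} {L : GrMod.{u, w''} k}

/-- The counit axiom of `S(L)`. -/
theorem cop_one (y : sym L) : tensorOne (sym L) (cop L 1 y) = y := by
  have h := counit_comul (C := coCom k) y
  have h2 : ∀ z : (coCom k).obj 1 ⊗[k] (⨂[k] _ : Fin 1, sym L),
      tensorOne (sym L) (TensorProduct.lid k _ (TensorProduct.map (coeff k 1) LinearMap.id z)) =
        TensorProduct.lid k _ (TensorProduct.map (coCom k).counit
          (tensorOne (sym L)).toLinearMap z) := by
    intro z
    induction z using TensorProduct.induction_on with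
    | zero => simp only [map_zero]
    | add t t' h h' => simp only [map_add, h, h']
    | tmul c x =>
      rw [TensorProduct.map_tmul, TensorProduct.lid_tmul, TensorProduct.map_tmul,
        TensorProduct.lid_tmul, LinearEquiv.map_smul]
      rfl
  exact (h2 _).trans h

theorem blockMap_sigmaPos_tprod {V : GrMod.{u, w} k} {m n : ℕ} {r : Fin m → ℕ}
    (hr : ∀ j, r j ≠ 0) (h : ∑ j, r j = n) {d : Fin n → ℤ} {x : Fin n → V}
    (hx : ∀ i, x i ∈ V.deg (d i)) :
    blockMap V r (sigmaPos r h) (PiTensorProduct.tprod k x) =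
      PiTensorProduct.tprod k fun j => PiTensorProduct.tprod k fun s => x (sigmaPos r h ⟨j, s⟩) := by
  rw [blockMap_tprod hr _ hx, regroupExp_of_mono, Finset.sum_eq_zero, ks_zero, one_smul]
  · intro j _
    simp
  · intro i i' hi h'
    exact ((sigmaPos_lt_iff r h i' i).1 (h'.imp_right fun h => ⟨h.1, h.2⟩)).asymm hi

theorem comp_blockMap_sigmaPos_ext {V : GrMod.{u, w''} k} {W : Type*} [AddCommGroup W]
    [Module k W] {m m' n : ℕ} {r : Fin m → ℕ} {r' : Fin m' → ℕ} (hr : ∀ j, r j ≠ 0)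
    (hr' : ∀ j, r' j ≠ 0) (h : ∑ j, r j = n) (h' : ∑ j, r' j = n)
    (G : (⨂[k] j, ⨂[k] _ : Fin (r j), V) →ₗ[k] W)
    (G' : (⨂[k] j, ⨂[k] _ : Fin (r' j), V) →ₗ[k] W)
    (H : ∀ x : Fin n → V,
      G (PiTensorProduct.tprod k fun j => PiTensorProduct.tprod k fun s =>
        x (sigmaPos r h ⟨j, s⟩)) =
      G' (PiTensorProduct.tprod k fun j => PiTensorProduct.tprod k fun s =>
        x (sigmaPos r' h' ⟨j, s⟩))) (z : ⨂[k] _ : Fin n, V) :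
    G (blockMap V r (sigmaPos r h) z) = G' (blockMap V r' (sigmaPos r' h') z) := by
  suffices h1 : G ∘ₗ blockMap V r (sigmaPos r h) = G' ∘ₗ blockMap V r' (sigmaPos r' h') from
    LinearMap.congr_fun h1 z
  refine pi_ext_deg fun d x hx => ?_
  rw [LinearMap.comp_apply, LinearMap.comp_apply, blockMap_sigmaPos_tprod hr h hx,
    blockMap_sigmaPos_tprod hr' h' hx, H]

/-- A composite of three maps as a function of a tensor that is split into blocks of two and one
factors. -/
def threeLeft {V : GrMod.{u, w''} k} {X Y T : Type*} [AddCommGroup X] [Module k X]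
    [AddCommGroup Y] [Module k Y] [AddCommGroup T] [Module k T]
    (β : (⨂[k] _ : Fin 2, V) →ₗ[k] (Y →ₗ[k] T)) (γ : V →ₗ[k] (X →ₗ[k] Y)) :
    (⨂[k] j : Fin 2, ⨂[k] _ : Fin (![2, 1] j), V) →ₗ[k] (X →ₗ[k] T) :=
  PiTensorProduct.lift (bilinMulti (M := fun j => ⨂[k] _ : Fin (![2, 1] j), V)
    ((LinearMap.llcomp k X Y T).compl₁₂ β (γ ∘ₗ (tensorOne V).toLinearMap)))

/-- A composite of three maps as a function of a tensor that is split into blocks of one and two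
factors. -/
def threeRight {V : GrMod.{u, w''} k} {X Y T : Type*} [AddCommGroup X] [Module k X]
    [AddCommGroup Y] [Module k Y] [AddCommGroup T] [Module k T]
    (β : V →ₗ[k] (Y →ₗ[k] T)) (γ : (⨂[k] _ : Fin 2, V) →ₗ[k] (X →ₗ[k] Y)) :
    (⨂[k] j : Fin 2, ⨂[k] _ : Fin (![1, 2] j), V) →ₗ[k] (X →ₗ[k] T) :=
  PiTensorProduct.lift (bilinMulti (M := fun j => ⨂[k] _ : Fin (![1, 2] j), V)
    ((LinearMap.llcomp k X Y T).compl₁₂ (β ∘ₗ (tensorOne V).toLinearMap) γ))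

theorem threeLeft_tprod {V : GrMod.{u, w''} k} {X Y T : Type*} [AddCommGroup X] [Module k X]
    [AddCommGroup Y] [Module k Y] [AddCommGroup T] [Module k T]
    (β : (⨂[k] _ : Fin 2, V) →ₗ[k] (Y →ₗ[k] T)) (γ : V →ₗ[k] (X →ₗ[k] Y))
    (z : ∀ j, ⨂[k] _ : Fin (![2, 1] j), V) :
    threeLeft β γ (PiTensorProduct.tprod k z) = β (z 0) ∘ₗ γ (tensorOne V (z 1)) :=
  PiTensorProduct.lift.tprod _

theorem threeRight_tprod {V : GrMod.{u, w''} k} {X Y T : Type*} [AddCommGroup X] [Module k X]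
    [AddCommGroup Y] [Module k Y] [AddCommGroup T] [Module k T]
    (β : V →ₗ[k] (Y →ₗ[k] T)) (γ : (⨂[k] _ : Fin 2, V) →ₗ[k] (X →ₗ[k] Y))
    (z : ∀ j, ⨂[k] _ : Fin (![1, 2] j), V) :
    threeRight β γ (PiTensorProduct.tprod k z) = β (tensorOne V (z 0)) ∘ₗ γ (z 1) :=
  PiTensorProduct.lift.tprod _

theorem threeLeft_blockMap {V : GrMod.{u, w''} k} {X Y Z T : Type*} [AddCommGroup X] [Module k X]
    [AddCommGroup Y] [Module k Y] [AddCommGroup Z] [Module k Z] [AddCommGroup T] [Module k T]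
    {θ : V →ₗ[k] (Z →ₗ[k] T)} {θ' : V →ₗ[k] (Y →ₗ[k] Z)} {θ'' : V →ₗ[k] (X →ₗ[k] Y)}
    {β : (⨂[k] _ : Fin 2, V) →ₗ[k] (Y →ₗ[k] T)} {β' : (⨂[k] _ : Fin 2, V) →ₗ[k] (X →ₗ[k] Z)}
    (hβ : ∀ x, β (PiTensorProduct.tprod k x) = θ (x 0) ∘ₗ θ' (x 1))
    (hβ' : ∀ x, β' (PiTensorProduct.tprod k x) = θ' (x 0) ∘ₗ θ'' (x 1))
    (h : ∑ j, ![2, 1] j = 3) (h' : ∑ j, ![1, 2] j = 3) (z : ⨂[k] _ : Fin 3, V) :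
    threeLeft β θ'' (blockMap V ![2, 1] (sigmaPos ![2, 1] h) z) =
      threeRight θ β' (blockMap V ![1, 2] (sigmaPos ![1, 2] h') z) := by
  refine comp_blockMap_sigmaPos_ext (by decide) (by decide) h h' (threeLeft β θ'')
    (threeRight θ β') (fun x => ?_) z
  rw [threeLeft_tprod, threeRight_tprod]
  have e0 : sigmaPos ![2, 1] h ⟨0, (0 : Fin 2)⟩ = 0 := rfl
  have e1 : sigmaPos ![2, 1] h ⟨0, (1 : Fin 2)⟩ = 1 := rfl
  have e2 : sigmaPos ![2, 1] h ⟨1, (0 : Fin 1)⟩ = 2 := rfl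
  have e0' : sigmaPos ![1, 2] h' ⟨0, (0 : Fin 1)⟩ = 0 := rfl
  have e1' : sigmaPos ![1, 2] h' ⟨1, (0 : Fin 2)⟩ = 1 := rfl
  have e2' : sigmaPos ![1, 2] h' ⟨1, (1 : Fin 2)⟩ = 2 := rfl
  have l1 := hβ fun s => x (sigmaPos ![2, 1] h ⟨0, s⟩)
  have l2 := hβ' fun s => x (sigmaPos ![1, 2] h' ⟨1, s⟩)
  have l3 := tensorOne_tprod V fun s => x (sigmaPos ![2, 1] h ⟨1, s⟩)
  have l4 := tensorOne_tprod V fun s => x (sigmaPos ![1, 2] h' ⟨0, s⟩)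
  rw [e0, e1] at l1
  rw [e1', e2'] at l2
  rw [e2] at l3
  rw [e0'] at l4
  refine (congrArg₂ LinearMap.comp l1 (congrArg θ'' l3)).trans (Eq.trans ?_
    (congrArg₂ LinearMap.comp (congrArg θ l4) l2).symm)
  exact LinearMap.comp_assoc _ _ _

/-- Iterated composites along a coassociative comultiplication agree. -/
theorem lift_comp_of_coassoc {V : GrMod.{u, w''} k} {X Y Z T : Type*} [AddCommGroup X]
    [Module k X] [AddCommGroup Y] [Module k Y] [AddCommGroup Z] [Module k Z] [AddCommGroup T]
    [Module k T] (c : ∀ n, V →ₗ[k] ⨂[k] _ : Fin n, V) (hc : ∀ y, tensorOne V (c 1 y) = y)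
    (h : ∑ j, ![2, 1] j = 3) (h' : ∑ j, ![1, 2] j = 3)
    (hb : ∀ y, blockMap V ![2, 1] (sigmaPos ![2, 1] h) (c 3 y) =
      PiTensorProduct.map (fun j => c (![2, 1] j)) (c 2 y))
    (hb' : ∀ y, blockMap V ![1, 2] (sigmaPos ![1, 2] h') (c 3 y) =
      PiTensorProduct.map (fun j => c (![1, 2] j)) (c 2 y))
    {θ : V →ₗ[k] (Z →ₗ[k] T)} {θ' : V →ₗ[k] (Y →ₗ[k] Z)} {θ'' : V →ₗ[k] (X →ₗ[k] Y)}
    {β : (⨂[k] _ : Fin 2, V) →ₗ[k] (Y →ₗ[k] T)} {β' : (⨂[k] _ : Fin 2, V) →ₗ[k] (X →ₗ[k] Z)}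
    (hβ : ∀ x, β (PiTensorProduct.tprod k x) = θ (x 0) ∘ₗ θ' (x 1))
    (hβ' : ∀ x, β' (PiTensorProduct.tprod k x) = θ' (x 0) ∘ₗ θ'' (x 1))
    {γ γ' : (⨂[k] _ : Fin 2, V) →ₗ[k] (X →ₗ[k] T)}
    (hγ : ∀ x, γ (PiTensorProduct.tprod k x) = β (c 2 (x 0)) ∘ₗ θ'' (x 1))
    (hγ' : ∀ x, γ' (PiTensorProduct.tprod k x) = θ (x 0) ∘ₗ β' (c 2 (x 1))) (y : V) :
    γ (c 2 y) = γ' (c 2 y) := by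
  have h1 : γ = threeLeft β θ'' ∘ₗ PiTensorProduct.map fun j => c (![2, 1] j) := by
    refine PiTensorProduct.ext (MultilinearMap.ext fun y => ?_)
    refine (hγ y).trans (Eq.trans ?_ (congrArg (threeLeft β θ'')
      (PiTensorProduct.map_tprod _ _)).symm)
    rw [threeLeft_tprod]
    exact congrArg (fun z => β (c 2 (y 0)) ∘ₗ θ'' z) (hc (y 1)).symm
  have h2 : γ' = threeRight θ β' ∘ₗ PiTensorProduct.map fun j => c (![1, 2] j) := by
    refine PiTensorProduct.ext (MultilinearMap.ext fun y => ?_)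
    refine (hγ' y).trans (Eq.trans ?_ (congrArg (threeRight θ β')
      (PiTensorProduct.map_tprod _ _)).symm)
    rw [threeRight_tprod]
    exact congrArg (fun z => θ z ∘ₗ β' (c 2 (y 1))) (hc (y 0)).symm
  have h3 := threeLeft_blockMap hβ hβ' h h' (c 3 y)
  rw [hb, hb'] at h3
  rw [h1, h2]
  exact h3

/-- The composition of families of maps is associative. -/
theorem star_assoc (Θ : sym L →ₗ[k] (cofree C A₃ →ₗ[k] cofree C A₄))
    (Θ' : sym L →ₗ[k] (cofree C A₂ →ₗ[k] cofree C A₃))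
    (Θ'' : sym L →ₗ[k] (cofree C A₁ →ₗ[k] cofree C A₂)) :
    star (star Θ Θ') Θ'' = star Θ (star Θ' Θ'') :=
  LinearMap.ext (lift_comp_of_coassoc (V := sym L) (cop L) cop_one (by decide) (by decide)
    (blockMap_cop two_ne_zero _ _) (blockMap_cop two_ne_zero _ _)
    (starLift_tprod Θ Θ') (starLift_tprod Θ' Θ'') (starLift_tprod (star Θ Θ') Θ'')
    (starLift_tprod Θ (star Θ' Θ'')))

end StarAssociativity

/-! ### Morphisms of symmetric coalgebras -/

section SymMaps

variable {k : Type u} [Field k] [CharZero k] {C : Cooperad.{u, v} k}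

theorem permPi_comp_map {A : GrMod.{u, w} k} {B : GrMod.{u, w'} k} {f : A →ₗ[k] B}
    (hf : IsDeg A.deg B.deg f 0) {n : ℕ} (σ : Equiv.Perm (Fin n)) :
    permPi (fun _ => B) σ ∘ₗ PiTensorProduct.map (fun _ => f) =
      PiTensorProduct.map (fun _ => f) ∘ₗ permPi (fun _ => A) σ := by
  refine pi_ext_deg fun d x hx => ?_
  have hfx : ∀ i, f (x i) ∈ B.deg (d i) := fun i => by simpa using hf _ _ (hx i)
  have h1 := permPi_tprod (fun _ => A) σ d x hx
  have h2 := permPi_tprod (fun _ => B) σ d (fun i => f (x i)) hfx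
  rw [LinearMap.comp_apply, LinearMap.comp_apply, h1, LinearMap.map_smul,
    PiTensorProduct.map_tprod, PiTensorProduct.map_tprod, h2]

theorem coalgLift_comp_proj_cls {A : GrMod.{u, w} k} {B : GrMod.{u, w'} k} {f : A →ₗ[k] B}
    (hf : IsDeg A.deg B.deg f 0) {n : ℕ} (t : Ten C A n) :
    coalgLift C (f ∘ₗ proj C A) (cls C A n t) =
      cls C B n (TensorProduct.map LinearMap.id (PiTensorProduct.map fun _ => f) t) := by
  have hfp : IsDeg (cofree C A).deg B.deg (f ∘ₗ proj C A) 0 :=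
    hf.comp (isDeg_proj C A) (add_zero 0)
  have h1 : ∀ m : ℕ, conv C A B m (fun _ => f ∘ₗ proj C A) (cls C A n t) =
      cls C B m (TensorProduct.map LinearMap.id (PiTensorProduct.map fun _ => f)
        (TensorProduct.map LinearMap.id (PiTensorProduct.map fun _ => proj C A)
          (comul C A m (cls C A n t)))) := by
    intro m
    rw [conv_of_degree_zero fun _ => hfp, PiTensorProduct.map_comp, ← LinearMap.id_comp
      (LinearMap.id : C.obj m →ₗ[k] C.obj m), TensorProduct.map_comp, LinearMap.id_comp]
    rfl
  have h2 : ∀ σ : Equiv.Perm (Fin n),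
      cls C B n (TensorProduct.map LinearMap.id (PiTensorProduct.map fun _ => f)
        (permTen C A σ t)) =
      cls C B n (TensorProduct.map LinearMap.id (PiTensorProduct.map fun _ => f) t) := by
    intro σ
    have h3 : TensorProduct.map LinearMap.id (PiTensorProduct.map fun _ => f) ∘ₗ permTen C A σ =
        permTen C B σ ∘ₗ TensorProduct.map LinearMap.id (PiTensorProduct.map fun _ => f) := by
      rw [permTen, permTen, ← TensorProduct.map_comp, ← TensorProduct.map_comp,
        permPi_comp_map hf, LinearMap.id_comp, LinearMap.comp_id]
    have h4 := LinearMap.congr_fun h3 t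
    rw [LinearMap.comp_apply, LinearMap.comp_apply] at h4
    rw [h4]
    exact LinearMap.congr_fun (cls_permTen C B σ) _
  rw [coalgLift_cls hfp le_rfl, Finset.sum_eq_single (Fin.last n)]
  · rw [Fin.val_last, h1, map_proj_comul_cls_self, map_sum, map_sum,
      Finset.sum_congr rfl fun σ _ => h2 σ, Finset.sum_const, Finset.card_univ,
      Fintype.card_perm, Fintype.card_fin, ← Nat.cast_smul_eq_nsmul k, smul_smul,
      inv_mul_cancel₀ (Nat.cast_ne_zero.2 n.factorial_ne_zero), one_smul]
  · intro m _ hm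
    have hm' : n ≠ m := fun h => hm (Fin.ext h.symm)
    rw [h1, map_proj_comul_cls_of_ne hm', map_zero, map_zero, smul_zero]
  · simp

/-- The morphism of coalgebras induced by a map of degree zero applies this map to every letter. -/
theorem coalgLift_comp_proj_word {L : GrMod.{u, w} k} {M : GrMod.{u, w'} k} {f : L →ₗ[k] M}
    (hf : IsDeg L.deg M.deg f 0) {n : ℕ} (x : Fin n → L) :
    coalgLift (coCom k) (f ∘ₗ proj (coCom k) L) (word x) = word fun i => f (x i) := by
  rw [word, coalgLift_comp_proj_cls hf, TensorProduct.map_tmul, PiTensorProduct.map_tprod]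
  rfl

/-- A morphism of coalgebras intertwines two coderivations as soon as it does so after projection
to the cogenerators. -/
theorem IsCoalgHom.comp_coderivation {A : GrMod.{u, w} k} {B : GrMod.{u, w'} k}
    {U : cofree C A →ₗ[k] cofree C B} (hU : IsCoalgHom C U) {Q : cofree C A →ₗ[k] cofree C A}
    {Q' : cofree C B →ₗ[k] cofree C B} (hQ : IsCoderivation C Q) (hQ' : IsCoderivation C Q')
    (h : ∀ y, proj C B (Q' (U y)) = proj C B (U (Q y))) : Q' ∘ₗ U = U ∘ₗ Q := by
  refine sub_eq_zero.1 (eq_zero_of_leib (p := 1) (U := U) (fun m => ?_) ?_)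
  · rw [leib_sub, LinearMap.comp_sub, LinearMap.sub_comp, ← LinearMap.comp_assoc,
      ← LinearMap.comp_assoc, (isCoderivation_iff.1 hQ').2, hU.comul, LinearMap.comp_assoc,
      LinearMap.comp_assoc, (isCoderivation_iff.1 hQ).2, hU.comul, ← LinearMap.comp_assoc,
      ← LinearMap.comp_assoc, map_comp_leib, leib_comp_map _ _ _ _ _ hU.deg]
    rfl
  · refine LinearMap.ext fun y => ?_
    rw [LinearMap.comp_apply, LinearMap.sub_apply, map_sub]
    exact sub_eq_zero.2 (h y)

end SymMaps

/-! ### The composition of convolution algebras -/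

section Composition

variable {k : Type u} [Field k] [CharZero k] {C : Cooperad.{u, v} k} {A B D : HoAlg.{u, v, w} C}
  {L : GrMod.{u, w''} k} {φ : L →ₗ[k] homSpace B D} {ψ : L →ₗ[k] homSpace A B}

variable (φ ψ) in
/-- The family of maps `C(A) → C(D)` that are composites of maps `C(B) → C(D)` and
`C(A) → C(B)`. -/
def compFam : sym L →ₗ[k] (cofree C A.space →ₗ[k] cofree C D.space) :=
  star (convSym C B.space D.space ∘ₗ coalgLift (coCom k) (φ ∘ₗ proj (coCom k) L))
    (convSym C A.space B.space ∘ₗ coalgLift (coCom k) (ψ ∘ₗ proj (coCom k) L))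

theorem isCoalgFam_compFam (hφ : IsDeg L.deg (homSpace B D).deg φ 0)
    (hψ : IsDeg L.deg (homSpace A B).deg ψ 0) :
    IsCoalgFam (compFam φ ψ) :=
  (isCoalgFam_convSym.comp (isCoalgHom_coalgLift (hφ.comp (isDeg_proj _ _) (add_zero 0)))).star
    (isCoalgFam_convSym.comp (isCoalgHom_coalgLift (hψ.comp (isDeg_proj _ _) (add_zero 0))))

theorem conv_eq_zero_of_eq_zero {A B : GrMod.{u, w} k} {n : ℕ} (hn : n = 0)
    (f : Fin n → cofree C A →ₗ[k] B) : conv C A B n f = 0 := by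
  subst hn
  exact conv_zero f

/-- The contribution of a splitting of a word to the composite. -/
theorem proj_comp_convSym_word {a b : ℕ} (g : Fin a → homSpace B D) (f : Fin b → homSpace A B) :
    proj C D.space ∘ₗ convSym C B.space D.space (word g) ∘ₗ convSym C A.space B.space (word f) =
      und B D (proj (coCom k) (homSpace B D) (word g)) ∘ₗ
        conv C A.space B.space b fun i => und A B (f i) := by
  rw [← LinearMap.comp_assoc, proj_comp_convSym, convSym_word]

theorem proj_compFam_word (hφ : IsDeg L.deg (homSpace B D).deg φ 0)
    (hψ : IsDeg L.deg (homSpace A B).deg ψ 0) {n : ℕ} (hn : n ≠ 0) {p : Fin n → ℤ} {x : Fin n → L}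
    (hx : ∀ i, x i ∈ L.deg (p i)) :
    proj C D.space ∘ₗ compFam φ ψ (word x) =
      ∑ r : Fin 2 → Fin (n + 1), (∏ j, ((r j : ℕ).factorial : k))⁻¹ •
      ∑ e : (Σ j, Fin (r j)) ≃ Fin n,
        ks k (regroupExp (fun j => (r j : ℕ)) e 0 fun i => (p i : ZMod 2)) •
          (und B D (proj (coCom k) (homSpace B D) (word fun s => φ (x (e ⟨0, s⟩)))) ∘ₗ
            conv C A.space B.space (r 1) fun s => und A B (ψ (x (e ⟨1, s⟩)))) := by
  rw [compFam, star_word _ _ hn hx, comp_sum]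
  refine Finset.sum_congr rfl fun r _ => ?_
  rw [LinearMap.comp_smul, comp_sum]
  congr 1
  refine Finset.sum_congr rfl fun e _ => ?_
  rw [LinearMap.comp_smul]
  congr 1
  rw [LinearMap.comp_apply, LinearMap.comp_apply, coalgLift_comp_proj_word hφ,
    coalgLift_comp_proj_word hψ]
  exact proj_comp_convSym_word _ _

theorem isDeg_plug_und (hφ : IsDeg L.deg (homSpace B D).deg φ 0)
    (hψ : IsDeg L.deg (homSpace A B).deg ψ 0) {n : ℕ} {p : Fin (n + 1) → ℤ} {x : Fin (n + 1) → L}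
    (hx : ∀ i, x i ∈ L.deg (p i)) :
    IsDeg (cofree C A.space).deg D.space.deg (plug A.space B.space D.space n (und B D (φ (x 0)))
      fun i => und A B (ψ (x i.succ))) (∑ i, p i) := by
  have h0 : φ (x 0) ∈ (homSpace B D).deg (p 0) := by simpa using hφ _ _ (hx 0)
  have h1 : ∀ i : Fin n, ψ (x i.succ) ∈ (homSpace A B).deg (p i.succ) := fun i => by
    simpa using hψ _ _ (hx i.succ)
  have h2 : ∑ i : Fin n, p i.succ + p 0 = ∑ i, p i := by rw [Fin.sum_univ_succ, add_comm]
  rw [← h2]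
  exact isDeg_plug A.space B.space D.space n (homMap_mem h0) fun i => homMap_mem (h1 i)

variable (hφ : IsDeg L.deg (homSpace B D).deg φ 0) (hψ : IsDeg L.deg (homSpace A B).deg ψ 0)

/-- The operation `x 0, …, x n ↦ φ (x 0) ((1 ⊗ ψ (x 1) ⊗ ⋯ ⊗ ψ (x n)) Δ n)`, for maps
`φ : L → Hom(C(B), D)` and `ψ : L → Hom(C(A), B)` of degree zero. -/
def compArg (n : ℕ) : MultilinearMap k (fun _ : Fin (n + 1) => L) (homSpace A D) :=
  homMulti
    (LinearMap.uncurryLeft (MultilinearMap.compLinearMapₗ (fun _ : Fin n => und A B ∘ₗ ψ) ∘ₗ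
      plug A.space B.space D.space n ∘ₗ und B D ∘ₗ φ))
    fun _ _ hx => ⟨_, isDeg_plug_und hφ hψ hx⟩

/-- The map `S(L) → Hom(C(A), D)` given by the symmetrizations of the operations `compArg`. -/
def compQ : sym L →ₗ[k] homSpace A D :=
  symElim fun n => match n with
    | 0 => 0
    | 1 => 0
    | n + 2 => ((n + 2 : ℕ) : k) • PiTensorProduct.lift (compArg hφ hψ (n + 1))

theorem und_compArg {n : ℕ} (x : Fin (n + 1) → L) :
    und A D (compArg hφ hψ n x) =
      und B D (φ (x 0)) ∘ₗ
        conv C A.space B.space n fun i => und A B (ψ (x i.succ)) := rfl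

theorem compQ_comp_cls {n : ℕ} (hn : n ≤ 1) :
    compQ hφ hψ ∘ₗ cls (coCom k) L n = 0 := by
  refine LinearMap.ext fun t => ?_
  rw [LinearMap.comp_apply, compQ, symElim_cls]
  interval_cases n <;> simp [symTen]

theorem compQ_word_of_le_one {n : ℕ} (hn : n ≤ 1) (x : Fin n → L) :
    compQ hφ hψ (word x) = 0 :=
  LinearMap.congr_fun (compQ_comp_cls hφ hψ hn) _

/-- The sum over all choices of the letter at which `φ` is evaluated and all orders of the other
letters. -/
theorem compQ_word {n : ℕ} {p : Fin (n + 2) → ℤ} {x : Fin (n + 2) → L}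
    (hx : ∀ i, x i ∈ L.deg (p i)) : compQ hφ hψ (word x) =
      ((n + 1).factorial : k)⁻¹ • ∑ σ : Equiv.Perm (Fin (n + 2)),
        koszulSign k id σ.symm (fun i => (p i : ZMod 2)) •
          compArg hφ hψ (n + 1) fun i => x (σ i) := by
  refine (symElim_word _ (Nat.succ_ne_zero _) hx).trans ?_
  have h : ((n + 2).factorial : k)⁻¹ * ((n + 2 : ℕ) : k) = ((n + 1).factorial : k)⁻¹ := by
    rw [Nat.factorial_succ (n + 1), Nat.cast_mul, mul_inv, mul_comm, ← mul_assoc,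
      mul_inv_cancel₀ (Nat.cast_ne_zero.2 (Nat.succ_ne_zero _)), one_mul]
  rw [← h, ← smul_smul, Finset.smul_sum (r := ((n + 2 : ℕ) : k))]
  congr 1
  refine Finset.sum_congr rfl fun σ _ => ?_
  rw [LinearMap.smul_apply, PiTensorProduct.lift.tprod, smul_comm]

theorem compArg_mem {n : ℕ} {p : Fin (n + 1) → ℤ} {x : Fin (n + 1) → L}
    (hx : ∀ i, x i ∈ L.deg (p i)) : compArg hφ hψ n x ∈ (homSpace A D).deg (∑ i, p i) := by
  have h : IsDeg _ _ (und A D (compArg hφ hψ n x)) (∑ i, p i) := isDeg_plug_und hφ hψ hx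
  exact h

theorem isDeg_compQ : IsDeg (sym L).deg (homSpace A D).deg (compQ hφ hψ) 0 := by
  refine isDeg_sym fun n p x hx => ?_
  rw [add_zero]
  match n, p, x, hx with
  | 0, p, x, hx =>
    rw [word_zero, map_zero]; exact Submodule.zero_mem _
  | 1, p, x, hx =>
    rw [compQ_word_of_le_one hφ hψ (le_refl 1)]; exact Submodule.zero_mem _
  | n + 2, p, x, hx =>
    rw [compQ_word hφ hψ hx]
    refine Submodule.smul_mem _ _ (Submodule.sum_mem _ fun σ _ => Submodule.smul_mem _ _ ?_)
    rw [← Equiv.sum_comp σ p]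
    exact compArg_mem hφ hψ fun i => hx (σ i)

/-- The projection of the composite of families to the cogenerators. Only splittings of a word with
exactly one letter in the first part contribute, and these are the terms of `compQ`. -/
theorem proj_comp_compFam (y : sym L) :
    proj C D.space ∘ₗ compFam φ ψ y = und A D (compQ hφ hψ y) := by
  suffices h : LinearMap.llcomp k _ _ _ (proj C D.space) ∘ₗ compFam φ ψ =
      und A D ∘ₗ compQ hφ hψ from LinearMap.congr_fun h y
  refine sym_ext fun n p x hn hx => ?_
  change proj C D.space ∘ₗ compFam φ ψ (word x) = und A D (compQ hφ hψ (word x))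
  rw [proj_compFam_word hφ hψ hn hx]
  have h0 : ∀ (r : Fin 2 → ℕ) (e : (Σ j, Fin (r j)) ≃ Fin n), r 0 ≠ 1 ∨ r 1 = 0 →
      und B D (proj (coCom k) (homSpace B D)
        (word fun s => φ (x (e ⟨0, s⟩)))) ∘ₗ
      (conv C A.space B.space (r 1) fun s =>
        und A B (ψ (x (e ⟨1, s⟩)))) = 0 := by
    rintro r e (h | h)
    · rw [proj_word_of_ne h, map_zero, LinearMap.zero_comp]
    · rw [conv_eq_zero_of_eq_zero h, LinearMap.comp_zero]
  have hsum : ∀ r : Fin 2 → ℕ, ((Σ j, Fin (r j)) ≃ Fin n) → r 0 + r 1 = n := by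
    intro r e
    have := Fintype.card_congr e
    simpa using this
  match n, p, x, hn, hx, h0, hsum with
  | 0, _, _, hn, _, _, _ => exact absurd rfl hn
  | 1, p, x, hn, hx, h0, hsum =>
    rw [compQ_word_of_le_one hφ hψ (le_refl 1), map_zero]
    refine Finset.sum_eq_zero fun r _ => smul_eq_zero_of_right _ (Finset.sum_eq_zero fun e _ =>
      smul_eq_zero_of_right _ (h0 (fun j => r j) e ?_))
    have := hsum (fun j => r j) e
    by_contra! hc
    omega
  | n + 2, p, x, hn, hx, h0, hsum =>
    -- the splittings with one letter in the first part
    let r₀ : Fin 2 → Fin (n + 2 + 1) := ![⟨1, by omega⟩, ⟨n + 1, by omega⟩]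
    have hr₀ : ∑ j, ((r₀ j : Fin (n + 2 + 1)) : ℕ) = n + 2 := by
      rw [Fin.sum_univ_two]
      change 1 + (n + 1) = n + 2
      omega
    rw [Finset.sum_eq_single r₀]
    · rw [compQ_word hφ hψ hx, map_smul, map_sum, sum_equiv_eq_sum_perm (sigmaPos _ hr₀)]
      refine congrArg₂ _ ?_ (Finset.sum_congr rfl fun σ _ => ?_)
      · rw [Fin.prod_univ_two]
        change ((Nat.factorial 1 : ℕ) * (Nat.factorial (n + 1) : ℕ) : k)⁻¹ = _
        rw [Nat.factorial_one, Nat.cast_one, one_mul]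
      · rw [regroupExp_trans_of_mono _ _ (sigmaPos_lt_iff _ hr₀), LinearMap.map_smul, und_compArg]
        congr 1
        have e0 : sigmaPos _ hr₀ ⟨0, (0 : Fin 1)⟩ = 0 := Fin.ext (by rw [sigmaPos_val]; simp)
        have e1 : ∀ s : Fin (n + 1), sigmaPos _ hr₀ ⟨1, s⟩ = s.succ := by
          intro s
          refine Fin.ext ?_
          rw [sigmaPos_val]
          have : (Finset.univ.filter fun j : Fin 2 => j < 1) = {0} := by decide
          change ∑ j with j < (1 : Fin 2), ((r₀ j : Fin (n + 2 + 1)) : ℕ) + (s : ℕ) = _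
          rw [this, Finset.sum_singleton, Fin.val_succ, add_comm]
          rfl
        have l1 := proj_word_one (k := k) (fun s : Fin 1 =>
          φ (x (σ (sigmaPos _ hr₀ ⟨0, s⟩))))
        rw [e0] at l1
        have l2 : (fun s : Fin (n + 1) => und A B (ψ
            (x (σ (sigmaPos _ hr₀ ⟨1, s⟩))))) = fun s => und A B
              (ψ (x (σ s.succ))) := by
          funext s
          rw [e1]
        exact congrArg₂ LinearMap.comp (congrArg (und B D) l1)
          (congrArg (conv C A.space B.space (n + 1)) l2)
    · intro r _ hr
      refine smul_eq_zero_of_right _ (Finset.sum_eq_zero fun e _ =>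
        smul_eq_zero_of_right _ (h0 (fun j => r j) e (Or.inl fun h => hr ?_)))
      have h1 := hsum (fun j => r j) e
      funext j
      match j with
      | 0 => exact Fin.ext h
      | 1 =>
        refine Fin.ext ?_
        change ((r 1 : Fin (n + 2 + 1)) : ℕ) = n + 1
        omega
    · intro h
      exact absurd (Finset.mem_univ _) h

end Composition

/-! ### The composition as a composition of families -/

section CoalgebraMorphisms

variable {k : Type u} [Field k] [CharZero k] {C : Cooperad.{u, v} k}

/-- A morphism of coalgebras is the lift of its projection. -/
theorem coalgLift_eq_of_proj {A : GrMod.{u, w} k} {B : GrMod.{u, w'} k} {g : cofree C A →ₗ[k] B}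
    (hg : IsDeg (cofree C A).deg B.deg g 0) {U : cofree C A →ₗ[k] cofree C B}
    (hU : IsCoalgHom C U) (h : proj C B ∘ₗ U = g) : coalgLift C g = U :=
  (isCoalgHom_coalgLift hg).ext hU ((proj_comp_coalgLift hg).trans h.symm)

theorem coalgLift_comp_coalgLift {A : GrMod.{u, w} k} {B : GrMod.{u, w'} k} {D : GrMod.{u, w''} k}
    {φ : B →ₗ[k] D} (hφ : IsDeg B.deg D.deg φ 0) {g : cofree C A →ₗ[k] B}
    (hg : IsDeg (cofree C A).deg B.deg g 0) :
    coalgLift C (φ ∘ₗ proj C B) ∘ₗ coalgLift C g = coalgLift C (φ ∘ₗ g) := by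
  have hφ' : IsDeg (cofree C B).deg D.deg (φ ∘ₗ proj C B) 0 := hφ.comp (isDeg_proj C B) (add_zero 0)
  refine (coalgLift_eq_of_proj (hφ.comp hg (add_zero 0))
    ((isCoalgHom_coalgLift hφ').comp (isCoalgHom_coalgLift hg)) ?_).symm
  rw [← LinearMap.comp_assoc, proj_comp_coalgLift hφ', LinearMap.comp_assoc,
    proj_comp_coalgLift hg]

end CoalgebraMorphisms

section Composition

variable {k : Type u} [Field k] [CharZero k] {C : Cooperad.{u, v} k} {A B D : HoAlg.{u, v, w} C}
  {L : GrMod.{u, w''} k} {φ : L →ₗ[k] homSpace B D} {ψ : L →ₗ[k] homSpace A B}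

theorem und_injective : Function.Injective (und A B) := Subtype.val_injective

/-- Elements of `S(Hom(C(A), B))` with the same image under `convSym` have the same projection. -/
theorem proj_eq_of_convSym_eq {y z : sym (homSpace A B)}
    (h : convSym C A.space B.space y = convSym C A.space B.space z) :
    proj (coCom k) (homSpace A B) y = proj (coCom k) (homSpace A B) z := by
  refine und_injective ?_
  rw [← proj_comp_convSym, ← proj_comp_convSym, h]

variable (hφ : IsDeg L.deg (homSpace B D).deg φ 0) (hψ : IsDeg L.deg (homSpace A B).deg ψ 0)

/-- The coalgebra morphism `S(L) → S(Hom(C(A), D))` with projection `compQ`. -/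
def compLift : sym L →ₗ[k] sym (homSpace A D) := coalgLift (coCom k) (compQ hφ hψ)

theorem isCoalgHom_compLift : IsCoalgHom (coCom k) (compLift hφ hψ) :=
  isCoalgHom_coalgLift (isDeg_compQ hφ hψ)

theorem proj_compLift (y : sym L) :
    proj (coCom k) (homSpace A D) (compLift hφ hψ y) = compQ hφ hψ y :=
  LinearMap.congr_fun (proj_comp_coalgLift (isDeg_compQ hφ hψ)) y

/-- The characterization of the composition by the composites of families. -/
theorem convSym_comp_compLift :
    convSym C A.space D.space ∘ₗ compLift hφ hψ = compFam φ ψ := by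
  refine (isCoalgFam_convSym.comp (isCoalgHom_compLift hφ hψ)).ext (isCoalgFam_compFam hφ hψ)
    fun y => ?_
  rw [proj_comp_compFam hφ hψ, LinearMap.comp_apply, proj_comp_convSym, proj_compLift]

/-- A morphism to the convolution algebra that commutes with codifferentials gives a family for
which the codifferential of the parameters becomes the commutator. -/
theorem convSym_codiff_of_comm {T : sym L →ₗ[k] sym L} {S : sym L →ₗ[k] sym (homSpace A B)}
    (hS : IsCoalgHom (coCom k) S) (h : mapCodiff A B ∘ₗ S = S ∘ₗ T) (y : sym L) :
    (convSym C A.space B.space ∘ₗ S) (T y) = B.codiff ∘ₗ (convSym C A.space B.space ∘ₗ S) y -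
      (convSym C A.space B.space ∘ₗ S) ((sym L).eps y) ∘ₗ A.codiff := by
  have h1 := LinearMap.congr_fun h y
  rw [LinearMap.comp_apply, LinearMap.comp_apply] at h1
  rw [LinearMap.comp_apply, ← h1, convSym_mapCodiff, eps_apply_of_isDeg hS.deg]
  rfl

/-- The composition is compatible with the codifferentials: under `convSym`, these become
commutators with the codifferentials of the cofree coalgebras, for which the Leibniz rule holds. -/
theorem mapCodiff_comp_compLift {T : sym L →ₗ[k] sym L} (hT : IsCoderivation (coCom k) T)
    (h : mapCodiff B D ∘ₗ coalgLift (coCom k) (φ ∘ₗ proj (coCom k) L) =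
      coalgLift (coCom k) (φ ∘ₗ proj (coCom k) L) ∘ₗ T)
    (h' : mapCodiff A B ∘ₗ coalgLift (coCom k) (ψ ∘ₗ proj (coCom k) L) =
      coalgLift (coCom k) (ψ ∘ₗ proj (coCom k) L) ∘ₗ T) :
    mapCodiff A D ∘ₗ compLift hφ hψ = compLift hφ hψ ∘ₗ T := by
  have hU := isCoalgHom_compLift hφ hψ
  have hM : IsCoderivation (coCom k) (mapCodiff A D) := isCoderivation_mapCodiff
  refine IsCoalgHom.comp_coderivation hU hT hM ?_
  intro y
  refine proj_eq_of_convSym_eq ?_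
  have hS := isCoalgHom_coalgLift (hφ.comp (isDeg_proj (coCom k) L) (add_zero 0))
  have hS' := isCoalgHom_coalgLift (hψ.comp (isDeg_proj (coCom k) L) (add_zero 0))
  have h1 : ∀ z, convSym C A.space D.space (compLift hφ hψ z) = compFam φ ψ z :=
    LinearMap.congr_fun (convSym_comp_compLift hφ hψ)
  rw [convSym_mapCodiff, eps_apply_of_isDeg hU.deg, h1, h1, h1]
  exact (star_codiff hT (convSym_codiff_of_comm hS h) (convSym_codiff_of_comm hS' h') y).symm

end Composition

/-! ### Associativity of the composition -/

section Associativity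

variable {k : Type u} [Field k] [CharZero k] {C : Cooperad.{u, v} k}
  {A₁ A₂ A₃ A₄ : HoAlg.{u, v, w} C}

/-- The two iterated compositions agree after `convSym`, where they are the two ways of composing
three families; coalgebra morphisms `Zᵢ` from a common source stand for the ways of feeding them. -/
theorem compLift_assoc {L₁ : GrMod.{u, w''} k} {L₂ L₃ L₄ P : GrMod.{u, w''} k}
    {φ₁ : L₁ →ₗ[k] homSpace A₃ A₄} (hφ₁ : IsDeg L₁.deg (homSpace A₃ A₄).deg φ₁ 0)
    {ψ₁ : L₁ →ₗ[k] homSpace A₂ A₃} (hψ₁ : IsDeg L₁.deg (homSpace A₂ A₃).deg ψ₁ 0)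
    {φ₂ : L₂ →ₗ[k] homSpace A₂ A₄} (hφ₂ : IsDeg L₂.deg (homSpace A₂ A₄).deg φ₂ 0)
    {ψ₂ : L₂ →ₗ[k] homSpace A₁ A₂} (hψ₂ : IsDeg L₂.deg (homSpace A₁ A₂).deg ψ₂ 0)
    {φ₃ : L₃ →ₗ[k] homSpace A₂ A₃} (hφ₃ : IsDeg L₃.deg (homSpace A₂ A₃).deg φ₃ 0)
    {ψ₃ : L₃ →ₗ[k] homSpace A₁ A₂} (hψ₃ : IsDeg L₃.deg (homSpace A₁ A₂).deg ψ₃ 0)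
    {φ₄ : L₄ →ₗ[k] homSpace A₃ A₄} (hφ₄ : IsDeg L₄.deg (homSpace A₃ A₄).deg φ₄ 0)
    {ψ₄ : L₄ →ₗ[k] homSpace A₁ A₃} (hψ₄ : IsDeg L₄.deg (homSpace A₁ A₃).deg ψ₄ 0)
    {Z₁ : sym P →ₗ[k] sym L₁} (hZ₁ : IsCoalgHom (coCom k) Z₁)
    {Z₂ : sym P →ₗ[k] sym L₂} (hZ₂ : IsCoalgHom (coCom k) Z₂)
    {Z₃ : sym P →ₗ[k] sym L₃} (hZ₃ : IsCoalgHom (coCom k) Z₃)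
    {Z₄ : sym P →ₗ[k] sym L₄} (hZ₄ : IsCoalgHom (coCom k) Z₄)
    (e₁ : coalgLift (coCom k) (φ₂ ∘ₗ proj (coCom k) L₂) ∘ₗ Z₂ = compLift hφ₁ hψ₁ ∘ₗ Z₁)
    (e₂ : coalgLift (coCom k) (ψ₂ ∘ₗ proj (coCom k) L₂) ∘ₗ Z₂ =
      coalgLift (coCom k) (ψ₃ ∘ₗ proj (coCom k) L₃) ∘ₗ Z₃)
    (e₃ : coalgLift (coCom k) (ψ₁ ∘ₗ proj (coCom k) L₁) ∘ₗ Z₁ =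
      coalgLift (coCom k) (φ₃ ∘ₗ proj (coCom k) L₃) ∘ₗ Z₃)
    (e₄ : coalgLift (coCom k) (φ₄ ∘ₗ proj (coCom k) L₄) ∘ₗ Z₄ =
      coalgLift (coCom k) (φ₁ ∘ₗ proj (coCom k) L₁) ∘ₗ Z₁)
    (e₅ : coalgLift (coCom k) (ψ₄ ∘ₗ proj (coCom k) L₄) ∘ₗ Z₄ = compLift hφ₃ hψ₃ ∘ₗ Z₃) :
    compLift hφ₂ hψ₂ ∘ₗ Z₂ = compLift hφ₄ hψ₄ ∘ₗ Z₄ := by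
  have key : ∀ {A B D : HoAlg.{u, v, w} C} {L : GrMod.{u, w''} k} {φ : L →ₗ[k] homSpace B D}
      {ψ : L →ₗ[k] homSpace A B} (hφ : IsDeg L.deg (homSpace B D).deg φ 0)
      (hψ : IsDeg L.deg (homSpace A B).deg ψ 0) {Z : sym P →ₗ[k] sym L}
      (_ : IsCoalgHom (coCom k) Z),
      convSym C A.space D.space ∘ₗ (compLift hφ hψ ∘ₗ Z) =
        star (convSym C B.space D.space ∘ₗ (coalgLift (coCom k) (φ ∘ₗ proj (coCom k) L) ∘ₗ Z))
          (convSym C A.space B.space ∘ₗ (coalgLift (coCom k) (ψ ∘ₗ proj (coCom k) L) ∘ₗ Z)) := by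
    intro A B D L φ ψ hφ hψ Z hZ
    rw [← LinearMap.comp_assoc, convSym_comp_compLift, ← LinearMap.comp_assoc,
      ← LinearMap.comp_assoc]
    exact LinearMap.ext (star_coalgHom hZ)
  have h₂ := (isCoalgHom_compLift hφ₂ hψ₂).comp hZ₂
  have h₄ := (isCoalgHom_compLift hφ₄ hψ₄).comp hZ₄
  refine h₂.ext h₄ ?_
  refine LinearMap.ext ?_
  intro y
  rw [LinearMap.comp_apply, LinearMap.comp_apply]
  refine proj_eq_of_convSym_eq ?_
  suffices h : convSym C A₁.space A₄.space ∘ₗ (compLift hφ₂ hψ₂ ∘ₗ Z₂) =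
      convSym C A₁.space A₄.space ∘ₗ (compLift hφ₄ hψ₄ ∘ₗ Z₄) from LinearMap.congr_fun h y
  rw [key hφ₂ hψ₂ hZ₂, key hφ₄ hψ₄ hZ₄, e₁, e₂, e₄, e₅, key hφ₁ hψ₁ hZ₁, key hφ₃ hψ₃ hZ₃, e₃,
    star_assoc]

end Associativity

/-! ### Projections of direct sums -/

section DirectSums

variable {k : Type u} [Field k] [CharZero k]

/-- A map of graded spaces that is compatible with differentials and multibrackets is compatible
with the codifferentials. -/
theorem codiff_comp_coalgLift {L : GrMod.{u, w} k} {M : GrMod.{u, w'} k} {f : L →ₗ[k] M}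
    (hf : IsDeg L.deg M.deg f 0) {d : L →ₗ[k] L} {q : sym L →ₗ[k] L} {d' : M →ₗ[k] M}
    {q' : sym M →ₗ[k] M} (hd : IsDeg L.deg L.deg d 1) (hq : IsDeg (sym L).deg L.deg q 1)
    (hd' : IsDeg M.deg M.deg d' 1) (hq' : IsDeg (sym M).deg M.deg q' 1)
    (h : ∀ x, d' (f x) = f (d x))
    (h' : ∀ y, q' (coalgLift (coCom k) (f ∘ₗ proj (coCom k) L) y) = f (q y)) :
    (cofreeDiff (coCom k) d' + coder (coCom k) q') ∘ₗ
        coalgLift (coCom k) (f ∘ₗ proj (coCom k) L) =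
      coalgLift (coCom k) (f ∘ₗ proj (coCom k) L) ∘ₗ
        (cofreeDiff (coCom k) d + coder (coCom k) q) := by
  have hfp : IsDeg (sym L).deg M.deg (f ∘ₗ proj (coCom k) L) 0 :=
    hf.comp (isDeg_proj (coCom k) L) (add_zero 0)
  have h1 : ∀ y, proj (coCom k) M (coalgLift (coCom k) (f ∘ₗ proj (coCom k) L) y) =
      f (proj (coCom k) L y) := LinearMap.congr_fun (proj_comp_coalgLift hfp)
  refine (isCoalgHom_coalgLift hfp).comp_coderivation
    (isCoderivation_cofreeDiff_add_coder hd hq) (isCoderivation_cofreeDiff_add_coder hd' hq') ?_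
  intro y
  rw [proj_cofreeDiff_add_coder hd' hq', h1, h1, proj_cofreeDiff_add_coder hd hq, h, h', map_add]

theorem isDeg_comp_proj {L : GrMod.{u, w} k} {M : GrMod.{u, w'} k} {f : L →ₗ[k] M}
    (hf : IsDeg L.deg M.deg f 0) : IsDeg (sym L).deg M.deg (f ∘ₗ proj (coCom k) L) 0 :=
  hf.comp (isDeg_proj (coCom k) L) (add_zero 0)

end DirectSums

section Composition

variable {k : Type u} [Field k] [CharZero k] {C : Cooperad.{u, v} k} {A B D : HoAlg.{u, v, w} C}

/-- The composition intertwines the codifferentials, for a space `M` with projections to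
`map(B, D)` and `map(A, B)` that are compatible with differentials and multibrackets. -/
theorem mapCodiff_comp_compLift_of_components {M : SLieData.{u, w''} k}
    {φ : M.space →ₗ[k] homSpace B D} (hφ : IsDeg M.space.deg (homSpace B D).deg φ 0)
    {ψ : M.space →ₗ[k] homSpace A B} (hψ : IsDeg M.space.deg (homSpace A B).deg ψ 0)
    (h : ∀ p x, φ x ∈ (homSpace B D).deg p → ψ x ∈ (homSpace A B).deg p → x ∈ M.space.deg p)
    (h₁ : ∀ x, homDiff B D (φ x) = φ (M.d x)) (h₂ : ∀ x, homDiff A B (ψ x) = ψ (M.d x))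
    (h₃ : ∀ y, mapQ B D (coalgLift (coCom k) (φ ∘ₗ proj (coCom k) M.space) y) = φ (M.q y))
    (h₄ : ∀ y, mapQ A B (coalgLift (coCom k) (ψ ∘ₗ proj (coCom k) M.space) y) = ψ (M.q y)) :
    mapCodiff A D ∘ₗ compLift hφ hψ = compLift hφ hψ ∘ₗ M.codiff := by
  have hS := isCoalgHom_coalgLift (isDeg_comp_proj hφ)
  have hS' := isCoalgHom_coalgLift (isDeg_comp_proj hψ)
  have hd : IsDeg M.space.deg M.space.deg M.d 1 := fun p x hx => by
    refine h _ _ ?_ ?_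
    · have := (isDeg_homDiff B D).comp hφ (zero_add 1) p x hx
      rw [LinearMap.comp_apply, h₁] at this
      exact this
    · have := (isDeg_homDiff A B).comp hψ (zero_add 1) p x hx
      rw [LinearMap.comp_apply, h₂] at this
      exact this
  have hq : IsDeg (sym M.space).deg M.space.deg M.q 1 := fun p x hx => by
    refine h _ _ ?_ ?_
    · have := (isDeg_mapQ (A := B) (B := D)).comp hS.deg (zero_add 1) p x hx
      rw [LinearMap.comp_apply, h₃] at this
      exact this
    · have := (isDeg_mapQ (A := A) (B := B)).comp hS'.deg (zero_add 1) p x hx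
      rw [LinearMap.comp_apply, h₄] at this
      exact this
  exact mapCodiff_comp_compLift hφ hψ (isCoderivation_cofreeDiff_add_coder hd hq)
    (codiff_comp_coalgLift hφ hd hq (isDeg_homDiff B D) isDeg_mapQ h₁ h₃)
    (codiff_comp_coalgLift hψ hd hq (isDeg_homDiff A B) isDeg_mapQ h₂ h₄)

/-- A morphism of coalgebras to `S(L)` whose components are given by morphisms of coalgebras. -/
theorem coalgLift_comp_of_component {L P V : GrMod.{u, w} k} {φ : L →ₗ[k] V}
    (hφ : IsDeg L.deg V.deg φ 0) {g : sym P →ₗ[k] L} (hg : IsDeg (sym P).deg L.deg g 0)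
    {U : sym P →ₗ[k] sym V} (hU : IsCoalgHom (coCom k) U)
    (h : ∀ y, φ (g y) = proj (coCom k) V (U y)) :
    coalgLift (coCom k) (φ ∘ₗ proj (coCom k) L) ∘ₗ coalgLift (coCom k) g = U := by
  have h' : φ ∘ₗ g = proj (coCom k) V ∘ₗ U := LinearMap.ext h
  rw [coalgLift_comp_coalgLift hφ hg, h']
  refine coalgLift_eq_of_proj ?_ hU rfl
  exact (isDeg_proj (coCom k) V).comp hU.deg (add_zero 0)

end Composition

section Associativity

variable {k : Type u} [Field k] [CharZero k] {C : Cooperad.{u, v} k}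
  {A₁ A₂ A₃ A₄ : HoAlg.{u, v, w} C}

/-- Associativity of the composition, for spaces `L₁`, `L₂`, `L₃`, `L₄`, `Q`, `P` with projections
that make them direct sums. -/
theorem compLift_assoc_of_components {L₁ L₂ L₃ L₄ P Q : GrMod.{u, max u v w} k}
    {φ₁ : L₁ →ₗ[k] homSpace A₃ A₄} (hφ₁ : IsDeg L₁.deg (homSpace A₃ A₄).deg φ₁ 0)
    {ψ₁ : L₁ →ₗ[k] homSpace A₂ A₃} (hψ₁ : IsDeg L₁.deg (homSpace A₂ A₃).deg ψ₁ 0)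
    {φ₂ : L₂ →ₗ[k] homSpace A₂ A₄} (hφ₂ : IsDeg L₂.deg (homSpace A₂ A₄).deg φ₂ 0)
    {ψ₂ : L₂ →ₗ[k] homSpace A₁ A₂} (hψ₂ : IsDeg L₂.deg (homSpace A₁ A₂).deg ψ₂ 0)
    {φ₃ : L₃ →ₗ[k] homSpace A₂ A₃} (hφ₃ : IsDeg L₃.deg (homSpace A₂ A₃).deg φ₃ 0)
    {ψ₃ : L₃ →ₗ[k] homSpace A₁ A₂} (hψ₃ : IsDeg L₃.deg (homSpace A₁ A₂).deg ψ₃ 0)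
    {φ₄ : L₄ →ₗ[k] homSpace A₃ A₄} (hφ₄ : IsDeg L₄.deg (homSpace A₃ A₄).deg φ₄ 0)
    {ψ₄ : L₄ →ₗ[k] homSpace A₁ A₃} (hψ₄ : IsDeg L₄.deg (homSpace A₁ A₃).deg ψ₄ 0)
    {φ₅ : P →ₗ[k] homSpace A₃ A₄} (hφ₅ : IsDeg P.deg (homSpace A₃ A₄).deg φ₅ 0)
    {ψ₅ : P →ₗ[k] L₃} (hψ₅ : IsDeg P.deg L₃.deg ψ₅ 0)
    {φ₆ : Q →ₗ[k] L₁} (hφ₆ : IsDeg Q.deg L₁.deg φ₆ 0)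
    {ψ₆ : Q →ₗ[k] homSpace A₁ A₂} (hψ₆ : IsDeg Q.deg (homSpace A₁ A₂).deg ψ₆ 0)
    (s₁ : ∀ p x, φ₁ x ∈ (homSpace A₃ A₄).deg p → ψ₁ x ∈ (homSpace A₂ A₃).deg p → x ∈ L₁.deg p)
    (s₂ : ∀ p x, φ₂ x ∈ (homSpace A₂ A₄).deg p → ψ₂ x ∈ (homSpace A₁ A₂).deg p → x ∈ L₂.deg p)
    (s₄ : ∀ p x, φ₄ x ∈ (homSpace A₃ A₄).deg p → ψ₄ x ∈ (homSpace A₁ A₃).deg p → x ∈ L₄.deg p)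
    (s₆ : ∀ p x, φ₆ x ∈ L₁.deg p → ψ₆ x ∈ (homSpace A₁ A₂).deg p → x ∈ Q.deg p)
    {α : P →ₗ[k] Q} (a₁ : ∀ x, φ₁ (φ₆ (α x)) = φ₅ x) (a₂ : ∀ x, ψ₁ (φ₆ (α x)) = φ₃ (ψ₅ x))
    (a₃ : ∀ x, ψ₆ (α x) = ψ₃ (ψ₅ x))
    {g : sym Q →ₗ[k] L₂}
    (g₁ : ∀ y, φ₂ (g y) = proj (coCom k) (homSpace A₂ A₄) (compLift hφ₁ hψ₁
      (coalgLift (coCom k) (φ₆ ∘ₗ proj (coCom k) Q) y)))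
    (g₂ : ∀ y, ψ₂ (g y) = proj (coCom k) (homSpace A₁ A₂)
      (coalgLift (coCom k) (ψ₆ ∘ₗ proj (coCom k) Q) y))
    {g' : sym P →ₗ[k] L₄}
    (g₃ : ∀ y, φ₄ (g' y) = proj (coCom k) (homSpace A₃ A₄)
      (coalgLift (coCom k) (φ₅ ∘ₗ proj (coCom k) P) y))
    (g₄ : ∀ y, ψ₄ (g' y) = proj (coCom k) (homSpace A₁ A₃) (compLift hφ₃ hψ₃
      (coalgLift (coCom k) (ψ₅ ∘ₗ proj (coCom k) P) y))) :
    compLift hφ₂ hψ₂ ∘ₗ coalgLift (coCom k) g ∘ₗ coalgLift (coCom k) (α ∘ₗ proj (coCom k) P) =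
      compLift hφ₄ hψ₄ ∘ₗ coalgLift (coCom k) g' := by
  have hS₅ := isCoalgHom_coalgLift (isDeg_comp_proj hφ₅)
  have hT₅ := isCoalgHom_coalgLift (isDeg_comp_proj hψ₅)
  have hS₆ := isCoalgHom_coalgLift (isDeg_comp_proj hφ₆)
  have hT₆ := isCoalgHom_coalgLift (isDeg_comp_proj hψ₆)
  have hU₁ := (isCoalgHom_compLift hφ₁ hψ₁).comp hS₆
  have hU₃ := (isCoalgHom_compLift hφ₃ hψ₃).comp hT₅
  have hα₆ : IsDeg P.deg L₁.deg (φ₆ ∘ₗ α) 0 := fun p x hx => s₁ _ _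
    (by rw [LinearMap.comp_apply, a₁]; exact hφ₅ p x hx)
    (by rw [LinearMap.comp_apply, a₂]; exact hφ₃.comp hψ₅ (add_zero 0) p x hx)
  have hα : IsDeg P.deg Q.deg α 0 := fun p x hx => s₆ _ _ (hα₆ p x hx)
    (by rw [a₃]; exact hψ₃.comp hψ₅ (add_zero 0) p x hx)
  have hg : IsDeg (sym Q).deg L₂.deg g 0 := fun p y hy => s₂ _ _
    (by rw [g₁]; exact (isDeg_proj (coCom k) _).comp hU₁.deg (add_zero 0) p y hy)
    (by rw [g₂]; exact (isDeg_proj (coCom k) _).comp hT₆.deg (add_zero 0) p y hy)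
  have hg' : IsDeg (sym P).deg L₄.deg g' 0 := fun p y hy => s₄ _ _
    (by rw [g₃]; exact (isDeg_proj (coCom k) _).comp hS₅.deg (add_zero 0) p y hy)
    (by rw [g₄]; exact (isDeg_proj (coCom k) _).comp hU₃.deg (add_zero 0) p y hy)
  have hA := isCoalgHom_coalgLift (isDeg_comp_proj hα)
  have hG := isCoalgHom_coalgLift hg
  have hA₆ := isCoalgHom_coalgLift (isDeg_comp_proj hα₆)
  have c : ∀ {X Y : GrMod.{u, max u v w} k} {f : Q →ₗ[k] X} {f' : P →ₗ[k] Y} {f'' : Y →ₗ[k] X}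
      (_ : IsDeg Q.deg X.deg f 0) (_ : IsDeg P.deg Y.deg f' 0) (_ : IsDeg Y.deg X.deg f'' 0)
      (_ : ∀ x, f (α x) = f'' (f' x)),
      coalgLift (coCom k) (f ∘ₗ proj (coCom k) Q) ∘ₗ
        coalgLift (coCom k) (α ∘ₗ proj (coCom k) P) =
      coalgLift (coCom k) (f'' ∘ₗ proj (coCom k) Y) ∘ₗ
        coalgLift (coCom k) (f' ∘ₗ proj (coCom k) P) := by
    intro X Y f f' f'' hf hf' hf'' h
    rw [coalgLift_comp_coalgLift hf (isDeg_comp_proj hα),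
      coalgLift_comp_coalgLift hf'' (isDeg_comp_proj hf')]
    exact congrArg _ (LinearMap.ext fun y => h _)
  have e₁ : coalgLift (coCom k) (φ₂ ∘ₗ proj (coCom k) L₂) ∘ₗ coalgLift (coCom k) g =
      compLift hφ₁ hψ₁ ∘ₗ coalgLift (coCom k) (φ₆ ∘ₗ proj (coCom k) Q) :=
    coalgLift_comp_of_component hφ₂ hg hU₁ g₁
  have e₂ : coalgLift (coCom k) (ψ₂ ∘ₗ proj (coCom k) L₂) ∘ₗ coalgLift (coCom k) g =
      coalgLift (coCom k) (ψ₆ ∘ₗ proj (coCom k) Q) :=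
    coalgLift_comp_of_component hψ₂ hg hT₆ g₂
  have e₃ : coalgLift (coCom k) (φ₄ ∘ₗ proj (coCom k) L₄) ∘ₗ coalgLift (coCom k) g' =
      coalgLift (coCom k) (φ₅ ∘ₗ proj (coCom k) P) :=
    coalgLift_comp_of_component hφ₄ hg' hS₅ g₃
  have e₄ : coalgLift (coCom k) (ψ₄ ∘ₗ proj (coCom k) L₄) ∘ₗ coalgLift (coCom k) g' =
      compLift hφ₃ hψ₃ ∘ₗ coalgLift (coCom k) (ψ₅ ∘ₗ proj (coCom k) P) :=
    coalgLift_comp_of_component hψ₄ hg' hU₃ g₄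
  have e₅ : coalgLift (coCom k) (φ₆ ∘ₗ proj (coCom k) Q) ∘ₗ
      coalgLift (coCom k) (α ∘ₗ proj (coCom k) P) =
      coalgLift (coCom k) ((φ₆ ∘ₗ α) ∘ₗ proj (coCom k) P) := by
    rw [coalgLift_comp_coalgLift hφ₆ (isDeg_comp_proj hα)]
    rfl
  refine compLift_assoc hφ₁ hψ₁ hφ₂ hψ₂ hφ₃ hψ₃ hφ₄ hψ₄ hA₆ (hG.comp hA) hT₅
    (isCoalgHom_coalgLift hg') ?_ ?_ ?_ ?_ e₄
  · rw [← LinearMap.comp_assoc, e₁, LinearMap.comp_assoc, e₅]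
  · rw [← LinearMap.comp_assoc, e₂]
    exact c hψ₆ hψ₅ hψ₃ a₃
  · rw [coalgLift_comp_coalgLift hψ₁ (isDeg_comp_proj hα₆),
      coalgLift_comp_coalgLift hφ₃ (isDeg_comp_proj hψ₅)]
    exact congrArg _ (LinearMap.ext fun y => a₂ _)
  · rw [e₃, coalgLift_comp_coalgLift hφ₁ (isDeg_comp_proj hα₆)]
    exact congrArg _ (LinearMap.ext fun y => (a₁ _).symm)

end Associativity

/-! ### Direct sums of convolution algebras -/

section Composition

variable {k : Type u} [Field k] [CharZero k] {C : Cooperad.{u, v} k}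

variable (L : SLieData.{u, w} k) (M : SLieData.{u, w'} k)

/-- The projection of a direct sum to the first summand. -/
def SLieData.fst : (L.prod M).space →ₗ[k] L.space := GrMod.fst L.space M.space

/-- The projection of a direct sum to the second summand. -/
def SLieData.snd : (L.prod M).space →ₗ[k] M.space := GrMod.snd L.space M.space

/-- The multibrackets of a direct sum are componentwise. -/
theorem SLieData.q_fst (y : sym (L.prod M).space) :
    L.q (coalgLift (coCom k) (L.fst M ∘ₗ proj (coCom k) (L.prod M).space) y) =
      L.fst M ((L.prod M).q y) := rfl

theorem SLieData.q_snd (y : sym (L.prod M).space) :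
    M.q (coalgLift (coCom k) (L.snd M ∘ₗ proj (coCom k) (L.prod M).space) y) =
      L.snd M ((L.prod M).q y) := rfl

variable (A B D : HoAlg.{u, v, w} C)

/-- The projection of `map(B, D) ⊕ map(A, B)` to the first summand. -/
def prodFst : ((mapSpace B D).prod (mapSpace A B)).space →ₗ[k] homSpace B D :=
  (mapSpace B D).fst (mapSpace A B)

/-- The projection of `map(B, D) ⊕ map(A, B)` to the second summand. -/
def prodSnd : ((mapSpace B D).prod (mapSpace A B)).space →ₗ[k] homSpace A B :=
  (mapSpace B D).snd (mapSpace A B)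

theorem isDeg_prodFst : IsDeg ((mapSpace B D).prod (mapSpace A B)).space.deg (homSpace B D).deg
    (prodFst A B D) 0 :=
  fun p x hx => by rw [add_zero]; exact hx.1

theorem isDeg_prodSnd : IsDeg ((mapSpace B D).prod (mapSpace A B)).space.deg (homSpace A B).deg
    (prodSnd A B D) 0 :=
  fun p x hx => by rw [add_zero]; exact hx.2

theorem isCoalgHom_compMap : IsCoalgHom (coCom k) (compMap A B D) :=
  isCoalgHom_compLift (isDeg_prodFst A B D) (isDeg_prodSnd A B D)

theorem coalgLift_id_comp_proj {V : GrMod.{u, w} k} (y : sym V) :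
    coalgLift (coCom k) (LinearMap.id ∘ₗ proj (coCom k) V) y = y :=
  LinearMap.congr_fun (coalgLift_eq_of_proj (U := LinearMap.id)
    (isDeg_comp_proj (fun p x hx => by rw [add_zero]; exact hx)) isCoalgHom_id rfl) y

section

variable {A B D}

/-- The composition intertwines the codifferentials, for algebras `N₁` and `N₂` with strict
morphisms to `map(B, D)` and `map(A, B)` that detect degrees. -/
theorem mapCodiff_comp_compLift_prod {N₁ : SLieData.{u, w'} k} {N₂ : SLieData.{u, w''} k}
    {φ : N₁.space →ₗ[k] homSpace B D} (hφ : IsDeg N₁.space.deg (homSpace B D).deg φ 0)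
    {ψ : N₂.space →ₗ[k] homSpace A B} (hψ : IsDeg N₂.space.deg (homSpace A B).deg ψ 0)
    (h : ∀ p x, φ x ∈ (homSpace B D).deg p → x ∈ N₁.space.deg p)
    (h' : ∀ p x, ψ x ∈ (homSpace A B).deg p → x ∈ N₂.space.deg p)
    (h₁ : ∀ x, homDiff B D (φ x) = φ (N₁.d x)) (h₂ : ∀ x, homDiff A B (ψ x) = ψ (N₂.d x))
    (h₃ : ∀ y, mapQ B D (coalgLift (coCom k) (φ ∘ₗ proj (coCom k) N₁.space) y) = φ (N₁.q y))
    (h₄ : ∀ y, mapQ A B (coalgLift (coCom k) (ψ ∘ₗ proj (coCom k) N₂.space) y) = ψ (N₂.q y))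
    {φ' : (N₁.prod N₂).space →ₗ[k] homSpace B D} (e : φ' = φ ∘ₗ N₁.fst N₂)
    {ψ' : (N₁.prod N₂).space →ₗ[k] homSpace A B} (e' : ψ' = ψ ∘ₗ N₁.snd N₂)
    (hφ' : IsDeg (N₁.prod N₂).space.deg (homSpace B D).deg φ' 0)
    (hψ' : IsDeg (N₁.prod N₂).space.deg (homSpace A B).deg ψ' 0) :
    mapCodiff A D ∘ₗ compLift hφ' hψ' = compLift hφ' hψ' ∘ₗ (N₁.prod N₂).codiff := by
  subst e e'
  have hf : IsDeg (N₁.prod N₂).space.deg N₁.space.deg (N₁.fst N₂) 0 :=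
    fun p x hx => by rw [add_zero]; exact hx.1
  have hs : IsDeg (N₁.prod N₂).space.deg N₂.space.deg (N₁.snd N₂) 0 :=
    fun p x hx => by rw [add_zero]; exact hx.2
  refine mapCodiff_comp_compLift_of_components hφ' hψ'
    (fun p x hx hx' => ⟨h p _ hx, h' p _ hx'⟩) (fun x => h₁ _) (fun x => h₂ _) ?_ ?_
  · intro y
    have := LinearMap.congr_fun (coalgLift_comp_coalgLift hφ (isDeg_comp_proj hf)) y
    rw [LinearMap.comp_apply] at this
    rw [LinearMap.comp_assoc, ← this, h₃, SLieData.q_fst, LinearMap.comp_apply]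
  · intro y
    have := LinearMap.congr_fun (coalgLift_comp_coalgLift hψ (isDeg_comp_proj hs)) y
    rw [LinearMap.comp_apply] at this
    rw [LinearMap.comp_assoc, ← this, h₄, SLieData.q_snd, LinearMap.comp_apply]

end

/-- The identity, as a map from the space of the convolution algebra to `Hom(C(A), B)`. -/
def mapSpaceId : (mapSpace A B).space →ₗ[k] homSpace A B := LinearMap.id

theorem mapQ_mapSpaceId (y : sym (mapSpace A B).space) :
    mapQ A B (coalgLift (coCom k) (mapSpaceId A B ∘ₗ proj (coCom k) (mapSpace A B).space) y) =
      mapSpaceId A B ((mapSpace A B).q y) :=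
  congrArg (mapQ A B) (coalgLift_id_comp_proj y)

theorem prodFst_eq : prodFst A B D = mapSpaceId B D ∘ₗ (mapSpace B D).fst (mapSpace A B) := rfl

theorem prodSnd_eq : prodSnd A B D = mapSpaceId A B ∘ₗ (mapSpace B D).snd (mapSpace A B) := rfl

theorem isDeg_mapSpaceId : IsDeg (mapSpace A B).space.deg (homSpace A B).deg (mapSpaceId A B) 0 :=
  fun p x hx => by rw [add_zero]; exact hx

theorem compLift_comm :
    mapCodiff A D ∘ₗ compLift (isDeg_prodFst A B D) (isDeg_prodSnd A B D) =
      compLift (isDeg_prodFst A B D) (isDeg_prodSnd A B D) ∘ₗ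
        ((mapSpace B D).prod (mapSpace A B)).codiff :=
  mapCodiff_comp_compLift_prod (isDeg_mapSpaceId B D) (isDeg_mapSpaceId A B)
    (fun _ _ h => h) (fun _ _ h => h) (fun _ => rfl) (fun _ => rfl)
    (mapQ_mapSpaceId B D) (mapQ_mapSpaceId A B) (prodFst_eq A B D) (prodSnd_eq A B D) _ _

/-- The composition intertwines the codifferentials. -/
theorem compMap_comm :
    (mapSpace A D).codiff ∘ₗ compMap A B D =
      compMap A B D ∘ₗ ((mapSpace B D).prod (mapSpace A B)).codiff :=
  compLift_comm A B D

end Composition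

section Associativity

variable {k : Type u} [Field k] [CharZero k] {C : Cooperad.{u, v} k}

theorem SLieData.isDeg_fst (L : SLieData.{u, w} k) (M : SLieData.{u, w'} k) :
    IsDeg (L.prod M).space.deg L.space.deg (L.fst M) 0 :=
  fun p x hx => by rw [add_zero]; exact hx.1

theorem SLieData.isDeg_snd (L : SLieData.{u, w} k) (M : SLieData.{u, w'} k) :
    IsDeg (L.prod M).space.deg M.space.deg (L.snd M) 0 :=
  fun p x hx => by rw [add_zero]; exact hx.2

variable {A₁ A₂ A₃ A₄ : HoAlg.{u, v, w} C}

/-- Associativity of the composition, for algebras with maps to the convolution algebras that detect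
degrees. -/
theorem compLift_assoc_prod {N₃₄ N₂₃ N₁₂ N₂₄ N₁₃ : SLieData.{u, max u v w} k}
    {ι₃₄ : N₃₄.space →ₗ[k] homSpace A₃ A₄} (h₃₄ : IsDeg N₃₄.space.deg (homSpace A₃ A₄).deg ι₃₄ 0)
    {ι₂₃ : N₂₃.space →ₗ[k] homSpace A₂ A₃}
    {ι₁₂ : N₁₂.space →ₗ[k] homSpace A₁ A₂} (h₁₂ : IsDeg N₁₂.space.deg (homSpace A₁ A₂).deg ι₁₂ 0)
    {ι₂₄ : N₂₄.space →ₗ[k] homSpace A₂ A₄}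
    {ι₁₃ : N₁₃.space →ₗ[k] homSpace A₁ A₃}
    (r₃₄ : ∀ p x, ι₃₄ x ∈ (homSpace A₃ A₄).deg p → x ∈ N₃₄.space.deg p)
    (r₂₃ : ∀ p x, ι₂₃ x ∈ (homSpace A₂ A₃).deg p → x ∈ N₂₃.space.deg p)
    (r₁₂ : ∀ p x, ι₁₂ x ∈ (homSpace A₁ A₂).deg p → x ∈ N₁₂.space.deg p)
    (r₂₄ : ∀ p x, ι₂₄ x ∈ (homSpace A₂ A₄).deg p → x ∈ N₂₄.space.deg p)
    (r₁₃ : ∀ p x, ι₁₃ x ∈ (homSpace A₁ A₃).deg p → x ∈ N₁₃.space.deg p)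
    {φ₁ : (N₃₄.prod N₂₃).space →ₗ[k] homSpace A₃ A₄} (eφ₁ : φ₁ = ι₃₄ ∘ₗ N₃₄.fst N₂₃)
    {ψ₁ : (N₃₄.prod N₂₃).space →ₗ[k] homSpace A₂ A₃} (eψ₁ : ψ₁ = ι₂₃ ∘ₗ N₃₄.snd N₂₃)
    {φ₂ : (N₂₄.prod N₁₂).space →ₗ[k] homSpace A₂ A₄} (eφ₂ : φ₂ = ι₂₄ ∘ₗ N₂₄.fst N₁₂)
    {ψ₂ : (N₂₄.prod N₁₂).space →ₗ[k] homSpace A₁ A₂} (eψ₂ : ψ₂ = ι₁₂ ∘ₗ N₂₄.snd N₁₂)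
    {φ₃ : (N₂₃.prod N₁₂).space →ₗ[k] homSpace A₂ A₃} (eφ₃ : φ₃ = ι₂₃ ∘ₗ N₂₃.fst N₁₂)
    {ψ₃ : (N₂₃.prod N₁₂).space →ₗ[k] homSpace A₁ A₂} (eψ₃ : ψ₃ = ι₁₂ ∘ₗ N₂₃.snd N₁₂)
    {φ₄ : (N₃₄.prod N₁₃).space →ₗ[k] homSpace A₃ A₄} (eφ₄ : φ₄ = ι₃₄ ∘ₗ N₃₄.fst N₁₃)
    {ψ₄ : (N₃₄.prod N₁₃).space →ₗ[k] homSpace A₁ A₃} (eψ₄ : ψ₄ = ι₁₃ ∘ₗ N₃₄.snd N₁₃)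
    (hφ₁ : IsDeg (N₃₄.prod N₂₃).space.deg (homSpace A₃ A₄).deg φ₁ 0)
    (hψ₁ : IsDeg (N₃₄.prod N₂₃).space.deg (homSpace A₂ A₃).deg ψ₁ 0)
    (hφ₂ : IsDeg (N₂₄.prod N₁₂).space.deg (homSpace A₂ A₄).deg φ₂ 0)
    (hψ₂ : IsDeg (N₂₄.prod N₁₂).space.deg (homSpace A₁ A₂).deg ψ₂ 0)
    (hφ₃ : IsDeg (N₂₃.prod N₁₂).space.deg (homSpace A₂ A₃).deg φ₃ 0)
    (hψ₃ : IsDeg (N₂₃.prod N₁₂).space.deg (homSpace A₁ A₂).deg ψ₃ 0)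
    (hφ₄ : IsDeg (N₃₄.prod N₁₃).space.deg (homSpace A₃ A₄).deg φ₄ 0)
    (hψ₄ : IsDeg (N₃₄.prod N₁₃).space.deg (homSpace A₁ A₃).deg ψ₄ 0)
    {U : sym (N₃₄.prod N₂₃).space →ₗ[k] sym N₂₄.space}
    (hU : ∀ y, ι₂₄ (proj (coCom k) N₂₄.space (U y)) =
      proj (coCom k) (homSpace A₂ A₄) (compLift hφ₁ hψ₁ y))
    {U' : sym (N₂₃.prod N₁₂).space →ₗ[k] sym N₁₃.space}
    (hU' : ∀ y, ι₁₃ (proj (coCom k) N₁₃.space (U' y)) =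
      proj (coCom k) (homSpace A₁ A₃) (compLift hφ₃ hψ₃ y)) :
    compLift hφ₂ hψ₂ ∘ₗ SLieData.tens U LinearMap.id ∘ₗ SLieData.assoc N₃₄ N₂₃ N₁₂ =
      compLift hφ₄ hψ₄ ∘ₗ SLieData.tens LinearMap.id U' := by
  subst eφ₁ eψ₁ eφ₂ eψ₂ eφ₃ eψ₃ eφ₄ eψ₄
  have e : ∀ {X Y : GrMod.{u, max u v w} k} {E E' : HoAlg.{u, v, w} C} {f : X →ₗ[k] Y}
      {j : Y →ₗ[k] homSpace E E'} (_ : IsDeg X.deg Y.deg f 0)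
      (_ : IsDeg Y.deg (homSpace E E').deg j 0) (y : sym X),
      j (proj (coCom k) Y (coalgLift (coCom k) (f ∘ₗ proj (coCom k) X) y)) =
        proj (coCom k) (homSpace E E') (coalgLift (coCom k) ((j ∘ₗ f) ∘ₗ proj (coCom k) X) y) := by
    intro X Y E E' f j hf hj y
    have h₁ := LinearMap.congr_fun (proj_comp_coalgLift (isDeg_comp_proj hf)) y
    have h₂ := LinearMap.congr_fun (proj_comp_coalgLift
      (isDeg_comp_proj (hj.comp hf (add_zero 0)))) y
    rw [LinearMap.comp_apply] at h₁ h₂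
    rw [h₁, h₂]
    rfl
  exact compLift_assoc_of_components hφ₁ hψ₁ hφ₂ hψ₂ hφ₃ hψ₃ hφ₄ hψ₄
    (h₃₄.comp (N₃₄.isDeg_fst (N₂₃.prod N₁₂)) (add_zero 0)) (N₃₄.isDeg_snd (N₂₃.prod N₁₂))
    ((N₃₄.prod N₂₃).isDeg_fst N₁₂) (h₁₂.comp ((N₃₄.prod N₂₃).isDeg_snd N₁₂) (add_zero 0))
    (fun p x hx hx' => ⟨r₃₄ p _ hx, r₂₃ p _ hx'⟩) (fun p x hx hx' => ⟨r₂₄ p _ hx, r₁₂ p _ hx'⟩)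
    (fun p x hx hx' => ⟨r₃₄ p _ hx, r₁₃ p _ hx'⟩) (fun p x hx hx' => ⟨hx, r₁₂ p _ hx'⟩)
    (fun _ => rfl) (fun _ => rfl) (fun _ => rfl)
    (fun y => hU _) (fun y => e ((N₃₄.prod N₂₃).isDeg_snd N₁₂) h₁₂ y)
    (fun y => e (N₃₄.isDeg_fst (N₂₃.prod N₁₂)) h₃₄ y) (fun y => hU' _)

/-- The composition is associative. -/
theorem compMap_assoc :
    compMap A₁ A₂ A₄ ∘ₗ SLieData.tens (compMap A₂ A₃ A₄) LinearMap.id ∘ₗ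
        SLieData.assoc (mapSpace A₃ A₄) (mapSpace A₂ A₃) (mapSpace A₁ A₂) =
      compMap A₁ A₃ A₄ ∘ₗ SLieData.tens LinearMap.id (compMap A₁ A₂ A₃) :=
  compLift_assoc_prod (isDeg_mapSpaceId A₃ A₄) (isDeg_mapSpaceId A₁ A₂)
    (fun _ _ h => h) (fun _ _ h => h) (fun _ _ h => h) (fun _ _ h => h) (fun _ _ h => h)
    (prodFst_eq A₂ A₃ A₄) (prodSnd_eq A₂ A₃ A₄) (prodFst_eq A₁ A₂ A₄) (prodSnd_eq A₁ A₂ A₄)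
    (prodFst_eq A₁ A₂ A₃) (prodSnd_eq A₁ A₂ A₃) (prodFst_eq A₁ A₃ A₄) (prodSnd_eq A₁ A₃ A₄)
    (isDeg_prodFst A₂ A₃ A₄) (isDeg_prodSnd A₂ A₃ A₄)
    (isDeg_prodFst A₁ A₂ A₄) (isDeg_prodSnd A₁ A₂ A₄)
    (isDeg_prodFst A₁ A₂ A₃) (isDeg_prodSnd A₁ A₂ A₃)
    (isDeg_prodFst A₁ A₃ A₄) (isDeg_prodSnd A₁ A₃ A₄)
    (fun _ => rfl) (fun _ => rfl)

end Associativity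

/-! ### Values of the composition on words -/

section Signs

variable {k : Type u} [Field k]

/-- A sum over permutations to which only those fixing `0` contribute. -/
theorem sum_perm_fin_succ {n : ℕ} {M : Type*} [AddCommMonoid M]
    {T : Equiv.Perm (Fin (n + 1)) → M} (h : ∀ σ, σ 0 ≠ 0 → T σ = 0) :
    ∑ σ, T σ = ∑ τ : Equiv.Perm (Fin n), T (Equiv.Perm.decomposeFin.symm (0, τ)) := by
  rw [← Equiv.sum_comp Equiv.Perm.decomposeFin.symm T, Fintype.sum_prod_type,
    Finset.sum_eq_single 0]
  · intro b _ hb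
    exact Finset.sum_eq_zero fun τ _ => h _ (by rwa [Equiv.Perm.decomposeFin_symm_apply_zero])
  · exact fun h => absurd (Finset.mem_univ _) h

theorem decomposeFin_zero_succ {n : ℕ} (τ : Equiv.Perm (Fin n)) (i : Fin n) :
    Equiv.Perm.decomposeFin.symm (0, τ) i.succ = (τ i).succ := by
  rw [Equiv.Perm.decomposeFin_symm_apply_succ, Equiv.swap_self, Equiv.refl_apply]

theorem koszulSign_decomposeFin {n : ℕ} (τ : Equiv.Perm (Fin n)) (p : Fin (n + 1) → ZMod 2) :
    koszulSign k id (Equiv.Perm.decomposeFin.symm (0, τ)).symm p =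
      koszulSign k id τ.symm fun i => p i.succ := by
  have h0 : (Equiv.Perm.decomposeFin.symm (0, τ)).symm 0 = 0 := by
    rw [Equiv.symm_apply_eq, Equiv.Perm.decomposeFin_symm_apply_zero]
  have h1 : ∀ i : Fin n, (Equiv.Perm.decomposeFin.symm (0, τ)).symm i.succ = (τ.symm i).succ := by
    intro i
    rw [Equiv.symm_apply_eq, decomposeFin_zero_succ, Equiv.apply_symm_apply]
  rw [koszulSign, koszulSign, Fin.prod_univ_succ, Finset.prod_eq_one, one_mul]
  · refine Finset.prod_congr rfl fun x _ => ?_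
    rw [Fin.prod_univ_succ, if_neg (fun h => absurd h.1 (Fin.not_lt_zero _)), one_mul]
    refine Finset.prod_congr rfl fun y _ => ?_
    simp only [h1, id, Fin.succ_lt_succ_iff]
  · intro y _
    refine if_neg fun h => ?_
    rw [h0] at h
    exact absurd h.2.1 (Fin.not_lt_zero _)

end Signs

section Composition

variable {k : Type u} [Field k] [CharZero k] {C : Cooperad.{u, v} k} {A B D : HoAlg.{u, v, w} C}
  {L : GrMod.{u, w''} k} {φ : L →ₗ[k] homSpace B D} {ψ : L →ₗ[k] homSpace A B}
  (hφ : IsDeg L.deg (homSpace B D).deg φ 0) (hψ : IsDeg L.deg (homSpace A B).deg ψ 0)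

theorem compArg_eq_zero {n : ℕ} {x : Fin (n + 1) → L}
    (h : φ (x 0) = 0 ∨ ∃ i : Fin n, ψ (x i.succ) = 0) : compArg hφ hψ n x = 0 := by
  refine und_injective ?_
  rw [und_compArg, map_zero]
  rcases h with h | ⟨i, hi⟩
  · rw [h, map_zero, LinearMap.zero_comp]
  · rw [MultilinearMap.map_coord_zero _ i (by rw [hi, map_zero]), LinearMap.comp_zero]

/-- If `φ` vanishes on all letters but the first one, only the permutations that fix the first
letter contribute, and they symmetrize a convolution, which is already symmetric. -/
theorem und_compQ_word_of_mem_ker {n : ℕ} {p : Fin (n + 2) → ℤ} {x : Fin (n + 2) → L}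
    (hx : ∀ i, x i ∈ L.deg (p i)) (h : ∀ i : Fin (n + 1), φ (x i.succ) = 0) :
    und A D (compQ hφ hψ (word x)) = und B D (φ (x 0)) ∘ₗ
      conv C A.space B.space (n + 1) fun i => und A B (ψ (x i.succ)) := by
  rw [compQ_word hφ hψ hx, sum_perm_fin_succ, map_smul, map_sum]
  · have hf : ∀ i : Fin (n + 1), IsDeg (cofree C A.space).deg B.space.deg
        (und A B (ψ (x i.succ))) (p i.succ) := fun i => by
      have := hψ _ _ (hx i.succ)
      rw [add_zero] at this
      exact homMap_mem this
    rw [conv_symm hf, LinearMap.comp_smul, comp_sum]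
    congr 1
    refine Finset.sum_congr rfl fun τ _ => ?_
    rw [koszulSign_decomposeFin, map_smul, und_compArg, LinearMap.comp_smul,
      Equiv.Perm.decomposeFin_symm_apply_zero]
    simp only [decomposeFin_zero_succ]
  · intro σ hσ
    obtain ⟨i, hi⟩ := Fin.exists_succ_eq.2 hσ
    refine smul_eq_zero_of_right _ (compArg_eq_zero hφ hψ (Or.inl ?_))
    rw [← hi, h]

/-- The formula of `und_compQ_word_of_mem_ker` for letters that need not be homogeneous. -/
theorem und_compQ_word_cons {n : ℕ} {α : homSpace B D →ₗ[k] L} {β : homSpace A B →ₗ[k] L}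
    (hα : IsDeg (homSpace B D).deg L.deg α 0) (hβ : IsDeg (homSpace A B).deg L.deg β 0)
    (h₁ : ∀ g, φ (α g) = g) (h₂ : ∀ f, φ (β f) = 0) (h₃ : ∀ f, ψ (β f) = f)
    (g : homSpace B D) (f : Fin (n + 1) → homSpace A B) :
    und A D (compQ hφ hψ (word (Fin.cons (α g) fun i => β (f i) : Fin (n + 2) → L))) =
      und B D g ∘ₗ conv C A.space B.space (n + 1) fun i => und A B (f i) := by
  let T : homSpace B D →ₗ[k] MultilinearMap k (fun _ : Fin (n + 1) => homSpace A B)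
      (cofree C A.space →ₗ[k] D.space) :=
    MultilinearMap.compLinearMapₗ (fun _ => β) ∘ₗ
      ((und A D ∘ₗ compQ hφ hψ).compMultilinearMap (wordMulti L (n + 2))).curryLeft ∘ₗ α
  have hT : T = MultilinearMap.compLinearMapₗ (fun _ => und A B) ∘ₗ
      plug A.space B.space D.space (n + 1) ∘ₗ und B D := by
    refine (homSpace B D).ext_deg fun p g hg => multilinear_ext_deg fun q f hf => ?_
    have hx : ∀ i, (Fin.cons (α g) fun i => β (f i) : Fin (n + 2) → L) i ∈
        L.deg ((Fin.cons p q : Fin (n + 2) → ℤ) i) := by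
      refine Fin.cases ?_ fun i => ?_
      · simpa using hα p g hg
      · simpa using hβ _ _ (hf i)
    have := und_compQ_word_of_mem_ker hφ hψ hx fun i => h₂ _
    simp only [Fin.cons_zero, Fin.cons_succ, h₁, h₃] at this
    exact this
  exact congrArg (fun T => T g f) hT

/-- The image of a map of degree zero consists of sums of homogeneous elements of the image. -/
theorem mem_iSup_deg_inf_ker {V : GrMod.{u, v'} k} {W : GrMod.{u, w'} k} {α : V →ₗ[k] L}
    (hα : IsDeg V.deg L.deg α 0) {χ : L →ₗ[k] W} (h : ∀ x, χ (α x) = 0) (x : V) :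
    α x ∈ ⨆ p, L.deg p ⊓ LinearMap.ker χ := by
  have : (⨆ p, V.deg p) ≤ (⨆ p, L.deg p ⊓ LinearMap.ker χ).comap α :=
    iSup_le fun p y hy => Submodule.mem_iSup_of_mem p ⟨by simpa using hα p y hy, h y⟩
  rw [V.iSup_deg] at this
  exact this trivial

/-- The composition vanishes on a word if, for every letter, either `φ` vanishes on it or `ψ`
vanishes on one of the others. -/
theorem compQ_word_eq_zero {n : ℕ} {x : Fin n → L} (K : Fin n → Submodule k L)
    (hx : ∀ i, x i ∈ ⨆ p, L.deg p ⊓ K i)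
    (h : n ≤ 1 ∨ ∀ i, K i ≤ LinearMap.ker φ ∨ ∃ j ≠ i, K j ≤ LinearMap.ker ψ) :
    compQ hφ hψ (word x) = 0 := by
  match n, x, K, hx, h with
  | 0, x, K, hx, h => exact compQ_word_of_le_one hφ hψ (Nat.zero_le 1) x
  | 1, x, K, hx, h => exact compQ_word_of_le_one hφ hψ le_rfl x
  | n + 2, x, K, hx, h =>
    have h := h.resolve_left (by omega)
    refine (Submodule.mem_bot k).1 (multilinear_mem (𝒱 := fun i p => L.deg p ⊓ K i)
      ((compQ hφ hψ).compMultilinearMap (wordMulti L (n + 2))) ⊥ (fun p x hx => ?_) x hx)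
    rw [Submodule.mem_bot, LinearMap.compMultilinearMap_apply, wordMulti_apply,
      compQ_word hφ hψ fun i => (hx i).1]
    refine smul_eq_zero_of_right _ (Finset.sum_eq_zero fun σ _ => smul_eq_zero_of_right _
      (compArg_eq_zero hφ hψ ?_))
    rcases h (σ 0) with h0 | ⟨j, hj, h0⟩
    · exact Or.inl (h0 (hx (σ 0)).2)
    · obtain ⟨i, hi⟩ := Fin.exists_succ_eq.2
        (show σ.symm j ≠ 0 from fun h => hj (by rw [← h, Equiv.apply_symm_apply]))
      refine Or.inr ⟨i, ?_⟩
      rw [hi, Equiv.apply_symm_apply]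
      exact h0 (hx j).2

/-- A composite `g ((1 ⊗ f 1 ⊗ ⋯ ⊗ f n) Δ n)` has nonzero values in arity `N` only if `N` is at
least the sum of the filtration degrees of the `f i`, `N ≥ n`, and `n` is at least the filtration
degree of `g`. -/
theorem compArg_mem_arityF {n : ℕ} {i : Fin (n + 1) → ℕ} {x : Fin (n + 1) → L}
    (h : ∀ j, φ (x j) ∈ arityF B D (i j)) (h' : ∀ j, ψ (x j) ∈ arityF A B (i j)) {m : ℕ}
    (hm : 2 * m ≤ ∑ j, i j + 1) : compArg hφ hψ n x ∈ arityF A D m := by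
  refine mem_arityF.2 fun N hN => ?_
  rw [und_compArg, LinearMap.comp_assoc]
  rw [Fin.sum_univ_succ] at hm
  rcases lt_or_ge N (∑ j : Fin n, i j.succ) with h1 | h1
  · rw [conv_comp_cls_of_mem_arityF (fun j => h' j.succ) h1, LinearMap.comp_zero]
  rcases lt_or_ge N n with h2 | h2
  · rw [conv_comp_cls_of_lt h2, LinearMap.comp_zero]
  · rw [← LinearMap.comp_assoc, conv_apply, ← LinearMap.comp_assoc,
      mem_arityF.1 (h 0) n (by omega), LinearMap.zero_comp, LinearMap.zero_comp]

theorem compQ_word_mem_arityF {n : ℕ} {p : Fin n → ℤ} {x : Fin n → L}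
    (hx : ∀ j, x j ∈ L.deg (p j)) {i : Fin n → ℕ}
    (h : ∀ j, φ (x j) ∈ arityF B D (i j)) (h' : ∀ j, ψ (x j) ∈ arityF A B (i j)) {m : ℕ}
    (hm : 2 * m ≤ ∑ j, i j + 1) : compQ hφ hψ (word x) ∈ arityF A D m := by
  match n, p, x, hx, i, h, h', hm with
  | 0, p, x, hx, i, h, h', hm =>
    rw [compQ_word_of_le_one hφ hψ (Nat.zero_le 1) x]
    exact Submodule.zero_mem _
  | 1, p, x, hx, i, h, h', hm =>
    rw [compQ_word_of_le_one hφ hψ le_rfl x]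
    exact Submodule.zero_mem _
  | n + 2, p, x, hx, i, h, h', hm =>
    rw [compQ_word hφ hψ hx]
    refine Submodule.smul_mem _ _ (Submodule.sum_mem _ fun σ _ => Submodule.smul_mem _ _ ?_)
    refine compArg_mem_arityF hφ hψ (fun j => h (σ j)) (fun j => h' (σ j)) ?_
    rwa [Equiv.sum_comp σ i]

end Composition

/-! ### Continuity of the composition -/

section Continuity

variable {k : Type u} [Field k] [CharZero k]

/-- A morphism of coalgebras on a word: the letters are distributed over the letters of the image.
-/
theorem coalgLift_word {L : GrMod.{u, w} k} {M : GrMod.{u, w'} k} {g : sym L →ₗ[k] M}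
    (hg : IsDeg (sym L).deg M.deg g 0) {n : ℕ} (hn : n ≠ 0) {p : Fin n → ℤ} {x : Fin n → L}
    (hx : ∀ i, x i ∈ L.deg (p i)) : coalgLift (coCom k) g (word x) =
      ∑ m : Fin (n + 1), ((m : ℕ).factorial : k)⁻¹ • ∑ r : Fin (m : ℕ) → Fin (n + 1),
        (∏ j, ((r j : ℕ).factorial : k))⁻¹ • ∑ e : (Σ j, Fin (r j)) ≃ Fin n,
          ks k (regroupExp (fun j => (r j : ℕ)) e 0 fun i => (p i : ZMod 2)) •
            word fun j => g (word fun s => x (e ⟨j, s⟩)) := by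
  rw [word, coalgLift_cls hg le_rfl]
  refine Finset.sum_congr rfl fun m _ => ?_
  congr 1
  rw [conv_of_degree_zero fun _ => hg, LinearMap.comp_apply, LinearMap.comp_apply,
    show comul (coCom k) L m (cls (coCom k) L n (gen k n ⊗ₜ PiTensorProduct.tprod k x)) = _ from
      comul_cls (C := coCom k) L (m : ℕ) (le_refl n) _, map_sum, map_sum]
  refine Finset.sum_congr rfl fun r _ => ?_
  rw [map_smul, map_smul, map_sum, map_sum]
  congr 1
  refine Finset.sum_congr rfl fun e _ => ?_
  rw [comulTerm_word hn _ e hx, map_smul, map_smul, TensorProduct.map_tmul,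
    PiTensorProduct.map_tprod]
  rfl

/-- The filtration of `S(L)` induced by a filtration of `L`. -/
def wordF (L : GrMod.{u, w} k) (F : ℕ → Submodule k L) (m : ℕ) : Submodule k (sym L) :=
  Submodule.span k {y | ∃ (n : ℕ) (i : Fin n → ℕ) (x : Fin n → L),
    (∀ j, 1 ≤ i j ∧ x j ∈ F (i j)) ∧ m ≤ ∑ j, i j ∧ y = word x}

variable {C : Cooperad.{u, v} k} {A B D : HoAlg.{u, v, w} C}
  {L : GrMod.{u, w''} k} {φ : L →ₗ[k] homSpace B D} {ψ : L →ₗ[k] homSpace A B}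
  (hφ : IsDeg L.deg (homSpace B D).deg φ 0) (hψ : IsDeg L.deg (homSpace A B).deg ψ 0)

/-- Continuity of the composition: it at most halves the filtration degree. -/
theorem compLift_mem_wordF {F : ℕ → Submodule k L} (hF : ∀ n, F n ≤ ⨆ p, F n ⊓ L.deg p)
    (h : ∀ n, ∀ x ∈ F n, φ x ∈ arityF B D n) (h' : ∀ n, ∀ x ∈ F n, ψ x ∈ arityF A B n) {m : ℕ}
    {y : sym L} (hy : y ∈ wordF L F (2 * m)) :
    compLift hφ hψ y ∈ wordF (homSpace A D) (arityF A D) m := by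
  refine (Submodule.span_le (p := (wordF (homSpace A D) (arityF A D) m).comap
    (compLift hφ hψ))).2 ?_ hy
  rintro _ ⟨n, i, x, hx, hi, rfl⟩
  rcases eq_or_ne n 0 with rfl | hn
  · rw [word_zero]
    exact Submodule.zero_mem _
  change compLift hφ hψ (word x) ∈ wordF (homSpace A D) (arityF A D) m
  refine multilinear_mem (𝒱 := fun j p => F (i j) ⊓ L.deg p)
    ((compLift hφ hψ).compMultilinearMap (wordMulti L n)) _ (fun p x hx => ?_) x
    fun j => hF _ (hx j).2
  rw [LinearMap.compMultilinearMap_apply, wordMulti_apply, compLift,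
    coalgLift_word (isDeg_compQ hφ hψ) hn fun j => (hx j).2]
  refine Submodule.sum_mem _ fun l _ => Submodule.smul_mem _ _ (Submodule.sum_mem _ fun r _ =>
    Submodule.smul_mem _ _ (Submodule.sum_mem _ fun e _ => Submodule.smul_mem _ _
      (Submodule.subset_span ?_)))
  have hs : ∑ j, ∑ s, i (e ⟨j, s⟩) = ∑ j, i j := sum_sigma_equiv e i
  refine ⟨l, fun j => max 1 ((∑ s, i (e ⟨j, s⟩) + 1) / 2), _, fun j => ⟨le_max_left _ _, ?_⟩, ?_,
    rfl⟩
  · beta_reduce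
    rcases max_cases 1 ((∑ s, i (e ⟨j, s⟩) + 1) / 2) with ⟨hc, _⟩ | ⟨hc, _⟩
    · -- for an empty block or a block of filtration degree one
      rw [hc, arityF_one]
      trivial
    · rw [hc]
      exact compQ_word_mem_arityF hφ hψ (fun s => (hx _).2) (fun s => h _ _ (hx _).1)
        (fun s => h' _ _ (hx _).1) (Nat.mul_div_le _ 2)
  · have : ∑ j, ∑ s, i (e ⟨j, s⟩) ≤
        2 * ∑ j, max 1 ((∑ s, i (e ⟨j, s⟩) + 1) / 2) := by
      rw [Finset.mul_sum]
      exact Finset.sum_le_sum fun j _ => by omega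
    beta_reduce
    omega

end Continuity

/-! ### The composition as an infinity-morphism -/

section Products

theorem append_rel {m n : ℕ} {X Y : Type*} {R : X → Y → Prop} {a : Fin m → X} {b : Fin n → X}
    {c : Fin m → Y} {d : Fin n → Y} (h : ∀ i, R (a i) (c i)) (h' : ∀ i, R (b i) (d i))
    (i : Fin (m + n)) : R (Fin.append a b i) (Fin.append c d i) := by
  refine Fin.addCases (fun i => ?_) (fun i => ?_) i
  · rw [Fin.append_left, Fin.append_left]
    exact h i
  · rw [Fin.append_right, Fin.append_right]
    exact h' i

variable {k : Type u} [Field k] [CharZero k]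

theorem isDeg_inl (V : GrMod.{u, v} k) (W : GrMod.{u, w} k) :
    IsDeg V.deg (V.prod W).deg (GrMod.inl V W) 0 :=
  fun p x hx => by rw [add_zero]; exact ⟨hx, Submodule.zero_mem _⟩

theorem isDeg_inr (V : GrMod.{u, v} k) (W : GrMod.{u, w} k) :
    IsDeg W.deg (V.prod W).deg (GrMod.inr V W) 0 :=
  fun p x hx => by rw [add_zero]; exact ⟨Submodule.zero_mem _, hx⟩

/-- The filtration of a direct sum of graded filtrations is graded. -/
theorem SLieData.prod_F_le_iSup {L : SLieData.{u, w} k} {M : SLieData.{u, w'} k} {n : ℕ}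
    (hL : L.F n = ⨆ p, L.F n ⊓ L.space.deg p) (hM : M.F n = ⨆ p, M.F n ⊓ M.space.deg p) :
    (L.prod M).F n ≤ ⨆ p, (L.prod M).F n ⊓ (L.prod M).space.deg p := by
  rintro ⟨a, b⟩ ⟨ha, hb⟩
  have h1 : (⨆ p, L.F n ⊓ L.space.deg p) ≤
      (⨆ p, (L.prod M).F n ⊓ (L.prod M).space.deg p).comap (GrMod.inl L.space M.space) :=
    iSup_le fun p x hx => Submodule.mem_iSup_of_mem p
      ⟨⟨hx.1, Submodule.zero_mem (M.F n)⟩, hx.2, Submodule.zero_mem _⟩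
  have h2 : (⨆ p, M.F n ⊓ M.space.deg p) ≤
      (⨆ p, (L.prod M).F n ⊓ (L.prod M).space.deg p).comap (GrMod.inr L.space M.space) :=
    iSup_le fun p x hx => Submodule.mem_iSup_of_mem p
      ⟨⟨Submodule.zero_mem (L.F n), hx.1⟩, Submodule.zero_mem _, hx.2⟩
  rw [← hL] at h1
  rw [← hM] at h2
  have ha' : a ∈ L.F n := ha
  have hb' : b ∈ M.F n := hb
  have h3 := Submodule.add_mem (⨆ p, (L.prod M).F n ⊓ (L.prod M).space.deg p)
    (Submodule.mem_comap.1 (h1 ha')) (Submodule.mem_comap.1 (h2 hb'))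
  have h4 : GrMod.inl L.space M.space a + GrMod.inr L.space M.space b = (a, b) :=
    Prod.ext (add_zero a) (zero_add b)
  exact h4 ▸ h3

end Products

section Composition

variable {k : Type u} [Field k] [CharZero k] {C : Cooperad.{u, v} k} (A B D : HoAlg.{u, v, w} C)

theorem compMap_mem_symF {m : ℕ} {y : sym ((mapSpace B D).prod (mapSpace A B)).space}
    (hy : y ∈ ((mapSpace B D).prod (mapSpace A B)).symF (2 * m)) :
    compMap A B D y ∈ (mapSpace A D).symF m :=
  compLift_mem_wordF (isDeg_prodFst A B D) (isDeg_prodSnd A B D)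
    (fun n => SLieData.prod_F_le_iSup (arityF_eq_iSup n) (arityF_eq_iSup n))
    (fun _ _ h => h.1) (fun _ _ h => h.2) hy

theorem isInfinityMorphism_compMap : SLieData.IsInfinityMorphism (compMap A B D) where
  coalgHom := isCoalgHom_compMap A B D
  comm := compMap_comm A B D
  continuous m := ⟨2 * m, fun _ hy => compMap_mem_symF A B D hy⟩

variable {A B D}

theorem proj_compMap (y : sym ((mapSpace B D).prod (mapSpace A B)).space) :
    proj (coCom k) (homSpace A D) (compMap A B D y) =
      compQ (isDeg_prodFst A B D) (isDeg_prodSnd A B D) y :=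
  proj_compLift (isDeg_prodFst A B D) (isDeg_prodSnd A B D) y

theorem prodFst_inl (g : homSpace B D) :
    prodFst A B D (GrMod.inl (homSpace B D) (homSpace A B) g) = g := rfl

theorem prodSnd_inl (g : homSpace B D) :
    prodSnd A B D (GrMod.inl (homSpace B D) (homSpace A B) g) = 0 := rfl

theorem prodFst_inr (f : homSpace A B) :
    prodFst A B D (GrMod.inr (homSpace B D) (homSpace A B) f) = 0 := rfl

theorem prodSnd_inr (f : homSpace A B) :
    prodSnd A B D (GrMod.inr (homSpace B D) (homSpace A B) f) = f := rfl

theorem und_proj_compMap_word_cons {n : ℕ} (g : homSpace B D) (f : Fin (n + 1) → homSpace A B) :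
    und A D (proj (coCom k) (homSpace A D) (compMap A B D (word
      (Fin.cons (GrMod.inl (homSpace B D) (homSpace A B) g)
        fun i => GrMod.inr (homSpace B D) (homSpace A B) (f i))))) =
      und B D g ∘ₗ conv C A.space B.space (n + 1) fun i => und A B (f i) :=
  (congrArg (und A D) (proj_compMap _)).trans
    (und_compQ_word_cons (isDeg_prodFst A B D) (isDeg_prodSnd A B D)
      (isDeg_inl (homSpace B D) (homSpace A B)) (isDeg_inr (homSpace B D) (homSpace A B))
      prodFst_inl prodFst_inr prodSnd_inr g f)

theorem inl_mem (g : homSpace B D) : GrMod.inl (homSpace B D) (homSpace A B) g ∈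
    ⨆ p, ((mapSpace B D).prod (mapSpace A B)).space.deg p ⊓ LinearMap.ker (prodSnd A B D) :=
  mem_iSup_deg_inf_ker (L := ((mapSpace B D).prod (mapSpace A B)).space)
    (isDeg_inl (homSpace B D) (homSpace A B)) prodSnd_inl g

theorem inr_mem (f : homSpace A B) : GrMod.inr (homSpace B D) (homSpace A B) f ∈
    ⨆ p, ((mapSpace B D).prod (mapSpace A B)).space.deg p ⊓ LinearMap.ker (prodFst A B D) :=
  mem_iSup_deg_inf_ker (L := ((mapSpace B D).prod (mapSpace A B)).space)
    (isDeg_inr (homSpace B D) (homSpace A B)) prodFst_inr f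

theorem proj_compMap_word_inl {n : ℕ} (g : Fin n → homSpace B D) :
    proj (coCom k) (homSpace A D) (compMap A B D (word fun i =>
      GrMod.inl (homSpace B D) (homSpace A B) (g i))) = 0 := by
  refine (proj_compMap _).trans (compQ_word_eq_zero _ _
    (fun _ => LinearMap.ker (prodSnd A B D)) (fun i => inl_mem (g i)) ?_)
  refine or_iff_not_imp_left.2 fun hn i => Or.inr ?_
  have : Nontrivial (Fin n) := Fin.nontrivial_iff_two_le.2 (by omega)
  obtain ⟨j, hj⟩ := exists_ne i
  exact ⟨j, hj, le_rfl⟩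

theorem proj_compMap_word_inr {n : ℕ} (f : Fin n → homSpace A B) :
    proj (coCom k) (homSpace A D) (compMap A B D (word fun i =>
      GrMod.inr (homSpace B D) (homSpace A B) (f i))) = 0 :=
  (proj_compMap _).trans (compQ_word_eq_zero _ _
    (fun _ => LinearMap.ker (prodFst A B D)) (fun i => inr_mem (f i)) (Or.inr fun _ => Or.inl le_rfl))

theorem proj_compMap_word_append {m n : ℕ} (g : Fin m → homSpace B D) (f : Fin n → homSpace A B)
    (hm : m ≠ 1) :
    proj (coCom k) (homSpace A D) (compMap A B D (word (Fin.append
      (fun i => GrMod.inl (homSpace B D) (homSpace A B) (g i))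
      fun i => GrMod.inr (homSpace B D) (homSpace A B) (f i)))) = 0 := by
  refine (proj_compMap _).trans (compQ_word_eq_zero _ _
    (Fin.append (fun _ => LinearMap.ker (prodSnd A B D)) fun _ => LinearMap.ker (prodFst A B D))
    (fun i => ?_) (Or.inr fun i => ?_))
  · exact append_rel (R := fun x K => x ∈ ⨆ p,
      ((mapSpace B D).prod (mapSpace A B)).space.deg p ⊓ K)
      (fun i => inl_mem (g i)) (fun i => inr_mem (f i)) i
  · refine Fin.addCases (fun i => ?_) (fun i => ?_) i
    · have h2 : 2 ≤ m := by have := i.2; omega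
      have : Nontrivial (Fin m) := Fin.nontrivial_iff_two_le.2 h2
      obtain ⟨j, hj⟩ := exists_ne i
      refine Or.inr ⟨Fin.castAdd n j, fun h => hj (Fin.castAdd_injective m n h), ?_⟩
      rw [Fin.append_left]
    · left
      rw [Fin.append_right]

end Composition

end HomotopyAlg

end

theorem mainTheorem8 {k : Type u} [Field k] [CharZero k] (C : Cooperad.{u, v} k) :
    -- `map(A, B)` is a filtered shifted Lie-infinity algebra with the convolution brackets
    (∀ A B : HoAlg.{u, v, w} C,
      (mapSpace A B).IsFilteredSLie ∧
      ∀ n ≥ 2, ∀ f : Fin n → homSpace A B,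
        und A B ((mapSpace A B).bracket f) =
          (proj C B.space ∘ₗ B.Q) ∘ₗ cls C B.space n ∘ₗ
            tensorMap (C.obj n) (cofree C A.space) B.space n (fun i => und A B (f i)) ∘ₗ
            comul C A.space n) ∧
    -- the composition is a continuous infinity-morphism, and its projection to `map(A, D)` is
    -- `g f₁ ⋯ fₙ ↦ g ∘ (1 ⊗ f₁ ⊗ ⋯ ⊗ fₙ) ∘ Δₙ` for `n ≥ 1`, and zero on all other types of words
    (∀ A B D : HoAlg.{u, v, w} C,
      SLieData.IsInfinityMorphism (compMap A B D) ∧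
      (∀ n ≥ 1, ∀ (g : homSpace B D) (f : Fin n → homSpace A B),
        und A D (proj (coCom k) (homSpace A D) (compMap A B D (word
          (Fin.cons (GrMod.inl (homSpace B D) (homSpace A B) g)
            fun i => GrMod.inr (homSpace B D) (homSpace A B) (f i))))) =
          und B D g ∘ₗ cls C B.space n ∘ₗ
            tensorMap (C.obj n) (cofree C A.space) B.space n (fun i => und A B (f i)) ∘ₗ
            comul C A.space n) ∧
      (∀ (n : ℕ) (g : Fin n → homSpace B D),
        proj (coCom k) (homSpace A D) (compMap A B D (word fun i =>
          GrMod.inl (homSpace B D) (homSpace A B) (g i))) = 0) ∧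
      (∀ (n : ℕ) (f : Fin n → homSpace A B),
        proj (coCom k) (homSpace A D) (compMap A B D (word fun i =>
          GrMod.inr (homSpace B D) (homSpace A B) (f i))) = 0) ∧
      ∀ (m n : ℕ) (g : Fin m → homSpace B D) (f : Fin n → homSpace A B), m ≠ 1 →
        proj (coCom k) (homSpace A D) (compMap A B D (word (Fin.append
          (fun i => GrMod.inl (homSpace B D) (homSpace A B) (g i))
          fun i => GrMod.inr (homSpace B D) (homSpace A B) (f i)))) = 0) ∧
    -- the composition is associative
    ∀ A₁ A₂ A₃ A₄ : HoAlg.{u, v, w} C,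
      compMap A₁ A₂ A₄ ∘ₗ SLieData.tens (compMap A₂ A₃ A₄) LinearMap.id ∘ₗ
          SLieData.assoc (mapSpace A₃ A₄) (mapSpace A₂ A₃) (mapSpace A₁ A₂) =
        compMap A₁ A₃ A₄ ∘ₗ SLieData.tens LinearMap.id (compMap A₁ A₂ A₃) := by
  refine ⟨fun A B => ⟨isFilteredSLie_mapSpace, fun n hn f => ?_⟩, fun A B D =>
    ⟨isInfinityMorphism_compMap A B D, fun n hn g f => ?_, fun n g => proj_compMap_word_inl g,
      fun n f => proj_compMap_word_inr f, fun m n g f hm => proj_compMap_word_append g f hm⟩,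
    fun A₁ A₂ A₃ A₄ => compMap_assoc⟩
  · exact (congrArg (und A B) (mapSpace_bracket f)).trans (mapQ_word hn f)
  · obtain ⟨n, rfl⟩ := Nat.exists_eq_add_of_le' hn
    exact und_proj_compMap_word_cons g f
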